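/- Let $\mathbb K$ be $\mathbb R$ or $\mathbb C$, $[n]=\{1,\dots,n\}$, and let $X=(X_{k,l})_{k,l\ge 0}$ be a family of sets. **ProPs.** An $\mathfrak S\times\mathfrak S^{op}$-module is a family $P=(P(k,l))_{k,l\ge 0}$ of $\mathbb K$-vector spaces with commuting linear actions of $\mathfrak S_l$ on the left and of $\mathfrak S_k$ on the right of $P(k,l)$. A ProP is such a module with bilinear products $*:P(k,l)\times P(k',l')\to P(k+k',l+l')$ and $\circ:P(l,m)\times P(k,l)\to P(k,m)$ and elements $I_0\in P(0,0)$, $I_1\in P(1,1)$, such that: $*$ is associative with unit $I_0$; $\circ$ is associative with units $I_n=I_1^{*n}$; $(p*p')\circ(q*q')=(p\circ q)*(p'\circ q')$; $\sigma\cdot(p\circ q)=(\sigma\cdot p)\circ q$, $(p\circ q)\cdot\nu=p\circ(q\cdot\nu)$, $(p\cdot\tau)\circ q=p\circ(\tau\cdot q)$; $(\sigma\cdot p)*(\sigma'\cdot p')=(\sigma\otimes\sigma')\cdot(p*p')$, $(p\cdot\tau)*(p'\cdot\tau')=(p*p')\cdot(\tau\otimes\tau')$; and $c_{l,l'}\cdot(p*p')=(p'*p)\cdot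 c_{k,k'}$, where $c_{m,n}\in\mathfrak S_{m+n}$ maps $i\le m$ to $i+n$ and $i>m$ to $i-m$. Morphisms of ProPs are families of linear maps compatible with the actions, with $*$ and $\circ$, and with $I_0$ and $I_1$. A ProP $Q$ is the *free ProP generated by* a sub-$\mathfrak S\times\mathfrak S^{op}$-module $M\subseteq Q$ if for every ProP $P$ and every morphism $\varphi:M\to P$ of $\mathfrak S\times\mathfrak S^{op}$-modules there is a unique morphism of ProPs $\Phi:Q\to P$ with $\Phi_{|M}=\varphi$. **Graphs.** A graph $G$ with $k$ inputs and $l$ outputs consists of finite, possibly empty sets $V,E,I,O,IO,L$ (vertices, internal edges, input edges, output edges, input-output edges, loops, i.e. edges without endpoints), maps $s:E\sqcup O\to V$ (source) and $t:E\sqcup I\to V$ (target), and bijections $\alpha:I\sqcup IO\to[k]$, $\beta:O\sqcup IO\to[l]$. For $v\in V$ put $I(v)=t^{-1}(v)$ and $O(v)=s^{-1}(v)$. An $X$-decorated graph is a graph with an element of $X_{|I(v)|,|O(v)|}$ attached to each vertex $v$; it is planar if, moreover, total orders are given on all the sets $I(v)$ and $O(v)$. Isomorphisms preserve all these data. Let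 $\mathbf{Gr}^{\circlearrowright}(X)(k,l)$ (resp. $\mathbf{PGr}^{\circlearrowright}(X)(k,l)$) be the vector space with basis the isomorphism classes of $X$-decorated (resp. planar $X$-decorated) graphs with $k$ inputs and $l$ outputs. The permutation $\sigma$ acts on the left by replacing $\beta$ by $\sigma\circ\beta$, and $\tau$ acts on the right by replacing $\alpha$ by $\tau^{-1}\circ\alpha$. The product $G*G'$ is the disjoint union, the inputs and outputs of $G'$ being indexed after those of $G$; $G'\circ G$ is obtained by gluing the $i$-th output of $G$ to the $i$-th input of $G'$ for all $i$; decorations and orders are kept. $I_0$ is the empty graph, and $I_1$ is the graph with a single input-output edge and nothing else. These structures are ProPs. A graph is *indecomposable* if either it is reduced to a single loop, or the following holds: $V\ne\emptyset$, $IO=\emptyset$, $L=\emptyset$, and whenever $G\cong G'\circ G''$ or $G\cong\sigma\cdot(G'*G'')\cdot\tau$ with graphs $G',G''$ and permutations $\sigma,\tau$, then $V(G')=\emptyset$ or $V(G'')=\emptyset$. A decorated or planar graph is indecomposable if its underlying graph is. The indecomposable graphs span sub-$\mathfrak S\times\mathfrak S^{op}$-modules $\mathbf{Gr}^{\circlearrowright}_{\mathrm{ind}}(X)$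 and $\mathbf{PGr}^{\circlearrowright}_{\mathrm{ind}}(X)$. The *cycleless* graphs, that is, those without oriented cycles and with $L=\emptyset$, span sub-ProPs $\mathbf{Gr}^{\uparrow}(X)$ and $\mathbf{PGr}^{\uparrow}(X)$; their submodules spanned by the cycleless indecomposable graphs are denoted $\mathbf{Gr}^{\uparrow}_{\mathrm{ind}}(X)$ and $\mathbf{PGr}^{\uparrow}_{\mathrm{ind}}(X)$. For $x\in X_{k,l}$, let $G_{k,l}(x)$ be the graph with one vertex, decorated by $x$, with $I=[k]$, $O=[l]$, $\alpha$ and $\beta$ the identity maps, and $E=IO=L=\emptyset$; let $PG_{k,l}(x)$ be the same graph with the usual orders on $[k]$ and $[l]$. **Theorem.** 1. $\mathbf{Gr}^{\circlearrowright}(X)$ is the free ProP generated by $\mathbf{Gr}^{\circlearrowright}_{\mathrm{ind}}(X)$. Furthermore, $\mathbf{Gr}^{\uparrow}(X)$ is the free ProP generated by $\mathbf{Gr}^{\uparrow}_{\mathrm{ind}}(X)$, and $x\mapsto G_{k,l}(x)$ $(x\in X_{k,l})$ extends to an isomorphism of $\mathfrak S\times\mathfrak S^{op}$-modules from the trivial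 $\mathfrak S\times\mathfrak S^{op}$-module generated by $X$ (the spaces $\mathbb K X_{k,l}$ with basis $X_{k,l}$ and trivial actions) onto $\mathbf{Gr}^{\uparrow}_{\mathrm{ind}}(X)$. 2. $\mathbf{PGr}^{\circlearrowright}(X)$ is the free ProP generated by $\mathbf{PGr}^{\circlearrowright}_{\mathrm{ind}}(X)$. Furthermore, $\mathbf{PGr}^{\uparrow}(X)$ is the free ProP generated by $\mathbf{PGr}^{\uparrow}_{\mathrm{ind}}(X)$, and $x\mapsto PG_{k,l}(x)$ $(x\in X_{k,l})$ extends to an isomorphism of $\mathfrak S\times\mathfrak S^{op}$-modules from the free $\mathfrak S\times\mathfrak S^{op}$-module generated by $X$ (the spaces with basis $\mathfrak S_l\times X_{k,l}\times\mathfrak S_k$, whose element $(\sigma,x,\tau)$ stands for $\sigma\cdot x\cdot\tau$) onto $\mathbf{PGr}^{\uparrow}_{\mathrm{ind}}(X)$. -/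

import Mathlib

open Equiv Function

universe u v w w'

namespace GraphProP

/-- Transport of an element of a family indexed by `ℕ × ℕ` along equalities of the indices. -/
def recast (F : ℕ → ℕ → Type w) {k l k' l' : ℕ} (hk : k = k') (hl : l = l') (x : F k l) :
    F k' l' := hl ▸ hk ▸ x

/-- The permutation `σ ⊗ τ` of `Fin (m + n)`: `σ` on the first `m` elements, `τ` on the last `n`. -/
def tensorPerm {m n : ℕ} (σ : Perm (Fin m)) (τ : Perm (Fin n)) : Perm (Fin (m + n)) :=
  finSumFinEquiv.permCongr (Equiv.sumCongr σ τ)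

/-- The permutation `c_{m,n}` of `Fin (m + n)`: it sends `i` to `i + n` if `i` is one of the
first `m` elements, and to `i - m` otherwise. -/
def blockSwap (m n : ℕ) : Perm (Fin (m + n)) :=
  finAddFlip.trans (finCongr (Nat.add_comm n m))

/-- The iterated horizontal power `I₁ * ⋯ * I₁` (`n` factors), with value `I₀` for `n = 0`. -/
def hpow {F : ℕ → ℕ → Type w} (h : ∀ {k l k' l' : ℕ}, F k l → F k' l' → F (k + k') (l + l'))
    (I₀ : F 0 0) (I₁ : F 1 1) : ∀ n : ℕ, F n n
  | 0 => I₀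
  | n + 1 => h (hpow h I₀ I₁ n) I₁

/-! ### Modules over the symmetric groups, and ProPs -/

/-- An `𝔖 × 𝔖ᵒᵖ`-module over `K`: a family of vector spaces `obj k l`, with commuting linear
actions of `𝔖_l` on the left (`lact σ p = σ · p`) and of `𝔖_k` on the right
(`ract τ p = p · τ`). -/
structure SModule (K : Type v) [Field K] where
  obj : ℕ → ℕ → Type w
  [addCommGroup : ∀ k l, AddCommGroup (obj k l)]
  [module : ∀ k l, Module K (obj k l)]
  lact : ∀ {k l : ℕ}, Perm (Fin l) → obj k l →ₗ[K] obj k l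
  ract : ∀ {k l : ℕ}, Perm (Fin k) → obj k l →ₗ[K] obj k l
  one_lact : ∀ {k l : ℕ} (p : obj k l), lact 1 p = p
  one_ract : ∀ {k l : ℕ} (p : obj k l), ract 1 p = p
  lact_lact : ∀ {k l : ℕ} (σ σ' : Perm (Fin l)) (p : obj k l),
    lact σ (lact σ' p) = lact (σ * σ') p
  ract_ract : ∀ {k l : ℕ} (τ τ' : Perm (Fin k)) (p : obj k l),
    ract τ' (ract τ p) = ract (τ * τ') p
  lact_ract : ∀ {k l : ℕ} (σ : Perm (Fin l)) (τ : Perm (Fin k)) (p : obj k l),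
    lact σ (ract τ p) = ract τ (lact σ p)

attribute [instance] SModule.addCommGroup SModule.module

/-- A ProP over `K`. -/
structure ProP (K : Type v) [Field K] extends SModule.{v, w} K where
  /-- horizontal concatenation `p * p'` -/
  hcomp : ∀ {k l k' l' : ℕ}, obj k l →ₗ[K] obj k' l' →ₗ[K] obj (k + k') (l + l')
  /-- vertical concatenation `p ∘ q` -/
  vcomp : ∀ {k l m : ℕ}, obj l m →ₗ[K] obj k l →ₗ[K] obj k m
  /-- the unit `I₀` -/
  unit₀ : obj 0 0
  /-- the unit `I₁` -/
  unit₁ : obj 1 1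
  hcomp_assoc : ∀ {k l k' l' k'' l'' : ℕ} (p : obj k l) (p' : obj k' l') (p'' : obj k'' l''),
    hcomp p (hcomp p' p'') =
      recast obj (Nat.add_assoc k k' k'') (Nat.add_assoc l l' l'') (hcomp (hcomp p p') p'')
  hcomp_unit₀ : ∀ {k l : ℕ} (p : obj k l),
    recast obj (Nat.add_zero k) (Nat.add_zero l) (hcomp p unit₀) = p
  unit₀_hcomp : ∀ {k l : ℕ} (p : obj k l),
    recast obj (Nat.zero_add k) (Nat.zero_add l) (hcomp unit₀ p) = p
  vcomp_assoc : ∀ {k l m n : ℕ} (p : obj m n) (q : obj l m) (r : obj k l),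
    vcomp p (vcomp q r) = vcomp (vcomp p q) r
  vcomp_unit : ∀ {k l : ℕ} (p : obj k l),
    vcomp p (hpow (F := obj) (fun a b => hcomp a b) unit₀ unit₁ k) = p
  unit_vcomp : ∀ {k l : ℕ} (p : obj k l),
    vcomp (hpow (F := obj) (fun a b => hcomp a b) unit₀ unit₁ l) p = p
  interchange : ∀ {k k' l l' m m' : ℕ} (p : obj l m) (p' : obj l' m') (q : obj k l)
    (q' : obj k' l'),
    vcomp (hcomp p p') (hcomp q q') = hcomp (vcomp p q) (vcomp p' q')
  lact_vcomp : ∀ {k l m : ℕ} (σ : Perm (Fin m)) (p : obj l m) (q : obj k l),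
    lact σ (vcomp p q) = vcomp (lact σ p) q
  ract_vcomp : ∀ {k l m : ℕ} (ν : Perm (Fin k)) (p : obj l m) (q : obj k l),
    ract ν (vcomp p q) = vcomp p (ract ν q)
  vcomp_lact : ∀ {k l m : ℕ} (τ : Perm (Fin l)) (p : obj l m) (q : obj k l),
    vcomp (ract τ p) q = vcomp p (lact τ q)
  hcomp_lact : ∀ {k l k' l' : ℕ} (σ : Perm (Fin l)) (σ' : Perm (Fin l')) (p : obj k l)
    (p' : obj k' l'),
    hcomp (lact σ p) (lact σ' p') = lact (tensorPerm σ σ') (hcomp p p')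
  hcomp_ract : ∀ {k l k' l' : ℕ} (τ : Perm (Fin k)) (τ' : Perm (Fin k')) (p : obj k l)
    (p' : obj k' l'),
    hcomp (ract τ p) (ract τ' p') = ract (tensorPerm τ τ') (hcomp p p')
  hcomp_comm : ∀ {k l k' l' : ℕ} (p : obj k l) (p' : obj k' l'),
    lact (blockSwap l l') (hcomp p p') =
      ract (blockSwap k k')
        (recast obj (Nat.add_comm k' k) (Nat.add_comm l' l) (hcomp p' p))

/-- Morphisms of `𝔖 × 𝔖ᵒᵖ`-modules. -/
structure SModule.Hom {K : Type v} [Field K] (M : SModule.{v, w} K) (N : SModule.{v, w'} K) where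
  toFun : ∀ k l : ℕ, M.obj k l →ₗ[K] N.obj k l
  map_lact : ∀ {k l : ℕ} (σ : Perm (Fin l)) (p : M.obj k l),
    toFun k l (M.lact σ p) = N.lact σ (toFun k l p)
  map_ract : ∀ {k l : ℕ} (τ : Perm (Fin k)) (p : M.obj k l),
    toFun k l (M.ract τ p) = N.ract τ (toFun k l p)

/-- Morphisms of ProPs. -/
structure ProP.Hom {K : Type v} [Field K] (P : ProP.{v, w} K) (Q : ProP.{v, w'} K) extends
    SModule.Hom P.toSModule Q.toSModule where
  map_hcomp : ∀ {k l k' l' : ℕ} (p : P.obj k l) (p' : P.obj k' l'),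
    toFun (k + k') (l + l') (P.hcomp p p') = Q.hcomp (toFun k l p) (toFun k' l' p')
  map_vcomp : ∀ {k l m : ℕ} (p : P.obj l m) (q : P.obj k l),
    toFun k m (P.vcomp p q) = Q.vcomp (toFun l m p) (toFun k l q)
  map_unit₀ : toFun 0 0 P.unit₀ = Q.unit₀
  map_unit₁ : toFun 1 1 P.unit₁ = Q.unit₁

/-- A sub-`𝔖 × 𝔖ᵒᵖ`-module. -/
structure SModule.Sub {K : Type v} [Field K] (M : SModule.{v, w} K) where
  carrier : ∀ k l : ℕ, Submodule K (M.obj k l)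
  lact_mem : ∀ {k l : ℕ} (σ : Perm (Fin l)) {p : M.obj k l}, p ∈ carrier k l →
    M.lact σ p ∈ carrier k l
  ract_mem : ∀ {k l : ℕ} (τ : Perm (Fin k)) {p : M.obj k l}, p ∈ carrier k l →
    M.ract τ p ∈ carrier k l

/-- A sub-`𝔖 × 𝔖ᵒᵖ`-module, as an `𝔖 × 𝔖ᵒᵖ`-module. -/
def SModule.Sub.toSModule {K : Type v} [Field K] {M : SModule.{v, w} K} (N : M.Sub) :
    SModule.{v, w} K where
  obj k l := N.carrier k l
  lact σ := (M.lact σ).restrict fun _ hp => N.lact_mem σ hp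
  ract τ := (M.ract τ).restrict fun _ hp => N.ract_mem τ hp
  one_lact p := Subtype.ext (M.one_lact p.1)
  one_ract p := Subtype.ext (M.one_ract p.1)
  lact_lact σ σ' p := Subtype.ext (M.lact_lact σ σ' p.1)
  ract_ract τ τ' p := Subtype.ext (M.ract_ract τ τ' p.1)
  lact_ract σ τ p := Subtype.ext (M.lact_ract σ τ p.1)

/-- The intersection of two sub-modules `N` and `N'` of `M`, as a sub-module of `N`. -/
def SModule.Sub.within {K : Type v} [Field K] {M : SModule.{v, w} K} (N' N : M.Sub) :
    N.toSModule.Sub where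
  carrier k l := (N'.carrier k l).comap (N.carrier k l).subtype
  lact_mem σ _ hp := N'.lact_mem σ hp
  ract_mem τ _ hp := N'.ract_mem τ hp

/-- A sub-ProP. -/
structure ProP.Sub {K : Type v} [Field K] (P : ProP.{v, w} K) extends
    SModule.Sub P.toSModule where
  hcomp_mem : ∀ {k l k' l' : ℕ} {p : P.obj k l} {p' : P.obj k' l'}, p ∈ carrier k l →
    p' ∈ carrier k' l' → P.hcomp p p' ∈ carrier (k + k') (l + l')
  vcomp_mem : ∀ {k l m : ℕ} {p : P.obj l m} {q : P.obj k l}, p ∈ carrier l m →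
    q ∈ carrier k l → P.vcomp p q ∈ carrier k m
  unit₀_mem : P.unit₀ ∈ carrier 0 0
  unit₁_mem : P.unit₁ ∈ carrier 1 1

theorem recast_val {K : Type v} [Field K] {P : ProP.{v, w} K} (Q : P.Sub) {k l k' l' : ℕ}
    (hk : k = k') (hl : l = l') (x : Q.carrier k l) :
    (recast (fun k l => Q.carrier k l) hk hl x : P.obj k' l') = recast P.obj hk hl x.1 := by
  subst hk hl; rfl

theorem hpow_val {K : Type v} [Field K] {P : ProP.{v, w} K} (Q : P.Sub)
    (h : ∀ {k l k' l' : ℕ}, Q.carrier k l → Q.carrier k' l' → Q.carrier (k + k') (l + l'))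
    (hh : ∀ {k l k' l' : ℕ} (x : Q.carrier k l) (y : Q.carrier k' l'),
      (h x y : P.obj _ _) = P.hcomp x.1 y.1) (n : ℕ) :
    (hpow (F := fun k l => Q.carrier k l) h ⟨P.unit₀, Q.unit₀_mem⟩ ⟨P.unit₁, Q.unit₁_mem⟩ n :
      P.obj n n) = hpow (F := P.obj) (fun a b => P.hcomp a b) P.unit₀ P.unit₁ n := by
  induction n with
  | zero => rfl
  | succ n ih => simp only [hpow, hh, ih]

/-- A sub-ProP, as a ProP. -/
def ProP.Sub.toProP {K : Type v} [Field K] {P : ProP.{v, w} K} (Q : P.Sub) : ProP.{v, w} K where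
  toSModule := Q.toSub.toSModule
  hcomp := LinearMap.mk₂ K (fun p p' => ⟨P.hcomp p.1 p'.1, Q.hcomp_mem p.2 p'.2⟩)
    (fun _ _ _ => Subtype.ext (LinearMap.map_add₂ _ _ _ _))
    (fun _ _ _ => Subtype.ext (LinearMap.map_smul₂ _ _ _ _))
    (fun _ _ _ => Subtype.ext (map_add _ _ _)) (fun _ _ _ => Subtype.ext (map_smul _ _ _))
  vcomp := LinearMap.mk₂ K (fun p q => ⟨P.vcomp p.1 q.1, Q.vcomp_mem p.2 q.2⟩)
    (fun _ _ _ => Subtype.ext (LinearMap.map_add₂ _ _ _ _))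
    (fun _ _ _ => Subtype.ext (LinearMap.map_smul₂ _ _ _ _))
    (fun _ _ _ => Subtype.ext (map_add _ _ _)) (fun _ _ _ => Subtype.ext (map_smul _ _ _))
  unit₀ := ⟨P.unit₀, Q.unit₀_mem⟩
  unit₁ := ⟨P.unit₁, Q.unit₁_mem⟩
  hcomp_assoc p p' p'' := Subtype.ext
    ((P.hcomp_assoc p.1 p'.1 p''.1).trans
      (recast_val Q _ _ ⟨_, Q.hcomp_mem (Q.hcomp_mem p.2 p'.2) p''.2⟩).symm)
  hcomp_unit₀ p := Subtype.ext ((recast_val Q _ _ _).trans (P.hcomp_unit₀ p.1))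
  unit₀_hcomp p := Subtype.ext ((recast_val Q _ _ _).trans (P.unit₀_hcomp p.1))
  vcomp_assoc p q r := Subtype.ext (P.vcomp_assoc p.1 q.1 r.1)
  vcomp_unit p := Subtype.ext ((congrArg (P.vcomp p.1)
    (hpow_val Q _ (fun _ _ => rfl) _)).trans (P.vcomp_unit p.1))
  unit_vcomp p := Subtype.ext ((congrArg (fun z => P.vcomp z p.1)
    (hpow_val Q _ (fun _ _ => rfl) _)).trans (P.unit_vcomp p.1))
  interchange p p' q q' := Subtype.ext (P.interchange p.1 p'.1 q.1 q'.1)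
  lact_vcomp σ p q := Subtype.ext (P.lact_vcomp σ p.1 q.1)
  ract_vcomp ν p q := Subtype.ext (P.ract_vcomp ν p.1 q.1)
  vcomp_lact τ p q := Subtype.ext (P.vcomp_lact τ p.1 q.1)
  hcomp_lact σ σ' p p' := Subtype.ext (P.hcomp_lact σ σ' p.1 p'.1)
  hcomp_ract τ τ' p p' := Subtype.ext (P.hcomp_ract τ τ' p.1 p'.1)
  hcomp_comm p p' := Subtype.ext
    ((P.hcomp_comm p.1 p'.1).trans (congrArg (P.ract _)
      (recast_val Q _ _ ⟨_, Q.hcomp_mem p'.2 p.2⟩).symm))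

/-- `Q` is the free ProP generated by its sub-`𝔖 × 𝔖ᵒᵖ`-module `M`: every morphism of
`𝔖 × 𝔖ᵒᵖ`-modules from `M` to a ProP `P` extends uniquely to a morphism of ProPs `Q → P`. -/
def ProP.IsFreeOn {K : Type v} [Field K] (Q : ProP.{v, w} K) (M : Q.toSModule.Sub) : Prop :=
  ∀ (P : ProP.{v, w'} K) (φ : M.toSModule.Hom P.toSModule),
    ∃! Φ : Q.Hom P, ∀ (k l : ℕ) (x : M.carrier k l), Φ.toFun k l x.1 = φ.toFun k l x

/-! ### ProPs in sets, and their linearisation -/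

/-- A ProP in sets: the data and the axioms of a ProP, without the linear structure. -/
structure SetProP where
  obj : ℕ → ℕ → Type w
  lact : ∀ {k l : ℕ}, Perm (Fin l) → obj k l → obj k l
  ract : ∀ {k l : ℕ}, Perm (Fin k) → obj k l → obj k l
  hcomp : ∀ {k l k' l' : ℕ}, obj k l → obj k' l' → obj (k + k') (l + l')
  vcomp : ∀ {k l m : ℕ}, obj l m → obj k l → obj k m
  unit₀ : obj 0 0
  unit₁ : obj 1 1
  one_lact : ∀ {k l : ℕ} (p : obj k l), lact 1 p = p
  one_ract : ∀ {k l : ℕ} (p : obj k l), ract 1 p = p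
  lact_lact : ∀ {k l : ℕ} (σ σ' : Perm (Fin l)) (p : obj k l),
    lact σ (lact σ' p) = lact (σ * σ') p
  ract_ract : ∀ {k l : ℕ} (τ τ' : Perm (Fin k)) (p : obj k l),
    ract τ' (ract τ p) = ract (τ * τ') p
  lact_ract : ∀ {k l : ℕ} (σ : Perm (Fin l)) (τ : Perm (Fin k)) (p : obj k l),
    lact σ (ract τ p) = ract τ (lact σ p)
  hcomp_assoc : ∀ {k l k' l' k'' l'' : ℕ} (p : obj k l) (p' : obj k' l') (p'' : obj k'' l''),
    hcomp p (hcomp p' p'') =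
      recast obj (Nat.add_assoc k k' k'') (Nat.add_assoc l l' l'') (hcomp (hcomp p p') p'')
  hcomp_unit₀ : ∀ {k l : ℕ} (p : obj k l),
    recast obj (Nat.add_zero k) (Nat.add_zero l) (hcomp p unit₀) = p
  unit₀_hcomp : ∀ {k l : ℕ} (p : obj k l),
    recast obj (Nat.zero_add k) (Nat.zero_add l) (hcomp unit₀ p) = p
  vcomp_assoc : ∀ {k l m n : ℕ} (p : obj m n) (q : obj l m) (r : obj k l),
    vcomp p (vcomp q r) = vcomp (vcomp p q) r
  vcomp_unit : ∀ {k l : ℕ} (p : obj k l), vcomp p (hpow (F := obj) hcomp unit₀ unit₁ k) = p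
  unit_vcomp : ∀ {k l : ℕ} (p : obj k l), vcomp (hpow (F := obj) hcomp unit₀ unit₁ l) p = p
  interchange : ∀ {k k' l l' m m' : ℕ} (p : obj l m) (p' : obj l' m') (q : obj k l)
    (q' : obj k' l'),
    vcomp (hcomp p p') (hcomp q q') = hcomp (vcomp p q) (vcomp p' q')
  lact_vcomp : ∀ {k l m : ℕ} (σ : Perm (Fin m)) (p : obj l m) (q : obj k l),
    lact σ (vcomp p q) = vcomp (lact σ p) q
  ract_vcomp : ∀ {k l m : ℕ} (ν : Perm (Fin k)) (p : obj l m) (q : obj k l),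
    ract ν (vcomp p q) = vcomp p (ract ν q)
  vcomp_lact : ∀ {k l m : ℕ} (τ : Perm (Fin l)) (p : obj l m) (q : obj k l),
    vcomp (ract τ p) q = vcomp p (lact τ q)
  hcomp_lact : ∀ {k l k' l' : ℕ} (σ : Perm (Fin l)) (σ' : Perm (Fin l')) (p : obj k l)
    (p' : obj k' l'),
    hcomp (lact σ p) (lact σ' p') = lact (tensorPerm σ σ') (hcomp p p')
  hcomp_ract : ∀ {k l k' l' : ℕ} (τ : Perm (Fin k)) (τ' : Perm (Fin k')) (p : obj k l)
    (p' : obj k' l'),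
    hcomp (ract τ p) (ract τ' p') = ract (tensorPerm τ τ') (hcomp p p')
  hcomp_comm : ∀ {k l k' l' : ℕ} (p : obj k l) (p' : obj k' l'),
    lact (blockSwap l l') (hcomp p p') =
      ract (blockSwap k k')
        (recast obj (Nat.add_comm k' k) (Nat.add_comm l' l) (hcomp p' p))

section Linearise

variable {K : Type v} [Field K]

/-- The bilinear extension of a map `f : A → B → C` to the vector spaces with bases `A`, `B`
and `C`. -/
noncomputable def lin₂ {A B C : Type w} (f : A → B → C) :
    (A →₀ K) →ₗ[K] (B →₀ K) →ₗ[K] (C →₀ K) :=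
  Finsupp.linearCombination K fun a => Finsupp.lmapDomain K K (f a)

theorem lin₂_single {A B C : Type w} (f : A → B → C) (a : A) (b : B) :
    lin₂ (K := K) f (Finsupp.single a 1) (Finsupp.single b 1) = Finsupp.single (f a b) 1 := by
  simp [lin₂]

theorem lin₁_single {A C : Type w} (f : A → C) (a : A) :
    Finsupp.lmapDomain K K f (Finsupp.single a 1) = Finsupp.single (f a) 1 := by
  simp

theorem lin_ext {A : Type w} {M : Type w'} [AddCommGroup M] [Module K M] {f g : (A →₀ K) → M}
    (h : ∀ a, f (Finsupp.single a 1) = g (Finsupp.single a 1))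
    (hf : IsLinearMap K f := by constructor <;> intros <;> simp only [map_add, map_smul,
      LinearMap.add_apply, LinearMap.smul_apply])
    (hg : IsLinearMap K g := by constructor <;> intros <;> simp only [map_add, map_smul,
      LinearMap.add_apply, LinearMap.smul_apply]) (x : A →₀ K) : f x = g x := by
  induction x using Finsupp.induction_linear with
  | zero => rw [hf.map_zero, hg.map_zero]
  | add x y hx hy => rw [hf.map_add, hg.map_add, hx, hy]
  | single a c =>
    have : Finsupp.single a c = c • Finsupp.single a (1 : K) := by simp
    rw [this, hf.map_smul, hg.map_smul, h]

variable (K)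

/-- `recast` for a family of vector spaces with given bases, as a linear map. -/
noncomputable def recastLin (F : ℕ → ℕ → Type w) {k l k' l' : ℕ} (hk : k = k') (hl : l = l') :
    (F k l →₀ K) →ₗ[K] (F k' l' →₀ K) :=
  Finsupp.lmapDomain K K (recast F hk hl)

variable {K}

theorem recastLin_eq (F : ℕ → ℕ → Type w) {k l k' l' : ℕ} (hk : k = k') (hl : l = l')
    (x : F k l →₀ K) :
    recast (fun k l => F k l →₀ K) hk hl x = recastLin K F hk hl x := by
  subst hk hl
  exact (Finsupp.mapDomain_id (v := x)).symm

theorem hpow_lin (S : SetProP.{w}) (n : ℕ) :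
    hpow (F := fun k l => S.obj k l →₀ K) (fun a b => lin₂ S.hcomp a b)
      (Finsupp.single S.unit₀ 1) (Finsupp.single S.unit₁ 1) n =
      Finsupp.single (hpow (F := S.obj) S.hcomp S.unit₀ S.unit₁ n) 1 := by
  induction n with
  | zero => rfl
  | succ n ih => simp only [hpow, ih, lin₂_single]

end Linearise

set_option linter.unusedSimpArgs false in
/-- The linearisation of a ProP in sets: `obj k l` is the vector space with basis `S.obj k l`. -/
noncomputable def SetProP.lin (K : Type v) [Field K] (S : SetProP.{w}) : ProP.{v, max v w} K where
  obj k l := S.obj k l →₀ K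
  lact σ := Finsupp.lmapDomain K K (S.lact σ)
  ract τ := Finsupp.lmapDomain K K (S.ract τ)
  hcomp := lin₂ S.hcomp
  vcomp := lin₂ S.vcomp
  unit₀ := Finsupp.single S.unit₀ 1
  unit₁ := Finsupp.single S.unit₁ 1
  one_lact := by
    refine lin_ext fun a => ?_
    simp only [lin₁_single, lin₂_single, recastLin, S.one_lact]
  one_ract := by
    refine lin_ext fun a => ?_
    simp only [lin₁_single, lin₂_single, recastLin, S.one_ract]
  lact_lact := by
    refine fun σ σ' => lin_ext fun a => ?_
    simp only [lin₁_single, lin₂_single, recastLin, S.lact_lact]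
  ract_ract := by
    refine fun τ τ' => lin_ext fun a => ?_
    simp only [lin₁_single, lin₂_single, recastLin, S.ract_ract]
  lact_ract := by
    refine fun σ τ => lin_ext fun a => ?_
    simp only [lin₁_single, lin₂_single, recastLin, S.lact_ract]
  hcomp_assoc := by
    intro _ _ _ _ _ _ p p' p''
    rw [recastLin_eq]
    revert p; refine lin_ext fun a => ?_
    revert p'; refine lin_ext fun b => ?_
    revert p''; refine lin_ext fun c => ?_
    simp only [lin₁_single, lin₂_single, recastLin, S.hcomp_assoc]
  hcomp_unit₀ := by
    intro _ _ p
    rw [recastLin_eq]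
    revert p
    refine lin_ext fun a => ?_
    simp only [lin₁_single, lin₂_single, recastLin, S.hcomp_unit₀]
  unit₀_hcomp := by
    intro _ _ p
    rw [recastLin_eq]
    revert p
    refine lin_ext fun a => ?_
    simp only [lin₁_single, lin₂_single, recastLin, S.unit₀_hcomp]
  vcomp_assoc := by
    intro _ _ _ _ p q r
    revert p; refine lin_ext fun a => ?_
    revert q; refine lin_ext fun b => ?_
    revert r; refine lin_ext fun c => ?_
    simp only [lin₁_single, lin₂_single, recastLin, S.vcomp_assoc]
  vcomp_unit := by
    intro _ _ p
    rw [hpow_lin]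
    revert p
    refine lin_ext fun a => ?_
    simp only [lin₁_single, lin₂_single, recastLin, S.vcomp_unit]
  unit_vcomp := by
    intro _ _ p
    rw [hpow_lin]
    revert p
    refine lin_ext fun a => ?_
    simp only [lin₁_single, lin₂_single, recastLin, S.unit_vcomp]
  interchange := by
    intro _ _ _ _ _ _ p p' q q'
    revert p; refine lin_ext fun a => ?_
    revert p'; refine lin_ext fun b => ?_
    revert q; refine lin_ext fun c => ?_
    revert q'; refine lin_ext fun d => ?_
    simp only [lin₁_single, lin₂_single, recastLin, S.interchange]
  lact_vcomp := by
    intro _ _ _ σ p q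
    revert p; refine lin_ext fun a => ?_
    revert q; refine lin_ext fun b => ?_
    simp only [lin₁_single, lin₂_single, recastLin, S.lact_vcomp]
  ract_vcomp := by
    intro _ _ _ σ p q
    revert p; refine lin_ext fun a => ?_
    revert q; refine lin_ext fun b => ?_
    simp only [lin₁_single, lin₂_single, recastLin, S.ract_vcomp]
  vcomp_lact := by
    intro _ _ _ σ p q
    revert p; refine lin_ext fun a => ?_
    revert q; refine lin_ext fun b => ?_
    simp only [lin₁_single, lin₂_single, recastLin, S.vcomp_lact]
  hcomp_lact := by
    intro _ _ _ _ σ σ' p q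
    revert p; refine lin_ext fun a => ?_
    revert q; refine lin_ext fun b => ?_
    simp only [lin₁_single, lin₂_single, recastLin, S.hcomp_lact]
  hcomp_ract := by
    intro _ _ _ _ σ σ' p q
    revert p; refine lin_ext fun a => ?_
    revert q; refine lin_ext fun b => ?_
    simp only [lin₁_single, lin₂_single, recastLin, S.hcomp_ract]
  hcomp_comm := by
    intro _ _ _ _ p q
    rw [recastLin_eq]
    revert p; refine lin_ext fun a => ?_
    revert q; refine lin_ext fun b => ?_
    simp only [lin₁_single, lin₂_single, recastLin, S.hcomp_comm]

/-! ### Graphs -/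

/-- A graph with inputs indexed by `Fin k` and outputs indexed by `Fin l`: finite sets of
vertices `V`, of internal edges `E`, of input edges `In`, of output edges `Out`, of input-output
edges `InOut` and of loops (edges without endpoints) `L`, a source map, a target map, and
indexations of the inputs and of the outputs. -/
structure Graph (k l : ℕ) where
  V : Type
  E : Type
  In : Type
  Out : Type
  InOut : Type
  L : Type
  [finV : Finite V]
  [finE : Finite E]
  [finIn : Finite In]
  [finOut : Finite Out]
  [finInOut : Finite InOut]
  [finL : Finite L]
  s : E ⊕ Out → V
  t : E ⊕ In → V
  α : In ⊕ InOut ≃ Fin k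
  β : Out ⊕ InOut ≃ Fin l

attribute [instance] Graph.finV Graph.finE Graph.finIn Graph.finOut Graph.finInOut Graph.finL

namespace Graph

variable {k l m n k' l' m' k'' l'' : ℕ}

/-- Isomorphisms of graphs. -/
structure Iso (G H : Graph k l) where
  onV : G.V ≃ H.V
  onE : G.E ≃ H.E
  onIn : G.In ≃ H.In
  onOut : G.Out ≃ H.Out
  onInOut : G.InOut ≃ H.InOut
  onL : G.L ≃ H.L
  map_s : ∀ x, H.s (Sum.map onE onOut x) = onV (G.s x)
  map_t : ∀ x, H.t (Sum.map onE onIn x) = onV (G.t x)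
  map_α : ∀ x, H.α (Sum.map onIn onInOut x) = G.α x
  map_β : ∀ x, H.β (Sum.map onOut onInOut x) = G.β x

def Iso.refl (G : Graph k l) : Iso G G where
  onV := .refl _
  onE := .refl _
  onIn := .refl _
  onOut := .refl _
  onInOut := .refl _
  onL := .refl _
  map_s := by rintro (x | x) <;> rfl
  map_t := by rintro (x | x) <;> rfl
  map_α := by rintro (x | x) <;> rfl
  map_β := by rintro (x | x) <;> rfl

def Iso.trans {G H J : Graph k l} (f : Iso G H) (g : Iso H J) : Iso G J where
  onV := f.onV.trans g.onV
  onE := f.onE.trans g.onE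
  onIn := f.onIn.trans g.onIn
  onOut := f.onOut.trans g.onOut
  onInOut := f.onInOut.trans g.onInOut
  onL := f.onL.trans g.onL
  map_s x := by rw [trans_apply, ← f.map_s, ← g.map_s]; rcases x with x | x <;> rfl
  map_t x := by rw [trans_apply, ← f.map_t, ← g.map_t]; rcases x with x | x <;> rfl
  map_α x := by rw [← f.map_α, ← g.map_α]; rcases x with x | x <;> rfl
  map_β x := by rw [← f.map_β, ← g.map_β]; rcases x with x | x <;> rfl

def Iso.symm {G H : Graph k l} (f : Iso G H) : Iso H G where
  onV := f.onV.symm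
  onE := f.onE.symm
  onIn := f.onIn.symm
  onOut := f.onOut.symm
  onInOut := f.onInOut.symm
  onL := f.onL.symm
  map_s x := by rw [Equiv.eq_symm_apply, ← f.map_s]; rcases x with x | x <;> simp
  map_t x := by rw [Equiv.eq_symm_apply, ← f.map_t]; rcases x with x | x <;> simp
  map_α x := by rw [← f.map_α]; rcases x with x | x <;> simp
  map_β x := by rw [← f.map_β]; rcases x with x | x <;> simp

/-- The same graph, with inputs and outputs reindexed. -/
def reindex (G : Graph k l) (a : Fin k ≃ Fin k') (b : Fin l ≃ Fin l') : Graph k' l' :=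
  { G with α := G.α.trans a, β := G.β.trans b }

/-- `σ · G` -/
def lact (σ : Perm (Fin l)) (G : Graph k l) : Graph k l := G.reindex (Equiv.refl _) σ

/-- `G · τ` -/
def ract (τ : Perm (Fin k)) (G : Graph k l) : Graph k l := G.reindex τ⁻¹ (Equiv.refl _)

/-- The graph without vertices and loops, with `n` input-output edges, which connect the `i`-th
input to the `i`-th output. For `n = 0` this is the empty graph `I₀`, and for `n = 1` it is `I₁`. -/
def unit (n : ℕ) : Graph n n where
  V := Empty
  E := Empty
  In := Empty
  Out := Empty
  InOut := Fin n
  L := Empty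
  s := Sum.elim Empty.elim Empty.elim
  t := Sum.elim Empty.elim Empty.elim
  α := emptySum _ _
  β := emptySum _ _

/-- Horizontal concatenation: the disjoint union `G * G'`, in which the inputs and the outputs of
`G'` are indexed after those of `G`. -/
def hcomp (G : Graph k l) (G' : Graph k' l') : Graph (k + k') (l + l') where
  V := G.V ⊕ G'.V
  E := G.E ⊕ G'.E
  In := G.In ⊕ G'.In
  Out := G.Out ⊕ G'.Out
  InOut := G.InOut ⊕ G'.InOut
  L := G.L ⊕ G'.L
  s := Sum.map G.s G'.s ∘ sumSumSumComm G.E G'.E G.Out G'.Out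
  t := Sum.map G.t G'.t ∘ sumSumSumComm G.E G'.E G.In G'.In
  α := (sumSumSumComm G.In G'.In G.InOut G'.InOut).trans
    ((sumCongr G.α G'.α).trans finSumFinEquiv)
  β := (sumSumSumComm G.Out G'.Out G.InOut G'.InOut).trans
    ((sumCongr G.β G'.β).trans finSumFinEquiv)

section Vertical

variable (G' : Graph l m) (G : Graph k l)

/-- The internal edges of `G' ∘ G`: those of `G` and of `G'`, and the pairs of an output edge of
`G` and an input edge of `G'` with the same index. -/
abbrev VE : Type := (G.E ⊕ G'.E) ⊕ {p : G.Out × G'.In // G.β (.inl p.1) = G'.α (.inl p.2)}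

/-- The input edges of `G' ∘ G`. -/
abbrev VIn : Type := G.In ⊕ {p : G.InOut × G'.In // G.β (.inr p.1) = G'.α (.inl p.2)}

/-- The output edges of `G' ∘ G`. -/
abbrev VOut : Type := G'.Out ⊕ {p : G.Out × G'.InOut // G.β (.inl p.1) = G'.α (.inr p.2)}

/-- The input-output edges of `G' ∘ G`. -/
abbrev VInOut : Type := {p : G.InOut × G'.InOut // G.β (.inr p.1) = G'.α (.inr p.2)}

/-- The edge of `G` or `G'` at which an internal or output edge of `G' ∘ G` starts. -/
def vS : VE G' G ⊕ VOut G' G → (G.E ⊕ G.Out) ⊕ (G'.E ⊕ G'.Out)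
  | .inl (.inl (.inl e)) => .inl (.inl e)
  | .inl (.inl (.inr e)) => .inr (.inl e)
  | .inl (.inr p) => .inl (.inr p.1.1)
  | .inr (.inl f) => .inr (.inr f)
  | .inr (.inr p) => .inl (.inr p.1.1)

/-- The edge of `G` or `G'` with which an internal or input edge of `G' ∘ G` ends. -/
def vT : VE G' G ⊕ VIn G' G → (G.E ⊕ G.In) ⊕ (G'.E ⊕ G'.In)
  | .inl (.inl (.inl e)) => .inl (.inl e)
  | .inl (.inl (.inr e)) => .inr (.inl e)
  | .inl (.inr p) => .inr (.inr p.1.2)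
  | .inr (.inl e) => .inl (.inr e)
  | .inr (.inr p) => .inr (.inr p.1.2)

/-- The edge of `G` with which an input or input-output edge of `G' ∘ G` begins. -/
def vα : VIn G' G ⊕ VInOut G' G → G.In ⊕ G.InOut
  | .inl (.inl e) => .inl e
  | .inl (.inr p) => .inr p.1.1
  | .inr p => .inr p.1.1

/-- The edge of `G'` with which an output or input-output edge of `G' ∘ G` ends. -/
def vβ : VOut G' G ⊕ VInOut G' G → G'.Out ⊕ G'.InOut
  | .inl (.inl f) => .inl f
  | .inl (.inr p) => .inr p.1.2
  | .inr p => .inr p.1.2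

theorem exists_above (i : Fin l) :
    (∃ e, G'.α (.inl e) = i) ∨ (∃ e, G'.α (.inr e) = i) := by
  obtain ⟨x | x, rfl⟩ := G'.α.surjective i
  exacts [.inl ⟨x, rfl⟩, .inr ⟨x, rfl⟩]

theorem exists_below (i : Fin l) :
    (∃ e, G.β (.inl e) = i) ∨ (∃ e, G.β (.inr e) = i) := by
  obtain ⟨x | x, rfl⟩ := G.β.surjective i
  exacts [.inl ⟨x, rfl⟩, .inr ⟨x, rfl⟩]

theorem vS_bijective : Bijective (vS G' G) := by
  constructor
  · rintro (((e | e) | ⟨⟨f, e⟩, h⟩) | (f | ⟨⟨f, e⟩, h⟩))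
      (((e' | e') | ⟨⟨f', e'⟩, h'⟩) | (f' | ⟨⟨f', e'⟩, h'⟩)) H
    all_goals cases H
    all_goals first | rfl | cases G'.α.injective (h.symm.trans h') <;> rfl
  · rintro ((e | f) | (e | f))
    · exact ⟨.inl (.inl (.inl e)), rfl⟩
    · rcases exists_above G' (G.β (.inl f)) with ⟨e, h⟩ | ⟨e, h⟩
      · exact ⟨.inl (.inr ⟨(f, e), h.symm⟩), rfl⟩
      · exact ⟨.inr (.inr ⟨(f, e), h.symm⟩), rfl⟩
    · exact ⟨.inl (.inl (.inr e)), rfl⟩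
    · exact ⟨.inr (.inl f), rfl⟩

theorem vT_bijective : Bijective (vT G' G) := by
  constructor
  · rintro (((e | e) | ⟨⟨f, e⟩, h⟩) | (f | ⟨⟨f, e⟩, h⟩))
      (((e' | e') | ⟨⟨f', e'⟩, h'⟩) | (f' | ⟨⟨f', e'⟩, h'⟩)) H
    all_goals cases H
    all_goals first | rfl | cases G.β.injective (h.trans h'.symm) <;> rfl
  · rintro ((e | e) | (e | e))
    · exact ⟨.inl (.inl (.inl e)), rfl⟩
    · exact ⟨.inr (.inl e), rfl⟩
    · exact ⟨.inl (.inl (.inr e)), rfl⟩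
    · rcases exists_below G (G'.α (.inl e)) with ⟨f, h⟩ | ⟨f, h⟩
      · exact ⟨.inl (.inr ⟨(f, e), h⟩), rfl⟩
      · exact ⟨.inr (.inr ⟨(f, e), h⟩), rfl⟩

theorem vα_bijective : Bijective (vα G' G) := by
  constructor
  · rintro ((e | ⟨⟨f, e⟩, h⟩) | ⟨⟨f, e⟩, h⟩) ((e' | ⟨⟨f', e'⟩, h'⟩) | ⟨⟨f', e'⟩, h'⟩) H
    all_goals cases H
    all_goals first | rfl | cases G'.α.injective (h.symm.trans h') <;> rfl
  · rintro (e | f)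
    · exact ⟨.inl (.inl e), rfl⟩
    · rcases exists_above G' (G.β (.inr f)) with ⟨e, h⟩ | ⟨e, h⟩
      · exact ⟨.inl (.inr ⟨(f, e), h.symm⟩), rfl⟩
      · exact ⟨.inr ⟨(f, e), h.symm⟩, rfl⟩

theorem vβ_bijective : Bijective (vβ G' G) := by
  constructor
  · rintro ((e | ⟨⟨f, e⟩, h⟩) | ⟨⟨f, e⟩, h⟩) ((e' | ⟨⟨f', e'⟩, h'⟩) | ⟨⟨f', e'⟩, h'⟩) H
    all_goals cases H
    all_goals first | rfl | cases G.β.injective (h.trans h'.symm) <;> rfl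
  · rintro (f | e)
    · exact ⟨.inl (.inl f), rfl⟩
    · rcases exists_below G (G'.α (.inr e)) with ⟨f, h⟩ | ⟨f, h⟩
      · exact ⟨.inl (.inr ⟨(f, e), h⟩), rfl⟩
      · exact ⟨.inr ⟨(f, e), h⟩, rfl⟩

/-- Vertical concatenation `G' ∘ G`: the `i`-th output of `G` is glued to the `i`-th input of
`G'`. -/
noncomputable def vcomp : Graph k m where
  V := G.V ⊕ G'.V
  E := VE G' G
  In := VIn G' G
  Out := VOut G' G
  InOut := VInOut G' G
  L := G.L ⊕ G'.L
  s := Sum.map G.s G'.s ∘ vS G' G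
  t := Sum.map G.t G'.t ∘ vT G' G
  α := (Equiv.ofBijective _ (vα_bijective G' G)).trans G.α
  β := (Equiv.ofBijective _ (vβ_bijective G' G)).trans G'.β

end Vertical

/-- A presentation of an isomorphism of graphs through the starting points and the end points of
their edges. -/
structure FlagIso (G H : Graph k l) where
  onV : G.V ≃ H.V
  onL : G.L ≃ H.L
  S : Type
  T : Type
  aS : G.E ⊕ G.Out ≃ S
  bS : H.E ⊕ H.Out ≃ S
  aT : G.E ⊕ G.In ≃ T
  bT : H.E ⊕ H.In ≃ T
  src : S → H.V
  tgt : T → H.V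
  aS_src : ∀ x, onV (G.s x) = src (aS x)
  bS_src : ∀ x, H.s x = src (bS x)
  aT_tgt : ∀ x, onV (G.t x) = tgt (aT x)
  bT_tgt : ∀ x, H.t x = tgt (bT x)
  hE : ∀ e, ∃ e', bS (.inl e') = aS (.inl e) ∧ bT (.inl e') = aT (.inl e)
  hIn : ∀ e, ∃ e', bT (.inr e') = aT (.inr e) ∧ H.α (.inl e') = G.α (.inl e)
  hOut : ∀ e, ∃ e', bS (.inr e') = aS (.inr e) ∧ H.β (.inl e') = G.β (.inl e)
  hInOut : ∀ e, ∃ e', H.α (.inr e') = G.α (.inr e) ∧ H.β (.inr e') = G.β (.inr e)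

theorem FlagIso.exists_iso {G H : Graph k l} (F : FlagIso G H) :
    ∃ f : Iso G H, f.onV = F.onV ∧ (∀ x, F.bS (Sum.map f.onE f.onOut x) = F.aS x) ∧
      ∀ x, F.bT (Sum.map f.onE f.onIn x) = F.aT x := by
  choose fE hE hE' using F.hE
  choose fIn hIn hIn' using F.hIn
  choose fOut hOut hOut' using F.hOut
  choose fThru hThru hThru' using F.hInOut
  have bE : Bijective fE := by
    constructor
    · intro a b h
      have := hE a
      rw [h, hE b] at this
      simpa using this.symm
    · intro e
      obtain ⟨x | x, hx⟩ := F.aS.surjective (F.bS (.inl e))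
      · exact ⟨x, by simpa [hx] using hE x⟩
      · simpa [hx] using hOut x
  have bIn : Bijective fIn := by
    constructor
    · intro a b h
      have := hIn a
      rw [h, hIn b] at this
      simpa using this.symm
    · intro e
      obtain ⟨x | x, hx⟩ := F.aT.surjective (F.bT (.inr e))
      · simpa [hx] using hE' x
      · exact ⟨x, by simpa [hx] using hIn x⟩
  have bOut : Bijective fOut := by
    constructor
    · intro a b h
      have := hOut a
      rw [h, hOut b] at this
      simpa using this.symm
    · intro e
      obtain ⟨x | x, hx⟩ := F.aS.surjective (F.bS (.inr e))
      · simpa [hx] using hE x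
      · exact ⟨x, by simpa [hx] using hOut x⟩
  have bThru : Bijective fThru := by
    constructor
    · intro a b h
      have := hThru a
      rw [h, hThru b] at this
      simpa using this.symm
    · intro e
      obtain ⟨x | x, hx⟩ := G.α.surjective (H.α (.inr e))
      · simpa [hx] using hIn' x
      · exact ⟨x, by simpa [hx] using hThru x⟩
  have hS : ∀ x, F.bS (Sum.map fE fOut x) = F.aS x := by rintro (x | x) <;> simp [hE, hOut]
  have hT : ∀ x, F.bT (Sum.map fE fIn x) = F.aT x := by rintro (x | x) <;> simp [hE', hIn]
  refine ⟨⟨F.onV, .ofBijective _ bE, .ofBijective _ bIn, .ofBijective _ bOut, .ofBijective _ bThru,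
    F.onL, fun x => ?_, fun x => ?_, ?_, ?_⟩, rfl, hS, hT⟩
  · rw [F.bS_src, F.aS_src]; exact congrArg F.src (hS x)
  · rw [F.bT_tgt, F.aT_tgt]; exact congrArg F.tgt (hT x)
  · rintro (x | x) <;> simp [hIn', hThru]
  · rintro (x | x) <;> simp [hOut', hThru']


/-! Isomorphisms behind the axioms of a ProP. -/

instance : IsEmpty (unit n).V := inferInstanceAs (IsEmpty Empty)
instance : IsEmpty (unit n).E := inferInstanceAs (IsEmpty Empty)
instance : IsEmpty (unit n).In := inferInstanceAs (IsEmpty Empty)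
instance : IsEmpty (unit n).Out := inferInstanceAs (IsEmpty Empty)
instance : IsEmpty (unit n).L := inferInstanceAs (IsEmpty Empty)

noncomputable def eS (G' : Graph l m) (G : Graph k l) :
    (vcomp G' G).E ⊕ (vcomp G' G).Out ≃ (G.E ⊕ G.Out) ⊕ (G'.E ⊕ G'.Out) :=
  .ofBijective _ (vS_bijective G' G)

noncomputable def eT (G' : Graph l m) (G : Graph k l) :
    (vcomp G' G).E ⊕ (vcomp G' G).In ≃ (G.E ⊕ G.In) ⊕ (G'.E ⊕ G'.In) :=
  .ofBijective _ (vT_bijective G' G)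

def hS (G : Graph k l) (G' : Graph k' l') :
    (hcomp G G').E ⊕ (hcomp G G').Out ≃ (G.E ⊕ G.Out) ⊕ (G'.E ⊕ G'.Out) :=
  sumSumSumComm _ _ _ _

def hT (G : Graph k l) (G' : Graph k' l') :
    (hcomp G G').E ⊕ (hcomp G G').In ≃ (G.E ⊕ G.In) ⊕ (G'.E ⊕ G'.In) :=
  sumSumSumComm _ _ _ _

theorem recast_eq (G : Graph k l) (hk : k = k') (hl : l = l') :
    recast Graph hk hl G = G.reindex (finCongr hk) (finCongr hl) := by
  subst hk hl; rfl

def Iso.onS {G H : Graph k l} (f : Iso G H) : G.E ⊕ G.Out ≃ H.E ⊕ H.Out := sumCongr f.onE f.onOut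

def Iso.onT {G H : Graph k l} (f : Iso G H) : G.E ⊕ G.In ≃ H.E ⊕ H.In := sumCongr f.onE f.onIn

def Iso.reindex {G H : Graph k l} (f : Iso G H) (a : Fin k ≃ Fin k') (b : Fin l ≃ Fin l') :
    Iso (G.reindex a b) (H.reindex a b) :=
  { f with
    map_α := fun x => congrArg a (f.map_α x)
    map_β := fun x => congrArg b (f.map_β x) }

def hcompCongr {G H : Graph k l} {G' H' : Graph k' l'} (f : Iso G H) (f' : Iso G' H') :
    FlagIso (G.hcomp G') (H.hcomp H') where
  onV := sumCongr f.onV f'.onV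
  onL := sumCongr f.onL f'.onL
  S := _
  T := _
  aS := (hS G G').trans (sumCongr f.onS f'.onS)
  bS := hS H H'
  aT := (hT G G').trans (sumCongr f.onT f'.onT)
  bT := hT H H'
  src := Sum.map H.s H'.s
  tgt := Sum.map H.t H'.t
  aS_src := by
    rintro ((x | x) | (x | x))
    exacts [congrArg Sum.inl (f.map_s (.inl x)).symm, congrArg Sum.inr (f'.map_s (.inl x)).symm,
      congrArg Sum.inl (f.map_s (.inr x)).symm, congrArg Sum.inr (f'.map_s (.inr x)).symm]
  bS_src _ := rfl
  aT_tgt := by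
    rintro ((x | x) | (x | x))
    exacts [congrArg Sum.inl (f.map_t (.inl x)).symm, congrArg Sum.inr (f'.map_t (.inl x)).symm,
      congrArg Sum.inl (f.map_t (.inr x)).symm, congrArg Sum.inr (f'.map_t (.inr x)).symm]
  bT_tgt _ := rfl
  hE := by
    rintro (e | e)
    exacts [⟨.inl (f.onE e), rfl, rfl⟩, ⟨.inr (f'.onE e), rfl, rfl⟩]
  hIn := by
    rintro (e | e)
    exacts [⟨.inl (f.onIn e), rfl, congrArg (Fin.castAdd k') (f.map_α (.inl e))⟩,
      ⟨.inr (f'.onIn e), rfl, congrArg (Fin.natAdd k) (f'.map_α (.inl e))⟩]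
  hOut := by
    rintro (e | e)
    exacts [⟨.inl (f.onOut e), rfl, congrArg (Fin.castAdd l') (f.map_β (.inl e))⟩,
      ⟨.inr (f'.onOut e), rfl, congrArg (Fin.natAdd l) (f'.map_β (.inl e))⟩]
  hInOut := by
    rintro (e | e)
    exacts [⟨.inl (f.onInOut e), congrArg (Fin.castAdd k') (f.map_α (.inr e)),
        congrArg (Fin.castAdd l') (f.map_β (.inr e))⟩,
      ⟨.inr (f'.onInOut e), congrArg (Fin.natAdd k) (f'.map_α (.inr e)),
        congrArg (Fin.natAdd l) (f'.map_β (.inr e))⟩]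

noncomputable def vcompCongr {G H : Graph k l} {G' H' : Graph l m} (f' : Iso G' H') (f : Iso G H) :
    FlagIso (G'.vcomp G) (H'.vcomp H) where
  onV := sumCongr f.onV f'.onV
  onL := sumCongr f.onL f'.onL
  S := _
  T := _
  aS := (eS G' G).trans (sumCongr f.onS f'.onS)
  bS := eS H' H
  aT := (eT G' G).trans (sumCongr f.onT f'.onT)
  bT := eT H' H
  src := Sum.map H.s H'.s
  tgt := Sum.map H.t H'.t
  aS_src := by
    intro x
    change Sum.map f.onV f'.onV (Sum.map G.s G'.s (eS G' G x)) =
      Sum.map H.s H'.s (Sum.map f.onS f'.onS (eS G' G x))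
    rcases eS G' G x with y | y
    exacts [congrArg Sum.inl (f.map_s y).symm, congrArg Sum.inr (f'.map_s y).symm]
  bS_src _ := rfl
  aT_tgt := by
    intro x
    change Sum.map f.onV f'.onV (Sum.map G.t G'.t (eT G' G x)) =
      Sum.map H.t H'.t (Sum.map f.onT f'.onT (eT G' G x))
    rcases eT G' G x with y | y
    exacts [congrArg Sum.inl (f.map_t y).symm, congrArg Sum.inr (f'.map_t y).symm]
  bT_tgt _ := rfl
  hE := by
    rintro ((e | e) | ⟨⟨x, y⟩, h⟩)
    exacts [⟨.inl (.inl (f.onE e)), rfl, rfl⟩, ⟨.inl (.inr (f'.onE e)), rfl, rfl⟩,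
      ⟨.inr ⟨(f.onOut x, f'.onIn y), (f.map_β (.inl x)).trans (h.trans (f'.map_α (.inl y)).symm)⟩,
        rfl, rfl⟩]
  hIn := by
    rintro (e | ⟨⟨x, y⟩, h⟩)
    exacts [⟨.inl (f.onIn e), rfl, f.map_α (.inl e)⟩,
      ⟨.inr ⟨(f.onInOut x, f'.onIn y),
        (f.map_β (.inr x)).trans (h.trans (f'.map_α (.inl y)).symm)⟩, rfl, f.map_α (.inr x)⟩]
  hOut := by
    rintro (e | ⟨⟨x, y⟩, h⟩)
    exacts [⟨.inl (f'.onOut e), rfl, f'.map_β (.inl e)⟩,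
      ⟨.inr ⟨(f.onOut x, f'.onInOut y),
        (f.map_β (.inl x)).trans (h.trans (f'.map_α (.inr y)).symm)⟩, rfl, f'.map_β (.inr y)⟩]
  hInOut := by
    rintro ⟨⟨x, y⟩, h⟩
    exact ⟨⟨(f.onInOut x, f'.onInOut y),
      (f.map_β (.inr x)).trans (h.trans (f'.map_α (.inr y)).symm)⟩,
      f.map_α (.inr x), f'.map_β (.inr y)⟩

def hcompAssoc (G : Graph k l) (G' : Graph k' l') (G'' : Graph k'' l'') :
    FlagIso (G.hcomp (G'.hcomp G'')) (((G.hcomp G').hcomp G'').reindex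
      (finCongr (Nat.add_assoc k k' k'')) (finCongr (Nat.add_assoc l l' l''))) where
  onV := (sumAssoc _ _ _).symm
  onL := (sumAssoc _ _ _).symm
  S := _
  T := _
  aS := ((hS G _).trans (sumCongr (.refl _) (hS G' G''))).trans (sumAssoc _ _ _).symm
  bS := (hS (G.hcomp G') G'').trans (sumCongr (hS G G') (.refl _))
  aT := ((hT G _).trans (sumCongr (.refl _) (hT G' G''))).trans (sumAssoc _ _ _).symm
  bT := (hT (G.hcomp G') G'').trans (sumCongr (hT G G') (.refl _))
  src := Sum.map (Sum.map G.s G'.s) G''.s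
  tgt := Sum.map (Sum.map G.t G'.t) G''.t
  aS_src := by rintro ((x | x | x) | (x | x | x)) <;> rfl
  bS_src := by rintro (((x | x) | x) | ((x | x) | x)) <;> rfl
  aT_tgt := by rintro ((x | x | x) | (x | x | x)) <;> rfl
  bT_tgt := by rintro (((x | x) | x) | ((x | x) | x)) <;> rfl
  hE := by
    rintro (e | e | e)
    exacts [⟨.inl (.inl e), rfl, rfl⟩, ⟨.inl (.inr e), rfl, rfl⟩, ⟨.inr e, rfl, rfl⟩]
  hIn := by
    rintro (e | e | e)
    exacts [⟨.inl (.inl e), rfl, rfl⟩, ⟨.inl (.inr e), rfl, rfl⟩,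
      ⟨.inr e, rfl, Fin.ext (Nat.add_assoc _ _ _)⟩]
  hOut := by
    rintro (e | e | e)
    exacts [⟨.inl (.inl e), rfl, rfl⟩, ⟨.inl (.inr e), rfl, rfl⟩,
      ⟨.inr e, rfl, Fin.ext (Nat.add_assoc _ _ _)⟩]
  hInOut := by
    rintro (e | e | e)
    exacts [⟨.inl (.inl e), rfl, rfl⟩, ⟨.inl (.inr e), rfl, rfl⟩,
      ⟨.inr e, Fin.ext (Nat.add_assoc _ _ _), Fin.ext (Nat.add_assoc _ _ _)⟩]

def hcompUnit (G : Graph k l) :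
    FlagIso ((G.hcomp (unit 0)).reindex (finCongr (Nat.add_zero k)) (finCongr (Nat.add_zero l)))
      G where
  onV := sumEmpty _ _
  onL := sumEmpty _ _
  S := _
  T := _
  aS := (hS G (unit 0)).trans ((sumCongr (.refl _) (sumEmpty _ _)).trans (sumEmpty _ Empty))
  bS := .refl _
  aT := (hT G (unit 0)).trans ((sumCongr (.refl _) (sumEmpty _ _)).trans (sumEmpty _ Empty))
  bT := .refl _
  src := G.s
  tgt := G.t
  aS_src := by rintro ((x | ⟨⟨⟩⟩) | (x | ⟨⟨⟩⟩)) <;> rfl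
  bS_src _ := rfl
  aT_tgt := by rintro ((x | ⟨⟨⟩⟩) | (x | ⟨⟨⟩⟩)) <;> rfl
  bT_tgt _ := rfl
  hE := by
    rintro (e | ⟨⟨⟩⟩)
    exact ⟨e, rfl, rfl⟩
  hIn := by
    rintro (e | ⟨⟨⟩⟩)
    exact ⟨e, rfl, rfl⟩
  hOut := by
    rintro (e | ⟨⟨⟩⟩)
    exact ⟨e, rfl, rfl⟩
  hInOut := by
    rintro (e | e)
    exacts [⟨e, rfl, rfl⟩, Fin.elim0 e]

def unitHcomp (G : Graph k l) :
    FlagIso (((unit 0).hcomp G).reindex (finCongr (Nat.zero_add k)) (finCongr (Nat.zero_add l)))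
      G where
  onV := emptySum _ _
  onL := emptySum _ _
  S := _
  T := _
  aS := (hS (unit 0) G).trans ((sumCongr (sumEmpty _ _) (.refl _)).trans (emptySum Empty _))
  bS := .refl _
  aT := (hT (unit 0) G).trans ((sumCongr (sumEmpty _ _) (.refl _)).trans (emptySum Empty _))
  bT := .refl _
  src := G.s
  tgt := G.t
  aS_src := by rintro ((⟨⟨⟩⟩ | x) | (⟨⟨⟩⟩ | x)) <;> rfl
  bS_src _ := rfl
  aT_tgt := by rintro ((⟨⟨⟩⟩ | x) | (⟨⟨⟩⟩ | x)) <;> rfl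
  bT_tgt _ := rfl
  hE := by
    rintro (⟨⟨⟩⟩ | e)
    exact ⟨e, rfl, rfl⟩
  hIn := by
    rintro (⟨⟨⟩⟩ | e)
    exact ⟨e, rfl, Fin.ext (Nat.zero_add _).symm⟩
  hOut := by
    rintro (⟨⟨⟩⟩ | e)
    exact ⟨e, rfl, Fin.ext (Nat.zero_add _).symm⟩
  hInOut := by
    rintro (e | e)
    exacts [Fin.elim0 e, ⟨e, Fin.ext (Nat.zero_add _).symm, Fin.ext (Nat.zero_add _).symm⟩]

def unitSucc (n : ℕ) : FlagIso ((unit n).hcomp (unit 1)) (unit (n + 1)) where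
  onV := sumEmpty _ _
  onL := sumEmpty _ _
  S := Empty
  T := Empty
  aS := (hS (unit n) (unit 1)).trans ((sumCongr (sumEmpty _ _) (sumEmpty _ _)).trans
    (sumEmpty Empty Empty))
  bS := sumEmpty _ _
  aT := (hT (unit n) (unit 1)).trans ((sumCongr (sumEmpty _ _) (sumEmpty _ _)).trans
    (sumEmpty Empty Empty))
  bT := sumEmpty _ _
  src := Empty.elim
  tgt := Empty.elim
  aS_src := by rintro ((⟨⟨⟩⟩ | ⟨⟨⟩⟩) | (⟨⟨⟩⟩ | ⟨⟨⟩⟩))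
  bS_src := by rintro (⟨⟨⟩⟩ | ⟨⟨⟩⟩)
  aT_tgt := by rintro ((⟨⟨⟩⟩ | ⟨⟨⟩⟩) | (⟨⟨⟩⟩ | ⟨⟨⟩⟩))
  bT_tgt := by rintro (⟨⟨⟩⟩ | ⟨⟨⟩⟩)
  hE := by rintro (⟨⟨⟩⟩ | ⟨⟨⟩⟩)
  hIn := by rintro (⟨⟨⟩⟩ | ⟨⟨⟩⟩)
  hOut := by rintro (⟨⟨⟩⟩ | ⟨⟨⟩⟩)
  hInOut := by
    rintro (e | e)
    exacts [⟨Fin.castAdd 1 e, rfl, rfl⟩, ⟨Fin.natAdd n e, rfl, rfl⟩]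

theorem blockSwap_castAdd (m n : ℕ) (i : Fin m) :
    blockSwap m n (Fin.castAdd n i) = finCongr (Nat.add_comm n m) (Fin.natAdd n i) :=
  congrArg (finCongr (Nat.add_comm n m)) (finAddFlip_apply_castAdd i n)

theorem blockSwap_natAdd (m n : ℕ) (i : Fin n) :
    blockSwap m n (Fin.natAdd m i) = finCongr (Nat.add_comm n m) (Fin.castAdd m i) :=
  congrArg (finCongr (Nat.add_comm n m)) (finAddFlip_apply_natAdd i m)

theorem tensorPerm_castAdd {m n : ℕ} (σ : Perm (Fin m)) (τ : Perm (Fin n)) (i : Fin m) :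
    tensorPerm σ τ (Fin.castAdd n i) = Fin.castAdd n (σ i) := by
  simp [tensorPerm, Equiv.permCongr_apply]

theorem tensorPerm_natAdd {m n : ℕ} (σ : Perm (Fin m)) (τ : Perm (Fin n)) (i : Fin n) :
    tensorPerm σ τ (Fin.natAdd m i) = Fin.natAdd m (τ i) := by
  simp [tensorPerm, Equiv.permCongr_apply]

theorem castAdd_ne_natAdd {m n : ℕ} (i : Fin m) (j : Fin n) : Fin.castAdd n i ≠ Fin.natAdd m j :=
  fun h => by have := congrArg Fin.val h; simp at this; omega

theorem comp_src (G' : Graph l m) (G : Graph k l) (x) :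
    (G'.vcomp G).s x = Sum.map G.s G'.s (eS G' G x) := rfl

theorem comp_tgt (G' : Graph l m) (G : Graph k l) (x) :
    (G'.vcomp G).t x = Sum.map G.t G'.t (eT G' G x) := rfl

noncomputable def vcompAssoc (G'' : Graph m n) (G' : Graph l m) (G : Graph k l) :
    FlagIso (G''.vcomp (G'.vcomp G)) ((G''.vcomp G').vcomp G) where
  onV := sumAssoc _ _ _
  onL := sumAssoc _ _ _
  S := _
  T := _
  aS := ((eS G'' (G'.vcomp G)).trans (sumCongr (eS G' G) (.refl _))).trans (sumAssoc _ _ _)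
  bS := (eS (G''.vcomp G') G).trans (sumCongr (.refl _) (eS G'' G'))
  aT := ((eT G'' (G'.vcomp G)).trans (sumCongr (eT G' G) (.refl _))).trans (sumAssoc _ _ _)
  bT := (eT (G''.vcomp G') G).trans (sumCongr (.refl _) (eT G'' G'))
  src := Sum.map G.s (Sum.map G'.s G''.s)
  tgt := Sum.map G.t (Sum.map G'.t G''.t)
  aS_src x := by
    simp only [comp_src, trans_apply, sumCongr_apply]
    rcases eS G'' (G'.vcomp G) x with y | y
    · simp only [Sum.map_inl, comp_src]
      rcases eS G' G y with z | z <;> rfl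
    · rfl
  bS_src x := by
    simp only [comp_src, trans_apply, sumCongr_apply]
    rcases eS (G''.vcomp G') G x with y | y <;> rfl
  aT_tgt x := by
    simp only [comp_tgt, trans_apply, sumCongr_apply]
    rcases eT G'' (G'.vcomp G) x with y | y
    · simp only [Sum.map_inl, comp_tgt]
      rcases eT G' G y with z | z <;> rfl
    · rfl
  bT_tgt x := by
    simp only [comp_tgt, trans_apply, sumCongr_apply]
    rcases eT (G''.vcomp G') G x with y | y <;> rfl
  hE := by
    rintro ((((e | e) | ⟨⟨x, y⟩, h⟩) | e) | ⟨⟨x | ⟨⟨x, y⟩, h⟩, z⟩, h'⟩)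
    exacts [⟨.inl (.inl e), rfl, rfl⟩, ⟨.inl (.inr (.inl (.inl e))), rfl, rfl⟩,
      ⟨.inr ⟨(x, .inl y), h⟩, rfl, rfl⟩, ⟨.inl (.inr (.inl (.inr e))), rfl, rfl⟩,
      ⟨.inl (.inr (.inr ⟨(x, z), h'⟩)), rfl, rfl⟩,
      ⟨.inr ⟨(x, .inr ⟨(y, z), h'⟩), h⟩, rfl, rfl⟩]
  hIn := by
    rintro ((e | ⟨⟨x, y⟩, h⟩) | ⟨⟨⟨⟨x, y⟩, h⟩, z⟩, h'⟩)
    exacts [⟨.inl e, rfl, rfl⟩, ⟨.inr ⟨(x, .inl y), h⟩, rfl, rfl⟩,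
      ⟨.inr ⟨(x, .inr ⟨(y, z), h'⟩), h⟩, rfl, rfl⟩]
  hOut := by
    rintro (e | ⟨⟨x | ⟨⟨x, y⟩, h⟩, z⟩, h'⟩)
    exacts [⟨.inl (.inl e), rfl, rfl⟩, ⟨.inl (.inr ⟨(x, z), h'⟩), rfl, rfl⟩,
      ⟨.inr ⟨(x, ⟨(y, z), h'⟩), h⟩, rfl, rfl⟩]
  hInOut := by
    rintro ⟨⟨⟨⟨x, y⟩, h⟩, z⟩, h'⟩
    exact ⟨⟨(x, ⟨(y, z), h'⟩), h⟩, rfl, rfl⟩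

noncomputable def vcompUnit (G : Graph k l) : FlagIso (G.vcomp (unit k)) G where
  onV := emptySum _ _
  onL := emptySum _ _
  S := _
  T := _
  aS := (eS G (unit k)).trans ((sumCongr (sumEmpty _ _) (.refl _)).trans (emptySum Empty _))
  bS := .refl _
  aT := (eT G (unit k)).trans ((sumCongr (sumEmpty _ _) (.refl _)).trans (emptySum Empty _))
  bT := .refl _
  src := G.s
  tgt := G.t
  aS_src x := by
    simp only [comp_src, trans_apply]
    rcases eS G (unit k) x with (⟨⟨⟩⟩ | ⟨⟨⟩⟩) | y
    rfl
  bS_src _ := rfl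
  aT_tgt x := by
    simp only [comp_tgt, trans_apply]
    rcases eT G (unit k) x with (⟨⟨⟩⟩ | ⟨⟨⟩⟩) | y
    rfl
  bT_tgt _ := rfl
  hE := by
    rintro ((⟨⟨⟩⟩ | e) | ⟨⟨⟨⟨⟩⟩, y⟩, h⟩)
    exact ⟨e, rfl, rfl⟩
  hIn := by
    rintro (⟨⟨⟩⟩ | ⟨⟨x, y⟩, h⟩)
    exact ⟨y, rfl, h.symm⟩
  hOut := by
    rintro (e | ⟨⟨⟨⟨⟩⟩, y⟩, h⟩)
    exact ⟨e, rfl, rfl⟩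
  hInOut := by
    rintro ⟨⟨x, y⟩, h⟩
    exact ⟨y, h.symm, rfl⟩

noncomputable def unitVcomp (G : Graph k l) : FlagIso ((unit l).vcomp G) G where
  onV := sumEmpty _ _
  onL := sumEmpty _ _
  S := _
  T := _
  aS := (eS (unit l) G).trans ((sumCongr (.refl _) (sumEmpty _ _)).trans (sumEmpty _ Empty))
  bS := .refl _
  aT := (eT (unit l) G).trans ((sumCongr (.refl _) (sumEmpty _ _)).trans (sumEmpty _ Empty))
  bT := .refl _
  src := G.s
  tgt := G.t
  aS_src x := by
    simp only [comp_src, trans_apply]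
    rcases eS (unit l) G x with y | (⟨⟨⟩⟩ | ⟨⟨⟩⟩)
    rfl
  bS_src _ := rfl
  aT_tgt x := by
    simp only [comp_tgt, trans_apply]
    rcases eT (unit l) G x with y | (⟨⟨⟩⟩ | ⟨⟨⟩⟩)
    rfl
  bT_tgt _ := rfl
  hE := by
    rintro ((e | ⟨⟨⟩⟩) | ⟨⟨x, ⟨⟨⟩⟩⟩, h⟩)
    exact ⟨e, rfl, rfl⟩
  hIn := by
    rintro (e | ⟨⟨x, ⟨⟨⟩⟩⟩, h⟩)
    exact ⟨e, rfl, rfl⟩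
  hOut := by
    rintro (⟨⟨⟩⟩ | ⟨⟨x, y⟩, h⟩)
    exact ⟨x, rfl, h⟩
  hInOut := by
    rintro ⟨⟨x, y⟩, h⟩
    exact ⟨x, rfl, h⟩

noncomputable def interchange (H : Graph l m) (H' : Graph l' m') (G : Graph k l)
    (G' : Graph k' l') :
    FlagIso ((H.hcomp H').vcomp (G.hcomp G')) ((H.vcomp G).hcomp (H'.vcomp G')) where
  onV := sumSumSumComm _ _ _ _
  onL := sumSumSumComm _ _ _ _
  S := _
  T := _
  aS := (eS (H.hcomp H') (G.hcomp G')).trans ((sumCongr (hS G G') (hS H H')).trans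
    (sumSumSumComm _ _ _ _))
  bS := (hS (H.vcomp G) (H'.vcomp G')).trans (sumCongr (eS H G) (eS H' G'))
  aT := (eT (H.hcomp H') (G.hcomp G')).trans ((sumCongr (hT G G') (hT H H')).trans
    (sumSumSumComm _ _ _ _))
  bT := (hT (H.vcomp G) (H'.vcomp G')).trans (sumCongr (eT H G) (eT H' G'))
  src := Sum.map (Sum.map G.s H.s) (Sum.map G'.s H'.s)
  tgt := Sum.map (Sum.map G.t H.t) (Sum.map G'.t H'.t)
  aS_src x := by
    simp only [comp_src, trans_apply, sumCongr_apply]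
    rcases eS (H.hcomp H') (G.hcomp G') x with ((y | y) | (y | y)) | ((y | y) | (y | y)) <;> rfl
  bS_src x := by
    change Sum.map _ _ (hS (H.vcomp G) (H'.vcomp G') x) = _
    simp only [trans_apply, sumCongr_apply]
    rcases hS (H.vcomp G) (H'.vcomp G') x with y | y <;> rfl
  aT_tgt x := by
    simp only [comp_tgt, trans_apply, sumCongr_apply]
    rcases eT (H.hcomp H') (G.hcomp G') x with ((y | y) | (y | y)) | ((y | y) | (y | y)) <;> rfl
  bT_tgt x := by
    change Sum.map _ _ (hT (H.vcomp G) (H'.vcomp G') x) = _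
    simp only [trans_apply, sumCongr_apply]
    rcases hT (H.vcomp G) (H'.vcomp G') x with y | y <;> rfl
  hE := by
    rintro (((e | e) | (e | e)) | ⟨⟨x | x, y | y⟩, h⟩)
    exacts [⟨.inl (.inl (.inl e)), rfl, rfl⟩, ⟨.inr (.inl (.inl e)), rfl, rfl⟩,
      ⟨.inl (.inl (.inr e)), rfl, rfl⟩, ⟨.inr (.inl (.inr e)), rfl, rfl⟩,
      ⟨.inl (.inr ⟨(x, y), Fin.castAdd_injective _ _ h⟩), rfl, rfl⟩,
      (castAdd_ne_natAdd _ _ h).elim, (castAdd_ne_natAdd _ _ h.symm).elim,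
      ⟨.inr (.inr ⟨(x, y), Fin.natAdd_injective _ _ h⟩), rfl, rfl⟩]
  hIn := by
    rintro ((e | e) | ⟨⟨x | x, y | y⟩, h⟩)
    exacts [⟨.inl (.inl e), rfl, rfl⟩, ⟨.inr (.inl e), rfl, rfl⟩,
      ⟨.inl (.inr ⟨(x, y), Fin.castAdd_injective _ _ h⟩), rfl, rfl⟩,
      (castAdd_ne_natAdd _ _ h).elim, (castAdd_ne_natAdd _ _ h.symm).elim,
      ⟨.inr (.inr ⟨(x, y), Fin.natAdd_injective _ _ h⟩), rfl, rfl⟩]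
  hOut := by
    rintro ((e | e) | ⟨⟨x | x, y | y⟩, h⟩)
    exacts [⟨.inl (.inl e), rfl, rfl⟩, ⟨.inr (.inl e), rfl, rfl⟩,
      ⟨.inl (.inr ⟨(x, y), Fin.castAdd_injective _ _ h⟩), rfl, rfl⟩,
      (castAdd_ne_natAdd _ _ h).elim, (castAdd_ne_natAdd _ _ h.symm).elim,
      ⟨.inr (.inr ⟨(x, y), Fin.natAdd_injective _ _ h⟩), rfl, rfl⟩]
  hInOut := by
    rintro ⟨⟨x | x, y | y⟩, h⟩
    exacts [⟨.inl ⟨(x, y), Fin.castAdd_injective _ _ h⟩, rfl, rfl⟩,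
      (castAdd_ne_natAdd _ _ h).elim, (castAdd_ne_natAdd _ _ h.symm).elim,
      ⟨.inr ⟨(x, y), Fin.natAdd_injective _ _ h⟩, rfl, rfl⟩]

noncomputable def vcompLact (τ : Perm (Fin l)) (G' : Graph l m) (G : Graph k l) :
    FlagIso ((G'.ract τ).vcomp G) (G'.vcomp (G.lact τ)) where
  onV := .refl _
  onL := .refl _
  S := _
  T := _
  aS := eS (G'.ract τ) G
  bS := eS G' (G.lact τ)
  aT := eT (G'.ract τ) G
  bT := eT G' (G.lact τ)
  src := Sum.map G.s G'.s
  tgt := Sum.map G.t G'.t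
  aS_src _ := rfl
  bS_src _ := rfl
  aT_tgt _ := rfl
  bT_tgt _ := rfl
  hE := by
    rintro ((e | e) | ⟨⟨x, y⟩, h⟩)
    exacts [⟨.inl (.inl e), rfl, rfl⟩, ⟨.inl (.inr e), rfl, rfl⟩,
      ⟨.inr ⟨(x, y), (Equiv.eq_symm_apply τ).1 h⟩, rfl, rfl⟩]
  hIn := by
    rintro (e | ⟨⟨x, y⟩, h⟩)
    exacts [⟨.inl e, rfl, rfl⟩, ⟨.inr ⟨(x, y), (Equiv.eq_symm_apply τ).1 h⟩, rfl, rfl⟩]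
  hOut := by
    rintro (e | ⟨⟨x, y⟩, h⟩)
    exacts [⟨.inl e, rfl, rfl⟩, ⟨.inr ⟨(x, y), (Equiv.eq_symm_apply τ).1 h⟩, rfl, rfl⟩]
  hInOut := by
    rintro ⟨⟨x, y⟩, h⟩
    exact ⟨⟨(x, y), (Equiv.eq_symm_apply τ).1 h⟩, rfl, rfl⟩

noncomputable def lactVcomp (σ : Perm (Fin m)) (G' : Graph l m) (G : Graph k l) :
    FlagIso ((G'.vcomp G).lact σ) ((G'.lact σ).vcomp G) where
  onV := .refl _
  onL := .refl _
  S := _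
  T := _
  aS := eS G' G
  bS := eS (G'.lact σ) G
  aT := eT G' G
  bT := eT (G'.lact σ) G
  src := Sum.map G.s G'.s
  tgt := Sum.map G.t G'.t
  aS_src _ := rfl
  bS_src _ := rfl
  aT_tgt _ := rfl
  bT_tgt _ := rfl
  hE e := ⟨e, by rcases e with (e | e) | e <;> exact ⟨rfl, rfl⟩⟩
  hIn e := ⟨e, by rcases e with e | e <;> exact ⟨rfl, rfl⟩⟩
  hOut e := ⟨e, by rcases e with e | e <;> exact ⟨rfl, rfl⟩⟩
  hInOut e := ⟨e, rfl, rfl⟩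

noncomputable def ractVcomp (ν : Perm (Fin k)) (G' : Graph l m) (G : Graph k l) :
    FlagIso ((G'.vcomp G).ract ν) (G'.vcomp (G.ract ν)) where
  onV := .refl _
  onL := .refl _
  S := _
  T := _
  aS := eS G' G
  bS := eS G' (G.ract ν)
  aT := eT G' G
  bT := eT G' (G.ract ν)
  src := Sum.map G.s G'.s
  tgt := Sum.map G.t G'.t
  aS_src _ := rfl
  bS_src _ := rfl
  aT_tgt _ := rfl
  bT_tgt _ := rfl
  hE e := ⟨e, by rcases e with (e | e) | e <;> exact ⟨rfl, rfl⟩⟩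
  hIn e := ⟨e, by rcases e with e | e <;> exact ⟨rfl, rfl⟩⟩
  hOut e := ⟨e, by rcases e with e | e <;> exact ⟨rfl, rfl⟩⟩
  hInOut e := ⟨e, rfl, rfl⟩

/-- A graph in which the indexations are replaced by equal ones. -/
def FlagIso.ofIndex (G : Graph k l) {a a' : G.In ⊕ G.InOut ≃ Fin k'}
    {b b' : G.Out ⊕ G.InOut ≃ Fin l'} (ha : ∀ x, a' x = a x) (hb : ∀ x, b' x = b x) :
    FlagIso ({ G with α := a, β := b } : Graph k' l') { G with α := a', β := b' } where
  onV := .refl _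
  onL := .refl _
  S := _
  T := _
  aS := .refl _
  bS := .refl _
  aT := .refl _
  bT := .refl _
  src := G.s
  tgt := G.t
  aS_src _ := rfl
  bS_src _ := rfl
  aT_tgt _ := rfl
  bT_tgt _ := rfl
  hE e := ⟨e, rfl, rfl⟩
  hIn e := ⟨e, rfl, ha _⟩
  hOut e := ⟨e, rfl, hb _⟩
  hInOut e := ⟨e, ha _, hb _⟩

def hcompLact (σ : Perm (Fin l)) (σ' : Perm (Fin l')) (G : Graph k l) (G' : Graph k' l') :
    FlagIso ((G.lact σ).hcomp (G'.lact σ')) ((G.hcomp G').lact (tensorPerm σ σ')) :=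
  FlagIso.ofIndex (G.hcomp G') (fun _ => rfl) (by
    rintro ((x | x) | (x | x))
    exacts [tensorPerm_castAdd _ _ _, tensorPerm_natAdd _ _ _, tensorPerm_castAdd _ _ _,
      tensorPerm_natAdd _ _ _])

def hcompRact (τ : Perm (Fin k)) (τ' : Perm (Fin k')) (G : Graph k l) (G' : Graph k' l') :
    FlagIso ((G.ract τ).hcomp (G'.ract τ')) ((G.hcomp G').ract (tensorPerm τ τ')) :=
  FlagIso.ofIndex (G.hcomp G') (by
    have h : (tensorPerm τ τ')⁻¹ = tensorPerm τ⁻¹ τ'⁻¹ := rfl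
    rintro ((x | x) | (x | x)) <;> simp only [trans_apply, h]
    exacts [tensorPerm_castAdd _ _ _, tensorPerm_natAdd _ _ _, tensorPerm_castAdd _ _ _,
      tensorPerm_natAdd _ _ _]) (fun _ => rfl)

def hcompComm (G : Graph k l) (G' : Graph k' l') :
    FlagIso ((G.hcomp G').lact (blockSwap l l'))
      (((G'.hcomp G).reindex (finCongr (Nat.add_comm k' k)) (finCongr (Nat.add_comm l' l))).ract
        (blockSwap k k')) where
  onV := sumComm _ _
  onL := sumComm _ _
  S := _
  T := _
  aS := (hS G G').trans (sumComm _ _)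
  bS := hS G' G
  aT := (hT G G').trans (sumComm _ _)
  bT := hT G' G
  src := Sum.map G'.s G.s
  tgt := Sum.map G'.t G.t
  aS_src := by rintro ((x | x) | (x | x)) <;> rfl
  bS_src _ := rfl
  aT_tgt := by rintro ((x | x) | (x | x)) <;> rfl
  bT_tgt _ := rfl
  hE := by
    rintro (e | e)
    exacts [⟨.inr e, rfl, rfl⟩, ⟨.inl e, rfl, rfl⟩]
  hIn := by
    rintro (e | e)
    exacts [⟨.inr e, rfl, (Equiv.symm_apply_eq _).2 (blockSwap_castAdd _ _ _).symm⟩,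
      ⟨.inl e, rfl, (Equiv.symm_apply_eq _).2 (blockSwap_natAdd _ _ _).symm⟩]
  hOut := by
    rintro (e | e)
    exacts [⟨.inr e, rfl, (blockSwap_castAdd _ _ _).symm⟩,
      ⟨.inl e, rfl, (blockSwap_natAdd _ _ _).symm⟩]
  hInOut := by
    rintro (e | e)
    exacts [⟨.inr e, (Equiv.symm_apply_eq _).2 (blockSwap_castAdd _ _ _).symm,
        (blockSwap_castAdd _ _ _).symm⟩,
      ⟨.inl e, (Equiv.symm_apply_eq _).2 (blockSwap_natAdd _ _ _).symm,
        (blockSwap_natAdd _ _ _).symm⟩]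

end Graph

/-! ### Decorated graphs -/

/-- The number of internal and input edges with target `v`. -/
noncomputable def Graph.inDeg {k l : ℕ} (G : Graph k l) (v : G.V) : ℕ :=
  Nat.card {e : G.E ⊕ G.In // G.t e = v}

/-- The number of internal and output edges with source `v`. -/
noncomputable def Graph.outDeg {k l : ℕ} (G : Graph k l) (v : G.V) : ℕ :=
  Nat.card {e : G.E ⊕ G.Out // G.s e = v}

theorem card_fibre_inl {A A' A'' B B' : Type} (f : A → B) (f' : A' → B') (φ : A'' ≃ A ⊕ A')
    (b : B) : Nat.card {e // Sum.map f f' (φ e) = .inl b} = Nat.card {a // f a = b} := by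
  symm
  refine Nat.card_eq_of_bijective (fun a => ⟨φ.symm (.inl a.1), by simp [a.2]⟩) ⟨?_, ?_⟩
  · rintro ⟨a, ha⟩ ⟨a', ha'⟩ h
    simpa using h
  · rintro ⟨e, he⟩
    obtain ⟨x, rfl⟩ := φ.symm.surjective e
    rcases x with x | x
    · exact ⟨⟨x, by simpa using he⟩, rfl⟩
    · simp at he

theorem card_fibre_inr {A A' A'' B B' : Type} (f : A → B) (f' : A' → B') (φ : A'' ≃ A ⊕ A')
    (b : B') : Nat.card {e // Sum.map f f' (φ e) = .inr b} = Nat.card {a // f' a = b} := by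
  symm
  refine Nat.card_eq_of_bijective (fun a => ⟨φ.symm (.inr a.1), by simp [a.2]⟩) ⟨?_, ?_⟩
  · rintro ⟨a, ha⟩ ⟨a', ha'⟩ h
    simpa using h
  · rintro ⟨e, he⟩
    obtain ⟨x, rfl⟩ := φ.symm.surjective e
    rcases x with x | x
    · simp at he
    · exact ⟨⟨x, by simpa using he⟩, rfl⟩

/-- A graph decorated by the family of sets `X`: every vertex `v` carries an element of
`X (inDeg v) (outDeg v)`. -/
structure DecGraph (X : ℕ → ℕ → Type u) (k l : ℕ) extends Graph k l where
  dec : V → Σ p : ℕ × ℕ, X p.1 p.2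
  dec_fst : ∀ v, (dec v).1 = (toGraph.inDeg v, toGraph.outDeg v)

namespace DecGraph

variable {X : ℕ → ℕ → Type u} {k l m k' l' : ℕ}

/-- Two decorated graphs are isomorphic if there is an isomorphism of graphs which preserves the
decorations. -/
def Rel (G H : DecGraph X k l) : Prop :=
  ∃ f : Graph.Iso G.toGraph H.toGraph, ∀ v, H.dec (f.onV v) = G.dec v

instance setoid (X : ℕ → ℕ → Type u) (k l : ℕ) : Setoid (DecGraph X k l) where
  r := Rel
  iseqv :=
    { refl := fun G => ⟨.refl _, fun _ => rfl⟩
      symm := fun ⟨f, hf⟩ => ⟨f.symm, fun v => by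
        rw [← hf]; exact congrArg _ (f.onV.apply_symm_apply v)⟩
      trans := fun ⟨f, hf⟩ ⟨g, hg⟩ => ⟨f.trans g, fun v => (hg _).trans (hf v)⟩ }

def reindex (G : DecGraph X k l) (a : Fin k ≃ Fin k') (b : Fin l ≃ Fin l') :
    DecGraph X k' l' where
  toGraph := G.toGraph.reindex a b
  dec := G.dec
  dec_fst := G.dec_fst

/-- `σ · G` -/
def lact (σ : Perm (Fin l)) (G : DecGraph X k l) : DecGraph X k l where
  toGraph := G.toGraph.lact σ
  dec := G.dec
  dec_fst := G.dec_fst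

/-- `G · τ` -/
def ract (τ : Perm (Fin k)) (G : DecGraph X k l) : DecGraph X k l where
  toGraph := G.toGraph.ract τ
  dec := G.dec
  dec_fst := G.dec_fst

variable (X) in
/-- The graph `I_n`, which has no vertices. -/
def unit (n : ℕ) : DecGraph X n n where
  toGraph := Graph.unit n
  dec := Empty.elim
  dec_fst v := v.elim

/-- `G * G'`, with the decorations of `G` and `G'`. -/
def hcomp (G : DecGraph X k l) (G' : DecGraph X k' l') : DecGraph X (k + k') (l + l') where
  toGraph := G.toGraph.hcomp G'.toGraph
  dec := Sum.elim G.dec G'.dec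
  dec_fst := by
    rintro (v | v)
    · exact (G.dec_fst v).trans (Prod.ext (card_fibre_inl _ _ (Graph.hT _ _) v).symm
        (card_fibre_inl _ _ (Graph.hS _ _) v).symm)
    · exact (G'.dec_fst v).trans (Prod.ext (card_fibre_inr _ _ (Graph.hT _ _) v).symm
        (card_fibre_inr _ _ (Graph.hS _ _) v).symm)

/-- `G' ∘ G`, with the decorations of `G` and `G'`. -/
noncomputable def vcomp (G' : DecGraph X l m) (G : DecGraph X k l) : DecGraph X k m where
  toGraph := G'.toGraph.vcomp G.toGraph
  dec := Sum.elim G.dec G'.dec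
  dec_fst := by
    rintro (v | v)
    · exact (G.dec_fst v).trans (Prod.ext (card_fibre_inl _ _ (Graph.eT _ _) v).symm
        (card_fibre_inl _ _ (Graph.eS _ _) v).symm)
    · exact (G'.dec_fst v).trans (Prod.ext (card_fibre_inr _ _ (Graph.eT _ _) v).symm
        (card_fibre_inr _ _ (Graph.eS _ _) v).symm)

theorem rel_of_flag {G H : DecGraph X k l} (F : Graph.FlagIso G.toGraph H.toGraph)
    (h : ∀ v, H.dec (F.onV v) = G.dec v) : G ≈ H := by
  obtain ⟨f, hf, -⟩ := F.exists_iso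
  exact ⟨f, fun v => by rw [hf, h]⟩

variable (X) in
/-- Isomorphism classes of decorated graphs. -/
def Class (k l : ℕ) : Type (max 1 u) := Quotient (setoid X k l)

theorem recast_mk (G : DecGraph X k l) (hk : k = k') (hl : l = l') :
    recast (Class X) hk hl (Quotient.mk _ G) =
      Quotient.mk _ (G.reindex (finCongr hk) (finCongr hl)) := by
  subst hk hl; rfl

/-- Horizontal concatenation of isomorphism classes. -/
def Class.hcomp : Class X k l → Class X k' l' → Class X (k + k') (l + l') :=
  Quotient.map₂ DecGraph.hcomp fun _ _ ⟨f, hf⟩ _ _ ⟨f', hf'⟩ =>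
    rel_of_flag (Graph.hcompCongr f f') (by rintro (v | v); exacts [hf v, hf' v])

/-- Vertical concatenation of isomorphism classes. -/
noncomputable def Class.vcomp : Class X l m → Class X k l → Class X k m :=
  Quotient.map₂ DecGraph.vcomp fun _ _ ⟨f', hf'⟩ _ _ ⟨f, hf⟩ =>
    rel_of_flag (Graph.vcompCongr f' f) (by rintro (v | v); exacts [hf v, hf' v])

theorem hpow_unit (n : ℕ) :
    hpow (F := Class X) Class.hcomp (Quotient.mk _ (unit X 0)) (Quotient.mk _ (unit X 1)) n =
      Quotient.mk _ (unit X n) := by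
  induction n with
  | zero => rfl
  | succ n ih =>
    refine (congrArg (fun z => Class.hcomp z (Quotient.mk _ (unit X 1))) ih).trans ?_
    exact Quotient.sound (rel_of_flag (Graph.unitSucc n) (by rintro (⟨⟨⟩⟩ | ⟨⟨⟩⟩)))

end DecGraph

/-- The ProP in sets of isomorphism classes of `X`-decorated graphs. -/
noncomputable def decGraphs (X : ℕ → ℕ → Type u) : SetProP.{max 1 u} where
  obj := DecGraph.Class X
  lact σ := Quotient.map (DecGraph.lact σ) fun _ _ ⟨f, hf⟩ => ⟨f.reindex _ _, hf⟩
  ract τ := Quotient.map (DecGraph.ract τ) fun _ _ ⟨f, hf⟩ => ⟨f.reindex _ _, hf⟩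
  hcomp := DecGraph.Class.hcomp
  vcomp := DecGraph.Class.vcomp
  unit₀ := Quotient.mk _ (DecGraph.unit X 0)
  unit₁ := Quotient.mk _ (DecGraph.unit X 1)
  one_lact := by rintro _ _ ⟨G⟩; rfl
  one_ract := by rintro _ _ ⟨G⟩; rfl
  lact_lact := by rintro _ _ σ σ' ⟨G⟩; rfl
  ract_ract := by rintro _ _ τ τ' ⟨G⟩; rfl
  lact_ract := by rintro _ _ σ τ ⟨G⟩; rfl
  hcomp_assoc := by
    rintro _ _ _ _ _ _ ⟨G⟩ ⟨G'⟩ ⟨G''⟩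
    exact (Quotient.sound (DecGraph.rel_of_flag (Graph.hcompAssoc _ _ _)
      (by rintro (v | v | v) <;> rfl))).trans
      (DecGraph.recast_mk ((G.hcomp G').hcomp G'') _ _).symm
  hcomp_unit₀ := by
    rintro _ _ ⟨G⟩
    exact (DecGraph.recast_mk (G.hcomp (.unit X 0)) _ _).trans
      (Quotient.sound (DecGraph.rel_of_flag (Graph.hcompUnit _) (by rintro (v | ⟨⟨⟩⟩); rfl)))
  unit₀_hcomp := by
    rintro _ _ ⟨G⟩
    exact (DecGraph.recast_mk ((DecGraph.unit X 0).hcomp G) _ _).trans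
      (Quotient.sound (DecGraph.rel_of_flag (Graph.unitHcomp _) (by rintro (⟨⟨⟩⟩ | v); rfl)))
  vcomp_assoc := by
    rintro _ _ _ _ ⟨G⟩ ⟨G'⟩ ⟨G''⟩
    exact Quotient.sound (DecGraph.rel_of_flag (Graph.vcompAssoc _ _ _)
      (by rintro ((v | v) | v) <;> rfl))
  vcomp_unit := by
    rintro _ _ ⟨G⟩
    rw [DecGraph.hpow_unit]
    exact Quotient.sound (DecGraph.rel_of_flag (Graph.vcompUnit _) (by rintro (⟨⟨⟩⟩ | v); rfl))
  unit_vcomp := by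
    rintro _ _ ⟨G⟩
    rw [DecGraph.hpow_unit]
    exact Quotient.sound (DecGraph.rel_of_flag (Graph.unitVcomp _) (by rintro (v | ⟨⟨⟩⟩); rfl))
  interchange := by
    rintro _ _ _ _ _ _ ⟨H⟩ ⟨H'⟩ ⟨G⟩ ⟨G'⟩
    exact Quotient.sound (DecGraph.rel_of_flag (Graph.interchange _ _ _ _)
      (by rintro ((v | v) | (v | v)) <;> rfl))
  lact_vcomp := by
    rintro _ _ _ σ ⟨G'⟩ ⟨G⟩
    exact Quotient.sound (DecGraph.rel_of_flag (Graph.lactVcomp σ _ _) fun _ => rfl)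
  ract_vcomp := by
    rintro _ _ _ ν ⟨G'⟩ ⟨G⟩
    exact Quotient.sound (DecGraph.rel_of_flag (Graph.ractVcomp ν _ _) fun _ => rfl)
  vcomp_lact := by
    rintro _ _ _ τ ⟨G'⟩ ⟨G⟩
    exact Quotient.sound (DecGraph.rel_of_flag (Graph.vcompLact τ _ _) fun _ => rfl)
  hcomp_lact := by
    rintro _ _ _ _ σ σ' ⟨G⟩ ⟨G'⟩
    exact Quotient.sound (DecGraph.rel_of_flag (Graph.hcompLact σ σ' _ _) fun _ => rfl)
  hcomp_ract := by
    rintro _ _ _ _ τ τ' ⟨G⟩ ⟨G'⟩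
    exact Quotient.sound (DecGraph.rel_of_flag (Graph.hcompRact τ τ' _ _) fun _ => rfl)
  hcomp_comm := by
    rintro _ _ _ _ ⟨G⟩ ⟨G'⟩
    refine (?_ : _ = _).trans (congrArg _ (DecGraph.recast_mk (G'.hcomp G) _ _).symm)
    exact Quotient.sound (DecGraph.rel_of_flag (Graph.hcompComm _ _)
      (by rintro (v | v) <;> rfl))

/-! ### Planar decorated graphs -/

/-- A (strict) total order on every fibre of `f`; elements of different fibres are not
comparable. -/
structure FibreOrder {A B : Type} (f : A → B) where
  lt : A → A → Prop
  fibre : ∀ {a b}, lt a b → f a = f b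
  irrefl : ∀ a, ¬ lt a a
  trans : ∀ {a b c}, lt a b → lt b c → lt a c
  total : ∀ {a b}, f a = f b → lt a b ∨ a = b ∨ lt b a

/-- The order on the fibres of a disjoint union of maps. -/
def FibreOrder.sum {A A' A'' B B' : Type} {f : A → B} {f' : A' → B'} (o : FibreOrder f)
    (o' : FibreOrder f') (φ : A'' ≃ A ⊕ A') : FibreOrder (Sum.map f f' ∘ φ) where
  lt a b := Sum.LiftRel o.lt o'.lt (φ a) (φ b)
  fibre {a b} h := by
    simp only [comp_apply]
    rcases hx : φ a with x | x <;> rcases hy : φ b with y | y <;> simp [hx, hy] at h ⊢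
    · exact o.fibre h
    · exact o'.fibre h
  irrefl a h := by
    rcases hx : φ a with x | x
    · exact o.irrefl x (by simpa [hx] using h)
    · exact o'.irrefl x (by simpa [hx] using h)
  trans {a b c} h h' := by
    rcases hx : φ a with x | x <;> rcases hy : φ b with y | y <;> rcases hz : φ c with z | z <;>
      simp only [hx, hy, hz, Sum.liftRel_inl_inl, Sum.liftRel_inr_inr, Sum.not_liftRel_inl_inr,
        Sum.not_liftRel_inr_inl] at h h' ⊢
    · exact o.trans h h'
    · exact o'.trans h h'
  total {a b} h := by
    rw [← φ.apply_eq_iff_eq]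
    simp only [comp_apply] at h
    rcases hx : φ a with x | x <;> rcases hy : φ b with y | y <;> simp [hx, hy] at h ⊢
    · exact o.total h
    · exact o'.total h

/-- A planar decorated graph: a decorated graph in which, for every vertex, the set of edges which
end at this vertex and the set of edges which start at this vertex are totally ordered. -/
structure PDecGraph (X : ℕ → ℕ → Type u) (k l : ℕ) extends DecGraph X k l where
  inOrd : FibreOrder t
  outOrd : FibreOrder s

namespace PDecGraph

variable {X : ℕ → ℕ → Type u} {k l m k' l' : ℕ}

/-- Two planar decorated graphs are isomorphic if there is an isomorphism of graphs which preserves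
the decorations and the orders. -/
def Rel (G H : PDecGraph X k l) : Prop :=
  ∃ f : Graph.Iso G.toGraph H.toGraph, (∀ v, H.dec (f.onV v) = G.dec v) ∧
    (∀ x y, H.inOrd.lt (f.onT x) (f.onT y) ↔ G.inOrd.lt x y) ∧
    (∀ x y, H.outOrd.lt (f.onS x) (f.onS y) ↔ G.outOrd.lt x y)

theorem onT_symm {G H : Graph k l} (f : Graph.Iso G H) (x) : f.onT (f.symm.onT x) = x := by
  rcases x with x | x
  · exact congrArg Sum.inl (f.onE.apply_symm_apply x)
  · exact congrArg Sum.inr (f.onIn.apply_symm_apply x)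

theorem onS_symm {G H : Graph k l} (f : Graph.Iso G H) (x) : f.onS (f.symm.onS x) = x := by
  rcases x with x | x
  · exact congrArg Sum.inl (f.onE.apply_symm_apply x)
  · exact congrArg Sum.inr (f.onOut.apply_symm_apply x)

theorem onT_trans {G H J : Graph k l} (f : Graph.Iso G H) (g : Graph.Iso H J) (x) :
    (f.trans g).onT x = g.onT (f.onT x) := by
  rcases x with x | x <;> rfl

theorem onS_trans {G H J : Graph k l} (f : Graph.Iso G H) (g : Graph.Iso H J) (x) :
    (f.trans g).onS x = g.onS (f.onS x) := by
  rcases x with x | x <;> rfl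

theorem onT_refl {G : Graph k l} (x) : (Graph.Iso.refl G).onT x = x := by
  rcases x with x | x <;> rfl

theorem onS_refl {G : Graph k l} (x) : (Graph.Iso.refl G).onS x = x := by
  rcases x with x | x <;> rfl

instance setoid (X : ℕ → ℕ → Type u) (k l : ℕ) : Setoid (PDecGraph X k l) where
  r := Rel
  iseqv :=
    { refl := fun G => ⟨.refl _, fun _ => rfl, fun x y => by rw [onT_refl, onT_refl],
        fun x y => by rw [onS_refl, onS_refl]⟩
      symm := fun ⟨f, hf, hi, ho⟩ => ⟨f.symm, fun v => by
        rw [← hf]; exact congrArg _ (f.onV.apply_symm_apply v),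
        fun x y => by rw [← hi, onT_symm, onT_symm], fun x y => by rw [← ho, onS_symm, onS_symm]⟩
      trans := fun ⟨f, hf, hi, ho⟩ ⟨g, hg, hi', ho'⟩ =>
        ⟨f.trans g, fun v => (hg _).trans (hf v),
          fun x y => by rw [onT_trans, onT_trans, hi', hi],
          fun x y => by rw [onS_trans, onS_trans, ho', ho]⟩ }

def reindex (G : PDecGraph X k l) (a : Fin k ≃ Fin k') (b : Fin l ≃ Fin l') :
    PDecGraph X k' l' where
  toDecGraph := G.toDecGraph.reindex a b
  inOrd := G.inOrd
  outOrd := G.outOrd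

/-- `σ · G` -/
def lact (σ : Perm (Fin l)) (G : PDecGraph X k l) : PDecGraph X k l where
  toDecGraph := G.toDecGraph.lact σ
  inOrd := G.inOrd
  outOrd := G.outOrd

/-- `G · τ` -/
def ract (τ : Perm (Fin k)) (G : PDecGraph X k l) : PDecGraph X k l where
  toDecGraph := G.toDecGraph.ract τ
  inOrd := G.inOrd
  outOrd := G.outOrd

/-- The only order on the fibres of a map on an empty type. -/
def emptyOrder {A B : Type} [IsEmpty A] (f : A → B) : FibreOrder f where
  lt _ _ := False
  fibre h := h.elim
  irrefl _ h := h
  trans h _ := h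
  total {a} _ := isEmptyElim a

variable (X) in
/-- The graph `I_n`, which has no vertices. -/
def unit (n : ℕ) : PDecGraph X n n where
  toDecGraph := DecGraph.unit X n
  inOrd := @emptyOrder _ _ (inferInstanceAs (IsEmpty (Empty ⊕ Empty))) _
  outOrd := @emptyOrder _ _ (inferInstanceAs (IsEmpty (Empty ⊕ Empty))) _

/-- `G * G'`, with the orders of `G` and `G'`. -/
def hcomp (G : PDecGraph X k l) (G' : PDecGraph X k' l') : PDecGraph X (k + k') (l + l') where
  toDecGraph := G.toDecGraph.hcomp G'.toDecGraph
  inOrd := G.inOrd.sum G'.inOrd (Graph.hT _ _)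
  outOrd := G.outOrd.sum G'.outOrd (Graph.hS _ _)

/-- `G' ∘ G`, with the orders of `G` and `G'`. -/
noncomputable def vcomp (G' : PDecGraph X l m) (G : PDecGraph X k l) : PDecGraph X k m where
  toDecGraph := G'.toDecGraph.vcomp G.toDecGraph
  inOrd := G.inOrd.sum G'.inOrd (Graph.eT _ _)
  outOrd := G.outOrd.sum G'.outOrd (Graph.eS _ _)

theorem rel_of_flag {G H : PDecGraph X k l} (F : Graph.FlagIso G.toGraph H.toGraph)
    (h : ∀ v, H.dec (F.onV v) = G.dec v) (RT : F.T → F.T → Prop) (RS : F.S → F.S → Prop)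
    (hGT : ∀ x y, G.inOrd.lt x y ↔ RT (F.aT x) (F.aT y))
    (hHT : ∀ x y, H.inOrd.lt x y ↔ RT (F.bT x) (F.bT y))
    (hGS : ∀ x y, G.outOrd.lt x y ↔ RS (F.aS x) (F.aS y))
    (hHS : ∀ x y, H.outOrd.lt x y ↔ RS (F.bS x) (F.bS y)) : G ≈ H := by
  obtain ⟨f, hf, hS, hT⟩ := F.exists_iso
  refine ⟨f, fun v => by rw [hf, h], fun x y => ?_, fun x y => ?_⟩
  · rw [hHT, hGT]
    exact iff_of_eq (congrArg₂ RT (hT x) (hT y))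
  · rw [hHS, hGS]
    exact iff_of_eq (congrArg₂ RS (hS x) (hS y))

variable (X) in
/-- Isomorphism classes of planar decorated graphs. -/
def Class (k l : ℕ) : Type (max 1 u) := Quotient (setoid X k l)

theorem recast_mk (G : PDecGraph X k l) (hk : k = k') (hl : l = l') :
    recast (Class X) hk hl (Quotient.mk _ G) =
      Quotient.mk _ (G.reindex (finCongr hk) (finCongr hl)) := by
  subst hk hl; rfl

theorem liftRel_map {A A' B B' : Type} {r : A → A → Prop} {r' : A' → A' → Prop}
    {q : B → B → Prop} {q' : B' → B' → Prop} {f : A → B} {f' : A' → B'}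
    (h : ∀ x y, r x y ↔ q (f x) (f y)) (h' : ∀ x y, r' x y ↔ q' (f' x) (f' y)) (u v : A ⊕ A') :
    Sum.LiftRel r r' u v ↔ Sum.LiftRel q q' (Sum.map f f' u) (Sum.map f f' v) := by
  rcases u with u | u <;> rcases v with v | v <;> simp [h, h']

theorem liftRel_assoc {A B C : Type} {r : A → A → Prop} {r' : B → B → Prop} {r'' : C → C → Prop}
    (u v : A ⊕ (B ⊕ C)) : Sum.LiftRel r (Sum.LiftRel r' r'') u v ↔
      Sum.LiftRel (Sum.LiftRel r r') r'' ((sumAssoc A B C).symm u) ((sumAssoc A B C).symm v) := by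
  rcases u with u | u | u <;> rcases v with v | v | v <;> simp

theorem liftRel_symm_assoc {A B C : Type} {r : A → A → Prop} {r' : B → B → Prop}
    {r'' : C → C → Prop} (u v : (A ⊕ B) ⊕ C) : Sum.LiftRel (Sum.LiftRel r r') r'' u v ↔
      Sum.LiftRel r (Sum.LiftRel r' r'') (sumAssoc A B C u) (sumAssoc A B C v) := by
  rcases u with (u | u) | u <;> rcases v with (v | v) | v <;> simp

theorem liftRel_comm {A B C D : Type} {p : A → A → Prop} {q : B → B → Prop} {r : C → C → Prop}
    {s : D → D → Prop} (u v : (A ⊕ B) ⊕ (C ⊕ D)) :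
    Sum.LiftRel (Sum.LiftRel p q) (Sum.LiftRel r s) u v ↔
      Sum.LiftRel (Sum.LiftRel p r) (Sum.LiftRel q s) (sumSumSumComm A B C D u)
        (sumSumSumComm A B C D v) := by
  rcases u with (u | u) | (u | u) <;> rcases v with (v | v) | (v | v) <;> simp

theorem liftRel_swap {A B : Type} {p : A → A → Prop} {q : B → B → Prop} (u v : A ⊕ B) :
    Sum.LiftRel p q u v ↔ Sum.LiftRel q p (sumComm A B u) (sumComm A B v) := by
  rcases u with u | u <;> rcases v with v | v <;> simp

theorem liftRel_empty {A : Type} {p : A → A → Prop} {q : Empty ⊕ Empty → Empty ⊕ Empty → Prop}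
    (u v : A ⊕ (Empty ⊕ Empty)) : Sum.LiftRel p q u v ↔
      p (sumEmpty A Empty (sumCongr (.refl A) (sumEmpty Empty Empty) u))
        (sumEmpty A Empty (sumCongr (.refl A) (sumEmpty Empty Empty) v)) := by
  rcases u with u | (⟨⟨⟩⟩ | ⟨⟨⟩⟩)
  rcases v with v | (⟨⟨⟩⟩ | ⟨⟨⟩⟩)
  exact Sum.liftRel_inl_inl

theorem empty_liftRel {A : Type} {p : A → A → Prop} {q : Empty ⊕ Empty → Empty ⊕ Empty → Prop}
    (u v : (Empty ⊕ Empty) ⊕ A) : Sum.LiftRel q p u v ↔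
      p (emptySum Empty A (sumCongr (sumEmpty Empty Empty) (.refl A) u))
        (emptySum Empty A (sumCongr (sumEmpty Empty Empty) (.refl A) v)) := by
  rcases u with (⟨⟨⟩⟩ | ⟨⟨⟩⟩) | u
  rcases v with (⟨⟨⟩⟩ | ⟨⟨⟩⟩) | v
  exact Sum.liftRel_inr_inr

/-- Horizontal concatenation of isomorphism classes. -/
def Class.hcomp : Class X k l → Class X k' l' → Class X (k + k') (l + l') :=
  Quotient.map₂ PDecGraph.hcomp fun _ H ⟨f, hf, hi, ho⟩ _ H' ⟨f', hf', hi', ho'⟩ =>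
    rel_of_flag (Graph.hcompCongr f f') (by rintro (v | v); exacts [hf v, hf' v])
      (Sum.LiftRel H.inOrd.lt H'.inOrd.lt) (Sum.LiftRel H.outOrd.lt H'.outOrd.lt)
      (fun x y => liftRel_map (fun a b => (hi a b).symm) (fun a b => (hi' a b).symm) _ _)
      (fun _ _ => Iff.rfl)
      (fun x y => liftRel_map (fun a b => (ho a b).symm) (fun a b => (ho' a b).symm) _ _)
      (fun _ _ => Iff.rfl)

/-- Vertical concatenation of isomorphism classes. -/
noncomputable def Class.vcomp : Class X l m → Class X k l → Class X k m :=
  Quotient.map₂ PDecGraph.vcomp fun _ H' ⟨f', hf', hi', ho'⟩ _ H ⟨f, hf, hi, ho⟩ =>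
    rel_of_flag (Graph.vcompCongr f' f) (by rintro (v | v); exacts [hf v, hf' v])
      (Sum.LiftRel H.inOrd.lt H'.inOrd.lt) (Sum.LiftRel H.outOrd.lt H'.outOrd.lt)
      (fun x y => liftRel_map (fun a b => (hi a b).symm) (fun a b => (hi' a b).symm) _ _)
      (fun _ _ => Iff.rfl)
      (fun x y => liftRel_map (fun a b => (ho a b).symm) (fun a b => (ho' a b).symm) _ _)
      (fun _ _ => Iff.rfl)

theorem hpow_unit (n : ℕ) :
    hpow (F := Class X) Class.hcomp (Quotient.mk _ (unit X 0)) (Quotient.mk _ (unit X 1)) n =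
      Quotient.mk _ (unit X n) := by
  induction n with
  | zero => rfl
  | succ n ih =>
    refine (congrArg (fun z => Class.hcomp z (Quotient.mk _ (unit X 1))) ih).trans ?_
    exact Quotient.sound (rel_of_flag (Graph.unitSucc n) (by rintro (⟨⟨⟩⟩ | ⟨⟨⟩⟩))
      (fun _ _ => False) (fun _ _ => False) (by rintro ((⟨⟨⟩⟩ | ⟨⟨⟩⟩) | (⟨⟨⟩⟩ | ⟨⟨⟩⟩)))
      (by rintro (⟨⟨⟩⟩ | ⟨⟨⟩⟩)) (by rintro ((⟨⟨⟩⟩ | ⟨⟨⟩⟩) | (⟨⟨⟩⟩ | ⟨⟨⟩⟩)))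
      (by rintro (⟨⟨⟩⟩ | ⟨⟨⟩⟩)))

end PDecGraph

/-- The ProP in sets of isomorphism classes of planar `X`-decorated graphs. -/
noncomputable def planarDecGraphs (X : ℕ → ℕ → Type u) : SetProP.{max 1 u} where
  obj := PDecGraph.Class X
  lact σ := Quotient.map (PDecGraph.lact σ) fun _ _ ⟨f, hf⟩ => ⟨f.reindex _ _, hf⟩
  ract τ := Quotient.map (PDecGraph.ract τ) fun _ _ ⟨f, hf⟩ => ⟨f.reindex _ _, hf⟩
  hcomp := PDecGraph.Class.hcomp
  vcomp := PDecGraph.Class.vcomp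
  unit₀ := Quotient.mk _ (PDecGraph.unit X 0)
  unit₁ := Quotient.mk _ (PDecGraph.unit X 1)
  one_lact := by rintro _ _ ⟨G⟩; rfl
  one_ract := by rintro _ _ ⟨G⟩; rfl
  lact_lact := by rintro _ _ σ σ' ⟨G⟩; rfl
  ract_ract := by rintro _ _ τ τ' ⟨G⟩; rfl
  lact_ract := by rintro _ _ σ τ ⟨G⟩; rfl
  hcomp_assoc := by
    rintro _ _ _ _ _ _ ⟨G⟩ ⟨G'⟩ ⟨G''⟩
    exact (Quotient.sound (PDecGraph.rel_of_flag (Graph.hcompAssoc _ _ _)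
      (by rintro (v | v | v) <;> rfl)
      (Sum.LiftRel (Sum.LiftRel G.inOrd.lt G'.inOrd.lt) G''.inOrd.lt)
      (Sum.LiftRel (Sum.LiftRel G.outOrd.lt G'.outOrd.lt) G''.outOrd.lt)
      (fun x y => (PDecGraph.liftRel_map (f := id) (f' := Graph.hT G'.toGraph G''.toGraph)
        (fun _ _ => .rfl) (fun _ _ => .rfl) _ _).trans
        (PDecGraph.liftRel_assoc _ _))
      (fun x y => PDecGraph.liftRel_map (f := Graph.hT G.toGraph G'.toGraph) (f' := id)
        (fun _ _ => .rfl) (fun _ _ => .rfl) _ _)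
      (fun x y => (PDecGraph.liftRel_map (f := id) (f' := Graph.hS G'.toGraph G''.toGraph)
        (fun _ _ => .rfl) (fun _ _ => .rfl) _ _).trans
        (PDecGraph.liftRel_assoc _ _))
      (fun x y => PDecGraph.liftRel_map (f := Graph.hS G.toGraph G'.toGraph) (f' := id)
        (fun _ _ => .rfl) (fun _ _ => .rfl) _ _))).trans
      (PDecGraph.recast_mk ((G.hcomp G').hcomp G'') _ _).symm
  hcomp_unit₀ := by
    rintro _ _ ⟨G⟩
    exact (PDecGraph.recast_mk (G.hcomp (.unit X 0)) _ _).trans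
      (Quotient.sound (PDecGraph.rel_of_flag (Graph.hcompUnit _) (by rintro (v | ⟨⟨⟩⟩); rfl)
        G.inOrd.lt G.outOrd.lt (fun x y => PDecGraph.liftRel_empty _ _) (fun _ _ => .rfl)
        (fun x y => PDecGraph.liftRel_empty _ _) (fun _ _ => .rfl)))
  unit₀_hcomp := by
    rintro _ _ ⟨G⟩
    exact (PDecGraph.recast_mk ((PDecGraph.unit X 0).hcomp G) _ _).trans
      (Quotient.sound (PDecGraph.rel_of_flag (Graph.unitHcomp _) (by rintro (⟨⟨⟩⟩ | v); rfl)
        G.inOrd.lt G.outOrd.lt (fun x y => PDecGraph.empty_liftRel _ _) (fun _ _ => .rfl)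
        (fun x y => PDecGraph.empty_liftRel _ _) (fun _ _ => .rfl)))
  vcomp_assoc := by
    rintro _ _ _ _ ⟨G''⟩ ⟨G'⟩ ⟨G⟩
    exact Quotient.sound (PDecGraph.rel_of_flag (Graph.vcompAssoc _ _ _)
      (by rintro ((v | v) | v) <;> rfl)
      (Sum.LiftRel G.inOrd.lt (Sum.LiftRel G'.inOrd.lt G''.inOrd.lt))
      (Sum.LiftRel G.outOrd.lt (Sum.LiftRel G'.outOrd.lt G''.outOrd.lt))
      (fun x y => (PDecGraph.liftRel_map (f := Graph.eT G'.toGraph G.toGraph) (f' := id)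
        (fun _ _ => .rfl) (fun _ _ => .rfl) _ _).trans
        (PDecGraph.liftRel_symm_assoc _ _))
      (fun x y => PDecGraph.liftRel_map (f := id) (f' := Graph.eT G''.toGraph G'.toGraph)
        (fun _ _ => .rfl) (fun _ _ => .rfl) _ _)
      (fun x y => (PDecGraph.liftRel_map (f := Graph.eS G'.toGraph G.toGraph) (f' := id)
        (fun _ _ => .rfl) (fun _ _ => .rfl) _ _).trans
        (PDecGraph.liftRel_symm_assoc _ _))
      (fun x y => PDecGraph.liftRel_map (f := id) (f' := Graph.eS G''.toGraph G'.toGraph)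
        (fun _ _ => .rfl) (fun _ _ => .rfl) _ _))
  vcomp_unit := by
    rintro _ _ ⟨G⟩
    rw [PDecGraph.hpow_unit]
    exact Quotient.sound (PDecGraph.rel_of_flag (Graph.vcompUnit _) (by rintro (⟨⟨⟩⟩ | v); rfl)
      G.inOrd.lt G.outOrd.lt (fun x y => PDecGraph.empty_liftRel _ _) (fun _ _ => .rfl)
      (fun x y => PDecGraph.empty_liftRel _ _) (fun _ _ => .rfl))
  unit_vcomp := by
    rintro _ _ ⟨G⟩
    rw [PDecGraph.hpow_unit]
    exact Quotient.sound (PDecGraph.rel_of_flag (Graph.unitVcomp _) (by rintro (v | ⟨⟨⟩⟩); rfl)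
      G.inOrd.lt G.outOrd.lt (fun x y => PDecGraph.liftRel_empty _ _) (fun _ _ => .rfl)
      (fun x y => PDecGraph.liftRel_empty _ _) (fun _ _ => .rfl))
  interchange := by
    rintro _ _ _ _ _ _ ⟨H⟩ ⟨H'⟩ ⟨G⟩ ⟨G'⟩
    exact Quotient.sound (PDecGraph.rel_of_flag (Graph.interchange _ _ _ _)
      (by rintro ((v | v) | (v | v)) <;> rfl)
      (Sum.LiftRel (Sum.LiftRel G.inOrd.lt H.inOrd.lt) (Sum.LiftRel G'.inOrd.lt H'.inOrd.lt))
      (Sum.LiftRel (Sum.LiftRel G.outOrd.lt H.outOrd.lt) (Sum.LiftRel G'.outOrd.lt H'.outOrd.lt))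
      (fun x y => (PDecGraph.liftRel_map (f := Graph.hT G.toGraph G'.toGraph)
        (f' := Graph.hT H.toGraph H'.toGraph)
        (fun _ _ => .rfl) (fun _ _ => .rfl) _ _).trans
        (PDecGraph.liftRel_comm _ _))
      (fun x y => PDecGraph.liftRel_map (f := Graph.eT H.toGraph G.toGraph)
        (f' := Graph.eT H'.toGraph G'.toGraph)
        (fun _ _ => .rfl) (fun _ _ => .rfl) _ _)
      (fun x y => (PDecGraph.liftRel_map (f := Graph.hS G.toGraph G'.toGraph)
        (f' := Graph.hS H.toGraph H'.toGraph)
        (fun _ _ => .rfl) (fun _ _ => .rfl) _ _).trans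
        (PDecGraph.liftRel_comm _ _))
      (fun x y => PDecGraph.liftRel_map (f := Graph.eS H.toGraph G.toGraph)
        (f' := Graph.eS H'.toGraph G'.toGraph)
        (fun _ _ => .rfl) (fun _ _ => .rfl) _ _))
  lact_vcomp := by
    rintro _ _ _ σ ⟨G'⟩ ⟨G⟩
    exact Quotient.sound (PDecGraph.rel_of_flag (Graph.lactVcomp σ _ _) (fun _ => rfl)
      (Sum.LiftRel G.inOrd.lt G'.inOrd.lt) (Sum.LiftRel G.outOrd.lt G'.outOrd.lt)
      (fun _ _ => .rfl) (fun _ _ => .rfl) (fun _ _ => .rfl) (fun _ _ => .rfl))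
  ract_vcomp := by
    rintro _ _ _ ν ⟨G'⟩ ⟨G⟩
    exact Quotient.sound (PDecGraph.rel_of_flag (Graph.ractVcomp ν _ _) (fun _ => rfl)
      (Sum.LiftRel G.inOrd.lt G'.inOrd.lt) (Sum.LiftRel G.outOrd.lt G'.outOrd.lt)
      (fun _ _ => .rfl) (fun _ _ => .rfl) (fun _ _ => .rfl) (fun _ _ => .rfl))
  vcomp_lact := by
    rintro _ _ _ τ ⟨G'⟩ ⟨G⟩
    exact Quotient.sound (PDecGraph.rel_of_flag (Graph.vcompLact τ _ _) (fun _ => rfl)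
      (Sum.LiftRel G.inOrd.lt G'.inOrd.lt) (Sum.LiftRel G.outOrd.lt G'.outOrd.lt)
      (fun _ _ => .rfl) (fun _ _ => .rfl) (fun _ _ => .rfl) (fun _ _ => .rfl))
  hcomp_lact := by
    rintro _ _ _ _ σ σ' ⟨G⟩ ⟨G'⟩
    exact Quotient.sound (PDecGraph.rel_of_flag (Graph.hcompLact σ σ' _ _) (fun _ => rfl)
      (G.hcomp G').inOrd.lt (G.hcomp G').outOrd.lt
      (fun _ _ => .rfl) (fun _ _ => .rfl) (fun _ _ => .rfl) (fun _ _ => .rfl))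
  hcomp_ract := by
    rintro _ _ _ _ τ τ' ⟨G⟩ ⟨G'⟩
    exact Quotient.sound (PDecGraph.rel_of_flag (Graph.hcompRact τ τ' _ _) (fun _ => rfl)
      (G.hcomp G').inOrd.lt (G.hcomp G').outOrd.lt
      (fun _ _ => .rfl) (fun _ _ => .rfl) (fun _ _ => .rfl) (fun _ _ => .rfl))
  hcomp_comm := by
    rintro _ _ _ _ ⟨G⟩ ⟨G'⟩
    refine (?_ : _ = _).trans (congrArg _ (PDecGraph.recast_mk (G'.hcomp G) _ _).symm)
    exact Quotient.sound (PDecGraph.rel_of_flag (Graph.hcompComm _ _)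
      (by rintro (v | v) <;> rfl)
      (Sum.LiftRel G'.inOrd.lt G.inOrd.lt) (Sum.LiftRel G'.outOrd.lt G.outOrd.lt)
      (fun _ _ => PDecGraph.liftRel_swap _ _) (fun _ _ => .rfl)
      (fun _ _ => PDecGraph.liftRel_swap _ _) (fun _ _ => .rfl))

/-! ### Indecomposable graphs and cycleless graphs -/

namespace Graph

variable {k l m k' l' : ℕ}

/-- The graph is reduced to a single loop. -/
def IsSingleLoop (G : Graph k l) : Prop :=
  IsEmpty G.V ∧ IsEmpty G.E ∧ IsEmpty G.In ∧ IsEmpty G.Out ∧ IsEmpty G.InOut ∧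
    Nat.card G.L = 1

/-- Indecomposable graphs. The graph which is reduced to a single loop is indecomposable. All the
other indecomposable graphs have at least one vertex, and no loop. -/
structure IsIndecomposable (G : Graph k l) : Prop where
  nonempty : Nonempty G.V ∨ G.IsSingleLoop
  isEmpty_inOut : IsEmpty G.InOut
  isEmpty_loops : IsEmpty G.L ∨ G.IsSingleLoop
  vertical : ∀ (m : ℕ) (G' : Graph m l) (G'' : Graph k m), Nonempty (Iso G (G'.vcomp G'')) →
    IsEmpty G'.V ∨ IsEmpty G''.V
  horizontal : ∀ (k₁ l₁ k₂ l₂ : ℕ) (hk : k₁ + k₂ = k) (hl : l₁ + l₂ = l) (G' : Graph k₁ l₁)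
    (G'' : Graph k₂ l₂) (σ : Perm (Fin l)) (τ : Perm (Fin k)),
    Nonempty (Iso G
      ((((G'.hcomp G'').reindex (finCongr hk) (finCongr hl)).ract τ).lact σ)) →
    IsEmpty G'.V ∨ IsEmpty G''.V

/-- There is an internal edge from `x` to `y`. -/
def Step (G : Graph k l) (x y : G.V) : Prop := ∃ e, G.s (.inl e) = x ∧ G.t (.inl e) = y

/-- The graph has no loop (edge without endpoints) and no oriented cycle. -/
structure IsCycleless (G : Graph k l) : Prop where
  isEmpty_loops : IsEmpty G.L
  not_cycle : ∀ x, ¬ Relation.TransGen G.Step x x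

theorem lact_inv_lact (G : Graph k l) (σ : Perm (Fin l)) : (G.lact σ).lact σ⁻¹ = G := by
  have h : (G.β.trans σ).trans σ⁻¹ = G.β := by
    ext x; exact congrArg Fin.val (σ.symm_apply_apply _)
  change { G with α := G.α, β := (G.β.trans σ).trans σ⁻¹ } = G
  rw [h]

theorem ract_inv_ract (G : Graph k l) (τ : Perm (Fin k)) : (G.ract τ).ract τ⁻¹ = G := by
  have h : (G.α.trans τ⁻¹).trans (τ⁻¹)⁻¹ = G.α := by
    ext x; exact congrArg Fin.val (τ.apply_symm_apply _)
  change { G with α := (G.α.trans τ⁻¹).trans (τ⁻¹)⁻¹, β := G.β } = G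
  rw [h]

theorem IsIndecomposable.lact {G : Graph k l} (h : G.IsIndecomposable) (σ : Perm (Fin l)) :
    (G.lact σ).IsIndecomposable where
  nonempty := h.nonempty
  isEmpty_inOut := h.isEmpty_inOut
  isEmpty_loops := h.isEmpty_loops
  vertical := by
    rintro m G' G'' ⟨f⟩
    have f' : Iso ((G.lact σ).lact σ⁻¹) ((G'.vcomp G'').lact σ⁻¹) := f.reindex _ _
    obtain ⟨g, -⟩ := (lactVcomp σ⁻¹ G' G'').exists_iso
    rw [lact_inv_lact] at f'
    exact h.vertical m (G'.lact σ⁻¹) G'' ⟨f'.trans g⟩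
  horizontal := by
    rintro k₁ l₁ k₂ l₂ hk hl G' G'' ρ τ ⟨f⟩
    have f' := f.reindex (Equiv.refl _) σ⁻¹
    change Iso ((G.lact σ).lact σ⁻¹) _ at f'
    rw [lact_inv_lact] at f'
    exact h.horizontal k₁ l₁ k₂ l₂ hk hl G' G'' (σ⁻¹ * ρ) τ ⟨f'⟩

theorem IsIndecomposable.ract {G : Graph k l} (h : G.IsIndecomposable) (τ : Perm (Fin k)) :
    (G.ract τ).IsIndecomposable where
  nonempty := h.nonempty
  isEmpty_inOut := h.isEmpty_inOut
  isEmpty_loops := h.isEmpty_loops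
  vertical := by
    rintro m G' G'' ⟨f⟩
    have f' : Iso ((G.ract τ).ract τ⁻¹) ((G'.vcomp G'').ract τ⁻¹) := f.reindex _ _
    obtain ⟨g, -⟩ := (ractVcomp τ⁻¹ G' G'').exists_iso
    rw [ract_inv_ract] at f'
    exact h.vertical m G' (G''.ract τ⁻¹) ⟨f'.trans g⟩
  horizontal := by
    rintro k₁ l₁ k₂ l₂ hk hl G' G'' σ ρ ⟨f⟩
    have f' := f.reindex (τ⁻¹)⁻¹ (Equiv.refl _)
    change Iso ((G.ract τ).ract τ⁻¹) _ at f'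
    rw [ract_inv_ract] at f'
    exact h.horizontal k₁ l₁ k₂ l₂ hk hl G' G'' σ (ρ * τ⁻¹) ⟨f'⟩

theorem IsCycleless.lact {G : Graph k l} (h : G.IsCycleless) (σ : Perm (Fin l)) :
    (G.lact σ).IsCycleless := ⟨h.1, h.2⟩

theorem IsCycleless.ract {G : Graph k l} (h : G.IsCycleless) (τ : Perm (Fin k)) :
    (G.ract τ).IsCycleless := ⟨h.1, h.2⟩

theorem isCycleless_unit (n : ℕ) : (unit n).IsCycleless :=
  ⟨inferInstanceAs (IsEmpty Empty), fun x => x.elim⟩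

theorem not_transGen_sum {A B : Type} {r : A ⊕ B → A ⊕ B → Prop} {p : A → A → Prop}
    {q : B → B → Prop} (hp : ∀ a a', r (.inl a) (.inl a') → p a a')
    (hq : ∀ b b', r (.inr b) (.inr b') → q b b') (hr : ∀ b a, ¬ r (.inr b) (.inl a))
    (np : ∀ a, ¬ Relation.TransGen p a a) (nq : ∀ b, ¬ Relation.TransGen q b b) (x : A ⊕ B) :
    ¬ Relation.TransGen r x x := by
  have key : ∀ x y, Relation.TransGen r x y → (∀ b, x = .inr b → ∃ b', y = .inr b' ∧
      Relation.TransGen q b b') ∧ (∀ a, y = .inl a → ∃ a', x = .inl a' ∧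
      Relation.TransGen p a' a) := by
    intro x y h
    induction h with
    | @single y h =>
      constructor
      · rintro b rfl
        rcases y with a | b'
        · exact (hr _ _ h).elim
        · exact ⟨b', rfl, .single (hq _ _ h)⟩
      · rintro a rfl
        rcases x with a' | b
        · exact ⟨a', rfl, .single (hp _ _ h)⟩
        · exact (hr _ _ h).elim
    | @tail y z _ h ih =>
      constructor
      · rintro b rfl
        obtain ⟨b', rfl, hb⟩ := ih.1 b rfl
        rcases z with a | b''
        · exact (hr _ _ h).elim
        · exact ⟨b'', rfl, hb.tail (hq _ _ h)⟩
      · rintro a rfl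
        rcases y with a' | b
        · obtain ⟨a'', rfl, ha⟩ := ih.2 a' rfl
          exact ⟨a'', rfl, ha.tail (hp _ _ h)⟩
        · exact (hr _ _ h).elim
  intro h
  rcases x with a | b
  · obtain ⟨a', e, ha⟩ := (key _ _ h).2 a rfl
    cases e; exact np _ ha
  · obtain ⟨b', e, hb⟩ := (key _ _ h).1 b rfl
    cases e; exact nq _ hb

theorem IsCycleless.hcomp {G : Graph k l} {G' : Graph k' l'} (h : G.IsCycleless)
    (h' : G'.IsCycleless) : (G.hcomp G').IsCycleless where
  isEmpty_loops := @instIsEmptySum _ _ h.1 h'.1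
  not_cycle := by
    refine not_transGen_sum (p := G.Step) (q := G'.Step) ?_ ?_ ?_ h.2 h'.2
    · rintro a a' ⟨e | e, hs, ht⟩
      · exact ⟨e, Sum.inl_injective hs, Sum.inl_injective ht⟩
      · cases hs
    · rintro a a' ⟨e | e, hs, ht⟩
      · cases hs
      · exact ⟨e, Sum.inr_injective hs, Sum.inr_injective ht⟩
    · rintro b a ⟨e | e, hs, ht⟩
      · cases hs
      · cases ht

theorem IsCycleless.vcomp {G' : Graph l m} {G : Graph k l} (h' : G'.IsCycleless)
    (h : G.IsCycleless) : (G'.vcomp G).IsCycleless where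
  isEmpty_loops := @instIsEmptySum _ _ h.1 h'.1
  not_cycle := by
    refine not_transGen_sum (p := G.Step) (q := G'.Step) ?_ ?_ ?_ h.2 h'.2
    · rintro a a' ⟨(e | e) | e, hs, ht⟩
      · exact ⟨e, Sum.inl_injective hs, Sum.inl_injective ht⟩
      · cases hs
      · cases ht
    · rintro a a' ⟨(e | e) | e, hs, ht⟩
      · cases hs
      · exact ⟨e, Sum.inr_injective hs, Sum.inr_injective ht⟩
      · cases hs
    · rintro b a ⟨(e | e) | e, hs, ht⟩
      · cases hs
      · cases ht
      · cases hs

end Graph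

/-! ### Submodules and sub-ProPs spanned by graphs -/

section Span

variable (K : Type v) [Field K] (S : SetProP.{w})

/-- A family of sets of elements of a ProP in sets which is stable under the actions. -/
structure SetProP.StableSet where
  set : ∀ k l : ℕ, Set (S.obj k l)
  lact_mem : ∀ {k l : ℕ} (σ : Perm (Fin l)) {p : S.obj k l}, p ∈ set k l → S.lact σ p ∈ set k l
  ract_mem : ∀ {k l : ℕ} (τ : Perm (Fin k)) {p : S.obj k l}, p ∈ set k l → S.ract τ p ∈ set k l

/-- A sub-ProP in sets. -/
structure SetProP.SubProP extends S.StableSet where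
  hcomp_mem : ∀ {k l k' l' : ℕ} {p : S.obj k l} {p' : S.obj k' l'}, p ∈ set k l →
    p' ∈ set k' l' → S.hcomp p p' ∈ set (k + k') (l + l')
  vcomp_mem : ∀ {k l m : ℕ} {p : S.obj l m} {q : S.obj k l}, p ∈ set l m →
    q ∈ set k l → S.vcomp p q ∈ set k m
  unit₀_mem : S.unit₀ ∈ set 0 0
  unit₁_mem : S.unit₁ ∈ set 1 1

variable {S}

theorem lin₁_mem_span {A B : Type w} (f : A → B) {s : Set A} {s' : Set B}
    (h : ∀ a ∈ s, f a ∈ s') {x : A →₀ K}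
    (hx : x ∈ Submodule.span K ((fun a => Finsupp.single a (1 : K)) '' s)) :
    Finsupp.lmapDomain K K f x ∈
      Submodule.span K ((fun a => Finsupp.single a (1 : K)) '' s') := by
  induction hx using Submodule.span_induction with
  | mem x hx =>
    obtain ⟨a, ha, rfl⟩ := hx
    rw [lin₁_single]
    exact Submodule.subset_span ⟨f a, h a ha, rfl⟩
  | zero => rw [map_zero]; exact Submodule.zero_mem _
  | add x y _ _ hx hy => rw [map_add]; exact Submodule.add_mem _ hx hy
  | smul c x _ hx => rw [map_smul]; exact Submodule.smul_mem _ _ hx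

theorem lin₂_mem_span {A B C : Type w} (f : A → B → C) {s : Set A} {s' : Set B} {s'' : Set C}
    (h : ∀ a ∈ s, ∀ b ∈ s', f a b ∈ s'') {x : A →₀ K} {y : B →₀ K}
    (hx : x ∈ Submodule.span K ((fun a => Finsupp.single a (1 : K)) '' s))
    (hy : y ∈ Submodule.span K ((fun a => Finsupp.single a (1 : K)) '' s')) :
    lin₂ f x y ∈ Submodule.span K ((fun a => Finsupp.single a (1 : K)) '' s'') := by
  refine Submodule.map₂_le.1 ?_ x hx y hy
  rw [Submodule.map₂_span_span, Submodule.span_le]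
  rintro _ ⟨_, ⟨a, ha, rfl⟩, _, ⟨b, hb, rfl⟩, rfl⟩
  simp only [lin₂_single]
  exact Submodule.subset_span ⟨_, h a ha b hb, rfl⟩

/-- The submodule of the linearisation spanned by a stable family of sets. -/
noncomputable def SetProP.StableSet.span (A : S.StableSet) : (S.lin K).toSModule.Sub where
  carrier k l := Submodule.span K ((fun g => Finsupp.single g (1 : K)) '' A.set k l)
  lact_mem σ _ := lin₁_mem_span K _ fun _ => A.lact_mem σ
  ract_mem τ _ := lin₁_mem_span K _ fun _ => A.ract_mem τ

/-- The sub-ProP of the linearisation spanned by a sub-ProP in sets. -/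
noncomputable def SetProP.SubProP.span (A : S.SubProP) : (S.lin K).Sub where
  toSub := A.toStableSet.span K
  hcomp_mem := lin₂_mem_span K _ fun _ ha _ hb => A.hcomp_mem ha hb
  vcomp_mem := lin₂_mem_span K _ fun _ ha _ hb => A.vcomp_mem ha hb
  unit₀_mem := Submodule.subset_span ⟨_, A.unit₀_mem, rfl⟩
  unit₁_mem := Submodule.subset_span ⟨_, A.unit₁_mem, rfl⟩

end Span

section Families

variable (X : ℕ → ℕ → Type u)

/-- The isomorphism classes of indecomposable decorated graphs. -/
def indDec : (decGraphs X).StableSet where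
  set _ _ := Quotient.mk _ '' {G | G.toGraph.IsIndecomposable}
  lact_mem := by rintro _ _ σ _ ⟨G, h, rfl⟩; exact ⟨G.lact σ, h.lact σ, rfl⟩
  ract_mem := by rintro _ _ τ _ ⟨G, h, rfl⟩; exact ⟨G.ract τ, h.ract τ, rfl⟩

/-- The isomorphism classes of cycleless indecomposable decorated graphs. -/
def indCyclelessDec : (decGraphs X).StableSet where
  set _ _ := Quotient.mk _ '' {G | G.toGraph.IsIndecomposable ∧ G.toGraph.IsCycleless}
  lact_mem := by rintro _ _ σ _ ⟨G, h, rfl⟩; exact ⟨G.lact σ, ⟨h.1.lact σ, h.2.lact σ⟩, rfl⟩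
  ract_mem := by rintro _ _ τ _ ⟨G, h, rfl⟩; exact ⟨G.ract τ, ⟨h.1.ract τ, h.2.ract τ⟩, rfl⟩

/-- The isomorphism classes of cycleless decorated graphs. -/
def cyclelessDec : (decGraphs X).SubProP where
  set _ _ := Quotient.mk _ '' {G | G.toGraph.IsCycleless}
  lact_mem := by rintro _ _ σ _ ⟨G, h, rfl⟩; exact ⟨G.lact σ, h.lact σ, rfl⟩
  ract_mem := by rintro _ _ τ _ ⟨G, h, rfl⟩; exact ⟨G.ract τ, h.ract τ, rfl⟩
  hcomp_mem := by rintro _ _ _ _ _ _ ⟨G, h, rfl⟩ ⟨G', h', rfl⟩; exact ⟨G.hcomp G', h.hcomp h', rfl⟩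
  vcomp_mem := by rintro _ _ _ _ _ ⟨G, h, rfl⟩ ⟨G', h', rfl⟩; exact ⟨G.vcomp G', h.vcomp h', rfl⟩
  unit₀_mem := ⟨_, Graph.isCycleless_unit 0, rfl⟩
  unit₁_mem := ⟨_, Graph.isCycleless_unit 1, rfl⟩

/-- The isomorphism classes of indecomposable planar decorated graphs. -/
def indPlanarDec : (planarDecGraphs X).StableSet where
  set _ _ := Quotient.mk _ '' {G | G.toGraph.IsIndecomposable}
  lact_mem := by rintro _ _ σ _ ⟨G, h, rfl⟩; exact ⟨G.lact σ, h.lact σ, rfl⟩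
  ract_mem := by rintro _ _ τ _ ⟨G, h, rfl⟩; exact ⟨G.ract τ, h.ract τ, rfl⟩

/-- The isomorphism classes of cycleless indecomposable planar decorated graphs. -/
def indCyclelessPlanarDec : (planarDecGraphs X).StableSet where
  set _ _ := Quotient.mk _ '' {G | G.toGraph.IsIndecomposable ∧ G.toGraph.IsCycleless}
  lact_mem := by rintro _ _ σ _ ⟨G, h, rfl⟩; exact ⟨G.lact σ, ⟨h.1.lact σ, h.2.lact σ⟩, rfl⟩
  ract_mem := by rintro _ _ τ _ ⟨G, h, rfl⟩; exact ⟨G.ract τ, ⟨h.1.ract τ, h.2.ract τ⟩, rfl⟩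

/-- The isomorphism classes of cycleless planar decorated graphs. -/
def cyclelessPlanarDec : (planarDecGraphs X).SubProP where
  set _ _ := Quotient.mk _ '' {G | G.toGraph.IsCycleless}
  lact_mem := by rintro _ _ σ _ ⟨G, h, rfl⟩; exact ⟨G.lact σ, h.lact σ, rfl⟩
  ract_mem := by rintro _ _ τ _ ⟨G, h, rfl⟩; exact ⟨G.ract τ, h.ract τ, rfl⟩
  hcomp_mem := by rintro _ _ _ _ _ _ ⟨G, h, rfl⟩ ⟨G', h', rfl⟩; exact ⟨G.hcomp G', h.hcomp h', rfl⟩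
  vcomp_mem := by rintro _ _ _ _ _ ⟨G, h, rfl⟩ ⟨G', h', rfl⟩; exact ⟨G.vcomp G', h.vcomp h', rfl⟩
  unit₀_mem := ⟨_, Graph.isCycleless_unit 0, rfl⟩
  unit₁_mem := ⟨_, Graph.isCycleless_unit 1, rfl⟩

variable (K : Type v) [Field K]

/-- The ProP of `X`-decorated graphs: `obj k l` is the vector space with basis the isomorphism
classes of decorated graphs with `k` inputs and `l` outputs. -/
noncomputable def Gr : ProP.{v, max v 1 u} K := (decGraphs X).lin K

/-- The module spanned by the indecomposable decorated graphs. -/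
noncomputable def GrInd : (Gr X K).toSModule.Sub := (indDec X).span K

/-- The sub-ProP spanned by the cycleless decorated graphs. -/
noncomputable def GrUp : (Gr X K).Sub := (cyclelessDec X).span K

/-- The module spanned by the cycleless indecomposable decorated graphs. -/
noncomputable def GrUpInd : (GrUp X K).toProP.toSModule.Sub :=
  ((indCyclelessDec X).span K).within (GrUp X K).toSub

/-- The ProP of planar `X`-decorated graphs: `obj k l` is the vector space with basis the
isomorphism classes of planar decorated graphs with `k` inputs and `l` outputs. -/
noncomputable def PGr : ProP.{v, max v 1 u} K := (planarDecGraphs X).lin K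

/-- The module spanned by the indecomposable planar decorated graphs. -/
noncomputable def PGrInd : (PGr X K).toSModule.Sub := (indPlanarDec X).span K

/-- The sub-ProP spanned by the cycleless planar decorated graphs. -/
noncomputable def PGrUp : (PGr X K).Sub := (cyclelessPlanarDec X).span K

/-- The module spanned by the cycleless indecomposable planar decorated graphs. -/
noncomputable def PGrUpInd : (PGrUp X K).toProP.toSModule.Sub :=
  ((indCyclelessPlanarDec X).span K).within (PGrUp X K).toSub

/-- The trivial `𝔖 × 𝔖ᵒᵖ`-module generated by `X`. -/
noncomputable def trivialSModule : SModule.{v, max v u} K where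
  obj k l := X k l →₀ K
  lact _ := LinearMap.id
  ract _ := LinearMap.id
  one_lact _ := rfl
  one_ract _ := rfl
  lact_lact _ _ _ := rfl
  ract_ract _ _ _ := rfl
  lact_ract _ _ _ := rfl

/-- The free `𝔖 × 𝔖ᵒᵖ`-module generated by `X`: the triple `(σ, x, τ)` stands for `σ · x · τ`. -/
noncomputable def freeSModule : SModule.{v, max v u} K where
  obj k l := Perm (Fin l) × X k l × Perm (Fin k) →₀ K
  lact σ := Finsupp.lmapDomain K K fun a => (σ * a.1, a.2.1, a.2.2)
  ract τ := Finsupp.lmapDomain K K fun a => (a.1, a.2.1, a.2.2 * τ)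
  one_lact := lin_ext fun a => by simp only [lin₁_single, one_mul]
  one_ract := lin_ext fun a => by simp only [lin₁_single, mul_one]
  lact_lact σ σ' := lin_ext fun a => by simp only [lin₁_single, mul_assoc]
  ract_ract τ τ' := lin_ext fun a => by simp only [lin₁_single, mul_assoc]
  lact_ract σ τ := lin_ext fun a => by simp only [lin₁_single]

end Families

/-! ### Graphs with one vertex -/

/-- The graph `G_{k,l}` with one vertex, `k` input edges and `l` output edges. -/
def Graph.corolla (k l : ℕ) : Graph k l where
  V := Unit
  E := Empty
  In := Fin k
  Out := Fin l
  InOut := Empty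
  L := Empty
  s _ := ()
  t _ := ()
  α := sumEmpty _ _
  β := sumEmpty _ _

/-- The graph `G_{k,l}`, whose vertex is decorated by `x`. -/
def DecGraph.corolla {X : ℕ → ℕ → Type u} {k l : ℕ} (x : X k l) : DecGraph X k l where
  toGraph := Graph.corolla k l
  dec _ := ⟨(k, l), x⟩
  dec_fst _ := by
    have h (n : ℕ) : Nat.card {e : Empty ⊕ Fin n // () = ()} = n := by simp
    exact Prod.ext (h k).symm (h l).symm

/-- The usual order of `Fin n`, as an order on the only fibre of a constant map. -/
def finOrder (n : ℕ) : FibreOrder (fun _ : Empty ⊕ Fin n => ()) where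
  lt a b := emptySum Empty (Fin n) a < emptySum Empty (Fin n) b
  fibre _ := rfl
  irrefl a := lt_irrefl _
  trans := lt_trans
  total {a b} _ := by
    rw [← (emptySum Empty (Fin n)).apply_eq_iff_eq]
    exact lt_trichotomy _ _

/-- The planar graph `G_{k,l}`, whose vertex is decorated by `x`: its input edges and its output
edges are ordered in the usual way. -/
def PDecGraph.corolla {X : ℕ → ℕ → Type u} {k l : ℕ} (x : X k l) : PDecGraph X k l where
  toDecGraph := DecGraph.corolla x
  inOrd := finOrder k
  outOrd := finOrder l

end GraphProP

open GraphProP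

namespace GraphProP

/-! ### ProPs in sets: products, identities, generated words -/

/-! Isomorphism classes of graphs are a basis which all the operations permute or multiply as sets,
so freeness only has to be proved for ProPs in sets. An equivariant linear map on the span of the
indecomposable classes is an equivariant map of sets on these classes, and a morphism found on the
basis is extended linearly (`SetProP.SubProP.IsFreeOn.of_hom`). Decorated and planar graphs are
embedded in one ProP of marked graphs, with marks on the vertices and loops and relations on the
edges at a vertex. The image of each family under study contains the factors of every composite
which it contains, and this is all that the argument needs
(`SetProP.SubProP.isFreeOn_of_embedding`).

Let `f` be an equivariant map from the indecomposable classes to a ProP `P`. In the product of the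
ProP of graphs with `P`, the pairs `(x, f x)` generate a sub-ProP, whose elements are the words:
stacks of layers `h * I_n`, with `h` a generator, separated by permutations. The required morphism
exists if and only if this sub-ProP is the graph of a map.

Every graph is reached (`hasWord`), by induction on the number of vertices and loops. A graph with
neither is a permutation. Otherwise the part spanned by the vertices, or a single loop if there is
no vertex, is split off horizontally. That part is a generator, or it decomposes into two parts with
fewer vertices.

The value in `P` depends only on the graph (`word_unique`), by induction on the same number. A
single layer determines its generator up to permutations (`Indec.hcomp_idn_unique`), and it is never
a composite of two factors of positive size (`Indec.layer_eq_vcomp`). A word with several layers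
cuts the graph in two, which amounts to a colouring `c` of the vertices and loops, true above and
false below, such that no edge goes from true to false. The two halves are determined by `c` up to a
permutation of the edges which are cut (`Class.cut_unique`), and this permutation cancels in `P`; by
induction, a colouring which takes both values determines the value in `P`. Two colourings `c` and
`c'` are compared as in a diamond lemma (`IsValue.eq`). If `c ∧ c'` is true somewhere, both have the
value of `c ∧ c'`, by cutting the graph in three. If `c ∨ c'` is false somewhere, both have the
value of `c ∨ c'`. Otherwise `c'` is the negation of `c`, no edge changes colour, the graph is a
horizontal product, and the interchange law gives the equality.

For the second half of each item, colour the vertices of a cycleless indecomposable graph by their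
accessibility from the source of an edge: indecomposability makes the colouring constant, which
would close a cycle. So there is no internal edge, then only one vertex, and the graph is a corolla
up to indexation. Without orders, every reindexation of a corolla is isomorphic to it, so the
actions are trivial. With orders, a corolla has no automorphism but the identity, so the actions are
free. -/

/-- The ProP in sets which underlies a ProP. -/
def ProP.toSetProP {K : Type v} [Field K] (P : ProP.{v, w} K) : SetProP.{w} where
  obj := P.obj
  lact σ := P.lact σ
  ract τ := P.ract τ
  hcomp a b := P.hcomp a b
  vcomp a b := P.vcomp a b
  unit₀ := P.unit₀
  unit₁ := P.unit₁
  one_lact := P.one_lact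
  one_ract := P.one_ract
  lact_lact := P.lact_lact
  ract_ract := P.ract_ract
  lact_ract := P.lact_ract
  hcomp_assoc := P.hcomp_assoc
  hcomp_unit₀ := P.hcomp_unit₀
  unit₀_hcomp := P.unit₀_hcomp
  vcomp_assoc := P.vcomp_assoc
  vcomp_unit := P.vcomp_unit
  unit_vcomp := P.unit_vcomp
  interchange := P.interchange
  lact_vcomp := P.lact_vcomp
  ract_vcomp := P.ract_vcomp
  vcomp_lact := P.vcomp_lact
  hcomp_lact := P.hcomp_lact
  hcomp_ract := P.hcomp_ract
  hcomp_comm := P.hcomp_comm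

theorem recast_prod {F : ℕ → ℕ → Type w} {F' : ℕ → ℕ → Type w'} {k l k' l' : ℕ} (hk : k = k')
    (hl : l = l') (x : F k l × F' k l) :
    recast (fun k l => F k l × F' k l) hk hl x = (recast F hk hl x.1, recast F' hk hl x.2) := by
  subst hk hl; rfl

theorem recast_rfl {F : ℕ → ℕ → Type w} {k l : ℕ} (hk : k = k) (hl : l = l) (x : F k l) :
    recast F hk hl x = x := rfl

theorem hpow_prod {F : ℕ → ℕ → Type w} {F' : ℕ → ℕ → Type w'}
    (h : ∀ {k l k' l' : ℕ}, F k l → F k' l' → F (k + k') (l + l'))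
    (h' : ∀ {k l k' l' : ℕ}, F' k l → F' k' l' → F' (k + k') (l + l'))
    (a : F 0 0) (a' : F' 0 0) (b : F 1 1) (b' : F' 1 1) (n : ℕ) :
    hpow (F := fun k l => F k l × F' k l) (fun x y => (h x.1 y.1, h' x.2 y.2)) (a, a') (b, b') n =
      (hpow h a b n, hpow h' a' b' n) := by
  induction n with
  | zero => rfl
  | succ n ih => simp only [hpow, ih]

namespace SetProP

/-- The product of two ProPs in sets. -/
def prod (S : SetProP.{w}) (T : SetProP.{w'}) : SetProP.{max w w'} where
  obj k l := S.obj k l × T.obj k l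
  lact σ x := (S.lact σ x.1, T.lact σ x.2)
  ract τ x := (S.ract τ x.1, T.ract τ x.2)
  hcomp x y := (S.hcomp x.1 y.1, T.hcomp x.2 y.2)
  vcomp x y := (S.vcomp x.1 y.1, T.vcomp x.2 y.2)
  unit₀ := (S.unit₀, T.unit₀)
  unit₁ := (S.unit₁, T.unit₁)
  one_lact _ := Prod.ext (S.one_lact _) (T.one_lact _)
  one_ract _ := Prod.ext (S.one_ract _) (T.one_ract _)
  lact_lact _ _ _ := Prod.ext (S.lact_lact _ _ _) (T.lact_lact _ _ _)
  ract_ract _ _ _ := Prod.ext (S.ract_ract _ _ _) (T.ract_ract _ _ _)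
  lact_ract _ _ _ := Prod.ext (S.lact_ract _ _ _) (T.lact_ract _ _ _)
  hcomp_assoc _ _ _ := by
    rw [recast_prod]; exact Prod.ext (S.hcomp_assoc _ _ _) (T.hcomp_assoc _ _ _)
  hcomp_unit₀ x := by
    rw [recast_prod]; exact Prod.ext (S.hcomp_unit₀ x.1) (T.hcomp_unit₀ x.2)
  unit₀_hcomp x := by
    rw [recast_prod]; exact Prod.ext (S.unit₀_hcomp x.1) (T.unit₀_hcomp x.2)
  vcomp_assoc _ _ _ := Prod.ext (S.vcomp_assoc _ _ _) (T.vcomp_assoc _ _ _)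
  vcomp_unit _ := by
    rw [hpow_prod (F := S.obj) (F' := T.obj) S.hcomp T.hcomp]; exact Prod.ext (S.vcomp_unit _) (T.vcomp_unit _)
  unit_vcomp _ := by
    rw [hpow_prod (F := S.obj) (F' := T.obj) S.hcomp T.hcomp]; exact Prod.ext (S.unit_vcomp _) (T.unit_vcomp _)
  interchange _ _ _ _ := Prod.ext (S.interchange _ _ _ _) (T.interchange _ _ _ _)
  lact_vcomp _ _ _ := Prod.ext (S.lact_vcomp _ _ _) (T.lact_vcomp _ _ _)
  ract_vcomp _ _ _ := Prod.ext (S.ract_vcomp _ _ _) (T.ract_vcomp _ _ _)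
  vcomp_lact _ _ _ := Prod.ext (S.vcomp_lact _ _ _) (T.vcomp_lact _ _ _)
  hcomp_lact _ _ _ _ := Prod.ext (S.hcomp_lact _ _ _ _) (T.hcomp_lact _ _ _ _)
  hcomp_ract _ _ _ _ := Prod.ext (S.hcomp_ract _ _ _ _) (T.hcomp_ract _ _ _ _)
  hcomp_comm _ _ := by
    rw [recast_prod]; exact Prod.ext (S.hcomp_comm _ _) (T.hcomp_comm _ _)

/-- The identity `I_n`. -/
def idn (S : SetProP.{w}) (n : ℕ) : S.obj n n := hpow (F := S.obj) S.hcomp S.unit₀ S.unit₁ n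

theorem idn_prod (S : SetProP.{w}) (T : SetProP.{w'}) (n : ℕ) :
    (S.prod T).idn n = (S.idn n, T.idn n) :=
  hpow_prod (F := S.obj) (F' := T.obj) S.hcomp T.hcomp _ _ _ _ n

variable (S : SetProP.{w}) {k l m n k' l' m' k₁ l₁ : ℕ}

theorem vcomp_idn (p : S.obj k l) : S.vcomp p (S.idn k) = p := S.vcomp_unit p

theorem idn_vcomp (p : S.obj k l) : S.vcomp (S.idn l) p = p := S.unit_vcomp p

theorem idn_hcomp_idn (m n : ℕ) : S.hcomp (S.idn m) (S.idn n) = S.idn (m + n) := by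
  induction n with
  | zero => exact S.hcomp_unit₀ (S.idn m)
  | succ n ih =>
    refine (S.hcomp_assoc (S.idn m) (S.idn n) S.unit₁).trans ?_
    rw [ih]; rfl

/-- A right action on an identity slides across to the left, so a permutation needs only one normal
form, `S.lact σ (S.idn k)`, in the definition of words. -/
theorem ract_idn (τ : Perm (Fin n)) : S.ract τ (S.idn n) = S.lact τ (S.idn n) := by
  rw [← S.vcomp_idn (S.ract τ (S.idn n)), S.vcomp_lact, S.idn_vcomp]

theorem lact_idn_vcomp (σ : Perm (Fin l)) (p : S.obj k l) :
    S.vcomp (S.lact σ (S.idn l)) p = S.lact σ p := by rw [← S.lact_vcomp, S.idn_vcomp]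

/-- By interchange, two blocks side by side can be stacked in either order. The equality of the two
stackings, this one and `hcomp_eq_vcomp'`, is what settles the case of complementary colourings. -/
theorem hcomp_eq_vcomp (p : S.obj k l) (q : S.obj k' l') :
    S.hcomp p q = S.vcomp (S.hcomp p (S.idn l')) (S.hcomp (S.idn k) q) := by
  rw [S.interchange, S.vcomp_idn, S.idn_vcomp]

theorem hcomp_eq_vcomp' (p : S.obj k l) (q : S.obj k' l') :
    S.hcomp p q = S.vcomp (S.hcomp (S.idn l) q) (S.hcomp p (S.idn k')) := by
  rw [S.interchange, S.vcomp_idn, S.idn_vcomp]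

/-- Renumbering the glued edges does not change a composite. This is the only indeterminacy in a cut
with a given colouring. -/
theorem ract_vcomp_lact_inv (π : Perm (Fin l)) (p : S.obj l m) (q : S.obj k l) :
    S.vcomp (S.ract π⁻¹ p) (S.lact π q) = S.vcomp p q := by
  rw [S.vcomp_lact, S.lact_lact, inv_mul_cancel, S.one_lact]

theorem recast_vcomp (hk : k = k') (hl : l = l') (hm : m = m') (p : S.obj l m) (q : S.obj k l) :
    recast S.obj hk hm (S.vcomp p q) = S.vcomp (recast S.obj hl hm p) (recast S.obj hk hl q) := by
  subst hk hl hm; rfl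

theorem lact_inv_lact (σ : Perm (Fin l)) (p : S.obj k l) : S.lact σ⁻¹ (S.lact σ p) = p := by
  rw [S.lact_lact, inv_mul_cancel, S.one_lact]

/-- The words on a family `A` of elements: the composites of permutations and of the layers
`h * I_n` with `h` in `A`. -/
inductive Word (A : ∀ k l, Set (S.obj k l)) : ∀ {k l : ℕ}, S.obj k l → Prop
  | perm {k : ℕ} (σ : Perm (Fin k)) : Word A (S.lact σ (S.idn k))
  | layer {k a b n : ℕ} (h : S.obj a b) (hA : h ∈ A a b) (y : S.obj k (a + n)) (hy : Word A y)
      (σ : Perm (Fin (b + n))) : Word A (S.lact σ (S.vcomp (S.hcomp h (S.idn n)) y))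

/-! ### The words form a sub-ProP which contains the generators. -/

variable {S} {A : ∀ k l, Set (S.obj k l)}

theorem Word.recast {x : S.obj k l} (h : S.Word A x) (hk : k = k') (hl : l = l') :
    S.Word A (recast S.obj hk hl x) := by
  subst hk hl; exact h

theorem word_recast_iff {x : S.obj k l} (hk : k = k') (hl : l = l') :
    S.Word A (GraphProP.recast S.obj hk hl x) ↔ S.Word A x := by
  subst hk hl; rfl

theorem word_idn (n : ℕ) : S.Word A (S.idn n) := by
  simpa only [S.one_lact] using Word.perm (S := S) (A := A) (1 : Perm (Fin n))

theorem Word.lact {x : S.obj k l} (h : S.Word A x) (σ : Perm (Fin l)) :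
    S.Word A (S.lact σ x) := by
  cases h with
  | perm τ => rw [S.lact_lact]; exact .perm _
  | layer h hA y hy τ => rw [S.lact_lact]; exact .layer h hA y hy _

theorem Word.ract {x : S.obj k l} (h : S.Word A x) (τ : Perm (Fin k)) :
    S.Word A (S.ract τ x) := by
  induction h with
  | perm σ => rw [← S.lact_ract, S.ract_idn, S.lact_lact]; exact .perm _
  | layer h hA y hy σ ih => rw [← S.lact_ract, S.ract_vcomp]; exact .layer h hA _ ih _

theorem Word.vcomp {x : S.obj l m} (hx : S.Word A x) {y : S.obj k l} (hy : S.Word A y) :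
    S.Word A (S.vcomp x y) := by
  induction hx with
  | perm σ => rw [S.lact_idn_vcomp]; exact hy.lact σ
  | layer h hA z _ σ ih =>
    rw [← S.lact_vcomp, ← S.vcomp_assoc]
    exact .layer h hA _ ih σ

/-- Adding strands on the right keeps layers as layers: `(h * I_n) * I_m` is `h * I_{n+m}` by
associativity, up to the transport of the indices from `b + n + m` to `b + (n + m)`. -/
theorem Word.hcomp_idn {x : S.obj k l} (hx : S.Word A x) (m : ℕ) :
    S.Word A (S.hcomp x (S.idn m)) := by
  induction hx with
  | perm σ =>
    rw [← S.one_lact (S.idn m), S.hcomp_lact, S.idn_hcomp_idn]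
    exact .perm _
  | @layer a b n h hA y _ σ ih =>
    have e : S.hcomp (S.lact σ (S.vcomp (S.hcomp h (S.idn n)) y)) (S.idn m) =
        S.lact (tensorPerm σ 1) (S.vcomp (S.hcomp (S.hcomp h (S.idn n)) (S.idn m))
          (S.hcomp y (S.idn m))) := by
      rw [S.interchange, S.vcomp_idn, ← S.hcomp_lact, S.one_lact]
    rw [e]
    refine Word.lact ?_ _
    rw [← word_recast_iff rfl (Nat.add_assoc b n m), S.recast_vcomp rfl (Nat.add_assoc a n m),
      ← S.hcomp_assoc, S.idn_hcomp_idn]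
    simpa only [S.one_lact] using Word.layer h hA _ (ih.recast rfl (Nat.add_assoc a n m)) 1

/-- Strands on the left are moved to the right by the commutation axiom, at the price of two block
permutations. -/
theorem Word.idn_hcomp {x : S.obj k l} (hx : S.Word A x) (m : ℕ) :
    S.Word A (S.hcomp (S.idn m) x) := by
  rw [← S.lact_inv_lact (blockSwap m l) (S.hcomp (S.idn m) x), S.hcomp_comm]
  exact (((hx.hcomp_idn m).recast _ _).ract _).lact _

theorem Word.hcomp {x : S.obj k l} (hx : S.Word A x) {y : S.obj k' l'} (hy : S.Word A y) :
    S.Word A (S.hcomp x y) := by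
  rw [S.hcomp_eq_vcomp]
  exact (hx.hcomp_idn _).vcomp (hy.idn_hcomp _)

/-- A generator is a layer with `n = 0` extra strands placed on an identity; `hcomp_unit₀` removes
the factor `I_0`. -/
theorem Word.of_mem {x : S.obj k l} (hx : x ∈ A k l) : S.Word A x := by
  have h := Word.layer x hx (S.idn (k + 0)) (word_idn _) 1
  rw [S.one_lact, S.vcomp_idn, ← word_recast_iff (Nat.add_zero k) (Nat.add_zero l)] at h
  exact (S.hcomp_unit₀ x) ▸ h

end SetProP

end GraphProP

namespace GraphProP

/-! ### Marked graphs -/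

/-- A graph whose vertices and loops carry marks in `D`, with relations between the edges which end
at the same vertex and between the edges which start at the same vertex. -/
structure MarkedGraph (D : Type u) (k l : ℕ) extends Graph k l where
  dec : V ⊕ L → D
  rT : E ⊕ In → E ⊕ In → Prop
  rS : E ⊕ Out → E ⊕ Out → Prop
  rT_fibre : ∀ {a b}, rT a b → t a = t b
  rS_fibre : ∀ {a b}, rS a b → s a = s b

theorem liftRel_fibre {A A' A'' B B' : Type} {f : A → B} {f' : A' → B'} {r : A → A → Prop}
    {r' : A' → A' → Prop} (h : ∀ {a b}, r a b → f a = f b) (h' : ∀ {a b}, r' a b → f' a = f' b)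
    (φ : A'' → A ⊕ A') {a b : A''} (H : Sum.LiftRel r r' (φ a) (φ b)) :
    (Sum.map f f' ∘ φ) a = (Sum.map f f' ∘ φ) b := by
  simp only [comp_apply]
  revert H
  rcases φ a with x | x <;> rcases φ b with y | y <;> intro H <;> simp at H ⊢
  exacts [h H, h' H]

namespace MarkedGraph

variable {D : Type u} {D' : Type v} {k l m n k' l' m' : ℕ}

/-- Isomorphisms of marked graphs. -/
structure IsIso (G H : MarkedGraph D k l) (f : Graph.Iso G.toGraph H.toGraph) : Prop where
  dec : ∀ x, H.dec (Sum.map f.onV f.onL x) = G.dec x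
  rT : ∀ x y, H.rT (f.onT x) (f.onT y) ↔ G.rT x y
  rS : ∀ x y, H.rS (f.onS x) (f.onS y) ↔ G.rS x y

/-- Two marked graphs are isomorphic. -/
def Rel (G H : MarkedGraph D k l) : Prop := ∃ f, IsIso G H f

theorem IsIso.refl (G : MarkedGraph D k l) : IsIso G G (.refl _) where
  dec := by rintro (x | x) <;> rfl
  rT x y := by rw [PDecGraph.onT_refl, PDecGraph.onT_refl]
  rS x y := by rw [PDecGraph.onS_refl, PDecGraph.onS_refl]

theorem IsIso.symm {G H : MarkedGraph D k l} {f} (h : IsIso G H f) : IsIso H G f.symm where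
  dec x := by
    rw [← h.dec]
    rcases x with x | x
    exacts [congrArg (fun z => H.dec (.inl z)) (f.onV.apply_symm_apply x),
      congrArg (fun z => H.dec (.inr z)) (f.onL.apply_symm_apply x)]
  rT x y := by rw [← h.rT, PDecGraph.onT_symm, PDecGraph.onT_symm]
  rS x y := by rw [← h.rS, PDecGraph.onS_symm, PDecGraph.onS_symm]

theorem IsIso.trans {G H J : MarkedGraph D k l} {f g} (h : IsIso G H f) (h' : IsIso H J g) :
    IsIso G J (f.trans g) where
  dec x := by
    rw [← h.dec, ← h'.dec]
    rcases x with x | x <;> rfl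
  rT x y := by rw [PDecGraph.onT_trans, PDecGraph.onT_trans, h'.rT, h.rT]
  rS x y := by rw [PDecGraph.onS_trans, PDecGraph.onS_trans, h'.rS, h.rS]

instance setoid (D : Type u) (k l : ℕ) : Setoid (MarkedGraph D k l) where
  r := Rel
  iseqv := ⟨fun G => ⟨_, .refl G⟩, fun ⟨_, h⟩ => ⟨_, h.symm⟩, fun ⟨_, h⟩ ⟨_, h'⟩ => ⟨_, h.trans h'⟩⟩

def reindex (G : MarkedGraph D k l) (a : Fin k ≃ Fin k') (b : Fin l ≃ Fin l') :
    MarkedGraph D k' l' :=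
  { G with toGraph := G.toGraph.reindex a b }

/-- `σ · G` -/
def lact (σ : Perm (Fin l)) (G : MarkedGraph D k l) : MarkedGraph D k l :=
  { G with toGraph := G.toGraph.lact σ }

/-- `G · τ` -/
def ract (τ : Perm (Fin k)) (G : MarkedGraph D k l) : MarkedGraph D k l :=
  { G with toGraph := G.toGraph.ract τ }

variable (D) in
/-- The graph `I_n`. -/
def unit (n : ℕ) : MarkedGraph D n n where
  toGraph := Graph.unit n
  dec := Sum.elim Empty.elim Empty.elim
  rT _ _ := False
  rS _ _ := False
  rT_fibre h := h.elim
  rS_fibre h := h.elim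

/-- `G * G'` -/
def hcomp (G : MarkedGraph D k l) (G' : MarkedGraph D k' l') :
    MarkedGraph D (k + k') (l + l') where
  toGraph := G.toGraph.hcomp G'.toGraph
  dec := Sum.elim G.dec G'.dec ∘ sumSumSumComm G.V G'.V G.L G'.L
  rT a b := Sum.LiftRel G.rT G'.rT (Graph.hT _ _ a) (Graph.hT _ _ b)
  rS a b := Sum.LiftRel G.rS G'.rS (Graph.hS _ _ a) (Graph.hS _ _ b)
  rT_fibre h := liftRel_fibre (f := G.t) (f' := G'.t) G.rT_fibre G'.rT_fibre _ h
  rS_fibre h := liftRel_fibre (f := G.s) (f' := G'.s) G.rS_fibre G'.rS_fibre _ h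

/-- `G' ∘ G` -/
noncomputable def vcomp (G' : MarkedGraph D l m) (G : MarkedGraph D k l) : MarkedGraph D k m where
  toGraph := G'.toGraph.vcomp G.toGraph
  dec := Sum.elim G.dec G'.dec ∘ sumSumSumComm G.V G'.V G.L G'.L
  rT a b := Sum.LiftRel G.rT G'.rT (Graph.eT _ _ a) (Graph.eT _ _ b)
  rS a b := Sum.LiftRel G.rS G'.rS (Graph.eS _ _ a) (Graph.eS _ _ b)
  rT_fibre h := liftRel_fibre (f := G.t) (f' := G'.t) G.rT_fibre G'.rT_fibre _ h
  rS_fibre h := liftRel_fibre (f := G.s) (f' := G'.s) G.rS_fibre G'.rS_fibre _ h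

theorem exists_isIso {G H : MarkedGraph D k l} (F : Graph.FlagIso G.toGraph H.toGraph)
    (h : ∀ x, H.dec (Sum.map F.onV F.onL x) = G.dec x) (RT : F.T → F.T → Prop)
    (RS : F.S → F.S → Prop)
    (hGT : ∀ x y, G.rT x y ↔ RT (F.aT x) (F.aT y))
    (hHT : ∀ x y, H.rT x y ↔ RT (F.bT x) (F.bT y))
    (hGS : ∀ x y, G.rS x y ↔ RS (F.aS x) (F.aS y))
    (hHS : ∀ x y, H.rS x y ↔ RS (F.bS x) (F.bS y)) :
    ∃ f, IsIso G H f ∧ f.onV = F.onV ∧ f.onL = F.onL := by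
  obtain ⟨f, hf, hS, hT⟩ := F.exists_iso
  -- The conclusion of `exists_iso` says nothing about loops. Since loops have no incidence
  -- condition, their bijection can be replaced by the prescribed one, which is the one compatible
  -- with the marks.
  refine ⟨{ f with onL := F.onL }, ⟨fun x => ?_, fun x y => ?_, fun x y => ?_⟩, hf, rfl⟩
  · rw [← h, ← hf]
  · rw [hHT, hGT]
    exact iff_of_eq (congrArg₂ RT (hT x) (hT y))
  · rw [hHS, hGS]
    exact iff_of_eq (congrArg₂ RS (hS x) (hS y))

theorem rel_of_flag {G H : MarkedGraph D k l} (F : Graph.FlagIso G.toGraph H.toGraph)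
    (h : ∀ x, H.dec (Sum.map F.onV F.onL x) = G.dec x) (RT : F.T → F.T → Prop)
    (RS : F.S → F.S → Prop)
    (hGT : ∀ x y, G.rT x y ↔ RT (F.aT x) (F.aT y))
    (hHT : ∀ x y, H.rT x y ↔ RT (F.bT x) (F.bT y))
    (hGS : ∀ x y, G.rS x y ↔ RS (F.aS x) (F.aS y))
    (hHS : ∀ x y, H.rS x y ↔ RS (F.bS x) (F.bS y)) : G ≈ H :=
  let ⟨f, hf, _⟩ := exists_isIso F h RT RS hGT hHT hGS hHS
  ⟨f, hf⟩

variable (D) in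
/-- Isomorphism classes of marked graphs. -/
def Class (k l : ℕ) : Type (max 1 u) := Quotient (setoid D k l)

theorem recast_mk (G : MarkedGraph D k l) (hk : k = k') (hl : l = l') :
    recast (Class D) hk hl (Quotient.mk _ G) =
      Quotient.mk _ (G.reindex (finCongr hk) (finCongr hl)) := by
  subst hk hl; rfl

/-- Horizontal concatenation of isomorphism classes. -/
def Class.hcomp : Class D k l → Class D k' l' → Class D (k + k') (l + l') :=
  Quotient.map₂ MarkedGraph.hcomp fun _ H ⟨f, h⟩ _ H' ⟨f', h'⟩ =>
    rel_of_flag (Graph.hcompCongr f f')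
      (by rintro ((x | x) | (x | x)); exacts [h.dec (.inl x), h'.dec (.inl x), h.dec (.inr x), h'.dec (.inr x)])
      (Sum.LiftRel H.rT H'.rT) (Sum.LiftRel H.rS H'.rS)
      (fun _ _ => PDecGraph.liftRel_map (fun a b => (h.rT a b).symm)
        (fun a b => (h'.rT a b).symm) _ _)
      (fun _ _ => Iff.rfl)
      (fun _ _ => PDecGraph.liftRel_map (fun a b => (h.rS a b).symm)
        (fun a b => (h'.rS a b).symm) _ _)
      (fun _ _ => Iff.rfl)

/-- Vertical concatenation of isomorphism classes. -/
noncomputable def Class.vcomp : Class D l m → Class D k l → Class D k m :=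
  Quotient.map₂ MarkedGraph.vcomp fun _ H' ⟨f', h'⟩ _ H ⟨f, h⟩ =>
    rel_of_flag (Graph.vcompCongr f' f)
      (by rintro ((x | x) | (x | x)); exacts [h.dec (.inl x), h'.dec (.inl x), h.dec (.inr x), h'.dec (.inr x)])
      (Sum.LiftRel H.rT H'.rT) (Sum.LiftRel H.rS H'.rS)
      (fun _ _ => PDecGraph.liftRel_map (fun a b => (h.rT a b).symm)
        (fun a b => (h'.rT a b).symm) _ _)
      (fun _ _ => Iff.rfl)
      (fun _ _ => PDecGraph.liftRel_map (fun a b => (h.rS a b).symm)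
        (fun a b => (h'.rS a b).symm) _ _)
      (fun _ _ => Iff.rfl)

theorem hpow_unit (n : ℕ) :
    hpow (F := Class D) Class.hcomp (Quotient.mk _ (unit D 0)) (Quotient.mk _ (unit D 1)) n =
      Quotient.mk _ (unit D n) := by
  induction n with
  | zero => rfl
  | succ n ih =>
    refine (congrArg (fun z => Class.hcomp z (Quotient.mk _ (unit D 1))) ih).trans ?_
    exact Quotient.sound (rel_of_flag (Graph.unitSucc n)
      (by rintro ((⟨⟨⟩⟩ | ⟨⟨⟩⟩) | (⟨⟨⟩⟩ | ⟨⟨⟩⟩)))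
      (fun _ _ => False) (fun _ _ => False) (by rintro ((⟨⟨⟩⟩ | ⟨⟨⟩⟩) | (⟨⟨⟩⟩ | ⟨⟨⟩⟩)))
      (by rintro (⟨⟨⟩⟩ | ⟨⟨⟩⟩)) (by rintro ((⟨⟨⟩⟩ | ⟨⟨⟩⟩) | (⟨⟨⟩⟩ | ⟨⟨⟩⟩)))
      (by rintro (⟨⟨⟩⟩ | ⟨⟨⟩⟩)))

end MarkedGraph

/-- The ProP in sets of isomorphism classes of marked graphs. -/
noncomputable def markedGraphs (D : Type u) : SetProP.{max 1 u} where
  obj := MarkedGraph.Class D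
  lact σ := Quotient.map (MarkedGraph.lact σ) fun _ _ ⟨f, h⟩ => ⟨f.reindex _ _, h.1, h.2, h.3⟩
  ract τ := Quotient.map (MarkedGraph.ract τ) fun _ _ ⟨f, h⟩ => ⟨f.reindex _ _, h.1, h.2, h.3⟩
  hcomp := MarkedGraph.Class.hcomp
  vcomp := MarkedGraph.Class.vcomp
  unit₀ := Quotient.mk _ (MarkedGraph.unit D 0)
  unit₁ := Quotient.mk _ (MarkedGraph.unit D 1)
  one_lact := by rintro _ _ ⟨G⟩; rfl
  one_ract := by rintro _ _ ⟨G⟩; rfl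
  lact_lact := by rintro _ _ σ σ' ⟨G⟩; rfl
  ract_ract := by rintro _ _ τ τ' ⟨G⟩; rfl
  lact_ract := by rintro _ _ σ τ ⟨G⟩; rfl
  hcomp_assoc := by
    rintro _ _ _ _ _ _ ⟨G⟩ ⟨G'⟩ ⟨G''⟩
    exact (Quotient.sound (MarkedGraph.rel_of_flag (Graph.hcompAssoc _ _ _)
      (by rintro ((v | v | v) | (v | v | v)) <;> rfl)
      (Sum.LiftRel (Sum.LiftRel G.rT G'.rT) G''.rT)
      (Sum.LiftRel (Sum.LiftRel G.rS G'.rS) G''.rS)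
      (fun x y => (PDecGraph.liftRel_map (f := id) (f' := Graph.hT G'.toGraph G''.toGraph)
        (fun _ _ => .rfl) (fun _ _ => .rfl) _ _).trans
        (PDecGraph.liftRel_assoc _ _))
      (fun x y => PDecGraph.liftRel_map (f := Graph.hT G.toGraph G'.toGraph) (f' := id)
        (fun _ _ => .rfl) (fun _ _ => .rfl) _ _)
      (fun x y => (PDecGraph.liftRel_map (f := id) (f' := Graph.hS G'.toGraph G''.toGraph)
        (fun _ _ => .rfl) (fun _ _ => .rfl) _ _).trans
        (PDecGraph.liftRel_assoc _ _))
      (fun x y => PDecGraph.liftRel_map (f := Graph.hS G.toGraph G'.toGraph) (f' := id)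
        (fun _ _ => .rfl) (fun _ _ => .rfl) _ _))).trans
      (MarkedGraph.recast_mk ((G.hcomp G').hcomp G'') _ _).symm
  hcomp_unit₀ := by
    rintro _ _ ⟨G⟩
    exact (MarkedGraph.recast_mk (G.hcomp (.unit D 0)) _ _).trans
      (Quotient.sound (MarkedGraph.rel_of_flag (Graph.hcompUnit _)
        (by rintro ((v | ⟨⟨⟩⟩) | (v | ⟨⟨⟩⟩)) <;> rfl)
        G.rT G.rS (fun x y => PDecGraph.liftRel_empty _ _) (fun _ _ => .rfl)
        (fun x y => PDecGraph.liftRel_empty _ _) (fun _ _ => .rfl)))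
  unit₀_hcomp := by
    rintro _ _ ⟨G⟩
    exact (MarkedGraph.recast_mk ((MarkedGraph.unit D 0).hcomp G) _ _).trans
      (Quotient.sound (MarkedGraph.rel_of_flag (Graph.unitHcomp _)
        (by rintro ((⟨⟨⟩⟩ | v) | (⟨⟨⟩⟩ | v)) <;> rfl)
        G.rT G.rS (fun x y => PDecGraph.empty_liftRel _ _) (fun _ _ => .rfl)
        (fun x y => PDecGraph.empty_liftRel _ _) (fun _ _ => .rfl)))
  vcomp_assoc := by
    rintro _ _ _ _ ⟨G''⟩ ⟨G'⟩ ⟨G⟩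
    exact Quotient.sound (MarkedGraph.rel_of_flag (Graph.vcompAssoc _ _ _)
      (by rintro (((v | v) | v) | ((v | v) | v)) <;> rfl)
      (Sum.LiftRel G.rT (Sum.LiftRel G'.rT G''.rT))
      (Sum.LiftRel G.rS (Sum.LiftRel G'.rS G''.rS))
      (fun x y => (PDecGraph.liftRel_map (f := Graph.eT G'.toGraph G.toGraph) (f' := id)
        (fun _ _ => .rfl) (fun _ _ => .rfl) _ _).trans
        (PDecGraph.liftRel_symm_assoc _ _))
      (fun x y => PDecGraph.liftRel_map (f := id) (f' := Graph.eT G''.toGraph G'.toGraph)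
        (fun _ _ => .rfl) (fun _ _ => .rfl) _ _)
      (fun x y => (PDecGraph.liftRel_map (f := Graph.eS G'.toGraph G.toGraph) (f' := id)
        (fun _ _ => .rfl) (fun _ _ => .rfl) _ _).trans
        (PDecGraph.liftRel_symm_assoc _ _))
      (fun x y => PDecGraph.liftRel_map (f := id) (f' := Graph.eS G''.toGraph G'.toGraph)
        (fun _ _ => .rfl) (fun _ _ => .rfl) _ _))
  vcomp_unit := by
    rintro _ _ ⟨G⟩
    rw [MarkedGraph.hpow_unit]
    exact Quotient.sound (MarkedGraph.rel_of_flag (Graph.vcompUnit _)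
      (by rintro ((⟨⟨⟩⟩ | v) | (⟨⟨⟩⟩ | v)) <;> rfl)
      G.rT G.rS (fun x y => PDecGraph.empty_liftRel _ _) (fun _ _ => .rfl)
      (fun x y => PDecGraph.empty_liftRel _ _) (fun _ _ => .rfl))
  unit_vcomp := by
    rintro _ _ ⟨G⟩
    rw [MarkedGraph.hpow_unit]
    exact Quotient.sound (MarkedGraph.rel_of_flag (Graph.unitVcomp _)
      (by rintro ((v | ⟨⟨⟩⟩) | (v | ⟨⟨⟩⟩)) <;> rfl)
      G.rT G.rS (fun x y => PDecGraph.liftRel_empty _ _) (fun _ _ => .rfl)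
      (fun x y => PDecGraph.liftRel_empty _ _) (fun _ _ => .rfl))
  interchange := by
    rintro _ _ _ _ _ _ ⟨H⟩ ⟨H'⟩ ⟨G⟩ ⟨G'⟩
    exact Quotient.sound (MarkedGraph.rel_of_flag (Graph.interchange _ _ _ _)
      (by rintro (((v | v) | (v | v)) | ((v | v) | (v | v))) <;> rfl)
      (Sum.LiftRel (Sum.LiftRel G.rT H.rT) (Sum.LiftRel G'.rT H'.rT))
      (Sum.LiftRel (Sum.LiftRel G.rS H.rS) (Sum.LiftRel G'.rS H'.rS))
      (fun x y => (PDecGraph.liftRel_map (f := Graph.hT G.toGraph G'.toGraph)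
        (f' := Graph.hT H.toGraph H'.toGraph)
        (fun _ _ => .rfl) (fun _ _ => .rfl) _ _).trans
        (PDecGraph.liftRel_comm _ _))
      (fun x y => PDecGraph.liftRel_map (f := Graph.eT H.toGraph G.toGraph)
        (f' := Graph.eT H'.toGraph G'.toGraph)
        (fun _ _ => .rfl) (fun _ _ => .rfl) _ _)
      (fun x y => (PDecGraph.liftRel_map (f := Graph.hS G.toGraph G'.toGraph)
        (f' := Graph.hS H.toGraph H'.toGraph)
        (fun _ _ => .rfl) (fun _ _ => .rfl) _ _).trans
        (PDecGraph.liftRel_comm _ _))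
      (fun x y => PDecGraph.liftRel_map (f := Graph.eS H.toGraph G.toGraph)
        (f' := Graph.eS H'.toGraph G'.toGraph)
        (fun _ _ => .rfl) (fun _ _ => .rfl) _ _))
  lact_vcomp := by
    rintro _ _ _ σ ⟨G'⟩ ⟨G⟩
    exact Quotient.sound (MarkedGraph.rel_of_flag (Graph.lactVcomp σ _ _)
      (by rintro (x | x) <;> rfl)
      (Sum.LiftRel G.rT G'.rT) (Sum.LiftRel G.rS G'.rS)
      (fun _ _ => .rfl) (fun _ _ => .rfl) (fun _ _ => .rfl) (fun _ _ => .rfl))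
  ract_vcomp := by
    rintro _ _ _ ν ⟨G'⟩ ⟨G⟩
    exact Quotient.sound (MarkedGraph.rel_of_flag (Graph.ractVcomp ν _ _)
      (by rintro (x | x) <;> rfl)
      (Sum.LiftRel G.rT G'.rT) (Sum.LiftRel G.rS G'.rS)
      (fun _ _ => .rfl) (fun _ _ => .rfl) (fun _ _ => .rfl) (fun _ _ => .rfl))
  vcomp_lact := by
    rintro _ _ _ τ ⟨G'⟩ ⟨G⟩
    exact Quotient.sound (MarkedGraph.rel_of_flag (Graph.vcompLact τ _ _)
      (by rintro (x | x) <;> rfl)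
      (Sum.LiftRel G.rT G'.rT) (Sum.LiftRel G.rS G'.rS)
      (fun _ _ => .rfl) (fun _ _ => .rfl) (fun _ _ => .rfl) (fun _ _ => .rfl))
  hcomp_lact := by
    rintro _ _ _ _ σ σ' ⟨G⟩ ⟨G'⟩
    exact Quotient.sound (MarkedGraph.rel_of_flag (Graph.hcompLact σ σ' _ _)
      (by rintro (x | x) <;> rfl)
      (G.hcomp G').rT (G.hcomp G').rS
      (fun _ _ => .rfl) (fun _ _ => .rfl) (fun _ _ => .rfl) (fun _ _ => .rfl))
  hcomp_ract := by
    rintro _ _ _ _ τ τ' ⟨G⟩ ⟨G'⟩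
    exact Quotient.sound (MarkedGraph.rel_of_flag (Graph.hcompRact τ τ' _ _)
      (by rintro (x | x) <;> rfl)
      (G.hcomp G').rT (G.hcomp G').rS
      (fun _ _ => .rfl) (fun _ _ => .rfl) (fun _ _ => .rfl) (fun _ _ => .rfl))
  hcomp_comm := by
    rintro _ _ _ _ ⟨G⟩ ⟨G'⟩
    refine (?_ : _ = _).trans (congrArg _ (MarkedGraph.recast_mk (G'.hcomp G) _ _).symm)
    exact Quotient.sound (MarkedGraph.rel_of_flag (Graph.hcompComm _ _)
      (by rintro ((v | v) | (v | v)) <;> rfl)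
      (Sum.LiftRel G'.rT G.rT) (Sum.LiftRel G'.rS G.rS)
      (fun _ _ => PDecGraph.liftRel_swap _ _) (fun _ _ => .rfl)
      (fun _ _ => PDecGraph.liftRel_swap _ _) (fun _ _ => .rfl))

end GraphProP

namespace GraphProP

namespace MarkedGraph

variable {D : Type u} {D' : Type v} {D'' : Type w} {k l m n k' l' m' : ℕ}

/-! ### Maps of marks, and properties of isomorphism classes -/

/-- The same graph, with other marks. -/
def remark (G : MarkedGraph D k l) (d : G.V ⊕ G.L → D') : MarkedGraph D' k l where
  toGraph := G.toGraph
  dec := d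
  rT := G.rT
  rS := G.rS
  rT_fibre := G.rT_fibre
  rS_fibre := G.rS_fibre

/-- The same graph, with the marks transformed by `g`. -/
def map (g : D → D') (G : MarkedGraph D k l) : MarkedGraph D' k l := G.remark fun x => g (G.dec x)

theorem IsIso.map {G H : MarkedGraph D k l} {f} (h : IsIso G H f) (g : D → D') :
    IsIso (G.map g) (H.map g) f := ⟨fun x => congrArg g (h.dec x), h.rT, h.rS⟩

/-- This is an equality of marked graphs, not only an isomorphism: the two sides have the same graph
and the same relations, and only the functions of marks are compared. -/
theorem map_hcomp (g : D → D') (G : MarkedGraph D k l) (G' : MarkedGraph D k' l') :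
    (G.hcomp G').map g = (G.map g).hcomp (G'.map g) :=
  congrArg (G.hcomp G').remark (funext (by rintro ((x | x) | (x | x)) <;> rfl) :
    (fun x => g ((G.hcomp G').dec x)) = ((G.map g).hcomp (G'.map g)).dec)

theorem map_vcomp (g : D → D') (G : MarkedGraph D l m) (G' : MarkedGraph D k l) :
    (G.vcomp G').map g = (G.map g).vcomp (G'.map g) :=
  congrArg (G.vcomp G').remark (funext (by rintro ((x | x) | (x | x)) <;> rfl) :
    (fun x => g ((G.vcomp G').dec x)) = ((G.map g).vcomp (G'.map g)).dec)

theorem map_unit (g : D → D') (n : ℕ) : (unit D n).map g = unit D' n :=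
  congrArg (unit D n).remark (funext (by rintro (⟨⟨⟩⟩ | ⟨⟨⟩⟩)) :
    (fun x => g ((unit D n).dec x)) = (unit D' n).dec)

namespace Class

/-- The class of a marked graph, as an element of the ProP of marked graphs. -/
def mk (G : MarkedGraph D k l) : (markedGraphs D).obj k l := Quotient.mk _ G

theorem mk_surjective (x : (markedGraphs D).obj k l) : ∃ G, mk G = x := Quotient.exists_rep x

theorem mk_eq_iff {G H : MarkedGraph D k l} : mk G = mk H ↔ ∃ f, IsIso G H f :=
  Quotient.eq

theorem mk_hcomp (G : MarkedGraph D k l) (G' : MarkedGraph D k' l') :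
    (markedGraphs D).hcomp (mk G) (mk G') = mk (G.hcomp G') := rfl

theorem mk_vcomp (G : MarkedGraph D l m) (G' : MarkedGraph D k l) :
    (markedGraphs D).vcomp (mk G) (mk G') = mk (G.vcomp G') := rfl

theorem mk_lact (σ : Perm (Fin l)) (G : MarkedGraph D k l) :
    (markedGraphs D).lact σ (mk G) = mk (G.lact σ) := rfl

theorem mk_ract (τ : Perm (Fin k)) (G : MarkedGraph D k l) :
    (markedGraphs D).ract τ (mk G) = mk (G.ract τ) := rfl

theorem mk_recast (G : MarkedGraph D k l) (hk : k = k') (hl : l = l') :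
    recast (markedGraphs D).obj hk hl (mk G) = mk (G.reindex (finCongr hk) (finCongr hl)) :=
  recast_mk G hk hl

theorem idn_eq (n : ℕ) : (markedGraphs D).idn n = mk (unit D n) := hpow_unit n

/-- The map induced on isomorphism classes by a transformation of the marks. -/
def map (g : D → D') : (markedGraphs D).obj k l → (markedGraphs D').obj k l :=
  Quotient.map (MarkedGraph.map g) fun _ _ ⟨_, h⟩ => ⟨_, h.map g⟩

theorem map_map (g : D → D') (g' : D' → D'') (x : (markedGraphs D).obj k l) :
    map g' (map g x) = map (fun d => g' (g d)) x := by
  obtain ⟨G, rfl⟩ := mk_surjective x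
  rfl

theorem map_id (x : (markedGraphs D).obj k l) : map (fun d => d) x = x := by
  obtain ⟨G, rfl⟩ := mk_surjective x
  rfl

theorem map_lact (g : D → D') (σ : Perm (Fin l)) (x : (markedGraphs D).obj k l) :
    map g ((markedGraphs D).lact σ x) = (markedGraphs D').lact σ (map g x) := by
  obtain ⟨G, rfl⟩ := mk_surjective x
  rfl

theorem map_ract (g : D → D') (τ : Perm (Fin k)) (x : (markedGraphs D).obj k l) :
    map g ((markedGraphs D).ract τ x) = (markedGraphs D').ract τ (map g x) := by
  obtain ⟨G, rfl⟩ := mk_surjective x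
  rfl

theorem map_vcomp (g : D → D') (x : (markedGraphs D).obj l m) (y : (markedGraphs D).obj k l) :
    map g ((markedGraphs D).vcomp x y) = (markedGraphs D').vcomp (map g x) (map g y) := by
  obtain ⟨G, rfl⟩ := mk_surjective x
  obtain ⟨G', rfl⟩ := mk_surjective y
  exact congrArg mk (MarkedGraph.map_vcomp g G G')

theorem map_hcomp (g : D → D') (x : (markedGraphs D).obj k l) (y : (markedGraphs D).obj k' l') :
    map g ((markedGraphs D).hcomp x y) = (markedGraphs D').hcomp (map g x) (map g y) := by
  obtain ⟨G, rfl⟩ := mk_surjective x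
  obtain ⟨G', rfl⟩ := mk_surjective y
  exact congrArg mk (MarkedGraph.map_hcomp g G G')

theorem map_idn (g : D → D') (n : ℕ) :
    map g ((markedGraphs D).idn n) = (markedGraphs D').idn n := by
  rw [idn_eq, idn_eq]
  exact congrArg mk (MarkedGraph.map_unit g n)

/-- Some vertex or loop has a mark with the property `p`. -/
def HasMark (p : D → Prop) : (markedGraphs D).obj k l → Prop :=
  Quotient.lift (fun G : MarkedGraph D k l => ∃ x, p (G.dec x)) <| by
    have key : ∀ G H : MarkedGraph D k l, G ≈ H → (∃ x, p (G.dec x)) → ∃ x, p (H.dec x) := by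
      rintro G H ⟨f, hf⟩ ⟨x, hx⟩
      exact ⟨_, (congrArg p (hf.dec x)).mpr hx⟩
    exact fun G H h => propext ⟨key _ _ h, key _ _ (Setoid.symm h)⟩

theorem hasMark_mk {p : D → Prop} {G : MarkedGraph D k l} :
    HasMark p (mk G) ↔ ∃ x, p (G.dec x) := Iff.rfl

theorem hasMark_map {p : D' → Prop} {g : D → D'} {x : (markedGraphs D).obj k l} :
    HasMark p (map g x) ↔ HasMark (fun d => p (g d)) x := by
  obtain ⟨G, rfl⟩ := mk_surjective x
  exact Iff.rfl

theorem HasMark.imp {p q : D → Prop} (h : ∀ d, p d → q d) {x : (markedGraphs D).obj k l}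
    (hx : HasMark p x) : HasMark q x := by
  obtain ⟨G, rfl⟩ := mk_surjective x
  obtain ⟨x, hx⟩ := hx
  exact ⟨x, h _ hx⟩

theorem hasMark_lact {p : D → Prop} {σ : Perm (Fin l)} {x : (markedGraphs D).obj k l} :
    HasMark p ((markedGraphs D).lact σ x) ↔ HasMark p x := by
  obtain ⟨G, rfl⟩ := mk_surjective x
  exact Iff.rfl

theorem hasMark_ract {p : D → Prop} {τ : Perm (Fin k)} {x : (markedGraphs D).obj k l} :
    HasMark p ((markedGraphs D).ract τ x) ↔ HasMark p x := by
  obtain ⟨G, rfl⟩ := mk_surjective x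
  exact Iff.rfl

theorem not_hasMark_idn {p : D → Prop} {n : ℕ} : ¬ HasMark p ((markedGraphs D).idn n) := by
  rw [idn_eq]
  rintro ⟨⟨⟨⟩⟩ | ⟨⟨⟩⟩, -⟩

theorem hasMark_vcomp {p : D → Prop} {x : (markedGraphs D).obj l m}
    {y : (markedGraphs D).obj k l} :
    HasMark p ((markedGraphs D).vcomp x y) ↔ HasMark p x ∨ HasMark p y := by
  obtain ⟨G, rfl⟩ := mk_surjective x
  obtain ⟨G', rfl⟩ := mk_surjective y
  rw [mk_vcomp, hasMark_mk, hasMark_mk, hasMark_mk]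
  constructor
  · rintro ⟨(x | x) | (x | x), h⟩
    exacts [.inr ⟨_, h⟩, .inl ⟨_, h⟩, .inr ⟨_, h⟩, .inl ⟨_, h⟩]
  · rintro (⟨x | x, h⟩ | ⟨x | x, h⟩)
    exacts [⟨.inl (.inr x), h⟩, ⟨.inr (.inr x), h⟩, ⟨.inl (.inl x), h⟩, ⟨.inr (.inl x), h⟩]

theorem hasMark_hcomp {p : D → Prop} {x : (markedGraphs D).obj k l}
    {y : (markedGraphs D).obj k' l'} :
    HasMark p ((markedGraphs D).hcomp x y) ↔ HasMark p x ∨ HasMark p y := by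
  obtain ⟨G, rfl⟩ := mk_surjective x
  obtain ⟨G', rfl⟩ := mk_surjective y
  rw [mk_hcomp, hasMark_mk, hasMark_mk, hasMark_mk]
  constructor
  · rintro ⟨(x | x) | (x | x), h⟩
    exacts [.inl ⟨_, h⟩, .inr ⟨_, h⟩, .inl ⟨_, h⟩, .inr ⟨_, h⟩]
  · rintro (⟨x | x, h⟩ | ⟨x | x, h⟩)
    exacts [⟨.inl (.inl x), h⟩, ⟨.inr (.inl x), h⟩, ⟨.inl (.inr x), h⟩, ⟨.inr (.inr x), h⟩]

/-- The marks of the endpoints of every internal edge are related by `r`. -/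
def StepRel (r : D → D → Prop) : (markedGraphs D).obj k l → Prop :=
  Quotient.lift (fun G : MarkedGraph D k l =>
    ∀ e, r (G.dec (.inl (G.s (.inl e)))) (G.dec (.inl (G.t (.inl e))))) <| by
    have key : ∀ G H : MarkedGraph D k l, G ≈ H →
        (∀ e, r (G.dec (.inl (G.s (.inl e)))) (G.dec (.inl (G.t (.inl e))))) →
        ∀ e, r (H.dec (.inl (H.s (.inl e)))) (H.dec (.inl (H.t (.inl e)))) := by
      rintro G H ⟨f, hf⟩ h e
      obtain ⟨e, rfl⟩ := f.onE.surjective e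
      have hs := f.map_s (.inl e)
      have ht := f.map_t (.inl e)
      simp only [Sum.map_inl] at hs ht
      have h1 := hf.dec (.inl (G.s (.inl e)))
      have h2 := hf.dec (.inl (G.t (.inl e)))
      simp only [Sum.map_inl] at h1 h2
      rw [hs, ht, h1, h2]
      exact h e
    exact fun G H h => propext ⟨key _ _ h, key _ _ (Setoid.symm h)⟩

theorem stepRel_map {r : D' → D' → Prop} {g : D → D'} {x : (markedGraphs D).obj k l} :
    StepRel r (map g x) ↔ StepRel (fun d d' => r (g d) (g d')) x := by
  obtain ⟨G, rfl⟩ := mk_surjective x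
  exact Iff.rfl

theorem StepRel.imp {r r' : D → D → Prop} (h : ∀ d d', r d d' → r' d d')
    {x : (markedGraphs D).obj k l} (hx : StepRel r x) : StepRel r' x := by
  obtain ⟨G, rfl⟩ := mk_surjective x
  exact fun e => h _ _ (hx e)

theorem StepRel.and {r r' : D → D → Prop} {x : (markedGraphs D).obj k l} (hx : StepRel r x)
    (hx' : StepRel r' x) : StepRel (fun d d' => r d d' ∧ r' d d') x := by
  obtain ⟨G, rfl⟩ := mk_surjective x
  exact fun e => ⟨hx e, hx' e⟩

/-- The lower factor keeps its own internal edges inside the composite. This lets a second colouring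
be restricted to the lower part of a cut and cut again. -/
theorem StepRel.right {r : D → D → Prop} {x : (markedGraphs D).obj l m}
    {y : (markedGraphs D).obj k l} (h : StepRel r ((markedGraphs D).vcomp x y)) :
    StepRel r y := by
  obtain ⟨G, rfl⟩ := mk_surjective x
  obtain ⟨G', rfl⟩ := mk_surjective y
  exact fun e => h (.inl (.inl e))

/-- The number of vertices and loops. -/
noncomputable def size : (markedGraphs D).obj k l → ℕ :=
  Quotient.lift (fun G : MarkedGraph D k l => Nat.card (G.V ⊕ G.L)) <| by
    rintro G H ⟨f, -⟩
    exact Nat.card_congr (sumCongr f.onV f.onL)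

theorem size_mk (G : MarkedGraph D k l) : size (mk G) = Nat.card (G.V ⊕ G.L) := rfl

theorem size_lact (σ : Perm (Fin l)) (x : (markedGraphs D).obj k l) :
    size ((markedGraphs D).lact σ x) = size x := by
  obtain ⟨G, rfl⟩ := mk_surjective x
  rfl

theorem size_ract (τ : Perm (Fin k)) (x : (markedGraphs D).obj k l) :
    size ((markedGraphs D).ract τ x) = size x := by
  obtain ⟨G, rfl⟩ := mk_surjective x
  rfl

theorem size_map (g : D → D') (x : (markedGraphs D).obj k l) : size (map g x) = size x := by
  obtain ⟨G, rfl⟩ := mk_surjective x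
  rfl

theorem size_vcomp (x : (markedGraphs D).obj l m) (y : (markedGraphs D).obj k l) :
    size ((markedGraphs D).vcomp x y) = size x + size y := by
  obtain ⟨G, rfl⟩ := mk_surjective x
  obtain ⟨G', rfl⟩ := mk_surjective y
  exact (Nat.card_congr (sumSumSumComm G'.V G.V G'.L G.L)).trans
    (Nat.card_sum.trans (add_comm _ _))

theorem size_hcomp (x : (markedGraphs D).obj k l) (y : (markedGraphs D).obj k' l') :
    size ((markedGraphs D).hcomp x y) = size x + size y := by
  obtain ⟨G, rfl⟩ := mk_surjective x
  obtain ⟨G', rfl⟩ := mk_surjective y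
  exact (Nat.card_congr (sumSumSumComm G.V G'.V G.L G'.L)).trans Nat.card_sum

theorem size_idn (n : ℕ) : size ((markedGraphs D).idn n) = 0 := by
  rw [idn_eq, size_mk]
  exact Nat.card_eq_zero.2 (.inl (inferInstanceAs (IsEmpty (Empty ⊕ Empty))))

theorem size_pos_iff {x : (markedGraphs D).obj k l} : 0 < size x ↔ HasMark (fun _ => True) x := by
  obtain ⟨G, rfl⟩ := mk_surjective x
  rw [size_mk, Finite.card_pos_iff, hasMark_mk]
  simp

end Class

end MarkedGraph

end GraphProP

namespace GraphProP

namespace Graph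

/-! ### Cutting a graph -/

section Cut

variable {k l : ℕ} (G : Graph k l) (W : G.V → Prop)

/-- The internal edges which cross the cut. -/
abbrev CutEdge : Type := {e : G.E // ¬ W (G.s (.inl e)) ∧ W (G.t (.inl e))}

/-- The edges which go from the part below the cut to the part above it. -/
abbrev CutMid : Type := (CutEdge G W ⊕ {o // ¬ W (G.s (.inr o))}) ⊕
  ({i // W (G.t (.inr i))} ⊕ G.InOut)

/-- `lowS`, `lowT`, `highS`, `highT` send the starts and ends of edges of the two parts to those of
`G`. An edge which crosses the cut starts in the lower part, as an output, and ends in the upper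
part, as an input. -/
def lowS : {e // ¬ W (G.t (.inl e))} ⊕ (CutEdge G W ⊕ {o // ¬ W (G.s (.inr o))}) → G.E ⊕ G.Out
  | .inl e => .inl e.1
  | .inr (.inl e) => .inl e.1
  | .inr (.inr o) => .inr o.1

def lowT : {e // ¬ W (G.t (.inl e))} ⊕ {i // ¬ W (G.t (.inr i))} → G.E ⊕ G.In
  | .inl e => .inl e.1
  | .inr i => .inr i.1

def highS : {e // W (G.s (.inl e))} ⊕ {o // W (G.s (.inr o))} → G.E ⊕ G.Out
  | .inl e => .inl e.1
  | .inr o => .inr o.1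

def highT : {e // W (G.s (.inl e))} ⊕ (CutEdge G W ⊕ {i // W (G.t (.inr i))}) → G.E ⊕ G.In
  | .inl e => .inl e.1
  | .inr (.inl e) => .inl e.1
  | .inr (.inr i) => .inr i.1

variable {W}

theorem lowS_spec
    (hW : ∀ e, W (G.s (.inl e)) → W (G.t (.inl e))) (x) : ¬ W (G.s (lowS G W x)) := by
  rcases x with e | e | o
  exacts [fun h => e.2 (hW _ h), e.2.1, o.2]

theorem lowT_spec (x) : ¬ W (G.t (lowT G W x)) := by
  rcases x with e | i
  exacts [e.2, i.2]

theorem highS_spec (x) : W (G.s (highS G W x)) := by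
  rcases x with e | o
  exacts [e.2, o.2]

theorem highT_spec
    (hW : ∀ e, W (G.s (.inl e)) → W (G.t (.inl e))) (x) : W (G.t (highT G W x)) := by
  rcases x with e | e | i
  exacts [hW _ e.2, e.2.2, i.2]

/-- By `hW`, an internal edge lies below the cut, crosses it upwards, or lies above it; each start
of an edge then belongs to exactly one part. `cutT_bijective` is the same count for the ends. -/
theorem cutS_bijective (hW : ∀ e, W (G.s (.inl e)) → W (G.t (.inl e))) :
    Bijective (Sum.elim (lowS G W) (highS G W)) := by
  constructor
  · rintro ((⟨e, h⟩ | ⟨e, h⟩ | ⟨o, h⟩) | (⟨e, h⟩ | ⟨o, h⟩))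
      ((⟨e', h'⟩ | ⟨e', h'⟩ | ⟨o', h'⟩) | (⟨e', h'⟩ | ⟨o', h'⟩)) H
    all_goals cases H
    all_goals first | rfl | (exfalso; tauto)
  · rintro (e | o)
    · by_cases h : W (G.t (.inl e))
      · by_cases h' : W (G.s (.inl e))
        · exact ⟨.inr (.inl ⟨e, h'⟩), rfl⟩
        · exact ⟨.inl (.inr (.inl ⟨e, h', h⟩)), rfl⟩
      · exact ⟨.inl (.inl ⟨e, h⟩), rfl⟩
    · by_cases h : W (G.s (.inr o))
      · exact ⟨.inr (.inr ⟨o, h⟩), rfl⟩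
      · exact ⟨.inl (.inr (.inr ⟨o, h⟩)), rfl⟩

theorem cutT_bijective (hW : ∀ e, W (G.s (.inl e)) → W (G.t (.inl e))) :
    Bijective (Sum.elim (lowT G W) (highT G W)) := by
  constructor
  · rintro ((⟨e, h⟩ | ⟨e, h⟩) | (⟨e, h⟩ | ⟨e, h⟩ | ⟨o, h⟩))
      ((⟨e', h'⟩ | ⟨e', h'⟩) | (⟨e', h'⟩ | ⟨e', h'⟩ | ⟨o', h'⟩)) H
    all_goals cases H
    all_goals first | rfl | (exfalso; tauto)
  · rintro (e | o)
    · by_cases h : W (G.t (.inl e))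
      · by_cases h' : W (G.s (.inl e))
        · exact ⟨.inr (.inl ⟨e, h'⟩), rfl⟩
        · exact ⟨.inr (.inr (.inl ⟨e, h', h⟩)), rfl⟩
      · exact ⟨.inl (.inl ⟨e, h⟩), rfl⟩
    · by_cases h : W (G.t (.inr o))
      · exact ⟨.inr (.inr (.inr ⟨o, h⟩)), rfl⟩
      · exact ⟨.inl (.inr ⟨o, h⟩), rfl⟩

open Classical in
/-- The splitting of a type according to a predicate, with a third summand. -/
noncomputable def splitEquiv {A B : Type} (p : A → Prop) :
    {a // p a} ⊕ ({a // ¬ p a} ⊕ B) ≃ A ⊕ B :=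
  (sumAssoc _ _ _).symm.trans (sumCongr (sumCompl p) (.refl _))

open Classical in
/-- The splitting of a type according to the negation of a predicate, with a third summand. -/
noncomputable def splitEquiv' {A B : Type} (p : A → Prop) :
    {a // ¬ p a} ⊕ ({a // p a} ⊕ B) ≃ A ⊕ B :=
  (sumAssoc _ _ _).symm.trans (sumCongr ((sumComm _ _).trans (sumCompl p)) (.refl _))

variable (hW : ∀ e, W (G.s (.inl e)) → W (G.t (.inl e))) (WL : G.L → Prop) {m : ℕ} (ε : CutMid G W ≃ Fin m)

/-- The part of `G` below a cut. -/
noncomputable def low : Graph k m where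
  V := {v // ¬ W v}
  E := {e // ¬ W (G.t (.inl e))}
  In := {i // ¬ W (G.t (.inr i))}
  Out := CutEdge G W ⊕ {o // ¬ W (G.s (.inr o))}
  -- An input which ends above the cut runs through the lower part without meeting a vertex.
  -- Symmetrically, in `high`, an output which starts below the cut runs through the upper part.
  InOut := {i // W (G.t (.inr i))} ⊕ G.InOut
  L := {x // ¬ WL x}
  s x := ⟨G.s (lowS G W x), lowS_spec G hW x⟩
  t x := ⟨G.t (lowT G W x), lowT_spec G x⟩
  α := (splitEquiv' fun i => W (G.t (.inr i))).trans G.α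
  β := ε

/-- The part of `G` above a cut. -/
noncomputable def high : Graph m l where
  V := {v // W v}
  E := {e // W (G.s (.inl e))}
  In := CutEdge G W ⊕ {i // W (G.t (.inr i))}
  Out := {o // W (G.s (.inr o))}
  InOut := {o // ¬ W (G.s (.inr o))} ⊕ G.InOut
  L := {x // WL x}
  s x := ⟨G.s (highS G W x), highS_spec G x⟩
  t x := ⟨G.t (highT G W x), highT_spec G hW x⟩
  -- The inputs of the upper part group the cut edges with the inputs above, while `CutMid` groups
  -- them with the outputs below. After the exchange of the middle summands, both parts number the
  -- cut by the same `ε`.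
  α := (sumSumSumComm _ _ _ _).trans ε
  β := (splitEquiv fun o => W (G.s (.inr o))).trans G.β

open Classical in
/-- A graph is recovered by gluing the two parts of a cut. -/
noncomputable def cutFlagIso :
    FlagIso ((high G hW WL ε).vcomp (low G hW WL ε)) G where
  onV := (sumComm _ _).trans (sumCompl W)
  onL := (sumComm _ _).trans (sumCompl WL)
  S := _
  T := _
  aS := (eS _ _).trans (.ofBijective _ (cutS_bijective G hW))
  bS := .refl _
  aT := (eT _ _).trans (.ofBijective _ (cutT_bijective G hW))
  bT := .refl _
  src := G.s
  tgt := G.t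
  aS_src x := by
    rw [comp_src, trans_apply]
    rcases eS _ _ x with y | y <;> rfl
  bS_src _ := rfl
  aT_tgt x := by
    rw [comp_tgt, trans_apply]
    rcases eT _ _ x with y | y <;> rfl
  bT_tgt _ := rfl
  hE := by
    rintro ((e | e) | ⟨⟨x | x, y | y⟩, h⟩)
    · exact ⟨e.1, rfl, rfl⟩
    · exact ⟨e.1, rfl, rfl⟩
    -- Glued edges have the same number under `ε`, so the two halves come from one edge of `G`;
    -- pairs of different kinds are excluded by injectivity.
    · have h := ε.injective h
      obtain rfl : x = y := Sum.inl_injective (Sum.inl_injective h)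
      exact ⟨x.1, rfl, rfl⟩
    all_goals cases ε.injective h
  hIn := by
    rintro (e | ⟨⟨x | x, y | y⟩, h⟩)
    · exact ⟨e.1, rfl, rfl⟩
    · cases ε.injective h
    · have h := ε.injective h
      obtain rfl : x = y := Sum.inl_injective (Sum.inr_injective h)
      exact ⟨x.1, rfl, rfl⟩
    all_goals cases ε.injective h
  hOut := by
    rintro (e | ⟨⟨x | x, y | y⟩, h⟩)
    · exact ⟨e.1, rfl, rfl⟩
    · cases ε.injective h
    · cases ε.injective h
    · have h := ε.injective h
      obtain rfl : x = y := Sum.inr_injective (Sum.inl_injective h)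
      exact ⟨x.1, rfl, rfl⟩
    all_goals cases ε.injective h
  hInOut := by
    rintro ⟨⟨x | x, y | y⟩, h⟩
    · cases ε.injective h
    · cases ε.injective h
    · cases ε.injective h
    · have h := ε.injective h
      obtain rfl : x = y := Sum.inr_injective (Sum.inr_injective h)
      exact ⟨x, rfl, rfl⟩

end Cut

end Graph

/-! ### Cutting a marked graph along a colouring. -/

namespace MarkedGraph

variable {D : Type u} {k l : ℕ}

/-- A colouring which does not decrease along the edges comes from a vertical decomposition. -/
theorem exists_cut (G : MarkedGraph (D × Bool) k l)
    (h : ∀ e, (G.dec (.inl (G.s (.inl e)))).2 = true → (G.dec (.inl (G.t (.inl e)))).2 = true) :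
    ∃ (m : ℕ) (A : MarkedGraph D m l) (B : MarkedGraph D k m),
      (A.map (·, true)).vcomp (B.map (·, false)) ≈ G := by
  obtain ⟨m, ⟨ε⟩⟩ := Finite.exists_equiv_fin
    (Graph.CutMid G.toGraph fun v => (G.dec (.inl v)).2 = true)
  let W : G.V → Prop := fun v => (G.dec (.inl v)).2 = true
  let A : MarkedGraph D m l :=
    { toGraph := G.toGraph.high h (fun x => (G.dec (.inr x)).2 = true) ε
      dec := Sum.elim (fun v => (G.dec (.inl v.1)).1) (fun v => (G.dec (.inr v.1)).1)
      rT := fun x y => G.rT (Graph.highT _ W x) (Graph.highT _ W y)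
      rS := fun x y => G.rS (Graph.highS _ W x) (Graph.highS _ W y)
      rT_fibre := fun H => Subtype.ext (G.rT_fibre H)
      rS_fibre := fun H => Subtype.ext (G.rS_fibre H) }
  let B : MarkedGraph D k m :=
    { toGraph := G.toGraph.low h (fun x => (G.dec (.inr x)).2 = true) ε
      dec := Sum.elim (fun v => (G.dec (.inl v.1)).1) (fun v => (G.dec (.inr v.1)).1)
      rT := fun x y => G.rT (Graph.lowT _ W x) (Graph.lowT _ W y)
      rS := fun x y => G.rS (Graph.lowS _ W x) (Graph.lowS _ W y)
      rT_fibre := fun H => Subtype.ext (G.rT_fibre H)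
      rS_fibre := fun H => Subtype.ext (G.rS_fibre H) }
  refine ⟨m, A, B, rel_of_flag (G.toGraph.cutFlagIso h (fun x => (G.dec (.inr x)).2 = true) ε)
    ?_ G.rT G.rS (fun x y => ?_) (fun _ _ => .rfl) (fun x y => ?_) (fun _ _ => .rfl)⟩
  · rintro ((⟨x, hx⟩ | ⟨x, hx⟩) | (⟨x, hx⟩ | ⟨x, hx⟩))
    exacts [Prod.ext rfl ((Bool.not_eq_true _).mp hx), Prod.ext rfl hx,
      Prod.ext rfl ((Bool.not_eq_true _).mp hx), Prod.ext rfl hx]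
  · change Sum.LiftRel B.rT A.rT (Graph.eT A.toGraph B.toGraph x) (Graph.eT A.toGraph B.toGraph y) ↔
      G.rT (Sum.elim (Graph.lowT _ W) (Graph.highT _ W) (Graph.eT A.toGraph B.toGraph x))
        (Sum.elim (Graph.lowT _ W) (Graph.highT _ W) (Graph.eT A.toGraph B.toGraph y))
    generalize Graph.eT A.toGraph B.toGraph x = x'
    generalize Graph.eT A.toGraph B.toGraph y = y'
    rcases x' with x' | x' <;> rcases y' with y' | y'
    · exact Sum.liftRel_inl_inl
    -- The relations of `G` only compare edges at one vertex, and a vertex lies in one part only. So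
    -- nothing is lost when they are restricted to the two parts.
    · refine iff_of_false (by simp) fun H => Graph.lowT_spec (W := W) G.toGraph x' ?_
      exact (congrArg W (G.rT_fibre H)).mpr (Graph.highT_spec (W := W) G.toGraph h y')
    · refine iff_of_false (by simp) fun H => Graph.lowT_spec (W := W) G.toGraph y' ?_
      exact (congrArg W (G.rT_fibre H)).mp (Graph.highT_spec (W := W) G.toGraph h x')
    · exact Sum.liftRel_inr_inr
  · change Sum.LiftRel B.rS A.rS (Graph.eS A.toGraph B.toGraph x) (Graph.eS A.toGraph B.toGraph y) ↔
      G.rS (Sum.elim (Graph.lowS _ W) (Graph.highS _ W) (Graph.eS A.toGraph B.toGraph x))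
        (Sum.elim (Graph.lowS _ W) (Graph.highS _ W) (Graph.eS A.toGraph B.toGraph y))
    generalize Graph.eS A.toGraph B.toGraph x = x'
    generalize Graph.eS A.toGraph B.toGraph y = y'
    rcases x' with x' | x' <;> rcases y' with y' | y'
    · exact Sum.liftRel_inl_inl
    · refine iff_of_false (by simp) fun H => Graph.lowS_spec (W := W) G.toGraph h x' ?_
      exact (congrArg W (G.rS_fibre H)).mpr (Graph.highS_spec (W := W) G.toGraph y')
    · refine iff_of_false (by simp) fun H => Graph.lowS_spec (W := W) G.toGraph h y' ?_
      exact (congrArg W (G.rS_fibre H)).mp (Graph.highS_spec (W := W) G.toGraph x')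
    · exact Sum.liftRel_inr_inr

end MarkedGraph

end GraphProP

namespace GraphProP

/-! ### Uniqueness of the parts of a cut -/

theorem exists_sumCongr {A B A' B' : Type} (e : A ⊕ B ≃ A' ⊕ B')
    (h : ∀ x, (e x).isLeft = x.isLeft) : ∃ (f : A ≃ A') (g : B ≃ B'), e = sumCongr f g := by
  have hl : ∀ a, ∃ a', e (.inl a) = .inl a' := fun a => by
    have := h (.inl a)
    revert this
    rcases e (.inl a) with x | x
    exacts [fun _ => ⟨x, rfl⟩, by simp]
  have hr : ∀ b, ∃ b', e (.inr b) = .inr b' := fun b => by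
    have := h (.inr b)
    revert this
    rcases e (.inr b) with x | x
    exacts [by simp, fun _ => ⟨x, rfl⟩]
  choose f hf using hl
  choose g hg using hr
  refine ⟨.ofBijective f ⟨fun a b hab => ?_, fun a' => ?_⟩,
    .ofBijective g ⟨fun a b hab => ?_, fun b' => ?_⟩, ?_⟩
  · exact Sum.inl_injective (e.injective (by rw [hf, hf, hab]))
  · obtain ⟨a | b, hx⟩ := e.surjective (.inl a')
    · exact ⟨a, Sum.inl_injective ((hf a).symm.trans hx)⟩
    · cases (hg b).symm.trans hx
  · exact Sum.inr_injective (e.injective (by rw [hg, hg, hab]))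
  · obtain ⟨a | b, hx⟩ := e.surjective (.inr b')
    · cases (hf a).symm.trans hx
    · exact ⟨b, Sum.inr_injective ((hg b).symm.trans hx)⟩
  · ext x
    rcases x with x | x
    exacts [hf x, hg x]

/-- Here `μ` and `μ'` are bijections from the elements where they are defined onto `M` and `M'`, and
`g` matches the domains of definition; the map is the conjugate of `g`. It is applied to edges and
to the numbers at which they are glued. -/
theorem exists_equiv_of_option {Z Z' M M' : Type} (μ : Z → Option M) (μ' : Z' → Option M')
    (inj : ∀ {z z' i}, μ z = some i → μ z' = some i → z = z') (surj : ∀ i, ∃ z, μ z = some i)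
    (inj' : ∀ {z z' i}, μ' z = some i → μ' z' = some i → z = z')
    (surj' : ∀ i, ∃ z, μ' z = some i) (g : Z ≃ Z') (h : ∀ z, μ z = none ↔ μ' (g z) = none) :
    ∃ π : M ≃ M', ∀ z i, μ z = some i → μ' (g z) = some (π i) := by
  choose z hz using surj
  have h' : ∀ i, ∃ j, μ' (g (z i)) = some j := fun i =>
    Option.ne_none_iff_exists'.1 fun H => by simpa [hz] using (h _).2 H
  choose p hp using h'
  have key : ∀ x i, μ x = some i → μ' (g x) = some (p i) := fun x i hx => by
    rw [inj hx (hz i), hp]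
  refine ⟨.ofBijective p ⟨fun i j hij => ?_, fun j => ?_⟩, key⟩
  · have := g.injective (inj' (hp i) (hij ▸ hp j))
    exact Option.some_injective _ ((hz i).symm.trans (this ▸ hz j))
  · obtain ⟨x, hx⟩ := surj' j
    obtain ⟨x, rfl⟩ := g.surjective x
    obtain ⟨i, hi⟩ : ∃ i, μ x = some i :=
      Option.ne_none_iff_exists'.1 fun H => by simpa [hx] using (h _).1 H
    exact ⟨i, Option.some_injective _ ((key x i hi).symm.trans hx)⟩

namespace Graph

variable {k l m m' : ℕ}

/-- The edges of a composite. -/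
abbrev VEdge (A : Graph m l) (B : Graph k m) : Type :=
  (VE A B ⊕ VIn A B) ⊕ (VOut A B ⊕ VInOut A B)

/-- The index at which an edge of a composite is glued, if there is one. -/
def glue (A : Graph m l) (B : Graph k m) : VEdge A B → Option (Fin m)
  | .inl (.inl (.inl _)) => none
  | .inl (.inl (.inr p)) => some (B.β (.inl p.1.1))
  | .inl (.inr (.inl _)) => none
  | .inl (.inr (.inr p)) => some (B.β (.inr p.1.1))
  | .inr (.inl (.inl _)) => none
  | .inr (.inl (.inr p)) => some (B.β (.inl p.1.1))
  | .inr (.inr p) => some (B.β (.inr p.1.1))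

/-- A gluing number determines the edge of `B` which ends there and the edge of `A` which begins
there, hence the glued edge. With `glue_surjective`, the numbers correspond exactly to the edges
which cross the cut. -/
theorem glue_injective (A : Graph m l) (B : Graph k m) {z z' : VEdge A B} {i : Fin m}
    (h : glue A B z = some i) (h' : glue A B z' = some i) : z = z' := by
  rcases z with ((z | ⟨⟨x, y⟩, hxy⟩) | (z | ⟨⟨x, y⟩, hxy⟩)) | ((z | ⟨⟨x, y⟩, hxy⟩) | ⟨⟨x, y⟩, hxy⟩) <;>
  rcases z' with ((z' | ⟨⟨x', y'⟩, hxy'⟩) | (z' | ⟨⟨x', y'⟩, hxy'⟩)) |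
    ((z' | ⟨⟨x', y'⟩, hxy'⟩) | ⟨⟨x', y'⟩, hxy'⟩) <;>
  simp only [glue, reduceCtorEq, Option.some.injEq] at h h' <;>
  have h1 := B.β.injective (h.trans h'.symm) <;>
  have h2 := A.α.injective (hxy.symm.trans ((h.trans h'.symm).trans hxy')) <;>
  cases h1 <;> cases h2 <;> rfl

theorem glue_surjective (A : Graph m l) (B : Graph k m) (i : Fin m) :
    ∃ z, glue A B z = some i := by
  rcases exists_below B i with ⟨x, rfl⟩ | ⟨x, rfl⟩
  · rcases exists_above A (B.β (.inl x)) with ⟨y, h⟩ | ⟨y, h⟩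
    · exact ⟨.inl (.inl (.inr ⟨(x, y), h.symm⟩)), rfl⟩
    · exact ⟨.inr (.inl (.inr ⟨(x, y), h.symm⟩)), rfl⟩
  · rcases exists_above A (B.β (.inr x)) with ⟨y, h⟩ | ⟨y, h⟩
    · exact ⟨.inl (.inr (.inr ⟨(x, y), h.symm⟩)), rfl⟩
    · exact ⟨.inr (.inr ⟨(x, y), h.symm⟩), rfl⟩

/-- An isomorphism of composites which respects the two factors, described by its effect on the
vertices, the starting points and the end points of the edges of the factors. -/
structure CutMatch (A : Graph m l) (B : Graph k m) (A' : Graph m' l) (B' : Graph k m') where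
  iso : Iso (A.vcomp B) (A'.vcomp B')
  vA : A.V ≃ A'.V
  vB : B.V ≃ B'.V
  lA : A.L ≃ A'.L
  lB : B.L ≃ B'.L
  sA : A.E ⊕ A.Out ≃ A'.E ⊕ A'.Out
  sB : B.E ⊕ B.Out ≃ B'.E ⊕ B'.Out
  tA : A.E ⊕ A.In ≃ A'.E ⊕ A'.In
  tB : B.E ⊕ B.In ≃ B'.E ⊕ B'.In
  iso_onV : iso.onV = sumCongr vB vA
  iso_onL : iso.onL = sumCongr lB lA
  iso_onS : ∀ x, eS A' B' (iso.onS x) = Sum.map sB sA (eS A B x)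
  iso_onT : ∀ x, eT A' B' (iso.onT x) = Sum.map tB tA (eT A B x)

theorem exists_cutMatch {A : Graph m l} {B : Graph k m} {A' : Graph m' l} {B' : Graph k m'}
    (f : Iso (A.vcomp B) (A'.vcomp B'))
    (hV : ∀ x : B.V ⊕ A.V, (show B'.V ⊕ A'.V from f.onV x).isLeft = x.isLeft)
    (hL : ∀ x : B.L ⊕ A.L, (show B'.L ⊕ A'.L from f.onL x).isLeft = x.isLeft) :
    ∃ M : CutMatch A B A' B', M.iso = f := by
  obtain ⟨vB, vA, ev⟩ := exists_sumCongr _ hV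
  obtain ⟨lB, lA, el⟩ := exists_sumCongr _ hL
  obtain ⟨sB, sA, es⟩ := exists_sumCongr ((eS A B).symm.trans (f.onS.trans (eS A' B'))) (by
    intro x
    obtain ⟨x, rfl⟩ := (eS A B).surjective x
    -- The side on which an edge starts is the side of its source. By `hV` the sides of vertices are
    -- preserved, hence so are those of the starts; the ends are treated in the same way below.
    have h := f.map_s x
    rw [comp_src, comp_src] at h
    have h' := hV (Sum.map B.s A.s (eS A B x))
    rw [trans_apply, trans_apply, symm_apply_apply]
    rw [Sum.isLeft_map] at h'
    rw [← h']
    refine Eq.trans ?_ (congrArg Sum.isLeft h)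
    rw [Sum.isLeft_map]
    rfl)
  obtain ⟨tB, tA, et⟩ := exists_sumCongr ((eT A B).symm.trans (f.onT.trans (eT A' B'))) (by
    intro x
    obtain ⟨x, rfl⟩ := (eT A B).surjective x
    have h := f.map_t x
    rw [comp_tgt, comp_tgt] at h
    have h' := hV (Sum.map B.t A.t (eT A B x))
    rw [trans_apply, trans_apply, symm_apply_apply]
    rw [Sum.isLeft_map] at h'
    rw [← h']
    refine Eq.trans ?_ (congrArg Sum.isLeft h)
    rw [Sum.isLeft_map]
    rfl)
  refine ⟨⟨f, vA, vB, lA, lB, sA, sB, tA, tB, ev, el, fun x => ?_, fun x => ?_⟩, rfl⟩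
  · simpa using DFunLike.congr_fun es (eS A B x)
  · simpa using DFunLike.congr_fun et (eT A B x)

namespace CutMatch

variable {A : Graph m l} {B : Graph k m} {A' : Graph m' l} {B' : Graph k m'}
  (M : CutMatch A B A' B')

theorem map_s (y : (B.E ⊕ B.Out) ⊕ (A.E ⊕ A.Out)) :
    Sum.map B'.s A'.s (Sum.map M.sB M.sA y) = Sum.map M.vB M.vA (Sum.map B.s A.s y) := by
  obtain ⟨x, rfl⟩ := (eS A B).surjective y
  rw [← M.iso_onS]
  refine (M.iso.map_s x).trans ?_
  rw [M.iso_onV]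
  rfl

theorem map_t (y : (B.E ⊕ B.In) ⊕ (A.E ⊕ A.In)) :
    Sum.map B'.t A'.t (Sum.map M.tB M.tA y) = Sum.map M.vB M.vA (Sum.map B.t A.t y) := by
  obtain ⟨x, rfl⟩ := (eT A B).surjective y
  rw [← M.iso_onT]
  refine (M.iso.map_t x).trans ?_
  rw [M.iso_onV]
  rfl

/-- The effect of the isomorphism on the edges. -/
def onEdge : VEdge A B ≃ VEdge A' B' :=
  sumCongr (sumCongr M.iso.onE M.iso.onIn) (sumCongr M.iso.onOut M.iso.onInOut)

/-- The kind of an edge of a composite is visible from the sides of its start and of its end: low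
and low, high and high, or low and high for a glued edge. Since `M` preserves sides, it preserves
kinds; this is the content of this lemma and of the six which follow. -/
theorem onE_low (e : B.E) : ∃ e', M.iso.onE (.inl (.inl e)) = .inl (.inl e') ∧
    M.sB (.inl e) = .inl e' ∧ M.tB (.inl e) = .inl e' := by
  have hs := M.iso_onS (.inl (.inl (.inl e)))
  have ht := M.iso_onT (.inl (.inl (.inl e)))
  change vS A' B' (.inl (M.iso.onE (.inl (.inl e)))) = .inl (M.sB (.inl e)) at hs
  change vT A' B' (.inl (M.iso.onE (.inl (.inl e)))) = .inl (M.tB (.inl e)) at ht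
  revert hs ht
  rcases M.iso.onE (.inl (.inl e)) with (e' | e') | p <;> intro hs ht
  · exact ⟨e', rfl, (Sum.inl_injective hs).symm, (Sum.inl_injective ht).symm⟩
  · cases hs
  · cases ht

theorem onE_high (e : A.E) : ∃ e', M.iso.onE (.inl (.inr e)) = .inl (.inr e') ∧
    M.sA (.inl e) = .inl e' ∧ M.tA (.inl e) = .inl e' := by
  have hs := M.iso_onS (.inl (.inl (.inr e)))
  have ht := M.iso_onT (.inl (.inl (.inr e)))
  change vS A' B' (.inl (M.iso.onE (.inl (.inr e)))) = .inr (M.sA (.inl e)) at hs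
  change vT A' B' (.inl (M.iso.onE (.inl (.inr e)))) = .inr (M.tA (.inl e)) at ht
  revert hs ht
  rcases M.iso.onE (.inl (.inr e)) with (e' | e') | p <;> intro hs ht
  · cases hs
  · exact ⟨e', rfl, (Sum.inr_injective hs).symm, (Sum.inr_injective ht).symm⟩
  · cases hs

theorem onE_glue (p) : ∃ p', M.iso.onE (.inr p) = .inr p' ∧
    M.sB (.inr p.1.1) = .inr p'.1.1 ∧ M.tA (.inr p.1.2) = .inr p'.1.2 := by
  have hs := M.iso_onS (.inl (.inr p))
  have ht := M.iso_onT (.inl (.inr p))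
  change vS A' B' (.inl (M.iso.onE (.inr p))) = .inl (M.sB (.inr p.1.1)) at hs
  change vT A' B' (.inl (M.iso.onE (.inr p))) = .inr (M.tA (.inr p.1.2)) at ht
  revert hs ht
  rcases M.iso.onE (.inr p) with (e' | e') | p' <;> intro hs ht
  · cases ht
  · cases hs
  · exact ⟨p', rfl, (Sum.inl_injective hs).symm, (Sum.inr_injective ht).symm⟩

theorem onIn_low (e : B.In) : ∃ e', M.iso.onIn (.inl e) = .inl e' ∧ M.tB (.inr e) = .inr e' := by
  have ht := M.iso_onT (.inr (.inl e))
  change vT A' B' (.inr (M.iso.onIn (.inl e))) = .inl (M.tB (.inr e)) at ht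
  revert ht
  rcases M.iso.onIn (.inl e) with e' | p <;> intro ht
  · exact ⟨e', rfl, (Sum.inl_injective ht).symm⟩
  · cases ht

theorem onIn_glue (p) : ∃ p', M.iso.onIn (.inr p) = .inr p' ∧
    M.tA (.inr p.1.2) = .inr p'.1.2 := by
  have ht := M.iso_onT (.inr (.inr p))
  change vT A' B' (.inr (M.iso.onIn (.inr p))) = .inr (M.tA (.inr p.1.2)) at ht
  revert ht
  rcases M.iso.onIn (.inr p) with e' | p' <;> intro ht
  · cases ht
  · exact ⟨p', rfl, (Sum.inr_injective ht).symm⟩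

theorem onOut_high (o : A.Out) : ∃ o', M.iso.onOut (.inl o) = .inl o' ∧
    M.sA (.inr o) = .inr o' := by
  have hs := M.iso_onS (.inr (.inl o))
  change vS A' B' (.inr (M.iso.onOut (.inl o))) = .inr (M.sA (.inr o)) at hs
  revert hs
  rcases M.iso.onOut (.inl o) with e' | p <;> intro hs
  · exact ⟨e', rfl, (Sum.inr_injective hs).symm⟩
  · cases hs

theorem onOut_glue (p) : ∃ p', M.iso.onOut (.inr p) = .inr p' ∧
    M.sB (.inr p.1.1) = .inr p'.1.1 := by
  have hs := M.iso_onS (.inr (.inr p))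
  change vS A' B' (.inr (M.iso.onOut (.inr p))) = .inl (M.sB (.inr p.1.1)) at hs
  revert hs
  rcases M.iso.onOut (.inr p) with e' | p' <;> intro hs
  · cases hs
  · exact ⟨p', rfl, (Sum.inl_injective hs).symm⟩

theorem onEdge_onE {e e'} (h : M.iso.onE e = e') : M.onEdge (.inl (.inl e)) = .inl (.inl e') :=
  congrArg (fun x => Sum.inl (Sum.inl x)) h

theorem onEdge_onIn {e e'} (h : M.iso.onIn e = e') : M.onEdge (.inl (.inr e)) = .inl (.inr e') :=
  congrArg (fun x => Sum.inl (Sum.inr x)) h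

theorem onEdge_onOut {e e'} (h : M.iso.onOut e = e') : M.onEdge (.inr (.inl e)) = .inr (.inl e') :=
  congrArg (fun x => Sum.inr (Sum.inl x)) h

theorem glue_eq_none_iff (z : VEdge A B) :
    glue A B z = none ↔ glue A' B' (M.onEdge z) = none := by
  rcases z with (((e | e) | p) | (i | p)) | ((o | p) | p)
  · obtain ⟨e', h, -⟩ := M.onE_low e
    simp [M.onEdge_onE h, glue]
  · obtain ⟨e', h, -⟩ := M.onE_high e
    simp [M.onEdge_onE h, glue]
  · obtain ⟨e', h, -⟩ := M.onE_glue p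
    simp [M.onEdge_onE h, glue]
  · obtain ⟨e', h, -⟩ := M.onIn_low i
    simp [M.onEdge_onIn h, glue]
  · obtain ⟨e', h, -⟩ := M.onIn_glue p
    simp [M.onEdge_onIn h, glue]
  · obtain ⟨e', h, -⟩ := M.onOut_high o
    simp [M.onEdge_onOut h, glue]
  · obtain ⟨e', h, -⟩ := M.onOut_glue p
    simp [M.onEdge_onOut h, glue]
  -- An input-output edge of a composite always passes through the gluing, on both sides of the
  -- isomorphism.
  · exact iff_of_false (fun h => by cases h) (fun h => by cases h)

/-- The permutation of the gluing indices which corresponds to the isomorphism. -/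
theorem exists_perm : ∃ π : Fin m ≃ Fin m', ∀ z i, glue A B z = some i →
    glue A' B' (M.onEdge z) = some (π i) :=
  exists_equiv_of_option _ _ (glue_injective A B) (glue_surjective A B) (glue_injective A' B')
    (glue_surjective A' B') M.onEdge M.glue_eq_none_iff

variable {π : Fin m ≃ Fin m'}

theorem glue_onE (hπ : ∀ z i, glue A B z = some i → glue A' B' (M.onEdge z) = some (π i))
    {p p'} (h : M.iso.onE (.inr p) = .inr p') : B'.β (.inl p'.1.1) = π (B.β (.inl p.1.1)) := by
  have := hπ (.inl (.inl (.inr p))) _ rfl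
  rw [M.onEdge_onE h] at this
  exact Option.some_injective _ this

theorem glue_onIn (hπ : ∀ z i, glue A B z = some i → glue A' B' (M.onEdge z) = some (π i))
    {p p'} (h : M.iso.onIn (.inr p) = .inr p') : B'.β (.inr p'.1.1) = π (B.β (.inr p.1.1)) := by
  have := hπ (.inl (.inr (.inr p))) _ rfl
  rw [M.onEdge_onIn h] at this
  exact Option.some_injective _ this

theorem glue_onOut (hπ : ∀ z i, glue A B z = some i → glue A' B' (M.onEdge z) = some (π i))
    {p p'} (h : M.iso.onOut (.inr p) = .inr p') : B'.β (.inl p'.1.1) = π (B.β (.inl p.1.1)) := by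
  have := hπ (.inr (.inl (.inr p))) _ rfl
  rw [M.onEdge_onOut h] at this
  exact Option.some_injective _ this

theorem glue_onInOut (hπ : ∀ z i, glue A B z = some i → glue A' B' (M.onEdge z) = some (π i))
    (p) : B'.β (.inr (M.iso.onInOut p).1.1) = π (B.β (.inr p.1.1)) := by
  exact Option.some_injective _ (hπ (.inr (.inr p)) _ rfl)

variable (hπ : ∀ z i, glue A B z = some i → glue A' B' (M.onEdge z) = some (π i))

/-- The isomorphism between the lower factors. -/
def lowFlagIso : FlagIso (B.reindex (.refl _) π) B' where
  onV := M.vB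
  onL := M.lB
  S := _
  T := _
  aS := M.sB
  bS := .refl _
  aT := M.tB
  bT := .refl _
  src := B'.s
  tgt := B'.t
  aS_src x := (Sum.inl_injective (M.map_s (.inl x))).symm
  bS_src _ := rfl
  aT_tgt x := (Sum.inl_injective (M.map_t (.inl x))).symm
  bT_tgt _ := rfl
  hE e := by
    obtain ⟨e', -, h, h'⟩ := M.onE_low e
    exact ⟨e', h.symm, h'.symm⟩
  hIn e := by
    obtain ⟨e', h, h'⟩ := M.onIn_low e
    refine ⟨e', h'.symm, ?_⟩
    -- The inputs of the lower factor are inputs of the composite, so their numbers are respected by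
    -- the isomorphism itself. Only the outputs involve `π`.
    exact (congrArg (fun x => (A'.vcomp B').α (.inl x)) h).symm.trans
      (M.iso.map_α (.inl (.inl e)))
  hOut e := by
    -- An output of `B` is part of an internal edge or of an output edge of the composite, according
    -- to what `A` glues to it. In both cases the image of that edge gives the output of `B'`.
    rcases exists_above A (B.β (.inl e)) with ⟨y, hy⟩ | ⟨y, hy⟩
    · obtain ⟨p', h, h', -⟩ := M.onE_glue ⟨(e, y), hy.symm⟩
      exact ⟨p'.1.1, h'.symm, M.glue_onE hπ h⟩
    · obtain ⟨p', h, h'⟩ := M.onOut_glue ⟨(e, y), hy.symm⟩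
      exact ⟨p'.1.1, h'.symm, M.glue_onOut hπ h⟩
  hInOut e := by
    rcases exists_above A (B.β (.inr e)) with ⟨y, hy⟩ | ⟨y, hy⟩
    · obtain ⟨p', h, -⟩ := M.onIn_glue ⟨(e, y), hy.symm⟩
      refine ⟨p'.1.1, ?_, M.glue_onIn hπ h⟩
      exact (congrArg (fun x => (A'.vcomp B').α (.inl x)) h).symm.trans
        (M.iso.map_α (.inl (.inr ⟨(e, y), hy.symm⟩)))
    · exact ⟨_, M.iso.map_α (.inr ⟨(e, y), hy.symm⟩), M.glue_onInOut hπ ⟨(e, y), hy.symm⟩⟩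

/-- The isomorphism between the upper factors. -/
def highFlagIso : FlagIso (A.reindex π (.refl _)) A' where
  onV := M.vA
  onL := M.lA
  S := _
  T := _
  aS := M.sA
  bS := .refl _
  aT := M.tA
  bT := .refl _
  src := A'.s
  tgt := A'.t
  aS_src x := (Sum.inr_injective (M.map_s (.inr x))).symm
  bS_src _ := rfl
  aT_tgt x := (Sum.inr_injective (M.map_t (.inr x))).symm
  bT_tgt _ := rfl
  hE e := by
    obtain ⟨e', -, h, h'⟩ := M.onE_high e
    exact ⟨e', h.symm, h'.symm⟩
  hOut e := by
    obtain ⟨e', h, h'⟩ := M.onOut_high e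
    refine ⟨e', h'.symm, ?_⟩
    exact (congrArg (fun x => (A'.vcomp B').β (.inl x)) h).symm.trans
      (M.iso.map_β (.inl (.inl e)))
  hIn e := by
    rcases exists_below B (A.α (.inl e)) with ⟨x, hx⟩ | ⟨x, hx⟩
    · obtain ⟨p', h, -, h'⟩ := M.onE_glue ⟨(x, e), hx⟩
      exact ⟨p'.1.2, h'.symm, p'.2.symm.trans ((M.glue_onE hπ h).trans (congrArg π hx))⟩
    · obtain ⟨p', h, h'⟩ := M.onIn_glue ⟨(x, e), hx⟩
      exact ⟨p'.1.2, h'.symm, p'.2.symm.trans ((M.glue_onIn hπ h).trans (congrArg π hx))⟩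
  hInOut e := by
    rcases exists_below B (A.α (.inr e)) with ⟨x, hx⟩ | ⟨x, hx⟩
    · obtain ⟨p', h, -⟩ := M.onOut_glue ⟨(x, e), hx⟩
      refine ⟨p'.1.2, p'.2.symm.trans ((M.glue_onOut hπ h).trans (congrArg π hx)), ?_⟩
      exact (congrArg (fun x => (A'.vcomp B').β (.inl x)) h).symm.trans
        (M.iso.map_β (.inl (.inr ⟨(x, e), hx⟩)))
    · exact ⟨_, (M.iso.onInOut ⟨(x, e), hx⟩).2.symm.trans
        ((M.glue_onInOut hπ ⟨(x, e), hx⟩).trans (congrArg π hx)),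
        M.iso.map_β (.inr ⟨(x, e), hx⟩)⟩

end CutMatch

end Graph

/-! ### The colouring determines the cut up to a permutation. -/

namespace MarkedGraph

variable {D : Type u} {k l m m' : ℕ}

theorem reindex_eq_ract (G : MarkedGraph D k l) (π : Perm (Fin k)) :
    G.reindex π (.refl _) = G.ract π⁻¹ := by
  unfold ract Graph.ract reindex
  rw [inv_inv]

/-- The Boolean in a mark records the factor from which the vertex or loop comes, so a bijection
which respects the marks respects the factors. This is why loops carry marks as well. -/
theorem isLeft_eq_of_dec {V L V' L' W M W' M' : Type} {d : V ⊕ L → D} {e : V' ⊕ L' → D}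
    {d' : W ⊕ M → D} {e' : W' ⊕ M' → D} (f : V ⊕ V' → W ⊕ W') (g : L ⊕ L' → M ⊕ M')
    (h : ∀ x, Sum.elim (fun x => (d' x, false)) (fun x => (e' x, true))
        (sumSumSumComm W W' M M' (Sum.map f g x)) =
      Sum.elim (fun x => (d x, false)) (fun x => (e x, true)) (sumSumSumComm V V' L L' x)) :
    (∀ x, (f x).isLeft = x.isLeft) ∧ ∀ x, (g x).isLeft = x.isLeft := by
  constructor
  · intro x
    have := congrArg Prod.snd (h (.inl x))
    revert this
    rw [Sum.map_inl]
    rcases x with x | x <;> rcases f _ with y | y <;> simp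
  · intro x
    have := congrArg Prod.snd (h (.inr x))
    revert this
    rw [Sum.map_inr]
    rcases x with x | x <;> rcases g _ with y | y <;> simp

/-- Two vertical decompositions with the same colouring differ by a permutation of the indices at
which the factors are glued. -/
theorem cut_unique {A : MarkedGraph D m l} {B : MarkedGraph D k m} {A' : MarkedGraph D m' l}
    {B' : MarkedGraph D k m'}
    (h : (A.map (·, true)).vcomp (B.map (·, false)) ≈
      (A'.map (·, true)).vcomp (B'.map (·, false))) :
    ∃ π : Fin m ≃ Fin m', A.reindex π (.refl _) ≈ A' ∧ B.reindex (.refl _) π ≈ B' := by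
  obtain ⟨f, hf⟩ := h
  have hside := isLeft_eq_of_dec (d := B.dec) (d' := B'.dec) (e := A.dec) (e' := A'.dec)
    f.onV f.onL hf.dec
  obtain ⟨M, rfl⟩ := Graph.exists_cutMatch (A := A.toGraph) (B := B.toGraph) (A' := A'.toGraph)
    (B' := B'.toGraph) f hside.1 hside.2
  obtain ⟨π, hπ⟩ := M.exists_perm
  -- Each end of an edge of a factor is an end of an edge of the composite, so the relations can be
  -- compared there, where `hf` applies. The same holds for the starts.
  have hT : ∀ x y, Sum.LiftRel B'.rT A'.rT (Sum.map M.tB M.tA x) (Sum.map M.tB M.tA y) ↔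
      Sum.LiftRel B.rT A.rT x y := by
    intro x y
    obtain ⟨x, rfl⟩ := (Graph.eT A.toGraph B.toGraph).surjective x
    obtain ⟨y, rfl⟩ := (Graph.eT A.toGraph B.toGraph).surjective y
    rw [← M.iso_onT, ← M.iso_onT]
    exact hf.rT x y
  have hS : ∀ x y, Sum.LiftRel B'.rS A'.rS (Sum.map M.sB M.sA x) (Sum.map M.sB M.sA y) ↔
      Sum.LiftRel B.rS A.rS x y := by
    intro x y
    obtain ⟨x, rfl⟩ := (Graph.eS A.toGraph B.toGraph).surjective x
    obtain ⟨y, rfl⟩ := (Graph.eS A.toGraph B.toGraph).surjective y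
    rw [← M.iso_onS, ← M.iso_onS]
    exact hf.rS x y
  have hdec : ∀ x, Sum.elim (fun x => (B'.dec x, false)) (fun x => (A'.dec x, true))
        (sumSumSumComm _ _ _ _ (Sum.map (sumCongr M.vB M.vA) (sumCongr M.lB M.lA) x)) =
      Sum.elim (fun x => (B.dec x, false)) (fun x => (A.dec x, true))
        (sumSumSumComm _ _ _ _ x) := by
    rw [← M.iso_onV, ← M.iso_onL]
    exact hf.dec
  refine ⟨π, rel_of_flag (M.highFlagIso hπ) ?_ A'.rT A'.rS
    (fun x y => ?_) (fun _ _ => .rfl) (fun x y => ?_) (fun _ _ => .rfl),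
    rel_of_flag (M.lowFlagIso hπ) ?_ B'.rT B'.rS
    (fun x y => ?_) (fun _ _ => .rfl) (fun x y => ?_) (fun _ _ => .rfl)⟩
  · rintro (x | x)
    exacts [congrArg Prod.fst (hdec (.inl (.inr x))), congrArg Prod.fst (hdec (.inr (.inr x)))]
  · exact Sum.liftRel_inr_inr.symm.trans ((hT (.inr x) (.inr y)).symm.trans Sum.liftRel_inr_inr)
  · exact Sum.liftRel_inr_inr.symm.trans ((hS (.inr x) (.inr y)).symm.trans Sum.liftRel_inr_inr)
  · rintro (x | x)
    exacts [congrArg Prod.fst (hdec (.inl (.inl x))), congrArg Prod.fst (hdec (.inr (.inl x)))]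
  · exact Sum.liftRel_inl_inl.symm.trans ((hT (.inl x) (.inl y)).symm.trans Sum.liftRel_inl_inl)
  · exact Sum.liftRel_inl_inl.symm.trans ((hS (.inl x) (.inl y)).symm.trans Sum.liftRel_inl_inl)

/-- Two vertical decompositions with the same colouring differ by a permutation of the indices at
which the factors are glued. -/
theorem Class.cut_unique {a : (markedGraphs D).obj m l} {b : (markedGraphs D).obj k m}
    {a' : (markedGraphs D).obj m' l} {b' : (markedGraphs D).obj k m'}
    (h : (markedGraphs (D × Bool)).vcomp (map (·, true) a) (map (·, false) b) =
      (markedGraphs (D × Bool)).vcomp (map (·, true) a') (map (·, false) b')) :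
    ∃ (hm : m = m') (π : Perm (Fin m')),
      a' = (markedGraphs D).ract π⁻¹ (recast (markedGraphs D).obj hm rfl a) ∧
      b' = (markedGraphs D).lact π (recast (markedGraphs D).obj rfl hm b) := by
  obtain ⟨A, rfl⟩ := mk_surjective a
  obtain ⟨B, rfl⟩ := mk_surjective b
  obtain ⟨A', rfl⟩ := mk_surjective a'
  obtain ⟨B', rfl⟩ := mk_surjective b'
  obtain ⟨π, hA, hB⟩ := MarkedGraph.cut_unique (mk_eq_iff.1 h)
  -- The number of edges which are cut depends only on the coloured graph.
  obtain rfl : m = m' := by simpa using Fintype.card_congr π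
  refine ⟨rfl, π, ?_, ?_⟩
  · rw [recast_rfl, mk_ract, ← reindex_eq_ract]
    exact (mk_eq_iff.2 hA).symm
  · exact (mk_eq_iff.2 hB).symm

/-- A colouring which does not decrease along the edges comes from a vertical decomposition. -/
theorem Class.exists_cut {x : (markedGraphs (D × Bool)).obj k l}
    (h : StepRel (fun d d' => d.2 = true → d'.2 = true) x) :
    ∃ (m : ℕ) (a : (markedGraphs D).obj m l) (b : (markedGraphs D).obj k m),
      x = (markedGraphs (D × Bool)).vcomp (map (·, true) a) (map (·, false) b) := by
  obtain ⟨G, rfl⟩ := mk_surjective x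
  obtain ⟨m, A, B, hAB⟩ := MarkedGraph.exists_cut G h
  exact ⟨m, mk A, mk B, (mk_eq_iff.2 hAB).symm⟩

end MarkedGraph

end GraphProP

namespace GraphProP

/-! ### Horizontal decompositions -/

theorem isLeft_apply_of_isEmpty_right {A B A' B' : Type} [IsEmpty B] [IsEmpty B']
    (e : A ⊕ B ≃ A' ⊕ B') (x) : (e x).isLeft = x.isLeft := by
  rcases x with x | x
  · rcases e (.inl x) with y | y
    exacts [rfl, isEmptyElim y]
  · exact isEmptyElim x

theorem isLeft_apply_of_isEmpty_left {A B A' B' : Type} [IsEmpty A] [IsEmpty A']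
    (e : A ⊕ B ≃ A' ⊕ B') (x) : (e x).isLeft = x.isLeft := by
  rcases x with x | x
  · exact isEmptyElim x
  · rcases e (.inr x) with y | y
    exacts [isEmptyElim y, rfl]

namespace Graph

variable {k l k₁ l₁ k₂ l₂ : ℕ} (G : Graph k l)

def resS (W : G.V → Prop) : {e // W (G.s (.inl e))} ⊕ {o // W (G.s (.inr o))} → G.E ⊕ G.Out
  | .inl e => .inl e.1
  | .inr o => .inr o.1

/-- The internal edges are selected by their sources here too, so that starts and ends refer to the
same type of edges. The selection by targets would agree, because no edge leaves the part. -/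
def resT (W : G.V → Prop) : {e // W (G.s (.inl e))} ⊕ {i // W (G.t (.inr i))} → G.E ⊕ G.In
  | .inl e => .inl e.1
  | .inr i => .inr i.1

theorem resS_spec (W : G.V → Prop) (x) : W (G.s (resS G W x)) := by
  rcases x with e | o
  exacts [e.2, o.2]

theorem resT_spec {W : G.V → Prop} (hW : ∀ e, W (G.s (.inl e)) ↔ W (G.t (.inl e))) (x) :
    W (G.t (resT G W x)) := by
  rcases x with e | o
  exacts [(hW _).1 e.2, o.2]

theorem elim_resS_bijective (W : G.V → Prop) :
    Bijective (Sum.elim (resS G W) (resS G fun v => ¬ W v)) := by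
  constructor
  · rintro ((⟨e, h⟩ | ⟨e, h⟩) | (⟨e, h⟩ | ⟨e, h⟩)) ((⟨e', h'⟩ | ⟨e', h'⟩) | (⟨e', h'⟩ | ⟨e', h'⟩)) H
    all_goals cases H
    all_goals first | rfl | exact absurd h' h | exact absurd h h'
  · rintro (e | e)
    · by_cases h : W (G.s (.inl e))
      exacts [⟨.inl (.inl ⟨e, h⟩), rfl⟩, ⟨.inr (.inl ⟨e, h⟩), rfl⟩]
    · by_cases h : W (G.s (.inr e))
      exacts [⟨.inl (.inr ⟨e, h⟩), rfl⟩, ⟨.inr (.inr ⟨e, h⟩), rfl⟩]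

theorem elim_resT_bijective (W : G.V → Prop) :
    Bijective (Sum.elim (resT G W) (resT G fun v => ¬ W v)) := by
  constructor
  · rintro ((⟨e, h⟩ | ⟨e, h⟩) | (⟨e, h⟩ | ⟨e, h⟩)) ((⟨e', h'⟩ | ⟨e', h'⟩) | (⟨e', h'⟩ | ⟨e', h'⟩)) H
    all_goals cases H
    all_goals first | rfl | exact absurd h' h | exact absurd h h'
  · rintro (e | e)
    · by_cases h : W (G.s (.inl e))
      exacts [⟨.inl (.inl ⟨e, h⟩), rfl⟩, ⟨.inr (.inl ⟨e, h⟩), rfl⟩]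
    · by_cases h : W (G.t (.inr e))
      exacts [⟨.inl (.inr ⟨e, h⟩), rfl⟩, ⟨.inr (.inr ⟨e, h⟩), rfl⟩]

/-- The subgraph of the vertices, the input-output edges and the loops with a given property. -/
def restrict (W : G.V → Prop) (WI : G.InOut → Prop) (WL : G.L → Prop)
    (hW : ∀ e, W (G.s (.inl e)) ↔ W (G.t (.inl e)))
    (a : {i // W (G.t (.inr i))} ⊕ {x // WI x} ≃ Fin k₁)
    (b : {o // W (G.s (.inr o))} ⊕ {x // WI x} ≃ Fin l₁) : Graph k₁ l₁ where
  V := {v // W v}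
  E := {e // W (G.s (.inl e))}
  In := {i // W (G.t (.inr i))}
  Out := {o // W (G.s (.inr o))}
  InOut := {x // WI x}
  L := {x // WL x}
  s x := ⟨G.s (resS G W x), resS_spec G W x⟩
  t x := ⟨G.t (resT G W x), resT_spec G hW x⟩
  α := a
  β := b

open Classical in
/-- The reindexation of the inputs or of the outputs of a graph which is split in two parts. -/
noncomputable def splitIndex {A B : Type} {p : A → Prop} {q : B → Prop}
    (a₁ : {x // p x} ⊕ {x // q x} ≃ Fin k₁) (a₂ : {x // ¬ p x} ⊕ {x // ¬ q x} ≃ Fin k₂)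
    (c : A ⊕ B ≃ Fin k) : Fin (k₁ + k₂) ≃ Fin k :=
  finSumFinEquiv.symm.trans ((sumCongr a₁.symm a₂.symm).trans
    ((sumSumSumComm _ _ _ _).trans ((sumCongr (sumCompl p) (sumCompl q)).trans c)))

theorem splitIndex_inl {A B : Type} {p : A → Prop} {q : B → Prop}
    (a₁ : {x // p x} ⊕ {x // q x} ≃ Fin k₁) (a₂ : {x // ¬ p x} ⊕ {x // ¬ q x} ≃ Fin k₂)
    (c : A ⊕ B ≃ Fin k) (x) :
    splitIndex a₁ a₂ c (finSumFinEquiv (.inl (a₁ x))) = c (Sum.map (↑) (↑) x) := by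
  rcases x with x | x <;> simp [splitIndex, -finSumFinEquiv_apply_left]

theorem splitIndex_inr {A B : Type} {p : A → Prop} {q : B → Prop}
    (a₁ : {x // p x} ⊕ {x // q x} ≃ Fin k₁) (a₂ : {x // ¬ p x} ⊕ {x // ¬ q x} ≃ Fin k₂)
    (c : A ⊕ B ≃ Fin k) (x) :
    splitIndex a₁ a₂ c (finSumFinEquiv (.inr (a₂ x))) = c (Sum.map (↑) (↑) x) := by
  rcases x with x | x <;> simp [splitIndex, -finSumFinEquiv_apply_right]

open Classical in
/-- A graph is recovered by the disjoint union of the two parts of a splitting. -/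
noncomputable def splitFlagIso (W : G.V → Prop) (WI : G.InOut → Prop) (WL : G.L → Prop)
    (hW : ∀ e, W (G.s (.inl e)) ↔ W (G.t (.inl e)))
    (hW' : ∀ e, ¬ W (G.s (.inl e)) ↔ ¬ W (G.t (.inl e)))
    (a₁ : {i // W (G.t (.inr i))} ⊕ {x // WI x} ≃ Fin k₁)
    (b₁ : {o // W (G.s (.inr o))} ⊕ {x // WI x} ≃ Fin l₁)
    (a₂ : {i // ¬ W (G.t (.inr i))} ⊕ {x // ¬ WI x} ≃ Fin k₂)
    (b₂ : {o // ¬ W (G.s (.inr o))} ⊕ {x // ¬ WI x} ≃ Fin l₂) :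
    FlagIso (((G.restrict W WI WL hW a₁ b₁).hcomp
      (G.restrict (fun v => ¬ W v) (fun v => ¬ WI v) (fun v => ¬ WL v) hW' a₂ b₂)).reindex
        (splitIndex a₁ a₂ G.α) (splitIndex b₁ b₂ G.β)) G where
  onV := sumCompl W
  onL := sumCompl WL
  S := _
  T := _
  aS := (hS _ _).trans (.ofBijective _ (elim_resS_bijective G W))
  bS := .refl _
  aT := (hT _ _).trans (.ofBijective _ (elim_resT_bijective G W))
  bT := .refl _
  src := G.s
  tgt := G.t
  aS_src := by rintro ((e | e) | (e | e)) <;> rfl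
  bS_src _ := rfl
  aT_tgt := by rintro ((e | e) | (e | e)) <;> rfl
  bT_tgt _ := rfl
  hE := by
    rintro (e | e)
    exacts [⟨e.1, rfl, rfl⟩, ⟨e.1, rfl, rfl⟩]
  hIn := by
    rintro (e | e)
    exacts [⟨e.1, rfl, (splitIndex_inl a₁ a₂ G.α (.inl e)).symm⟩,
      ⟨e.1, rfl, (splitIndex_inr a₁ a₂ G.α (.inl e)).symm⟩]
  hOut := by
    rintro (e | e)
    exacts [⟨e.1, rfl, (splitIndex_inl b₁ b₂ G.β (.inl e)).symm⟩,
      ⟨e.1, rfl, (splitIndex_inr b₁ b₂ G.β (.inl e)).symm⟩]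
  hInOut := by
    rintro (e | e)
    exacts [⟨e.1, (splitIndex_inl a₁ a₂ G.α (.inr e)).symm,
      (splitIndex_inl b₁ b₂ G.β (.inr e)).symm⟩, ⟨e.1, (splitIndex_inr a₁ a₂ G.α (.inr e)).symm,
      (splitIndex_inr b₁ b₂ G.β (.inr e)).symm⟩]

end Graph

/-! ### Splitting a marked graph, and uniqueness of the part without strands. -/

namespace MarkedGraph

variable {D : Type u} {k l p q p' q' n n' : ℕ}

/-- A colouring which is constant along the edges comes from a horizontal decomposition. -/
theorem exists_split (G : MarkedGraph (D × Bool) k l)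
    (h : ∀ e, (G.dec (.inl (G.s (.inl e)))).2 = (G.dec (.inl (G.t (.inl e)))).2) :
    ∃ (k₁ l₁ k₂ l₂ : ℕ) (A : MarkedGraph D k₁ l₁) (B : MarkedGraph D k₂ l₂)
      (a : Fin (k₁ + k₂) ≃ Fin k) (b : Fin (l₁ + l₂) ≃ Fin l), IsEmpty A.InOut ∧
      ((A.map (·, true)).hcomp (B.map (·, false))).reindex a b ≈ G := by
  let W : G.V → Prop := fun v => (G.dec (.inl v)).2 = true
  let WL : G.L → Prop := fun x => (G.dec (.inr x)).2 = true
  -- All the input-output edges are sent to the second part. The first part then has none, as an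
  -- indecomposable graph must.
  let WI : G.InOut → Prop := fun _ => False
  have hW : ∀ e, W (G.s (.inl e)) ↔ W (G.t (.inl e)) := fun e => by simp only [W, h]
  have hW' : ∀ e, ¬ W (G.s (.inl e)) ↔ ¬ W (G.t (.inl e)) := fun e => by simp only [W, h]
  obtain ⟨k₁, ⟨a₁⟩⟩ := Finite.exists_equiv_fin ({i // W (G.t (.inr i))} ⊕ {x // WI x})
  obtain ⟨l₁, ⟨b₁⟩⟩ := Finite.exists_equiv_fin ({o // W (G.s (.inr o))} ⊕ {x // WI x})
  obtain ⟨k₂, ⟨a₂⟩⟩ := Finite.exists_equiv_fin ({i // ¬ W (G.t (.inr i))} ⊕ {x // ¬ WI x})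
  obtain ⟨l₂, ⟨b₂⟩⟩ := Finite.exists_equiv_fin ({o // ¬ W (G.s (.inr o))} ⊕ {x // ¬ WI x})
  let A : MarkedGraph D k₁ l₁ :=
    { toGraph := G.restrict W WI WL hW a₁ b₁
      dec := Sum.elim (fun v => (G.dec (.inl v.1)).1) (fun v => (G.dec (.inr v.1)).1)
      rT := fun x y => G.rT (Graph.resT _ W x) (Graph.resT _ W y)
      rS := fun x y => G.rS (Graph.resS _ W x) (Graph.resS _ W y)
      rT_fibre := fun H => Subtype.ext (G.rT_fibre H)
      rS_fibre := fun H => Subtype.ext (G.rS_fibre H) }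
  let B : MarkedGraph D k₂ l₂ :=
    { toGraph := G.restrict (fun v => ¬ W v) (fun v => ¬ WI v) (fun v => ¬ WL v) hW' a₂ b₂
      dec := Sum.elim (fun v => (G.dec (.inl v.1)).1) (fun v => (G.dec (.inr v.1)).1)
      rT := fun x y => G.rT (Graph.resT _ (fun v => ¬ W v) x) (Graph.resT _ (fun v => ¬ W v) y)
      rS := fun x y => G.rS (Graph.resS _ (fun v => ¬ W v) x) (Graph.resS _ (fun v => ¬ W v) y)
      rT_fibre := fun H => Subtype.ext (G.rT_fibre H)
      rS_fibre := fun H => Subtype.ext (G.rS_fibre H) }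
  refine ⟨k₁, l₁, k₂, l₂, A, B, Graph.splitIndex a₁ a₂ G.α, Graph.splitIndex b₁ b₂ G.β,
    ⟨fun x => x.2⟩, rel_of_flag (G.splitFlagIso W WI WL hW hW' a₁ b₁ a₂ b₂) ?_ G.rT G.rS
      ?_ (fun _ _ => .rfl) ?_ (fun _ _ => .rfl)⟩
  · rintro ((⟨x, hx⟩ | ⟨x, hx⟩) | (⟨x, hx⟩ | ⟨x, hx⟩))
    exacts [Prod.ext rfl hx, Prod.ext rfl ((Bool.not_eq_true _).mp hx), Prod.ext rfl hx,
      Prod.ext rfl ((Bool.not_eq_true _).mp hx)]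
  · intro x y
    change Sum.LiftRel A.rT B.rT (Graph.hT A.toGraph B.toGraph x) (Graph.hT A.toGraph B.toGraph y) ↔
      G.rT (Sum.elim (Graph.resT _ W) (Graph.resT _ fun v => ¬ W v) (Graph.hT A.toGraph B.toGraph x))
        (Sum.elim (Graph.resT _ W) (Graph.resT _ fun v => ¬ W v) (Graph.hT A.toGraph B.toGraph y))
    generalize Graph.hT A.toGraph B.toGraph x = x'
    generalize Graph.hT A.toGraph B.toGraph y = y'
    rcases x' with x' | x' <;> rcases y' with y' | y'
    · exact Sum.liftRel_inl_inl
    · refine iff_of_false (by simp) fun H => Graph.resT_spec (W := fun v => ¬ W v) G.toGraph hW' y' ?_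
      exact (congrArg W (G.rT_fibre H)).mp (Graph.resT_spec G.toGraph hW x')
    · refine iff_of_false (by simp) fun H => Graph.resT_spec (W := fun v => ¬ W v) G.toGraph hW' x' ?_
      exact (congrArg W (G.rT_fibre H)).mpr (Graph.resT_spec G.toGraph hW y')
    · exact Sum.liftRel_inr_inr
  · intro x y
    change Sum.LiftRel A.rS B.rS (Graph.hS A.toGraph B.toGraph x) (Graph.hS A.toGraph B.toGraph y) ↔
      G.rS (Sum.elim (Graph.resS _ W) (Graph.resS _ fun v => ¬ W v) (Graph.hS A.toGraph B.toGraph x))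
        (Sum.elim (Graph.resS _ W) (Graph.resS _ fun v => ¬ W v) (Graph.hS A.toGraph B.toGraph y))
    generalize Graph.hS A.toGraph B.toGraph x = x'
    generalize Graph.hS A.toGraph B.toGraph y = y'
    rcases x' with x' | x' <;> rcases y' with y' | y'
    · exact Sum.liftRel_inl_inl
    · refine iff_of_false (by simp) fun H => Graph.resS_spec G.toGraph (fun v => ¬ W v) y' ?_
      exact (congrArg W (G.rS_fibre H)).mp (Graph.resS_spec G.toGraph W x')
    · refine iff_of_false (by simp) fun H => Graph.resS_spec G.toGraph (fun v => ¬ W v) x' ?_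
      exact (congrArg W (G.rS_fibre H)).mpr (Graph.resS_spec G.toGraph W y')
    · exact Sum.liftRel_inr_inr

/-- The sum of two bijections between initial segments of `ℕ`. -/
def sumFin (r : Fin p ≃ Fin p') (ν : Fin n ≃ Fin n') : Fin (p + n) ≃ Fin (p' + n') :=
  finSumFinEquiv.symm.trans ((sumCongr r ν).trans finSumFinEquiv)

/-- The part without input-output edges is determined by a horizontal decomposition. -/
theorem hcomp_unit_unique {H : MarkedGraph D p q} {H' : MarkedGraph D p' q'}
    (hH : IsEmpty H.InOut) (hH' : IsEmpty H'.InOut) {a : Fin (p + n) ≃ Fin k}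
    {b : Fin (q + n) ≃ Fin l} {a' : Fin (p' + n') ≃ Fin k} {b' : Fin (q' + n') ≃ Fin l}
    (h : (H.hcomp (unit D n)).reindex a b ≈ (H'.hcomp (unit D n')).reindex a' b') :
    ∃ (r : Fin p ≃ Fin p') (r' : Fin q ≃ Fin q') (ν : Fin n ≃ Fin n'),
      H.reindex r r' ≈ H' ∧ (sumFin r ν).trans a' = a ∧ (sumFin r' ν).trans b' = b := by
  obtain ⟨f, hf⟩ := h
  -- `H` and the identity use disjoint kinds of data: the identity has only input-output edges, and
  -- `H` has none. So every component of the isomorphism respects the two factors, without any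
  -- colouring.
  obtain ⟨fV, gV, eV⟩ := exists_sumCongr (A := H.V) (B := Empty) (A' := H'.V) (B' := Empty) f.onV
    (isLeft_apply_of_isEmpty_right _)
  obtain ⟨fL, gL, eL⟩ := exists_sumCongr (A := H.L) (B := Empty) (A' := H'.L) (B' := Empty) f.onL
    (isLeft_apply_of_isEmpty_right _)
  obtain ⟨fE, gE, eE⟩ := exists_sumCongr (A := H.E) (B := Empty) (A' := H'.E) (B' := Empty) f.onE
    (isLeft_apply_of_isEmpty_right _)
  obtain ⟨fI, gI, eI⟩ := exists_sumCongr (A := H.In) (B := Empty) (A' := H'.In) (B' := Empty) f.onIn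
    (isLeft_apply_of_isEmpty_right _)
  obtain ⟨fO, gO, eO⟩ := exists_sumCongr (A := H.Out) (B := Empty) (A' := H'.Out) (B' := Empty)
    f.onOut (isLeft_apply_of_isEmpty_right _)
  obtain ⟨g, ν, eν⟩ := exists_sumCongr (A := H.InOut) (B := Fin n) (A' := H'.InOut) (B' := Fin n')
    f.onInOut (isLeft_apply_of_isEmpty_left _)
  obtain ⟨onV, onE, onIn, onOut, onInOut, onL, map_s, map_t, map_α, map_β⟩ := f
  obtain ⟨h1, h2, h3⟩ := hf
  dsimp only at eV eL eE eI eO eν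
  subst eV eL eE eI eO eν
  -- The renumbering of the inputs of `H` is read off from the bijection of its input edges. It
  -- exhausts all the indices because `H` has no input-output edge.
  let r : Fin p ≃ Fin p' := H.α.symm.trans ((sumCongr fI g).trans H'.α)
  let r' : Fin q ≃ Fin q' := H.β.symm.trans ((sumCongr fO g).trans H'.β)
  have hr : ∀ x, r (H.α x) = H'.α (Sum.map fI g x) := fun x =>
    congrArg (fun z => H'.α (sumCongr fI g z)) (H.α.symm_apply_apply x)
  have hr' : ∀ x, r' (H.β x) = H'.β (Sum.map fO g x) := fun x =>
    congrArg (fun z => H'.β (sumCongr fO g z)) (H.β.symm_apply_apply x)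
  refine ⟨r, r', ν, ⟨⟨fV, fE, fI, fO, g, fL, ?_, ?_, ?_, ?_⟩, ?_, ?_, ?_⟩, ?_, ?_⟩
  · rintro (x | x)
    exacts [Sum.inl_injective (map_s (.inl (.inl x))), Sum.inl_injective (map_s (.inr (.inl x)))]
  · rintro (x | x)
    exacts [Sum.inl_injective (map_t (.inl (.inl x))), Sum.inl_injective (map_t (.inr (.inl x)))]
  · exact fun x => (hr x).symm
  · exact fun x => (hr' x).symm
  · rintro (x | x)
    exacts [h1 (.inl (.inl x)), h1 (.inr (.inl x))]
  · intro x y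
    refine .trans ?_ ((h2 (Sum.map .inl .inl x) (Sum.map .inl .inl y)).trans ?_)
    · rcases x with x | x <;> rcases y with y | y <;> exact Sum.liftRel_inl_inl.symm
    · rcases x with x | x <;> rcases y with y | y <;> exact Sum.liftRel_inl_inl
  · intro x y
    refine .trans ?_ ((h3 (Sum.map .inl .inl x) (Sum.map .inl .inl y)).trans ?_)
    · rcases x with x | x <;> rcases y with y | y <;> exact Sum.liftRel_inl_inl.symm
    · rcases x with x | x <;> rcases y with y | y <;> exact Sum.liftRel_inl_inl
  · refine Equiv.ext fun i => ?_
    obtain ⟨i | i, rfl⟩ := finSumFinEquiv.surjective i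
    · obtain ⟨i | i, rfl⟩ := H.α.surjective i
      · refine .trans ?_ (map_α (.inl (.inl i)))
        change a' (finSumFinEquiv (sumCongr r ν (finSumFinEquiv.symm (finSumFinEquiv _)))) = _
        rw [symm_apply_apply]
        exact congrArg (fun z => a' (finSumFinEquiv (.inl z))) (hr (.inl i))
      · exact hH.elim i
    · refine .trans ?_ (map_α (.inr (.inr i)))
      change a' (finSumFinEquiv (sumCongr r ν (finSumFinEquiv.symm (finSumFinEquiv _)))) = _
      rw [symm_apply_apply]
      rfl
  · refine Equiv.ext fun i => ?_
    obtain ⟨i | i, rfl⟩ := finSumFinEquiv.surjective i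
    · obtain ⟨i | i, rfl⟩ := H.β.surjective i
      · refine .trans ?_ (map_β (.inl (.inl i)))
        change b' (finSumFinEquiv (sumCongr r' ν (finSumFinEquiv.symm (finSumFinEquiv _)))) = _
        rw [symm_apply_apply]
        exact congrArg (fun z => b' (finSumFinEquiv (.inl z))) (hr' (.inl i))
      · exact hH.elim i
    · refine .trans ?_ (map_β (.inr (.inr i)))
      change b' (finSumFinEquiv (sumCongr r' ν (finSumFinEquiv.symm (finSumFinEquiv _)))) = _
      rw [symm_apply_apply]
      rfl

end MarkedGraph

end GraphProP

namespace GraphProP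

/-! ### Indecomposable classes and colourings -/

theorem Graph.IsSingleLoop.of_iso {k l : ℕ} {G H : Graph k l} (h : G.IsSingleLoop)
    (f : Graph.Iso G H) : H.IsSingleLoop :=
  ⟨@Equiv.isEmpty _ _ f.onV.symm h.1, @Equiv.isEmpty _ _ f.onE.symm h.2.1,
    @Equiv.isEmpty _ _ f.onIn.symm h.2.2.1, @Equiv.isEmpty _ _ f.onOut.symm h.2.2.2.1,
    @Equiv.isEmpty _ _ f.onInOut.symm h.2.2.2.2.1,
    (Nat.card_congr f.onL).symm.trans h.2.2.2.2.2⟩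

theorem Graph.IsIndecomposable.of_iso {k l : ℕ} {G H : Graph k l} (h : G.IsIndecomposable)
    (f : Graph.Iso G H) : H.IsIndecomposable where
  nonempty := h.nonempty.imp (fun ⟨v⟩ => ⟨f.onV v⟩) fun h => h.of_iso f
  isEmpty_inOut := @Equiv.isEmpty _ _ f.onInOut.symm h.isEmpty_inOut
  isEmpty_loops := h.isEmpty_loops.imp (fun h => @Equiv.isEmpty _ _ f.onL.symm h)
    fun h => h.of_iso f
  vertical m G' G'' := fun ⟨g⟩ => h.vertical m G' G'' ⟨f.trans g⟩
  horizontal k₁ l₁ k₂ l₂ hk hl G' G'' σ τ := fun ⟨g⟩ =>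
    h.horizontal k₁ l₁ k₂ l₂ hk hl G' G'' σ τ ⟨f.trans g⟩

namespace MarkedGraph

variable {D : Type u} {D' : Type v} {D'' : Type w} {k l m n k' l' m' : ℕ}

namespace Class

theorem mk_reindex (G : MarkedGraph D k l) (a : Perm (Fin k)) (b : Perm (Fin l)) :
    mk (G.reindex a b) = (markedGraphs D).lact b ((markedGraphs D).ract a⁻¹ (mk G)) := by
  rw [mk_ract, ← reindex_eq_ract]
  rfl

theorem stepRel_lact {r : D → D → Prop} {σ : Perm (Fin l)} {x : (markedGraphs D).obj k l} :
    StepRel r ((markedGraphs D).lact σ x) ↔ StepRel r x := by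
  obtain ⟨G, rfl⟩ := mk_surjective x
  exact Iff.rfl

theorem stepRel_ract {r : D → D → Prop} {τ : Perm (Fin k)} {x : (markedGraphs D).obj k l} :
    StepRel r ((markedGraphs D).ract τ x) ↔ StepRel r x := by
  obtain ⟨G, rfl⟩ := mk_surjective x
  exact Iff.rfl

theorem StepRel.hcomp_left {r : D → D → Prop} {x : (markedGraphs D).obj k l}
    {y : (markedGraphs D).obj k' l'} (h : StepRel r ((markedGraphs D).hcomp x y)) :
    StepRel r x := by
  obtain ⟨G, rfl⟩ := mk_surjective x
  obtain ⟨G', rfl⟩ := mk_surjective y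
  exact fun e => h (.inl e)

/-- The colouring of a vertical composite does not decrease along the edges. -/
theorem stepRel_cut (a : (markedGraphs D).obj m l) (b : (markedGraphs D).obj k m) :
    StepRel (fun d d' => d.2 = true → d'.2 = true)
      ((markedGraphs (D × Bool)).vcomp (map (·, true) a) (map (·, false) b)) := by
  obtain ⟨G, rfl⟩ := mk_surjective a
  obtain ⟨G', rfl⟩ := mk_surjective b
  rintro ((e | e) | e) H
  exacts [H, rfl, rfl]

theorem map_congr {f g : D → D'} {x : (markedGraphs D).obj k l}
    (h : ¬ HasMark (fun d => f d ≠ g d) x) : map f x = map g x := by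
  obtain ⟨G, rfl⟩ := mk_surjective x
  rw [hasMark_mk] at h
  push Not at h
  exact congrArg mk (congrArg G.remark (funext h))

/-- The marks are transported along an isomorphism to a representative fixed in advance. Extra marks
on a class thus become a function on the vertices and loops of one given graph. -/
theorem exists_remark {G : MarkedGraph D k l} {y : (markedGraphs (D × D')).obj k l}
    (h : map Prod.fst y = mk G) : ∃ c : G.V ⊕ G.L → D',
      y = mk (G.remark fun x => (G.dec x, c x)) := by
  obtain ⟨Y, rfl⟩ := mk_surjective y
  obtain ⟨f, hf⟩ := mk_eq_iff.1 h
  have hf' := hf.symm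
  refine ⟨fun x => (Y.dec (Sum.map f.symm.onV f.symm.onL x)).2, ((mk_eq_iff
    (G := G.remark fun x => (G.dec x, (Y.dec (Sum.map f.symm.onV f.symm.onL x)).2)) (H := Y)).2
      ⟨f.symm, ?_⟩).symm⟩
  exact ⟨fun x => Prod.ext (hf'.dec x) rfl, hf'.rT, hf'.rS⟩

/-- Classes forget how the two underlying graphs are identified, and there may be automorphisms.
Both colourings are moved to one representative, where any choice of identification will do; only
then do expressions such as `c ∧ c'` make sense. -/
theorem exists_joint {y : (markedGraphs (D × D')).obj k l} {y' : (markedGraphs (D × D'')).obj k l}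
    (h : map Prod.fst y = map Prod.fst y') : ∃ z : (markedGraphs (D × D' × D'')).obj k l,
      map (fun d => (d.1, d.2.1)) z = y ∧ map (fun d => (d.1, d.2.2)) z = y' := by
  obtain ⟨G, hG⟩ := mk_surjective (map Prod.fst y)
  obtain ⟨c, rfl⟩ := exists_remark hG.symm
  obtain ⟨c', rfl⟩ := exists_remark (h.symm.trans hG.symm)
  exact ⟨mk (G.remark fun x => (G.dec x, c x, c' x)), rfl, rfl⟩

/-- A colouring which is constant along the edges comes from a horizontal decomposition. -/
theorem exists_split {x : (markedGraphs (D × Bool)).obj k l}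
    (h : StepRel (fun d d' => d.2 = d'.2) x) :
    ∃ (k₁ l₁ k₂ l₂ : ℕ) (hk : k₁ + k₂ = k) (hl : l₁ + l₂ = l) (A : MarkedGraph D k₁ l₁)
      (b : (markedGraphs D).obj k₂ l₂) (σ : Perm (Fin l)) (τ : Perm (Fin k)),
      IsEmpty A.InOut ∧ x = (markedGraphs (D × Bool)).lact σ ((markedGraphs (D × Bool)).ract τ
        (recast (markedGraphs (D × Bool)).obj hk hl
          ((markedGraphs (D × Bool)).hcomp (map (·, true) (mk A)) (map (·, false) b)))) := by
  obtain ⟨G, rfl⟩ := mk_surjective x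
  obtain ⟨k₁, l₁, k₂, l₂, A, B, a, b, hA, H⟩ := MarkedGraph.exists_split G h
  obtain rfl : k₁ + k₂ = k := by simpa using Fintype.card_congr a
  obtain rfl : l₁ + l₂ = l := by simpa using Fintype.card_congr b
  exact ⟨k₁, l₁, k₂, l₂, rfl, rfl, A, mk B, b, a⁻¹, hA,
    (mk_eq_iff.2 H).symm.trans (mk_reindex _ a b)⟩

/-- The class of an indecomposable graph. -/
def Indec (x : (markedGraphs D).obj k l) : Prop :=
  ∃ G : MarkedGraph D k l, mk G = x ∧ G.toGraph.IsIndecomposable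

theorem Indec.of_mk {G : MarkedGraph D k l} (h : Indec (mk G)) : G.toGraph.IsIndecomposable := by
  obtain ⟨H, hH, h⟩ := h
  obtain ⟨f, -⟩ := mk_eq_iff.1 hH
  exact h.of_iso f

theorem Indec.size_pos {x : (markedGraphs D).obj k l} (h : Indec x) : 0 < size x := by
  obtain ⟨G, rfl, h⟩ := h
  rw [size_mk, Finite.card_pos_iff]
  rcases h.nonempty with ⟨⟨v⟩⟩ | h
  · exact ⟨.inl v⟩
  · have : Nonempty G.L := Finite.card_pos_iff.1 (h.2.2.2.2.2 ▸ Nat.one_pos)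
    exact ⟨.inr this.some⟩

/-- The definition of indecomposability speaks of vertices, the induction of vertices and loops.
Without loops the two agree; a single loop has size 1, so one of its factors has size 0. -/
theorem Indec.vcomp {x : (markedGraphs D).obj m l} {y : (markedGraphs D).obj k m}
    (h : Indec ((markedGraphs D).vcomp x y)) : size x = 0 ∨ size y = 0 := by
  obtain ⟨A, rfl⟩ := mk_surjective x
  obtain ⟨B, rfl⟩ := mk_surjective y
  have h' := Indec.of_mk (G := A.vcomp B) h
  rcases h'.isEmpty_loops with hL | hL
  · have h1 := h'.vertical m A.toGraph B.toGraph ⟨.refl _⟩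
    have hA : IsEmpty A.L := ⟨fun x => hL.elim' (.inr x)⟩
    have hB : IsEmpty B.L := ⟨fun x => hL.elim' (.inl x)⟩
    exact h1.imp (fun h1 => @Nat.card_of_isEmpty _ (@instIsEmptySum _ _ h1 hA))
      fun h1 => @Nat.card_of_isEmpty _ (@instIsEmptySum _ _ h1 hB)
  · have h1 := hL.2.2.2.2.2
    have h2 : size ((markedGraphs D).vcomp (mk A) (mk B)) = 1 := by
      refine (Nat.card_sum (α := B.V ⊕ A.V) (β := B.L ⊕ A.L)).trans ?_
      rw [show Nat.card (B.L ⊕ A.L) = 1 from h1, show Nat.card (B.V ⊕ A.V) = 0 from @Nat.card_of_isEmpty _ hL.1]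
    rw [size_vcomp] at h2
    omega

/-- The decompositions of a class by horizontal concatenation of an indecomposable class and an
identity have the same sizes. -/
theorem Indec.hcomp_idn_eq {a b a' b' : ℕ} {h : (markedGraphs D).obj a b}
    {h' : (markedGraphs D).obj a' b'} (hh : Indec h) (hh' : Indec h') {n n' : ℕ}
    (hk : a' + n' = a + n) (hl : b' + n' = b + n) {σ : Perm (Fin (b + n))}
    {σ' : Perm (Fin (b' + n'))} {τ : Perm (Fin (a + n))} {τ' : Perm (Fin (a' + n'))}
    (H : (markedGraphs D).lact σ ((markedGraphs D).ract τ
        ((markedGraphs D).hcomp h ((markedGraphs D).idn n))) =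
      recast (markedGraphs D).obj hk hl ((markedGraphs D).lact σ' ((markedGraphs D).ract τ'
        ((markedGraphs D).hcomp h' ((markedGraphs D).idn n'))))) :
    a = a' ∧ b = b' ∧ n = n' := by
  obtain ⟨A, rfl⟩ := mk_surjective h
  obtain ⟨A', rfl⟩ := mk_surjective h'
  rw [idn_eq, idn_eq, mk_hcomp, mk_hcomp, mk_ract, mk_ract, mk_lact, mk_lact, mk_recast] at H
  obtain ⟨r, r', ν, -, -, -⟩ := hcomp_unit_unique hh.of_mk.isEmpty_inOut hh'.of_mk.isEmpty_inOut
    (a := τ⁻¹) (b := σ) (a' := (τ'⁻¹).trans (finCongr hk)) (b' := σ'.trans (finCongr hl))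
    (mk_eq_iff.1 H)
  exact ⟨by simpa using Fintype.card_congr r, by simpa using Fintype.card_congr r',
    by simpa using Fintype.card_congr ν⟩

/-- The only freedom in writing a layer is a permutation of the outputs of `h`, one of its inputs,
and one of the extra strands, which acts by `ν` above and by `ν⁻¹` below. This freedom is absorbed
in any ProP by `SetProP.lact_ract_hcomp_idn`. -/
theorem Indec.hcomp_idn_unique {a b n : ℕ} {h h' : (markedGraphs D).obj a b} (hh : Indec h)
    (hh' : Indec h') {σ σ' : Perm (Fin (b + n))} {τ τ' : Perm (Fin (a + n))}
    (H : (markedGraphs D).lact σ ((markedGraphs D).ract τ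
        ((markedGraphs D).hcomp h ((markedGraphs D).idn n))) =
      (markedGraphs D).lact σ' ((markedGraphs D).ract τ'
        ((markedGraphs D).hcomp h' ((markedGraphs D).idn n)))) :
    ∃ (ρ : Perm (Fin b)) (ρ' : Perm (Fin a)) (ν : Perm (Fin n)),
      h' = (markedGraphs D).lact ρ ((markedGraphs D).ract ρ' h) ∧ σ = σ' * tensorPerm ρ ν ∧
        τ = tensorPerm ρ' ν⁻¹ * τ' := by
  obtain ⟨A, rfl⟩ := mk_surjective h
  obtain ⟨A', rfl⟩ := mk_surjective h'
  rw [idn_eq, mk_hcomp, mk_hcomp, mk_ract, mk_ract, mk_lact, mk_lact] at H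
  obtain ⟨r, r', ν, h1, h2, h3⟩ := hcomp_unit_unique hh.of_mk.isEmpty_inOut
    hh'.of_mk.isEmpty_inOut (a := τ⁻¹) (b := σ) (a' := τ'⁻¹) (b' := σ') (mk_eq_iff.1 H)
  refine ⟨r', r⁻¹, ν, ?_, h3.symm, ?_⟩
  · rw [← mk_reindex]
    exact (mk_eq_iff.2 h1).symm
  · have h2' : τ⁻¹ = τ'⁻¹ * tensorPerm r ν := h2.symm
    have h4 : tensorPerm r⁻¹ ν⁻¹ = (tensorPerm r ν)⁻¹ := rfl
    rw [h4, ← inv_inj, h2', mul_inv_rev, inv_inv]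

theorem lact_idn_injective {σ σ' : Perm (Fin n)}
    (h : (markedGraphs D).lact σ ((markedGraphs D).idn n) =
      (markedGraphs D).lact σ' ((markedGraphs D).idn n)) : σ = σ' := by
  rw [idn_eq, mk_lact, mk_lact] at h
  obtain ⟨f, -⟩ := mk_eq_iff.1 h
  refine Equiv.ext fun i => ?_
  have h1 : f.onInOut i = i := f.map_α (.inr i)
  have h2 : σ' (f.onInOut i) = σ i := f.map_β (.inr i)
  rw [← h2, h1]

/-- Without vertices there are no internal, input or output edges, and without loops only
input-output edges remain. These match the inputs with the outputs, and the matching is the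
permutation. -/
theorem eq_of_size_eq_zero {x : (markedGraphs D).obj k l} (h : size x = 0) :
    ∃ (hl : k = l) (σ : Perm (Fin l)),
      x = (markedGraphs D).lact σ (recast (markedGraphs D).obj rfl hl ((markedGraphs D).idn k)) := by
  obtain ⟨G, rfl⟩ := mk_surjective x
  have h0 : IsEmpty (G.V ⊕ G.L) := by
    by_contra H
    rw [not_isEmpty_iff] at H
    have := Finite.card_pos_iff.2 H
    rw [size_mk] at h
    omega
  have hV : IsEmpty G.V := ⟨fun v => h0.elim (.inl v)⟩
  have hL : IsEmpty G.L := ⟨fun v => h0.elim (.inr v)⟩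
  have hE : IsEmpty G.E := ⟨fun e => hV.elim (G.s (.inl e))⟩
  have hI : IsEmpty G.In := ⟨fun e => hV.elim (G.t (.inr e))⟩
  have hO : IsEmpty G.Out := ⟨fun e => hV.elim (G.s (.inr e))⟩
  let a : G.InOut ≃ Fin k := (emptySum _ _).symm.trans G.α
  let b : G.InOut ≃ Fin l := (emptySum _ _).symm.trans G.β
  obtain rfl : k = l := by simpa using Fintype.card_congr (a.symm.trans b)
  refine ⟨rfl, a.symm.trans b, ?_⟩
  rw [recast_rfl, idn_eq, mk_lact]
  refine mk_eq_iff.2 ⟨⟨equivOfIsEmpty _ Empty, equivOfIsEmpty _ Empty, equivOfIsEmpty _ Empty,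
    equivOfIsEmpty _ Empty, a, equivOfIsEmpty _ Empty, ?_, ?_, ?_, ?_⟩, ?_, ?_, ?_⟩
  · rintro (x | x) <;> exact isEmptyElim x
  · rintro (x | x) <;> exact isEmptyElim x
  · rintro (x | x)
    exacts [isEmptyElim x, rfl]
  · rintro (x | x)
    exacts [isEmptyElim x, congrArg b (a.symm_apply_apply x)]
  · rintro (x | x) <;> exact isEmptyElim x
  · rintro (x | x) <;> exact isEmptyElim x
  · rintro (x | x) <;> exact isEmptyElim x

end Class

end MarkedGraph

end GraphProP

namespace GraphProP

namespace MarkedGraph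

variable {D : Type u} {k l m n k' l' m' : ℕ}

namespace Class

theorem hasMark_const {a : (markedGraphs D).obj k l} {c c' : Bool} :
    HasMark (fun d => d.2 = c) (map (fun d => (d, c')) a) ↔ 0 < size a ∧ c' = c := by
  rw [hasMark_map, size_pos_iff]
  obtain ⟨G, rfl⟩ := mk_surjective a
  exact ⟨fun ⟨x, hx⟩ => ⟨⟨x, trivial⟩, hx⟩, fun ⟨⟨x, _⟩, hx⟩ => ⟨x, hx⟩⟩

theorem hasMark_cut_true {a : (markedGraphs D).obj m l} {b : (markedGraphs D).obj k m} :
    HasMark (fun d => d.2 = true)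
      ((markedGraphs (D × Bool)).vcomp (map (·, true) a) (map (·, false) b)) ↔ 0 < size a := by
  simp [hasMark_vcomp, hasMark_const]

theorem hasMark_cut_false {a : (markedGraphs D).obj m l} {b : (markedGraphs D).obj k m} :
    HasMark (fun d => d.2 = false)
      ((markedGraphs (D × Bool)).vcomp (map (·, true) a) (map (·, false) b)) ↔ 0 < size b := by
  simp [hasMark_vcomp, hasMark_const]

theorem hasMark_split_true {a : (markedGraphs D).obj k l} {b : (markedGraphs D).obj k' l'} :
    HasMark (fun d => d.2 = true)
      ((markedGraphs (D × Bool)).hcomp (map (·, true) a) (map (·, false) b)) ↔ 0 < size a := by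
  simp [hasMark_hcomp, hasMark_const]

theorem hasMark_split_false {a : (markedGraphs D).obj k l} {b : (markedGraphs D).obj k' l'} :
    HasMark (fun d => d.2 = false)
      ((markedGraphs (D × Bool)).hcomp (map (·, true) a) (map (·, false) b)) ↔ 0 < size b := by
  simp [hasMark_hcomp, hasMark_const]

theorem map_fst_split (a : (markedGraphs D).obj k l) (b : (markedGraphs D).obj k' l')
    (σ : Perm (Fin (l + l'))) (τ : Perm (Fin (k + k'))) :
    map Prod.fst ((markedGraphs (D × Bool)).lact σ ((markedGraphs (D × Bool)).ract τ
      ((markedGraphs (D × Bool)).hcomp (map (·, true) a) (map (·, false) b)))) =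
      (markedGraphs D).lact σ ((markedGraphs D).ract τ ((markedGraphs D).hcomp a b)) := by
  rw [map_lact, map_ract, map_hcomp, map_map, map_map]
  exact congrArg _ (congrArg _ (congrArg₂ _ (map_id a) (map_id b)))

theorem map_fst_cut (a : (markedGraphs D).obj m l) (b : (markedGraphs D).obj k m) :
    map Prod.fst ((markedGraphs (D × Bool)).vcomp (map (·, true) a) (map (·, false) b)) =
      (markedGraphs D).vcomp a b := by
  rw [map_vcomp, map_map, map_map]
  exact congrArg₂ _ (map_id a) (map_id b)

/-- An indecomposable class, together with input-output edges, has no vertical decomposition. -/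
theorem Indec.layer_eq_vcomp {a b : ℕ} {h : (markedGraphs D).obj a b} (hh : Indec h)
    {σ : Perm (Fin (b + n))} {τ : Perm (Fin (a + n))} {u : (markedGraphs D).obj m (b + n)}
    {v : (markedGraphs D).obj (a + n) m}
    (H : (markedGraphs D).lact σ ((markedGraphs D).ract τ
        ((markedGraphs D).hcomp h ((markedGraphs D).idn n))) = (markedGraphs D).vcomp u v) :
    size u = 0 ∨ size v = 0 := by
  obtain ⟨G, rfl⟩ := mk_surjective h
  have hy := (map_fst_cut u v).trans H.symm
  have hs := stepRel_cut u v
  have ht := hasMark_cut_true (a := u) (b := v)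
  have hf := hasMark_cut_false (a := u) (b := v)
  -- The cut is remembered only as a coloured class `y` over the layer: a colouring without
  -- descending edge, in which true and false occur if and only if `u` and `v` have positive size.
  generalize (markedGraphs (D × Bool)).vcomp (map (·, true) u) (map (·, false) v) = y at hy hs ht hf
  rw [idn_eq] at hy
  obtain ⟨c, hc⟩ := exists_remark (G := ((G.hcomp (unit D n)).ract τ).lact σ) hy
  -- The extra strands carry no mark, so the colouring lives on the indecomposable part alone. It
  -- cuts that part, which forces one of the colours to be absent.
  obtain ⟨z, hz, rfl⟩ : ∃ z : (markedGraphs (D × Bool)).obj a b, map Prod.fst z = mk G ∧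
      y = (markedGraphs (D × Bool)).lact σ ((markedGraphs (D × Bool)).ract τ
        ((markedGraphs (D × Bool)).hcomp z ((markedGraphs (D × Bool)).idn n))) := by
    refine ⟨mk (G.remark fun x => (G.dec x, c (Sum.map .inl .inl x))), rfl, ?_⟩
    rw [hc, idn_eq]
    refine congrArg (fun d => mk (MarkedGraph.remark (((G.hcomp (unit D n)).ract τ).lact σ) d)) ?_
    funext x
    rcases x with (x | ⟨⟨⟩⟩) | (x | ⟨⟨⟩⟩) <;> rfl
  rw [stepRel_lact, stepRel_ract] at hs
  obtain ⟨m', a', b', rfl⟩ := exists_cut hs.hcomp_left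
  rw [map_fst_cut] at hz
  rw [hasMark_lact, hasMark_ract, hasMark_hcomp, hasMark_cut_true,
    or_iff_left not_hasMark_idn] at ht
  rw [hasMark_lact, hasMark_ract, hasMark_hcomp, hasMark_cut_false,
    or_iff_left not_hasMark_idn] at hf
  have := Indec.vcomp (hz ▸ hh)
  omega

end Class

end MarkedGraph

namespace SetProP

variable (S : SetProP.{w}) {k l n : ℕ}

/-- The permutation `ν` of the strands of `I_n` meets its inverse and disappears; the rest acts on
`h`. -/
theorem lact_ract_hcomp_idn (σ : Perm (Fin (l + n))) (ρ : Perm (Fin l)) (ν : Perm (Fin n))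
    (ρ' : Perm (Fin k)) (τ : Perm (Fin (k + n))) (h : S.obj k l) :
    S.lact (σ * tensorPerm ρ ν) (S.ract (tensorPerm ρ' ν⁻¹ * τ) (S.hcomp h (S.idn n))) =
      S.lact σ (S.ract τ (S.hcomp (S.lact ρ (S.ract ρ' h)) (S.idn n))) := by
  have e : S.lact ν (S.ract ν⁻¹ (S.idn n)) = S.idn n := by
    rw [S.ract_idn, S.lact_lact, mul_inv_cancel, S.one_lact]
  conv_rhs => rw [← e]
  rw [S.hcomp_lact, S.hcomp_ract, ← S.lact_lact, ← S.ract_ract, S.lact_ract (tensorPerm ρ ν)]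

end SetProP

/-! ### Families closed under factors, generators, and the words over them. -/

namespace MarkedGraph.Class

variable {D : Type u} {P : SetProP.{w}} {k l m n k' l' m' : ℕ}

/-- A family of classes which is stable under the actions, and which contains the factors of the
concatenations which it contains. -/
structure FactorClosed (V : ∀ k l, Set ((markedGraphs D).obj k l)) : Prop where
  lact : ∀ {k l : ℕ} (σ : Perm (Fin l)) {x : (markedGraphs D).obj k l}, x ∈ V k l →
    (markedGraphs D).lact σ x ∈ V k l
  ract : ∀ {k l : ℕ} (τ : Perm (Fin k)) {x : (markedGraphs D).obj k l}, x ∈ V k l →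
    (markedGraphs D).ract τ x ∈ V k l
  vcomp : ∀ {k l m : ℕ} {x : (markedGraphs D).obj l m} {y : (markedGraphs D).obj k l},
    (markedGraphs D).vcomp x y ∈ V k m → x ∈ V l m ∧ y ∈ V k l
  hcomp : ∀ {k l k' l' : ℕ} {x : (markedGraphs D).obj k l} {y : (markedGraphs D).obj k' l'},
    (markedGraphs D).hcomp x y ∈ V (k + k') (l + l') → x ∈ V k l ∧ y ∈ V k' l'

/-- A stable graph of a function from the indecomposable classes in `V` to a ProP. -/
structure IsGenerating (V : ∀ k l, Set ((markedGraphs D).obj k l))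
    (A : ∀ k l, Set (((markedGraphs D).prod P).obj k l)) : Prop where
  lact : ∀ {k l : ℕ} (σ : Perm (Fin l)) {z : ((markedGraphs D).prod P).obj k l}, z ∈ A k l →
    ((markedGraphs D).prod P).lact σ z ∈ A k l
  ract : ∀ {k l : ℕ} (τ : Perm (Fin k)) {z : ((markedGraphs D).prod P).obj k l}, z ∈ A k l →
    ((markedGraphs D).prod P).ract τ z ∈ A k l
  eq_of_fst_eq : ∀ {k l : ℕ} {z z' : ((markedGraphs D).prod P).obj k l}, z ∈ A k l → z' ∈ A k l →
    z.1 = z'.1 → z = z'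
  indec : ∀ {k l : ℕ} {z : ((markedGraphs D).prod P).obj k l}, z ∈ A k l → Indec z.1
  exists_mem : ∀ {k l : ℕ} {x : (markedGraphs D).obj k l}, x ∈ V k l → Indec x → ∃ p, (x, p) ∈ A k l

theorem FactorClosed.of_lact {V : ∀ k l, Set ((markedGraphs D).obj k l)} (hV : FactorClosed V)
    {σ : Perm (Fin l)} {x : (markedGraphs D).obj k l} (h : (markedGraphs D).lact σ x ∈ V k l) :
    x ∈ V k l := by
  rw [← (markedGraphs D).lact_inv_lact σ x]
  exact hV.lact _ h

theorem FactorClosed.of_ract {V : ∀ k l, Set ((markedGraphs D).obj k l)} (hV : FactorClosed V)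
    {τ : Perm (Fin k)} {x : (markedGraphs D).obj k l} (h : (markedGraphs D).ract τ x ∈ V k l) :
    x ∈ V k l := by
  rw [← (markedGraphs D).one_ract x, ← mul_inv_cancel τ, ← (markedGraphs D).ract_ract]
  exact hV.ract _ h

/-! ### Every class is the value of a word -/

/-- The class `x` is the first component of a word. -/
def HasWord (A : ∀ k l, Set (((markedGraphs D).prod P).obj k l)) (x : (markedGraphs D).obj k l) :
    Prop := ∃ p, ((markedGraphs D).prod P).Word A (x, p)

variable {A : ∀ k l, Set (((markedGraphs D).prod P).obj k l)}

theorem HasWord.lact {x : (markedGraphs D).obj k l} (h : HasWord A x) (σ : Perm (Fin l)) :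
    HasWord A ((markedGraphs D).lact σ x) := let ⟨_, h⟩ := h; ⟨_, h.lact σ⟩

theorem HasWord.ract {x : (markedGraphs D).obj k l} (h : HasWord A x) (τ : Perm (Fin k)) :
    HasWord A ((markedGraphs D).ract τ x) := let ⟨_, h⟩ := h; ⟨_, h.ract τ⟩

theorem HasWord.vcomp {x : (markedGraphs D).obj l m} {y : (markedGraphs D).obj k l}
    (hx : HasWord A x) (hy : HasWord A y) : HasWord A ((markedGraphs D).vcomp x y) :=
  let ⟨_, hx⟩ := hx; let ⟨_, hy⟩ := hy; ⟨_, hx.vcomp hy⟩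

theorem HasWord.hcomp {x : (markedGraphs D).obj k l} {y : (markedGraphs D).obj k' l'}
    (hx : HasWord A x) (hy : HasWord A y) : HasWord A ((markedGraphs D).hcomp x y) :=
  let ⟨_, hx⟩ := hx; let ⟨_, hy⟩ := hy; ⟨_, hx.hcomp hy⟩

theorem hasWord_idn (n : ℕ) : HasWord A ((markedGraphs D).idn n) :=
  ⟨P.idn n, by
    have := SetProP.word_idn (S := (markedGraphs D).prod P) (A := A) n
    rwa [SetProP.idn_prod] at this⟩

variable {V : ∀ k l, Set ((markedGraphs D).obj k l)}

/-- Suppose that there is no word. Then in any decomposition one of the factors has no vertex, since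
otherwise both factors would be smaller and would have words. So the graph is indecomposable, and it
is a generator, a contradiction. -/
theorem hasWord_of_connected (hV : FactorClosed V) (hA : IsGenerating V A)
    (G : MarkedGraph D k l) (hI : IsEmpty G.InOut) (hL : IsEmpty G.L) (hne : Nonempty G.V)
    (hG : mk G ∈ V k l)
    (ih : ∀ {k l : ℕ} (x : (markedGraphs D).obj k l), size x < size (mk G) → x ∈ V k l →
      HasWord A x) : HasWord A (mk G) := by
  by_contra H
  suffices h : Indec (mk G) by
    obtain ⟨p, hp⟩ := hA.exists_mem hG h
    exact H ⟨p, .of_mem hp⟩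
  refine ⟨G, rfl, .inl hne, hI, .inl hL, ?_, ?_⟩
  · rintro m G' G'' ⟨f⟩
    by_contra hn
    rw [not_or, not_isEmpty_iff, not_isEmpty_iff] at hn
    refine H ?_
    -- The factors `G'` and `G''` are bare graphs, without marks or relations. Only the colouring
    -- which they induce on `G` is kept, and `exists_cut` returns factors with marks. The colour of
    -- loops is arbitrary, as there are none.
    let c : G.V ⊕ G.L → Bool := Sum.elim (fun v => (f.onV v : G''.V ⊕ G'.V).isRight) fun _ => true
    let y : (markedGraphs (D × Bool)).obj k l := mk (G.remark fun x => (G.dec x, c x))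
    have hy : map Prod.fst y = mk G := rfl
    have hs : StepRel (fun d d' => d.2 = true → d'.2 = true) y := by
      intro (e : G.E)
      change (f.onV (G.s (.inl e)) : G''.V ⊕ G'.V).isRight = true →
        (f.onV (G.t (.inl e)) : G''.V ⊕ G'.V).isRight = true
      have h1 : f.onV (G.s (.inl e)) = (G'.vcomp G'').s (.inl (f.onE e)) := (f.map_s (.inl e)).symm
      have h2 : f.onV (G.t (.inl e)) = (G'.vcomp G'').t (.inl (f.onE e)) := (f.map_t (.inl e)).symm
      rw [h1, h2]
      rcases f.onE e with (e' | e') | e'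
      exacts [id, id, fun _ => rfl]
    have ht : HasMark (fun d => d.2 = true) y := by
      obtain ⟨v⟩ := hn.1
      exact ⟨.inl (f.onV.symm (.inr v)), congrArg Sum.isRight (f.onV.apply_symm_apply (.inr v))⟩
    have hf : HasMark (fun d => d.2 = false) y := by
      obtain ⟨v⟩ := hn.2
      exact ⟨.inl (f.onV.symm (.inl v)), congrArg Sum.isRight (f.onV.apply_symm_apply (.inl v))⟩
    obtain ⟨m', a, b, e⟩ := exists_cut hs
    rw [e, hasMark_cut_true] at ht
    rw [e, hasMark_cut_false] at hf
    rw [e, map_fst_cut] at hy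
    rw [← hy] at hG ih ⊢
    rw [size_vcomp] at ih
    exact (ih a (by omega) (hV.vcomp hG).1).vcomp (ih b (by omega) (hV.vcomp hG).2)
  · rintro k₁ l₁ k₂ l₂ hk hl G' G'' σ τ ⟨f⟩
    by_contra hn
    rw [not_or, not_isEmpty_iff, not_isEmpty_iff] at hn
    refine H ?_
    let c : G.V ⊕ G.L → Bool := Sum.elim (fun v => (f.onV v : G'.V ⊕ G''.V).isLeft) fun _ => true
    let y : (markedGraphs (D × Bool)).obj k l := mk (G.remark fun x => (G.dec x, c x))
    have hy : map Prod.fst y = mk G := rfl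
    have hs : StepRel (fun d d' => d.2 = d'.2) y := by
      intro (e : G.E)
      change (f.onV (G.s (.inl e)) : G'.V ⊕ G''.V).isLeft =
        (f.onV (G.t (.inl e)) : G'.V ⊕ G''.V).isLeft
      have h1 : f.onV (G.s (.inl e)) = (G'.hcomp G'').s (.inl (f.onE e)) := (f.map_s (.inl e)).symm
      have h2 : f.onV (G.t (.inl e)) = (G'.hcomp G'').t (.inl (f.onE e)) := (f.map_t (.inl e)).symm
      rw [h1, h2]
      rcases f.onE e with e' | e' <;> rfl
    have ht : HasMark (fun d => d.2 = true) y := by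
      obtain ⟨v⟩ := hn.1
      exact ⟨.inl (f.onV.symm (.inl v)), congrArg Sum.isLeft (f.onV.apply_symm_apply (.inl v))⟩
    have hf : HasMark (fun d => d.2 = false) y := by
      obtain ⟨v⟩ := hn.2
      exact ⟨.inl (f.onV.symm (.inr v)), congrArg Sum.isLeft (f.onV.apply_symm_apply (.inr v))⟩
    -- The arities of these factors may differ from those of `G'` and `G''`, because input-output
    -- edges can be distributed differently. Only the colours matter.
    obtain ⟨k₃, l₃, k₄, l₄, rfl, rfl, B, b, σ', τ', -, e⟩ := exists_split hs
    rw [recast_rfl] at e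
    rw [e, hasMark_lact, hasMark_ract, hasMark_split_true] at ht
    rw [e, hasMark_lact, hasMark_ract, hasMark_split_false] at hf
    rw [e, map_fst_split] at hy
    rw [← hy] at hG ih ⊢
    rw [size_lact, size_ract, size_hcomp] at ih
    have hG' := hV.hcomp (hV.of_ract (hV.of_lact hG))
    exact (((ih _ (by omega) hG'.1).hcomp (ih b (by omega) hG'.2)).ract _).lact _

/-- A part `B` of positive size without input-output edges is split off. If there are vertices, `B`
carries all of them and no loop, and `hasWord_of_connected` applies; otherwise `B` is one loop,
which is indecomposable. The remaining part is smaller. -/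
theorem hasWord_of_size_ne_zero (hV : FactorClosed V) (hA : IsGenerating V A)
    {x : (markedGraphs D).obj k l} (hx : x ∈ V k l) (h0 : size x ≠ 0)
    (ih : ∀ {k l : ℕ} (y : (markedGraphs D).obj k l), size y < size x → y ∈ V k l →
      HasWord A y) : HasWord A x := by
  obtain ⟨G, rfl⟩ := mk_surjective x
  have hne : Nonempty (G.V ⊕ G.L) := Finite.card_pos_iff.1 (Nat.pos_of_ne_zero h0)
  -- The colour is constant on the vertices, hence along the edges, as a horizontal splitting
  -- requires. It is true on all vertices and false on loops, or true on one chosen loop `x₀` when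
  -- there is no vertex.
  obtain ⟨c, hc, hc'⟩ : ∃ c : G.V ⊕ G.L → Bool, (∀ v v', c (.inl v) = c (.inl v')) ∧
      ((Nonempty G.V ∧ ∀ x, c x = x.isLeft) ∨
        (IsEmpty G.V ∧ ∃ x₀ : G.L, ∀ x, c (.inr x) = true ↔ x = x₀)) := by
    classical
    rcases isEmpty_or_nonempty G.V with hV | hV
    · obtain ⟨v | x₀⟩ := hne
      · exact hV.elim v
      · exact ⟨Sum.elim (fun _ => true) fun x => decide (x = x₀), fun _ _ => rfl,
          .inr ⟨hV, x₀, by simp⟩⟩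
    · exact ⟨Sum.isLeft, fun _ _ => rfl, .inl ⟨hV, fun _ => rfl⟩⟩
  obtain ⟨k₁, l₁, k₂, l₂, rfl, rfl, B, b, σ, τ, hB, e⟩ :=
    exists_split (x := mk (G.remark fun x => (G.dec x, c x))) (fun e => hc _ _)
  rw [recast_rfl] at e
  have hy := (congrArg (map Prod.fst) e).trans (map_fst_split _ _ _ _)
  change mk G = _ at hy
  obtain ⟨C, rfl⟩ := mk_surjective b
  obtain ⟨f, hf⟩ := mk_eq_iff.1 e.symm
  have hfV : ∀ v, c (.inl (f.onV (.inl v))) = true := fun v => congrArg Prod.snd (hf.dec (.inl (.inl v)))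
  have hfL : ∀ v, c (.inr (f.onL (.inl v))) = true := fun v => congrArg Prod.snd (hf.dec (.inr (.inl v)))
  have hfV' : ∀ v, c (.inl (f.onV (.inr v))) = false := fun v => congrArg Prod.snd (hf.dec (.inl (.inr v)))
  have hfL' : ∀ v, c (.inr (f.onL (.inr v))) = false := fun v => congrArg Prod.snd (hf.dec (.inr (.inr v)))
  have hBC := hV.hcomp (hV.of_ract (hV.of_lact (hy ▸ hx)))
  have hs : size (mk G) = size (mk B) + size (mk C) := by
    rw [hy, size_lact, size_ract, size_hcomp]
  suffices h : 0 < size (mk B) ∧ HasWord A (mk B) by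
    rw [hy]
    exact ((h.2.hcomp (ih _ (by omega) hBC.2)).ract _).lact _
  rcases hc' with ⟨⟨v⟩, hc'⟩ | ⟨hGV, x₀, hx₀⟩
  · have hBL : IsEmpty B.L := ⟨fun x => Bool.false_ne_true ((hc' _).symm.trans (hfL x))⟩
    have hBV : Nonempty B.V := by
      obtain ⟨w | w, rfl⟩ := f.onV.surjective v
      · exact ⟨w⟩
      · have := hfV' w
        rw [hc'] at this
        cases this
    refine ⟨Finite.card_pos_iff.2 ⟨.inl hBV.some⟩,
      hasWord_of_connected hV hA B hB hBL hBV hBC.1 fun y h => ih y (by omega)⟩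
  · have hBV : IsEmpty B.V := ⟨fun v => hGV.elim (f.onV (.inl v))⟩
    have hBL : Nat.card B.L = 1 := by
      rw [Nat.card_eq_one_iff_unique]
      constructor
      · exact ⟨fun x y => Sum.inl_injective (f.onL.injective
          (((hx₀ _).1 (hfL x)).trans ((hx₀ _).1 (hfL y)).symm))⟩
      · obtain ⟨w | w, hw⟩ := f.onL.surjective x₀
        · exact ⟨w⟩
        · have := hfL' w
          rw [hw, (hx₀ x₀).2 rfl] at this
          cases this
    have hloop : B.toGraph.IsSingleLoop := ⟨hBV, ⟨fun e => hBV.elim (B.s (.inl e))⟩,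
      ⟨fun e => hBV.elim (B.t (.inr e))⟩, ⟨fun e => hBV.elim (B.s (.inr e))⟩, hB, hBL⟩
    have hind : Indec (mk B) := ⟨B, rfl, .inr hloop, hB, .inr hloop,
      fun m G' G'' ⟨f⟩ => .inl ⟨fun v => hBV.elim (f.onV.symm (.inr v))⟩,
      fun k₁ l₁ k₂ l₂ hk hl G' G'' σ τ ⟨f⟩ => .inl ⟨fun v => hBV.elim (f.onV.symm (.inl v))⟩⟩
    obtain ⟨p, hp⟩ := hA.exists_mem hBC.1 hind
    exact ⟨hind.size_pos, p, .of_mem hp⟩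

/-- Every class in `V` is the first component of a word. -/
theorem hasWord (hV : FactorClosed V) (hA : IsGenerating V A) {x : (markedGraphs D).obj k l}
    (hx : x ∈ V k l) : HasWord A x := by
  obtain ⟨n, hn⟩ : ∃ n, size x = n := ⟨_, rfl⟩
  induction n using Nat.strong_induction_on generalizing k l x with
  | _ n ih =>
    by_cases h0 : size x = 0
    · obtain ⟨rfl, σ, rfl⟩ := eq_of_size_eq_zero h0
      exact (hasWord_idn _).lact σ
    · exact hasWord_of_size_ne_zero hV hA hx h0 fun y hy hy' => ih _ (hn ▸ hy) hy' rfl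

end MarkedGraph.Class

end GraphProP

namespace GraphProP

namespace MarkedGraph.Class

variable {D : Type u} {P : SetProP.{w}} {k l m n k' l' m' : ℕ}
  {A : ∀ k l, Set (((markedGraphs D).prod P).obj k l)}
  {V : ∀ k l, Set ((markedGraphs D).obj k l)}

/-! ### Words with the same class have the same value -/

theorem word_hcomp_idn {x : (markedGraphs D).obj k l} {p : P.obj k l}
    (h : ((markedGraphs D).prod P).Word A (x, p)) (n : ℕ) : ((markedGraphs D).prod P).Word A
      ((markedGraphs D).hcomp x ((markedGraphs D).idn n), P.hcomp p (P.idn n)) := by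
  have := h.hcomp_idn n
  rwa [SetProP.idn_prod] at this

theorem word_idn_hcomp {x : (markedGraphs D).obj k l} {p : P.obj k l}
    (h : ((markedGraphs D).prod P).Word A (x, p)) (n : ℕ) : ((markedGraphs D).prod P).Word A
      ((markedGraphs D).hcomp ((markedGraphs D).idn n) x, P.hcomp (P.idn n) p) := by
  have := h.idn_hcomp n
  rwa [SetProP.idn_prod] at this

/-- Generators are indecomposable, so they have positive size, and a word of size zero has no layer.
-/
theorem eq_perm_of_size_eq_zero (hA : IsGenerating V A) {z : ((markedGraphs D).prod P).obj k l}
    (h : ((markedGraphs D).prod P).Word A z) (h0 : size z.1 = 0) :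
    ∃ (hl : k = l) (σ : Perm (Fin l)), z = ((markedGraphs D).prod P).lact σ
      (recast ((markedGraphs D).prod P).obj rfl hl (((markedGraphs D).prod P).idn k)) := by
  cases h with
  | perm σ => exact ⟨rfl, σ, rfl⟩
  | @layer a b n y hy w hw σ =>
    have h2 : 0 < size y.1 := (hA.indec hy).size_pos
    change size ((markedGraphs D).lact σ ((markedGraphs D).vcomp
      ((markedGraphs D).hcomp y.1 _) w.1)) = 0 at h0
    rw [size_lact, size_vcomp, size_hcomp] at h0
    omega

/-- The three cases are those of words with no layer, with one layer, and with at least two. In the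
last case the top layer and the rest are the two factors. -/
theorem word_cases (hA : IsGenerating V A) {z : ((markedGraphs D).prod P).obj k l}
    (h : ((markedGraphs D).prod P).Word A z) :
    (size z.1 = 0 ∧ ∃ (hl : k = l) (σ : Perm (Fin l)), z = ((markedGraphs D).prod P).lact σ
      (recast ((markedGraphs D).prod P).obj rfl hl (((markedGraphs D).prod P).idn k))) ∨
    (∃ (a b n : ℕ) (hk : a + n = k) (hl : b + n = l) (y : ((markedGraphs D).prod P).obj a b)
      (σ : Perm (Fin (b + n))) (τ : Perm (Fin (a + n))), y ∈ A a b ∧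
      z = recast ((markedGraphs D).prod P).obj hk hl (((markedGraphs D).prod P).lact σ
        (((markedGraphs D).prod P).ract τ
          (((markedGraphs D).prod P).hcomp y (((markedGraphs D).prod P).idn n))))) ∨
    ∃ (m : ℕ) (u : ((markedGraphs D).prod P).obj m l) (v : ((markedGraphs D).prod P).obj k m),
      ((markedGraphs D).prod P).Word A u ∧ ((markedGraphs D).prod P).Word A v ∧
      z = ((markedGraphs D).prod P).vcomp u v ∧ 0 < size u.1 ∧ 0 < size v.1 := by
  cases h with
  | perm σ =>
    refine .inl ⟨?_, rfl, σ, rfl⟩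
    change size ((markedGraphs D).lact σ (((markedGraphs D).prod P).idn k).1) = 0
    rw [SetProP.idn_prod, size_lact, size_idn]
  | @layer a b n y hy w hw σ =>
    have h1 : 0 < size y.1 := (hA.indec hy).size_pos
    -- If nothing but a permutation lies under the top layer, this permutation is turned into a
    -- right action on the layer.
    rcases Nat.eq_zero_or_pos (size w.1) with h0 | h0
    · refine .inr (.inl ?_)
      obtain ⟨rfl, τ, rfl⟩ := eq_perm_of_size_eq_zero hA hw h0
      refine ⟨a, b, n, rfl, rfl, y, σ, τ, hy, ?_⟩
      rw [recast_rfl, recast_rfl, ← SetProP.ract_idn, ← SetProP.ract_vcomp, SetProP.vcomp_idn]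
    · refine .inr (.inr ⟨_, _, w, (SetProP.Word.of_mem hy).hcomp_idn n |>.lact σ, hw,
        SetProP.lact_vcomp _ _ _ _, ?_, h0⟩)
      change 0 < size ((markedGraphs D).lact σ ((markedGraphs D).hcomp y.1 _))
      rw [size_lact, size_hcomp]
      omega

/-- The element `p` is the value of a word, which is cut in two words according to the colouring
`y`. -/
def IsValue (A : ∀ k l, Set (((markedGraphs D).prod P).obj k l))
    (y : (markedGraphs (D × Bool)).obj k l) (p : P.obj k l) : Prop :=
  ∃ (m : ℕ) (a : ((markedGraphs D).prod P).obj m l) (b : ((markedGraphs D).prod P).obj k m),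
    ((markedGraphs D).prod P).Word A a ∧ ((markedGraphs D).prod P).Word A b ∧
    y = (markedGraphs (D × Bool)).vcomp (map (·, true) a.1) (map (·, false) b.1) ∧
    p = P.vcomp a.2 b.2

/-- The words of size less than `N` are determined by their class. -/
def UniqueBelow (V : ∀ k l, Set ((markedGraphs D).obj k l))
    (A : ∀ k l, Set (((markedGraphs D).prod P).obj k l)) (N : ℕ) : Prop :=
  ∀ {k l : ℕ} {x : (markedGraphs D).obj k l} {p p' : P.obj k l}, size x < N → x ∈ V k l →
    ((markedGraphs D).prod P).Word A (x, p) → ((markedGraphs D).prod P).Word A (x, p') → p = p'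

/-- Two cuts with the same colouring differ by a permutation `π` of the glued edges. Both colours
occur, so both halves are smaller than the whole and their values are unique by induction; then `π`
and its inverse cancel in `P`. -/
theorem IsValue.unique (hV : FactorClosed V) {y : (markedGraphs (D × Bool)).obj k l}
    (hU : UniqueBelow V A (size y)) (hy : map Prod.fst y ∈ V k l)
    (ht : HasMark (fun d => d.2 = true) y) (hf : HasMark (fun d => d.2 = false) y) {p p' : P.obj k l}
    (h : IsValue A y p) (h' : IsValue A y p') : p = p' := by
  obtain ⟨m, ⟨a, pa⟩, ⟨b, pb⟩, ha, hb, rfl, rfl⟩ := h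
  obtain ⟨m', ⟨a', pa'⟩, ⟨b', pb'⟩, ha', hb', e, rfl⟩ := h'
  dsimp only at e ht hf hU hy ⊢
  obtain ⟨rfl, π, rfl, rfl⟩ := cut_unique e
  rw [hasMark_cut_true] at ht
  rw [hasMark_cut_false] at hf
  rw [map_fst_cut] at hy
  rw [recast_rfl] at ha' hb'
  have hs : size ((markedGraphs (D × Bool)).vcomp (map (·, true) a) (map (·, false) b)) =
      size a + size b := by rw [size_vcomp, size_map, size_map]
  have h1 : P.ract π⁻¹ pa = pa' := hU (by rw [size_ract]; omega) (hV.ract _ (hV.vcomp hy).1)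
    (ha.ract π⁻¹) ha'
  have h2 : P.lact π pb = pb' := hU (by rw [size_lact]; omega) (hV.lact _ (hV.vcomp hy).2)
    (hb.lact π) hb'
  rw [← h1, ← h2, SetProP.ract_vcomp_lact_inv]

/-- Two nested colourings have a common value. -/
theorem exists_isValue_of_nested (hV : FactorClosed V) (hA : IsGenerating V A)
    {z : (markedGraphs (D × Bool × Bool)).obj k l} (hz : map Prod.fst z ∈ V k l)
    (h1 : StepRel (fun d d' => d.2.1 = true → d'.2.1 = true) z)
    (h2 : StepRel (fun d d' => d.2.2 = true → d'.2.2 = true) z)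
    (h : ¬ HasMark (fun d => d.2.1 = true ∧ d.2.2 = false) z) :
    ∃ p, IsValue A (map (fun d => (d.1, d.2.1)) z) p ∧
      IsValue A (map (fun d => (d.1, d.2.2)) z) p := by
  -- The first colour is put outermost, so that the cut along it leaves two parts which still carry
  -- the second colour.
  obtain ⟨z', rfl⟩ : ∃ z' : (markedGraphs ((D × Bool) × Bool)).obj k l,
      map (fun d => (d.1.1, d.2, d.1.2)) z' = z :=
    ⟨map (fun d => ((d.1, d.2.2), d.2.1)) z, by rw [map_map]; exact map_id z⟩
  rw [map_map] at hz
  rw [stepRel_map] at h1 h2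
  rw [hasMark_map] at h
  obtain ⟨m, a, b, rfl⟩ := exists_cut h1
  have h2' := h2.right
  rw [stepRel_map] at h2'
  obtain ⟨m', b₁, b₀, rfl⟩ := exists_cut h2'
  -- By `h`, the second colour is true wherever the first one is, so it is constant on the upper
  -- part.
  obtain ⟨a, rfl⟩ : ∃ a', a = map (·, true) a' := by
    refine ⟨map Prod.fst a, ?_⟩
    rw [map_map]
    refine (map_id a).symm.trans (map_congr fun H => h ?_)
    rw [hasMark_vcomp, hasMark_map]
    refine .inl (H.imp fun d hd => ⟨rfl, ?_⟩)
    by_contra hne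
    exact hd (Prod.ext rfl ((Bool.not_eq_false _).mp hne))
  have hx : (markedGraphs D).vcomp a ((markedGraphs D).vcomp b₁ b₀) ∈ V k l := by
    simp only [map_vcomp, map_map] at hz
    convert hz <;> exact (map_id _).symm
  obtain ⟨pa, hpa⟩ := hasWord hV hA (hV.vcomp hx).1
  obtain ⟨p₁, hp₁⟩ := hasWord hV hA (hV.vcomp (hV.vcomp hx).2).1
  obtain ⟨p₀, hp₀⟩ := hasWord hV hA (hV.vcomp (hV.vcomp hx).2).2
  -- The graph is now cut in three, with `a` above `b₁` above `b₀`. The first colouring brackets the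
  -- product as `a ∘ (b₁ ∘ b₀)` and the second as `(a ∘ b₁) ∘ b₀`.
  refine ⟨P.vcomp pa (P.vcomp p₁ p₀), ⟨m, (a, pa), _, hpa, hp₁.vcomp hp₀, ?_, rfl⟩,
    ⟨m', _, (b₀, p₀), hpa.vcomp hp₁, hp₀, ?_, SetProP.vcomp_assoc _ _ _ _⟩⟩
  · simp only [map_vcomp, map_map]
    exact congrArg _ (map_vcomp _ _ _).symm
  · simp only [map_vcomp, map_map]
    refine (SetProP.vcomp_assoc _ _ _ _).trans ?_
    exact congrArg (fun t => (markedGraphs (D × Bool)).vcomp t _) (map_vcomp _ _ _).symm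

/-- Two complementary colourings have a common value. -/
theorem exists_isValue_of_compl (hV : FactorClosed V) (hA : IsGenerating V A)
    {y : (markedGraphs (D × Bool)).obj k l} (hy : map Prod.fst y ∈ V k l)
    (h : StepRel (fun d d' => d.2 = d'.2) y) :
    ∃ p, IsValue A y p ∧ IsValue A (map (fun d => (d.1, !d.2)) y) p := by
  obtain ⟨k₁, l₁, k₂, l₂, rfl, rfl, B, c, σ, τ, -, rfl⟩ := exists_split h
  generalize mk B = b at *
  rw [recast_rfl, map_fst_split] at hy
  have hbc := hV.hcomp (hV.of_ract (hV.of_lact hy))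
  obtain ⟨pb, hb⟩ := hasWord hV hA hbc.1
  obtain ⟨pc, hc⟩ := hasWord hV hA hbc.2
  -- The value of the disjoint union is obtained from either stacking, `b` above `c` or `c` above
  -- `b`. These are the cuts of the colouring and of its negation.
  refine ⟨P.lact σ (P.ract τ (P.hcomp pb pc)),
    ⟨_, _, _, (word_hcomp_idn hb l₂).lact σ, (word_idn_hcomp hc k₁).ract τ, ?_, ?_⟩,
    ⟨_, _, _, (word_idn_hcomp hc l₁).lact σ, (word_hcomp_idn hb k₂).ract τ, ?_, ?_⟩⟩
  · change _ = (markedGraphs (D × Bool)).vcomp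
      (map (·, true) ((markedGraphs D).lact σ ((markedGraphs D).hcomp b _)))
      (map (·, false) ((markedGraphs D).ract τ ((markedGraphs D).hcomp _ c)))
    rw [recast_rfl, SetProP.hcomp_eq_vcomp, map_lact, map_ract, map_hcomp, map_hcomp, map_idn,
      map_idn, SetProP.ract_vcomp, SetProP.lact_vcomp]
  · change _ = P.vcomp (P.lact σ _) (P.ract τ _)
    rw [SetProP.hcomp_eq_vcomp, SetProP.ract_vcomp, SetProP.lact_vcomp]
  · change _ = (markedGraphs (D × Bool)).vcomp
      (map (·, true) ((markedGraphs D).lact σ ((markedGraphs D).hcomp _ c)))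
      (map (·, false) ((markedGraphs D).ract τ ((markedGraphs D).hcomp b _)))
    rw [recast_rfl, SetProP.hcomp_eq_vcomp', map_lact, map_ract, map_vcomp, map_hcomp, map_hcomp,
      map_idn, map_idn, map_lact, map_ract, map_hcomp, map_hcomp, map_idn, map_idn, map_map,
      map_map, SetProP.ract_vcomp, SetProP.lact_vcomp]
    rfl
  · change _ = P.vcomp (P.lact σ _) (P.ract τ _)
    rw [SetProP.hcomp_eq_vcomp', SetProP.ract_vcomp, SetProP.lact_vcomp]

/-- Two cuts are compared through a third one which is comparable with both, namely their meet or
their join. When the meet is empty and the join is everything, the colourings are complementary and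
the graph is disconnected along them. -/
theorem IsValue.eq (hV : FactorClosed V) (hA : IsGenerating V A)
    {y y' : (markedGraphs (D × Bool)).obj k l} (hU : UniqueBelow V A (size y))
    (hy : map Prod.fst y ∈ V k l) (hyy : map Prod.fst y = map Prod.fst y')
    (hs : StepRel (fun d d' => d.2 = true → d'.2 = true) y)
    (hs' : StepRel (fun d d' => d.2 = true → d'.2 = true) y')
    (ht : HasMark (fun d => d.2 = true) y) (hf : HasMark (fun d => d.2 = false) y)
    (ht' : HasMark (fun d => d.2 = true) y') (hf' : HasMark (fun d => d.2 = false) y')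
    {p p' : P.obj k l} (h : IsValue A y p) (h' : IsValue A y' p') : p = p' := by
  obtain ⟨z, rfl, rfl⟩ := exists_joint hyy
  rw [size_map] at hU
  rw [map_map] at hy
  rw [stepRel_map] at hs hs'
  rw [hasMark_map] at ht ht' hf hf'
  -- All the colourings in play are functions of the pair of colours, so uniqueness and comparison
  -- are stated once for such functions.
  have uniq : ∀ (f : Bool × Bool → Bool), HasMark (fun d => f d.2 = true) z →
      HasMark (fun d => f d.2 = false) z → ∀ {p p'}, IsValue A (map (fun d => (d.1, f d.2)) z) p →
      IsValue A (map (fun d => (d.1, f d.2)) z) p' → p = p' := by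
    intro f h1 h2 p p' h h'
    refine IsValue.unique hV (by rwa [size_map]) (by rwa [map_map]) ?_ ?_ h h' <;> rwa [hasMark_map]
  have nested : ∀ (f g : Bool × Bool → Bool), (∀ c, f c = true → g c = true) →
      StepRel (fun d d' => f d.2 = true → f d'.2 = true) z →
      StepRel (fun d d' => g d.2 = true → g d'.2 = true) z →
      ∃ p, IsValue A (map (fun d => (d.1, f d.2)) z) p ∧
        IsValue A (map (fun d => (d.1, g d.2)) z) p := by
    intro f g hfg h1 h2
    obtain ⟨p, h3, h4⟩ := exists_isValue_of_nested hV hA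
      (z := map (fun d => (d.1, f d.2, g d.2)) z) (by rwa [map_map]) (by rwa [stepRel_map])
      (by rwa [stepRel_map]) (by
        rw [hasMark_map]
        intro H
        obtain ⟨G, rfl⟩ := mk_surjective z
        obtain ⟨x, h1, h2⟩ := H
        dsimp only at h1 h2
        rw [hfg _ h1] at h2
        cases h2)
    rw [map_map] at h3 h4
    exact ⟨p, h3, h4⟩
  by_cases hi : HasMark (fun d => (d.2.1 && d.2.2) = true) z
  · have hs3 : StepRel (fun d d' => (d.2.1 && d.2.2) = true → (d'.2.1 && d'.2.2) = true) z :=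
      (hs.and hs').imp fun d d' h => by simp only [Bool.and_eq_true]; exact fun H => ⟨h.1 H.1, h.2 H.2⟩
    obtain ⟨q, h1, h2⟩ := nested (fun c => c.1 && c.2) (fun c => c.1)
      (fun c => by simp only [Bool.and_eq_true]; exact And.left) hs3 hs
    obtain ⟨q', h1', h2'⟩ := nested (fun c => c.1 && c.2) (fun c => c.2)
      (fun c => by simp only [Bool.and_eq_true]; exact And.right) hs3 hs'
    -- The meet takes the value true by `hi`, and the value false wherever the first colour does.
    have e := uniq (fun c => c.1 && c.2) hi
      (hf.imp fun d h => by simp only [Bool.and_eq_false_iff]; exact .inl h) h1 h1'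
    exact (uniq _ ht hf h h2).trans (e.trans (uniq _ ht' hf' h' h2').symm)
  by_cases hu : HasMark (fun d => (d.2.1 || d.2.2) = false) z
  · have hs3 : StepRel (fun d d' => (d.2.1 || d.2.2) = true → (d'.2.1 || d'.2.2) = true) z :=
      (hs.and hs').imp fun d d' h => by simp only [Bool.or_eq_true]; exact Or.imp h.1 h.2
    obtain ⟨q, h1, h2⟩ := nested (fun c => c.1) (fun c => c.1 || c.2)
      (fun c => by simp only [Bool.or_eq_true]; exact .inl) hs hs3
    obtain ⟨q', h1', h2'⟩ := nested (fun c => c.2) (fun c => c.1 || c.2)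
      (fun c => by simp only [Bool.or_eq_true]; exact .inr) hs' hs3
    have e := uniq (fun c => c.1 || c.2)
      (ht.imp fun d h => by simp only [Bool.or_eq_true]; exact .inl h) hu h2 h2'
    exact (uniq _ ht hf h h1).trans (e.trans (uniq _ ht' hf' h' h1').symm)
  -- No mark has both colours true and none has both false, so the second colour is the negation of
  -- the first.
  have hc : ¬ HasMark (fun d => d.2.2 ≠ !d.2.1) z := by
    obtain ⟨G, rfl⟩ := mk_surjective z
    rintro ⟨x, hx⟩
    rw [hasMark_mk, not_exists] at hi hu
    have hi := hi x
    have hu := hu x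
    revert hi hu hx
    rcases (G.dec x).2 with ⟨_ | _, _ | _⟩ <;> simp
  -- A colouring which is nondecreasing along the edges, and whose negation is too, is constant
  -- along them.
  have hse : StepRel (fun d d' => d.2.1 = d'.2.1) z := by
    obtain ⟨G, rfl⟩ := mk_surjective z
    intro e
    have hcs : ∀ x, (G.dec x).2.2 = !(G.dec x).2.1 := by
      rw [hasMark_mk, not_exists] at hc
      exact fun x => by_contra fun H => hc x H
    have h1 := hs e
    have h2 := hs' e
    dsimp only at h1 h2
    rw [hcs, hcs] at h2
    revert h1 h2
    rcases (G.dec (.inl (G.s (.inl e)))).2.1 <;> rcases (G.dec (.inl (G.t (.inl e)))).2.1 <;> simp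
  obtain ⟨q, h1, h2⟩ := exists_isValue_of_compl hV hA
    (y := map (fun d => (d.1, d.2.1)) z) (by rwa [map_map]) (by rwa [stepRel_map])
  rw [map_map] at h2
  have e : map (fun d => (d.1, !d.2.1)) z = map (fun d => (d.1, d.2.2)) z :=
    map_congr fun H => hc (H.imp fun d h => fun H => h (Prod.ext rfl H.symm))
  rw [e] at h2
  exact (uniq _ ht hf h h1).trans (uniq _ ht' hf' h' h2).symm

/-- The value of a layer is determined by its class. -/
theorem layer_unique (hA : IsGenerating V A) {a b n a' b' n' : ℕ}
    {y : ((markedGraphs D).prod P).obj a b} {y' : ((markedGraphs D).prod P).obj a' b'}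
    (hy : y ∈ A a b) (hy' : y' ∈ A a' b') (hk : a' + n' = a + n) (hl : b' + n' = b + n)
    {σ : Perm (Fin (b + n))} {σ' : Perm (Fin (b' + n'))} {τ : Perm (Fin (a + n))}
    {τ' : Perm (Fin (a' + n'))}
    (h : (markedGraphs D).lact σ ((markedGraphs D).ract τ
        ((markedGraphs D).hcomp y.1 ((markedGraphs D).idn n))) =
      recast (markedGraphs D).obj hk hl ((markedGraphs D).lact σ' ((markedGraphs D).ract τ'
        ((markedGraphs D).hcomp y'.1 ((markedGraphs D).idn n'))))) :
    P.lact σ (P.ract τ (P.hcomp y.2 (P.idn n))) =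
      recast P.obj hk hl (P.lact σ' (P.ract τ' (P.hcomp y'.2 (P.idn n')))) := by
  obtain ⟨rfl, rfl, rfl⟩ := (hA.indec hy).hcomp_idn_eq (hA.indec hy') hk hl h
  rw [recast_rfl] at h ⊢
  obtain ⟨ρ, ρ', ν, e, rfl, rfl⟩ := (hA.indec hy).hcomp_idn_unique (hA.indec hy') h
  -- Generators are functional and stable under the actions, so the value attached to the second
  -- generator is forced by that of the first.
  obtain rfl := hA.eq_of_fst_eq hy' (hA.lact ρ (hA.ract ρ' hy)) e
  exact P.lact_ract_hcomp_idn σ' ρ ν ρ' τ' y.2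

/-- The value of a word is determined by its class. -/
theorem word_unique (hV : FactorClosed V) (hA : IsGenerating V A) {x : (markedGraphs D).obj k l}
    (hx : x ∈ V k l) {p p' : P.obj k l} (h : ((markedGraphs D).prod P).Word A (x, p))
    (h' : ((markedGraphs D).prod P).Word A (x, p')) : p = p' := by
  obtain ⟨N, hN⟩ : ∃ N, size x = N := ⟨_, rfl⟩
  induction N using Nat.strong_induction_on generalizing k l x with
  | _ N ih =>
    have hU : UniqueBelow V A N := fun hs hx h h' => ih _ hs hx h h' rfl
    by_cases h0 : size x = 0
    · obtain ⟨rfl, σ, e⟩ := eq_perm_of_size_eq_zero hA h h0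
      obtain ⟨_, σ', e'⟩ := eq_perm_of_size_eq_zero hA h' h0
      rw [recast_rfl, SetProP.idn_prod] at e e'
      have e1 : x = (markedGraphs D).lact σ ((markedGraphs D).idn k) := congrArg Prod.fst e
      have e1' : x = (markedGraphs D).lact σ' ((markedGraphs D).idn k) := congrArg Prod.fst e'
      obtain rfl := lact_idn_injective (e1.symm.trans e1')
      exact congrArg Prod.snd (e.trans e'.symm)
    -- One word with a single layer and another with at least two cannot have the same class, by
    -- `Indec.layer_eq_vcomp`.
    have mixed : ∀ {p p' : P.obj k l}, (∃ (a b n : ℕ) (hk : a + n = k) (hl : b + n = l)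
        (y : ((markedGraphs D).prod P).obj a b) (σ : Perm (Fin (b + n))) (τ : Perm (Fin (a + n))),
        y ∈ A a b ∧ (x, p) = recast ((markedGraphs D).prod P).obj hk hl
          (((markedGraphs D).prod P).lact σ (((markedGraphs D).prod P).ract τ
            (((markedGraphs D).prod P).hcomp y (((markedGraphs D).prod P).idn n))))) →
        (∃ (m : ℕ) (u : ((markedGraphs D).prod P).obj m l) (v : ((markedGraphs D).prod P).obj k m),
          ((markedGraphs D).prod P).Word A u ∧ ((markedGraphs D).prod P).Word A v ∧
          (x, p') = ((markedGraphs D).prod P).vcomp u v ∧ 0 < size u.1 ∧ 0 < size v.1) → False := by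
      rintro p p' ⟨a, b, n, rfl, rfl, y, σ, τ, hy, e⟩ ⟨m, u, v, -, -, e', hu, hv⟩
      rw [recast_rfl, SetProP.idn_prod] at e
      have := (hA.indec hy).layer_eq_vcomp ((congrArg Prod.fst e).symm.trans (congrArg Prod.fst e'))
      omega
    rcases word_cases hA h with ⟨h0', -⟩ | h1 | h1
    · exact (h0 h0').elim
    · rcases word_cases hA h' with ⟨h0', -⟩ | h2 | h2
      · exact (h0 h0').elim
      · obtain ⟨a, b, n, rfl, rfl, y, σ, τ, hy, e⟩ := h1
        obtain ⟨a', b', n', hk, hl, y', σ', τ', hy', e'⟩ := h2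
        rw [recast_rfl, SetProP.idn_prod] at e
        rw [SetProP.idn_prod] at e'
        have e1 := e'.trans (recast_prod (F := (markedGraphs D).obj) (F' := P.obj) hk hl _)
        exact (congrArg Prod.snd e).trans ((layer_unique hA hy hy' hk hl
          ((congrArg Prod.fst e).symm.trans (congrArg Prod.fst e1))).trans
            (congrArg Prod.snd e1).symm)
      · exact (mixed h1 h2).elim
    · rcases word_cases hA h' with ⟨h0', -⟩ | h2 | h2
      · exact (h0 h0').elim
      · exact (mixed h2 h1).elim
      · obtain ⟨m, u, v, hu, hv, e, hu0, hv0⟩ := h1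
        obtain ⟨m', u', v', hu', hv', e', hu0', hv0'⟩ := h2
        have e1 : x = (markedGraphs D).vcomp u.1 v.1 := congrArg Prod.fst e
        have e1' : x = (markedGraphs D).vcomp u'.1 v'.1 := congrArg Prod.fst e'
        refine IsValue.eq hV hA (y := (markedGraphs (D × Bool)).vcomp (map (·, true) u.1)
          (map (·, false) v.1)) (y' := (markedGraphs (D × Bool)).vcomp (map (·, true) u'.1)
          (map (·, false) v'.1)) ?_ ?_ ?_ (stepRel_cut _ _) (stepRel_cut _ _)
          (hasMark_cut_true.2 hu0) (hasMark_cut_false.2 hv0) (hasMark_cut_true.2 hu0')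
          (hasMark_cut_false.2 hv0') ⟨m, u, v, hu, hv, rfl, congrArg Prod.snd e⟩
          ⟨m', u', v', hu', hv', rfl, congrArg Prod.snd e'⟩
        · rw [size_vcomp, size_map, size_map, ← size_vcomp, ← e1, hN]
          exact hU
        · rwa [map_fst_cut, ← e1]
        · rw [map_fst_cut, map_fst_cut, ← e1, ← e1']

end MarkedGraph.Class

end GraphProP

namespace GraphProP

/-! ### Free ProPs in sets -/

namespace SetProP

variable {S : SetProP.{w}}

/-- The sub-ProP of all the elements. -/
def SubProP.univ (S : SetProP.{w}) : S.SubProP where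
  set _ _ := Set.univ
  lact_mem _ _ _ := trivial
  ract_mem _ _ _ := trivial
  hcomp_mem _ _ := trivial
  vcomp_mem _ _ := trivial
  unit₀_mem := trivial
  unit₁_mem := trivial

/-- The map `Ψ` restricts to a morphism from the sub-ProP `B` to the ProP `P`. -/
structure IsHomOn (B : S.SubProP) (P : SetProP.{w'}) (Ψ : ∀ k l, S.obj k l → P.obj k l) :
    Prop where
  map_lact : ∀ {k l : ℕ} (σ : Perm (Fin l)) {x : S.obj k l}, x ∈ B.set k l →
    Ψ k l (S.lact σ x) = P.lact σ (Ψ k l x)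
  map_ract : ∀ {k l : ℕ} (τ : Perm (Fin k)) {x : S.obj k l}, x ∈ B.set k l →
    Ψ k l (S.ract τ x) = P.ract τ (Ψ k l x)
  map_hcomp : ∀ {k l k' l' : ℕ} {x : S.obj k l} {y : S.obj k' l'}, x ∈ B.set k l →
    y ∈ B.set k' l' → Ψ _ _ (S.hcomp x y) = P.hcomp (Ψ k l x) (Ψ k' l' y)
  map_vcomp : ∀ {k l m : ℕ} {x : S.obj l m} {y : S.obj k l}, x ∈ B.set l m →
    y ∈ B.set k l → Ψ _ _ (S.vcomp x y) = P.vcomp (Ψ l m x) (Ψ k l y)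
  map_unit₀ : Ψ 0 0 S.unit₀ = P.unit₀
  map_unit₁ : Ψ 1 1 S.unit₁ = P.unit₁

theorem SubProP.idn_mem (B : S.SubProP) (n : ℕ) : S.idn n ∈ B.set n n := by
  induction n with
  | zero => exact B.unit₀_mem
  | succ n ih => exact B.hcomp_mem ih B.unit₁_mem

theorem IsHomOn.map_idn {B : S.SubProP} {P : SetProP.{w'}} {Ψ : ∀ k l, S.obj k l → P.obj k l}
    (h : IsHomOn B P Ψ) (n : ℕ) : Ψ n n (S.idn n) = P.idn n := by
  induction n with
  | zero => exact h.map_unit₀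
  | succ n ih =>
    refine (h.map_hcomp (B.idn_mem n) B.unit₁_mem).trans ?_
    rw [ih, h.map_unit₁]; rfl

/-- The map `f` restricts to an equivariant map from the stable family `I` to the ProP `P`. -/
structure IsEquivariantOn (I : S.StableSet) (P : SetProP.{w'}) (f : ∀ k l, S.obj k l → P.obj k l) :
    Prop where
  map_lact : ∀ {k l : ℕ} (σ : Perm (Fin l)) {x : S.obj k l}, x ∈ I.set k l →
    f k l (S.lact σ x) = P.lact σ (f k l x)
  map_ract : ∀ {k l : ℕ} (τ : Perm (Fin k)) {x : S.obj k l}, x ∈ I.set k l →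
    f k l (S.ract τ x) = P.ract τ (f k l x)

/-- The sub-ProP `B` is free on the stable family `I`, among the ProPs in sets. -/
structure SubProP.IsFreeOn (B : S.SubProP) (I : S.StableSet) : Prop where
  subset : ∀ k l, I.set k l ⊆ B.set k l
  exists_hom : ∀ (P : SetProP.{w'}) (f : ∀ k l, S.obj k l → P.obj k l), IsEquivariantOn I P f →
    ∃ Ψ : ∀ k l, S.obj k l → P.obj k l, IsHomOn B P Ψ ∧ ∀ k l, ∀ x ∈ I.set k l, Ψ k l x = f k l x
  unique : ∀ (P : SetProP.{w'}) (Ψ Ψ' : ∀ k l, S.obj k l → P.obj k l), IsHomOn B P Ψ →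
    IsHomOn B P Ψ' → (∀ k l, ∀ x ∈ I.set k l, Ψ k l x = Ψ' k l x) →
    ∀ k l, ∀ x ∈ B.set k l, Ψ k l x = Ψ' k l x

open MarkedGraph.Class in
/-- A sub-ProP which embeds into marked graphs, with a factor closed image, is free on its
indecomposable elements. -/
theorem SubProP.isFreeOn_of_embedding {D : Type u} {B : S.SubProP} {I : S.StableSet}
    {ι : ∀ k l, S.obj k l → (markedGraphs D).obj k l} (hι : IsHomOn B (markedGraphs D) ι)
    (inj : ∀ k l, Set.InjOn (ι k l) (B.set k l)) (hV : FactorClosed fun k l => ι k l '' B.set k l)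
    (subset : ∀ k l, I.set k l ⊆ B.set k l)
    (hI : ∀ {k l} {x : S.obj k l}, x ∈ B.set k l → (x ∈ I.set k l ↔ Indec (ι k l x))) :
    B.IsFreeOn.{w, w'} I := by
  -- The generators are the pairs `(ι x, f x)` with `x` in `I`. They are functional because `ι` is
  -- injective on `B`.
  have gen : ∀ (P : SetProP.{w'}) (f : ∀ k l, S.obj k l → P.obj k l), IsEquivariantOn I P f →
      IsGenerating (P := P) (fun k l => ι k l '' B.set k l)
        (fun k l => (fun x => (ι k l x, f k l x)) '' I.set k l) := by
    intro P f hf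
    refine ⟨?_, ?_, ?_, ?_, ?_⟩
    · rintro k l σ _ ⟨x, hx, rfl⟩
      exact ⟨_, I.lact_mem σ hx, Prod.ext (hι.map_lact σ (subset _ _ hx)) (hf.map_lact σ hx)⟩
    · rintro k l τ _ ⟨x, hx, rfl⟩
      exact ⟨_, I.ract_mem τ hx, Prod.ext (hι.map_ract τ (subset _ _ hx)) (hf.map_ract τ hx)⟩
    · rintro k l _ _ ⟨x, hx, rfl⟩ ⟨y, hy, rfl⟩ h
      rw [inj k l (subset _ _ hx) (subset _ _ hy) h]
    · rintro k l _ ⟨x, hx, rfl⟩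
      exact (hI (subset _ _ hx)).1 hx
    · rintro k l _ ⟨x, hx, rfl⟩ h
      exact ⟨_, x, (hI hx).2 h, rfl⟩
  refine ⟨subset, ?_, ?_⟩
  · intro P f hf
    have hA := gen P f hf
    -- `Ψ` must be defined on all of `S`, but its values outside `B` play no role; `f` is used
    -- there.
    have ex : ∀ k l (x : S.obj k l), ∃ p, x ∈ B.set k l → ((markedGraphs D).prod P).Word
        (fun k l => (fun x => (ι k l x, f k l x)) '' I.set k l) (ι k l x, p) := by
      intro k l x
      by_cases hx : x ∈ B.set k l
      · obtain ⟨p, hp⟩ := hasWord hV hA ⟨x, hx, rfl⟩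
        exact ⟨p, fun _ => hp⟩
      · exact ⟨f k l x, fun h => (hx h).elim⟩
    choose Ψ hΨ using ex
    have eq : ∀ {k l} {x : S.obj k l} {p : P.obj k l}, x ∈ B.set k l →
        ((markedGraphs D).prod P).Word
        (fun k l => (fun x => (ι k l x, f k l x)) '' I.set k l) (ι k l x, p) → Ψ k l x = p :=
      fun hx h => word_unique hV hA ⟨_, hx, rfl⟩ (hΨ _ _ _ hx) h
    refine ⟨Ψ, ⟨?_, ?_, ?_, ?_, ?_, ?_⟩, ?_⟩
    · intro k l σ x hx
      exact eq (B.lact_mem σ hx) (hι.map_lact σ hx ▸ (hΨ _ _ _ hx).lact σ)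
    · intro k l τ x hx
      exact eq (B.ract_mem τ hx) (hι.map_ract τ hx ▸ (hΨ _ _ _ hx).ract τ)
    · intro k l k' l' x y hx hy
      exact eq (B.hcomp_mem hx hy) (hι.map_hcomp hx hy ▸ (hΨ _ _ _ hx).hcomp (hΨ _ _ _ hy))
    · intro k l m x y hx hy
      exact eq (B.vcomp_mem hx hy) (hι.map_vcomp hx hy ▸ (hΨ _ _ _ hx).vcomp (hΨ _ _ _ hy))
    · refine eq B.unit₀_mem (hι.map_unit₀ ▸ ?_)
      exact word_idn (S := (markedGraphs D).prod P) 0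
    · refine eq B.unit₁_mem (hι.map_unit₁ ▸ ?_)
      have h := word_idn (S := (markedGraphs D).prod P)
        (A := fun k l => (fun x => (ι k l x, f k l x)) '' I.set k l) (0 + 1)
      -- The identity on one strand is defined as `I_0 * I_1`, which has to be identified with
      -- `I_1`.
      have e : ((markedGraphs D).prod P).idn (0 + 1) = ((markedGraphs D).prod P).unit₁ := by
        exact ((markedGraphs D).prod P).unit₀_hcomp ((markedGraphs D).prod P).unit₁
      rw [e] at h
      exact h
    · intro k l x hx
      exact eq (subset _ _ hx) (Word.of_mem (S := (markedGraphs D).prod P) ⟨x, hx, rfl⟩)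
  · intro P Ψ Ψ' hΨ hΨ' h k l x hx
    have hA := gen P Ψ ⟨fun σ _ hx => hΨ.map_lact σ (subset _ _ hx),
      fun τ _ hx => hΨ.map_ract τ (subset _ _ hx)⟩
    -- Every word over the graph of `Ψ` on `I` lifts to an element of `B` on which any morphism that
    -- agrees with `Ψ` on `I` takes the value of the word. For one word over `x`, the injectivity of
    -- `ι` makes this element `x` itself, both for `Ψ` and for `Ψ'`.
    have key : ∀ {Ψ' : ∀ k l, S.obj k l → P.obj k l}, IsHomOn B P Ψ' →
        (∀ k l, ∀ x ∈ I.set k l, Ψ k l x = Ψ' k l x) →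
        ∀ {k l} {z : ((markedGraphs D).prod P).obj k l}, ((markedGraphs D).prod P).Word
        (fun k l => (fun x => (ι k l x, Ψ k l x)) '' I.set k l) z →
        ∃ b ∈ B.set k l, ι k l b = z.1 ∧ Ψ' k l b = z.2 := by
      intro Ψ' hΨ' h k l z hz
      induction hz with
      | perm σ =>
        rw [idn_prod]
        refine ⟨_, B.lact_mem σ (B.idn_mem _), ?_, ?_⟩
        · rw [hι.map_lact σ (B.idn_mem _), hι.map_idn]; rfl
        · rw [hΨ'.map_lact σ (B.idn_mem _), hΨ'.map_idn]; rfl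
      | @layer _ _ n g hg y hy σ ih =>
        obtain ⟨a, ha, rfl⟩ := hg
        obtain ⟨b, hb, e, e'⟩ := ih
        have m₁ := B.hcomp_mem (subset _ _ ha) (B.idn_mem n)
        have m₂ := B.vcomp_mem m₁ hb
        refine ⟨_, B.lact_mem σ m₂, ?_, ?_⟩
        · rw [hι.map_lact σ m₂, hι.map_vcomp m₁ hb, hι.map_hcomp (subset _ _ ha) (B.idn_mem _),
            hι.map_idn, e, idn_prod]
          rfl
        · rw [hΨ'.map_lact σ m₂, hΨ'.map_vcomp m₁ hb, hΨ'.map_hcomp (subset _ _ ha) (B.idn_mem _),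
            hΨ'.map_idn, e', idn_prod, ← h _ _ _ ha]
          rfl
    obtain ⟨p, hp⟩ := hasWord hV hA ⟨x, hx, rfl⟩
    obtain ⟨b, hb, e, rfl⟩ := key hΨ (fun _ _ _ _ => rfl) hp
    obtain ⟨b', hb', e', h'⟩ := key hΨ' h hp
    rw [inj _ _ hb hx e] at h'
    rw [inj _ _ hb' hx e'] at h'
    exact h'.symm

end SetProP

end GraphProP

namespace GraphProP

/-! ### Linearisation of free ProPs in sets -/

section

variable {K : Type v} [Field K] {S : SetProP.{w}}

theorem span_single_induction {A : Type w} {s : Set A} {p : (A →₀ K) → Prop} {x : A →₀ K}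
    (hx : x ∈ Submodule.span K ((fun a => Finsupp.single a (1 : K)) '' s))
    (single : ∀ a ∈ s, p (Finsupp.single a 1)) (zero : p 0) (add : ∀ x y, p x → p y → p (x + y))
    (smul : ∀ (c : K) x, p x → p (c • x)) : p x := by
  induction hx using Submodule.span_induction with
  | mem x hx => obtain ⟨a, ha, rfl⟩ := hx; exact single a ha
  | zero => exact zero
  | add x y _ _ hx hy => exact add x y hx hy
  | smul c x _ hx => exact smul c x hx

theorem ProP.Hom.ext_toFun {P : ProP.{v, w} K} {Q : ProP.{v, w'} K} {Φ Ψ : P.Hom Q}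
    (h : Φ.toFun = Ψ.toFun) : Φ = Ψ := by
  obtain ⟨⟨F, _, _⟩, _, _, _, _⟩ := Φ
  obtain ⟨⟨F', _, _⟩, _, _, _, _⟩ := Ψ
  dsimp only at h
  subst h
  rfl

open Finsupp in
/-- A ProP which is identified with the span of a free ProP in sets is free. -/
theorem SetProP.SubProP.IsFreeOn.of_hom {B : S.SubProP} {I : S.StableSet}
    (hB : B.IsFreeOn.{w, w'} I) {Q : ProP.{v, max v w} K} (π : Q.Hom (S.lin K))
    (inj : ∀ k l, Injective (π.toFun k l))
    (hrange : ∀ k l x, x ∈ (B.span K).carrier k l ↔ ∃ y, π.toFun k l y = x)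
    (M : Q.toSModule.Sub)
    (hM : ∀ k l y, y ∈ M.carrier k l ↔ π.toFun k l y ∈ (I.span K).carrier k l) :
    Q.IsFreeOn.{v, max v w, w'} M := by
  -- `Q` may be the span of `B` or the whole linearisation, so its basis is named through `π`: `e x`
  -- is the element over the basis vector of `x`. Outside `B` it is 0, a value never used. The
  -- injectivity of `π` then shows that `e` respects all the operations on `B`.
  have ex : ∀ k l (x : S.obj k l), ∃ y : Q.obj k l, x ∈ B.set k l →
      π.toFun k l y = single x (1 : K) := by
    intro k l x
    by_cases hx : x ∈ B.set k l
    · obtain ⟨y, hy⟩ := (hrange k l _).1 (Submodule.subset_span ⟨x, hx, rfl⟩)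
      exact ⟨y, fun _ => hy⟩
    · exact ⟨0, fun h => (hx h).elim⟩
  choose e he using ex
  have e_lact : ∀ {k l} (σ : Perm (Fin l)) {x : S.obj k l}, x ∈ B.set k l →
      e k l (S.lact σ x) = Q.lact σ (e k l x) := by
    intro k l σ x hx
    apply inj
    rw [he _ _ _ (B.lact_mem σ hx), π.map_lact, he _ _ _ hx]
    exact (lin₁_single _ _).symm
  have e_ract : ∀ {k l} (σ : Perm (Fin k)) {x : S.obj k l}, x ∈ B.set k l →
      e k l (S.ract σ x) = Q.ract σ (e k l x) := by
    intro k l σ x hx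
    apply inj
    rw [he _ _ _ (B.ract_mem σ hx), π.map_ract, he _ _ _ hx]
    exact (lin₁_single _ _).symm
  have e_hcomp : ∀ {k l k' l'} {x : S.obj k l} {y : S.obj k' l'}, x ∈ B.set k l →
      y ∈ B.set k' l' → e _ _ (S.hcomp x y) = Q.hcomp (e k l x) (e k' l' y) := by
    intro k l k' l' x y hx hy
    apply inj
    rw [he _ _ _ (B.hcomp_mem hx hy), π.map_hcomp, he _ _ _ hx, he _ _ _ hy]
    exact (lin₂_single _ _ _).symm
  have e_vcomp : ∀ {k l m} {x : S.obj l m} {y : S.obj k l}, x ∈ B.set l m →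
      y ∈ B.set k l → e _ _ (S.vcomp x y) = Q.vcomp (e l m x) (e k l y) := by
    intro k l m x y hx hy
    apply inj
    rw [he _ _ _ (B.vcomp_mem hx hy), π.map_vcomp, he _ _ _ hx, he _ _ _ hy]
    exact (lin₂_single _ _ _).symm
  have e_unit₀ : e 0 0 S.unit₀ = Q.unit₀ := by
    apply inj
    rw [he _ _ _ B.unit₀_mem, π.map_unit₀]; rfl
  have e_unit₁ : e 1 1 S.unit₁ = Q.unit₁ := by
    apply inj
    rw [he _ _ _ B.unit₁_mem, π.map_unit₁]; rfl
  have e_mem : ∀ {k l} {x : S.obj k l}, x ∈ I.set k l → e k l x ∈ M.carrier k l := by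
    intro k l x hx
    rw [hM, he _ _ _ (hB.subset _ _ hx)]
    exact Submodule.subset_span ⟨x, hx, rfl⟩
  -- Linear induction over the `e x` with `x` in `s`: it serves for all of `Q` with `s` given by
  -- `B`, and for `M` with `s` given by `I`.
  have ind : ∀ {k l} {p : Q.obj k l → Prop} (s : Set (S.obj k l)), s ⊆ B.set k l →
      (∀ x ∈ s, p (e k l x)) → p 0 → (∀ x y, p x → p y → p (x + y)) →
      (∀ (c : K) x, p x → p (c • x)) → ∀ y, π.toFun k l y ∈
        Submodule.span K ((fun a => single a (1 : K)) '' s) → p y := by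
    intro k l p s hs h1 h0 ha hc y hy
    obtain ⟨z, hz, h⟩ : ∃ z, p z ∧ π.toFun k l z = π.toFun k l y := by
      refine span_single_induction (p := fun x => ∃ z, p z ∧ π.toFun k l z = x) hy ?_ ?_ ?_ ?_
      · exact fun a h => ⟨_, h1 a h, he _ _ _ (hs h)⟩
      · exact ⟨0, h0, map_zero _⟩
      · rintro _ _ ⟨x, hx, rfl⟩ ⟨y, hy, rfl⟩
        exact ⟨_, ha _ _ hx hy, map_add _ _ _⟩
      · rintro c _ ⟨x, hx, rfl⟩
        exact ⟨_, hc _ _ hx, map_smul _ _ _⟩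
    rwa [← inj _ _ h]
  have indB : ∀ {k l} {p : Q.obj k l → Prop}, (∀ x ∈ B.set k l, p (e k l x)) → p 0 →
      (∀ x y, p x → p y → p (x + y)) → (∀ (c : K) x, p x → p (c • x)) → ∀ y, p y :=
    fun h1 h0 ha hc y => ind _ subset_rfl h1 h0 ha hc y ((hrange _ _ _).2 ⟨y, rfl⟩)
  intro P φ
  -- The map `φ` only makes sense on `M`, which contains `e x` for `x` in `I`; elsewhere `f` takes
  -- the value 0.
  let f : ∀ k l, S.obj k l → P.obj k l := fun k l x => by
    classical exact if h : e k l x ∈ M.carrier k l then φ.toFun k l ⟨_, h⟩ else 0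
  have f_eq : ∀ {k l} {x : S.obj k l} (hx : e k l x ∈ M.carrier k l),
      f k l x = φ.toFun k l ⟨_, hx⟩ := fun hx => dif_pos hx
  have hf : SetProP.IsEquivariantOn I P.toSetProP f := by
    constructor
    · intro k l σ x hx
      rw [f_eq (e_mem hx), f_eq (e_mem (I.lact_mem σ hx))]
      refine Eq.trans ?_ (φ.map_lact σ _)
      exact congrArg _ (Subtype.ext (e_lact σ (hB.subset _ _ hx)))
    · intro k l σ x hx
      rw [f_eq (e_mem hx), f_eq (e_mem (I.ract_mem σ hx))]
      refine Eq.trans ?_ (φ.map_ract σ _)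
      exact congrArg _ (Subtype.ext (e_ract σ (hB.subset _ _ hx)))
  obtain ⟨Ψ, hΨ, hΨf⟩ : ∃ Ψ : ∀ k l, S.obj k l → P.obj k l, SetProP.IsHomOn B P.toSetProP Ψ ∧
    ∀ k l, ∀ x ∈ I.set k l, Ψ k l x = f k l x := hB.exists_hom P.toSetProP f hf
  let L : ∀ k l, Q.obj k l →ₗ[K] P.obj k l := fun k l =>
    (linearCombination K (Ψ k l)).comp (π.toFun k l)
  have L_e : ∀ {k l} {x : S.obj k l}, x ∈ B.set k l → L k l (e k l x) = Ψ k l x := by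
    intro k l x hx
    refine (congrArg (linearCombination K (Ψ k l)) (he _ _ _ hx)).trans ?_
    exact (linearCombination_single _ _ _).trans (one_smul _ _)
  refine ⟨⟨⟨L, ?_, ?_⟩, ?_, ?_, ?_, ?_⟩, ?_, ?_⟩
  · intro k l σ p
    refine indB (p := fun p => L k l (Q.lact σ p) = P.lact σ (L k l p)) ?_ ?_ ?_ ?_ p
    · intro x hx
      rw [← e_lact σ hx, L_e (B.lact_mem σ hx), L_e hx]; exact hΨ.map_lact σ hx
    · simp only [map_zero]
    · intro x y hx hy; simp only [map_add, hx, hy]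
    · intro c x hx; simp only [map_smul, hx]
  · intro k l σ p
    refine indB (p := fun p => L k l (Q.ract σ p) = P.ract σ (L k l p)) ?_ ?_ ?_ ?_ p
    · intro x hx
      rw [← e_ract σ hx, L_e (B.ract_mem σ hx), L_e hx]; exact hΨ.map_ract σ hx
    · simp only [map_zero]
    · intro x y hx hy; simp only [map_add, hx, hy]
    · intro c x hx; simp only [map_smul, hx]
  · intro k l k' l' p q
    refine indB (p := fun p => L _ _ (Q.hcomp p q) = P.hcomp (L k l p) (L k' l' q)) ?_ ?_ ?_ ?_ p
    · intro x hx
      refine indB (p := fun q => L _ _ (Q.hcomp _ q) = P.hcomp (L k l _) (L k' l' q)) ?_ ?_ ?_ ?_ q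
      · intro y hy
        rw [← e_hcomp hx hy, L_e (B.hcomp_mem hx hy), L_e hx, L_e hy]; exact hΨ.map_hcomp hx hy
      · simp only [map_zero]
      · intro x y hx hy; simp only [map_add, hx, hy]
      · intro c x hx; simp only [map_smul, hx]
    · simp only [map_zero, LinearMap.zero_apply]
    · intro x y hx hy; simp only [map_add, LinearMap.add_apply, hx, hy]
    · intro c x hx; simp only [map_smul, LinearMap.smul_apply, hx]
  · intro k l m p q
    refine indB (p := fun p => L _ _ (Q.vcomp p q) = P.vcomp (L l m p) (L k l q)) ?_ ?_ ?_ ?_ p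
    · intro x hx
      refine indB (p := fun q => L _ _ (Q.vcomp _ q) = P.vcomp (L l m _) (L k l q)) ?_ ?_ ?_ ?_ q
      · intro y hy
        rw [← e_vcomp hx hy, L_e (B.vcomp_mem hx hy), L_e hx, L_e hy]; exact hΨ.map_vcomp hx hy
      · simp only [map_zero]
      · intro x y hx hy; simp only [map_add, hx, hy]
      · intro c x hx; simp only [map_smul, hx]
    · simp only [map_zero, LinearMap.zero_apply]
    · intro x y hx hy; simp only [map_add, LinearMap.add_apply, hx, hy]
    · intro c x hx; simp only [map_smul, LinearMap.smul_apply, hx]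
  · rw [← e_unit₀, L_e B.unit₀_mem]; exact hΨ.map_unit₀
  · rw [← e_unit₁, L_e B.unit₁_mem]; exact hΨ.map_unit₁
  · rintro k l ⟨y, hy⟩
    -- Membership in `M` is carried along in the induction because `φ` is applied to elements of a
    -- subtype.
    refine (ind (p := fun y => ∃ hy : y ∈ M.carrier k l, L k l y = φ.toFun k l ⟨y, hy⟩)
      (I.set k l) (hB.subset k l) ?_ ?_ ?_ ?_ y ((hM _ _ _).1 hy)).2
    · intro x hx
      exact ⟨e_mem hx, (L_e (hB.subset _ _ hx)).trans ((hΨf _ _ _ hx).trans (f_eq (e_mem hx)))⟩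
    · exact ⟨Submodule.zero_mem _, (map_zero (L k l)).trans (map_zero (φ.toFun k l)).symm⟩
    · rintro x y ⟨hx, ex⟩ ⟨hy, ey⟩
      refine ⟨Submodule.add_mem _ hx hy, ?_⟩
      rw [map_add, ex, ey]; exact (map_add (φ.toFun k l) ⟨x, hx⟩ ⟨y, hy⟩).symm
    · rintro c x ⟨hx, ex⟩
      refine ⟨Submodule.smul_mem _ c hx, ?_⟩
      rw [map_smul, ex]; exact (map_smul (φ.toFun k l) c ⟨x, hx⟩).symm
  · intro Φ hΦ
    have hom : ∀ (Θ : Q.Hom P), SetProP.IsHomOn B P.toSetProP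
        (fun k l x => Θ.toFun k l (e k l x)) := by
      intro Θ
      refine ⟨?_, ?_, ?_, ?_, ?_, ?_⟩
      · intro k l σ x hx
        rw [e_lact σ hx]; exact Θ.map_lact _ _
      · intro k l σ x hx
        rw [e_ract σ hx]; exact Θ.map_ract _ _
      · intro k l k' l' x y hx hy
        rw [e_hcomp hx hy]; exact Θ.map_hcomp _ _
      · intro k l m x y hx hy
        rw [e_vcomp hx hy]; exact Θ.map_vcomp _ _
      · rw [e_unit₀]; exact Θ.map_unit₀
      · rw [e_unit₁]; exact Θ.map_unit₁
    have key : Φ.toFun = L := by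
      funext k l
      refine LinearMap.ext fun y => ?_
      refine indB (p := fun y => Φ.toFun k l y = L k l y) ?_ ?_ ?_ ?_ y
      · intro x hx
        rw [L_e hx]
        -- On basis elements, `Φ` is a morphism of ProPs in sets which agrees with `Ψ` on `I`.
        refine hB.unique P.toSetProP _ Ψ (hom Φ) hΨ ?_ k l x hx
        intro k l x hx
        rw [hΨf _ _ _ hx, f_eq (e_mem hx)]
        exact hΦ k l ⟨_, e_mem hx⟩
      · simp only [map_zero]
      · intro x y hx hy; simp only [map_add, hx, hy]
      · intro c x hx; simp only [map_smul, hx]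
    exact ProP.Hom.ext_toFun key

theorem SetProP.SubProP.IsFreeOn.span {B : S.SubProP} {I : S.StableSet}
    (hB : B.IsFreeOn.{w, w'} I) :
    (B.span K).toProP.IsFreeOn.{v, max v w, w'} ((I.span K).within (B.span K).toSub) := by
  refine hB.of_hom ⟨⟨fun k l => ((B.span K).carrier k l).subtype, ?_, ?_⟩, ?_, ?_, ?_, ?_⟩
    (fun _ _ => Subtype.val_injective) ?_ _ (fun _ _ _ => Iff.rfl)
  · exact fun _ _ => rfl
  · exact fun _ _ => rfl
  · exact fun _ _ => rfl
  · exact fun _ _ => rfl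
  · rfl
  · rfl
  · exact fun k l x => ⟨fun h => ⟨⟨x, h⟩, rfl⟩, fun ⟨y, hy⟩ => hy ▸ y.2⟩

theorem SetProP.SubProP.IsFreeOn.lin {I : S.StableSet}
    (hB : (SetProP.SubProP.univ S).IsFreeOn.{w, w'} I) :
    (S.lin K).IsFreeOn.{v, max v w, w'} (I.span K) := by
  refine hB.of_hom ⟨⟨fun k l => LinearMap.id, ?_, ?_⟩, ?_, ?_, ?_, ?_⟩
    (fun _ _ => injective_id) ?_ _ (fun _ _ _ => Iff.rfl)
  · exact fun _ _ => rfl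
  · exact fun _ _ => rfl
  · exact fun _ _ => rfl
  · exact fun _ _ => rfl
  · rfl
  · rfl
  · refine fun k l x => ⟨fun _ => ⟨x, rfl⟩, fun h => ?_⟩
    clear h
    induction x using Finsupp.induction_linear with
    | zero => exact Submodule.zero_mem _
    | add x y hx hy => exact Submodule.add_mem _ hx hy
    | single a c =>
      rw [← mul_one c, ← smul_eq_mul, ← Finsupp.smul_single]
      exact Submodule.smul_mem _ c (Submodule.subset_span ⟨a, trivial, rfl⟩)

end

end GraphProP

namespace GraphProP

/-! ### Properties of marked graphs which are inherited by factors -/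

/-- The relation `r` is a strict total order on every fibre of `f`. -/
structure IsFibreOrder {A B : Type} (f : A → B) (r : A → A → Prop) : Prop where
  irrefl : ∀ a, ¬ r a a
  trans : ∀ {a b c}, r a b → r b c → r a c
  total : ∀ {a b}, f a = f b → r a b ∨ a = b ∨ r b a

theorem IsFibreOrder.of_embedding {A B A' B' : Type} {f : A → B} {r : A → A → Prop} {f' : A' → B'}
    {r' : A' → A' → Prop} (h : IsFibreOrder f' r') (j : A → A') (hj : Injective j)
    (hr : ∀ x y, r' (j x) (j y) ↔ r x y) (hf : ∀ x y, f x = f y → f' (j x) = f' (j y)) :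
    IsFibreOrder f r where
  irrefl a ha := h.irrefl _ ((hr a a).2 ha)
  trans {a b c} hab hbc := (hr a c).1 (h.trans ((hr a b).2 hab) ((hr b c).2 hbc))
  total {a b} hab := by
    rw [← hr a b, ← hr b a, ← hj.eq_iff]
    exact h.total (hf _ _ hab)

theorem IsFibreOrder.sum_left {A A' A'' B B' : Type} {f : A → B} {f' : A' → B'} {r : A → A → Prop}
    {r' : A' → A' → Prop} {φ : A'' ≃ A ⊕ A'}
    (h : IsFibreOrder (Sum.map f f' ∘ φ) fun a b => Sum.LiftRel r r' (φ a) (φ b)) :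
    IsFibreOrder f r :=
  h.of_embedding (fun a => φ.symm (.inl a)) (φ.symm.injective.comp Sum.inl_injective)
    (fun x y => by simp) fun x y h => by simp [h]

theorem IsFibreOrder.sum_right {A A' A'' B B' : Type} {f : A → B} {f' : A' → B'} {r : A → A → Prop}
    {r' : A' → A' → Prop} {φ : A'' ≃ A ⊕ A'}
    (h : IsFibreOrder (Sum.map f f' ∘ φ) fun a b => Sum.LiftRel r r' (φ a) (φ b)) :
    IsFibreOrder f' r' :=
  h.of_embedding (fun a => φ.symm (.inr a)) (φ.symm.injective.comp Sum.inr_injective)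
    (fun x y => by simp) fun x y h => by simp [h]

theorem liftRel_false_left {A A' A'' : Type} {r : A → A → Prop} {r' : A' → A' → Prop}
    {φ : A'' ≃ A ⊕ A'} (h : ∀ a b, ¬ Sum.LiftRel r r' (φ a) (φ b)) (a b : A) : ¬ r a b := by
  simpa using h (φ.symm (.inl a)) (φ.symm (.inl b))

theorem liftRel_false_right {A A' A'' : Type} {r : A → A → Prop} {r' : A' → A' → Prop}
    {φ : A'' ≃ A ⊕ A'} (h : ∀ a b, ¬ Sum.LiftRel r r' (φ a) (φ b)) (a b : A') : ¬ r' a b := by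
  simpa using h (φ.symm (.inr a)) (φ.symm (.inr b))

theorem Graph.Iso.inDeg_eq {k l : ℕ} {G H : Graph k l} (f : Graph.Iso G H) (v : G.V) :
    H.inDeg (f.onV v) = G.inDeg v :=
  (Nat.card_congr (f.onT.subtypeEquiv fun x => by
    rw [← f.onV.apply_eq_iff_eq, ← f.map_t]; rfl)).symm

theorem Graph.Iso.outDeg_eq {k l : ℕ} {G H : Graph k l} (f : Graph.Iso G H) (v : G.V) :
    H.outDeg (f.onV v) = G.outDeg v :=
  (Nat.card_congr (f.onS.subtypeEquiv fun x => by
    rw [← f.onV.apply_eq_iff_eq, ← f.map_s]; rfl)).symm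

theorem Graph.IsCycleless.of_iso {k l : ℕ} {G H : Graph k l} (h : H.IsCycleless)
    (f : Graph.Iso G H) : G.IsCycleless where
  isEmpty_loops := @Equiv.isEmpty _ _ f.onL h.1
  not_cycle x hx := h.2 (f.onV x) (hx.lift f.onV fun _ _ ⟨e, hs, ht⟩ =>
    ⟨f.onE e, (f.map_s (.inl e)).trans (congrArg f.onV hs), (f.map_t (.inl e)).trans (congrArg f.onV ht)⟩)

namespace MarkedGraph

variable {D : Type u} {k l m n k' l' : ℕ}

/-- An isomorphism invariant property of marked graphs which passes to the factors of the two
compositions. -/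
structure IsFactorProp (p : ∀ k l : ℕ, MarkedGraph D k l → Prop) : Prop where
  iso : ∀ {k l : ℕ} {G H : MarkedGraph D k l} {f}, IsIso G H f → p k l H → p k l G
  lact : ∀ {k l : ℕ} {G : MarkedGraph D k l} (σ : Perm (Fin l)), p k l G → p k l (G.lact σ)
  ract : ∀ {k l : ℕ} {G : MarkedGraph D k l} (τ : Perm (Fin k)), p k l G → p k l (G.ract τ)
  vcomp : ∀ {k l m : ℕ} {G : MarkedGraph D l m} {H : MarkedGraph D k l}, p k m (G.vcomp H) →
    p l m G ∧ p k l H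
  hcomp : ∀ {k l k' l' : ℕ} {G : MarkedGraph D k l} {H : MarkedGraph D k' l'},
    p (k + k') (l + l') (G.hcomp H) → p k l G ∧ p k' l' H

theorem IsFactorProp.and {p q : ∀ k l : ℕ, MarkedGraph D k l → Prop} (hp : IsFactorProp p)
    (hq : IsFactorProp q) : IsFactorProp (fun k l G => p k l G ∧ q k l G) where
  iso h h' := ⟨hp.iso h h'.1, hq.iso h h'.2⟩
  lact σ h := ⟨hp.lact σ h.1, hq.lact σ h.2⟩
  ract τ h := ⟨hp.ract τ h.1, hq.ract τ h.2⟩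
  vcomp h := ⟨⟨(hp.vcomp h.1).1, (hq.vcomp h.2).1⟩, (hp.vcomp h.1).2, (hq.vcomp h.2).2⟩
  hcomp h := ⟨⟨(hp.hcomp h.1).1, (hq.hcomp h.2).1⟩, (hp.hcomp h.1).2, (hq.hcomp h.2).2⟩

open MarkedGraph.Class in
-- A composite of classes which has a representative with the property `p` also has the composite of
-- any chosen representatives as a representative. The invariance under isomorphism moves `p` there,
-- and then to the factors.
theorem IsFactorProp.factorClosed {p : ∀ k l : ℕ, MarkedGraph D k l → Prop}
    (hp : IsFactorProp p) : FactorClosed fun k l =>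
      {x | ∃ G : MarkedGraph D k l, Class.mk G = x ∧ p k l G} where
  lact := by rintro _ _ σ _ ⟨G, rfl, h⟩; exact ⟨_, rfl, hp.lact σ h⟩
  ract := by rintro _ _ τ _ ⟨G, rfl, h⟩; exact ⟨_, rfl, hp.ract τ h⟩
  vcomp := by
    rintro k l m x y ⟨G, e, h⟩
    obtain ⟨A, rfl⟩ := mk_surjective x
    obtain ⟨B, rfl⟩ := mk_surjective y
    rw [mk_vcomp, eq_comm, mk_eq_iff] at e
    have h' := hp.vcomp (hp.iso e.choose_spec h)
    exact ⟨⟨A, rfl, h'.1⟩, ⟨B, rfl, h'.2⟩⟩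
  hcomp := by
    rintro k l k' l' x y ⟨G, e, h⟩
    obtain ⟨A, rfl⟩ := mk_surjective x
    obtain ⟨B, rfl⟩ := mk_surjective y
    rw [mk_hcomp, eq_comm, mk_eq_iff] at e
    have h' := hp.hcomp (hp.iso e.choose_spec h)
    exact ⟨⟨A, rfl, h'.1⟩, ⟨B, rfl, h'.2⟩⟩

theorem isFactorProp_isCycleless : IsFactorProp (D := D) (fun _ _ G => G.toGraph.IsCycleless) where
  iso {_ _ _ _ f} _ h' := h'.of_iso f
  lact σ h := h.lact σ
  ract τ h := h.ract τ
  vcomp h := by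
    constructor
    · exact ⟨⟨fun x => h.1.elim' (Sum.inr x)⟩, fun x hx => h.2 (.inr x)
        (hx.lift Sum.inr fun _ _ ⟨e, hs, ht⟩ =>
          ⟨.inl (.inr e), congrArg Sum.inr hs, congrArg Sum.inr ht⟩)⟩
    · exact ⟨⟨fun x => h.1.elim' (Sum.inl x)⟩, fun x hx => h.2 (.inl x)
        (hx.lift Sum.inl fun _ _ ⟨e, hs, ht⟩ =>
          ⟨.inl (.inl e), congrArg Sum.inl hs, congrArg Sum.inl ht⟩)⟩
  hcomp h := by
    constructor
    · exact ⟨⟨fun x => h.1.elim' (Sum.inl x)⟩, fun x hx => h.2 (.inl x)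
        (hx.lift Sum.inl fun _ _ ⟨e, hs, ht⟩ =>
          ⟨.inl e, congrArg Sum.inl hs, congrArg Sum.inl ht⟩)⟩
    · exact ⟨⟨fun x => h.1.elim' (Sum.inr x)⟩, fun x hx => h.2 (.inr x)
        (hx.lift Sum.inr fun _ _ ⟨e, hs, ht⟩ =>
          ⟨.inr e, congrArg Sum.inr hs, congrArg Sum.inr ht⟩)⟩

/-- The relations on the edges are empty. -/
def IsUnordered (G : MarkedGraph D k l) : Prop := (∀ a b, ¬ G.rT a b) ∧ ∀ a b, ¬ G.rS a b

theorem isFactorProp_isUnordered : IsFactorProp (D := D) (fun _ _ G => G.IsUnordered) where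
  iso h h' := ⟨fun a b => (h.rT a b).not.1 (h'.1 _ _), fun a b => (h.rS a b).not.1 (h'.2 _ _)⟩
  lact _ h := h
  ract _ h := h
  vcomp {_ _ _ A B} h := ⟨⟨liftRel_false_right (φ := Graph.eT A.toGraph B.toGraph) h.1,
    liftRel_false_right (φ := Graph.eS A.toGraph B.toGraph) h.2⟩,
    liftRel_false_left (φ := Graph.eT A.toGraph B.toGraph) h.1,
    liftRel_false_left (φ := Graph.eS A.toGraph B.toGraph) h.2⟩
  hcomp {_ _ _ _ A B} h := ⟨⟨liftRel_false_left (φ := Graph.hT A.toGraph B.toGraph) h.1,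
    liftRel_false_left (φ := Graph.hS A.toGraph B.toGraph) h.2⟩,
    liftRel_false_right (φ := Graph.hT A.toGraph B.toGraph) h.1,
    liftRel_false_right (φ := Graph.hS A.toGraph B.toGraph) h.2⟩

/-- The relations on the edges are total orders on the fibres of the target and of the source. -/
def IsOrdered (G : MarkedGraph D k l) : Prop := IsFibreOrder G.t G.rT ∧ IsFibreOrder G.s G.rS

theorem isFactorProp_isOrdered : IsFactorProp (D := D) (fun _ _ G => G.IsOrdered) where
  iso {_ _ _ _ f} h h' := ⟨h'.1.of_embedding _ f.onT.injective h.rT fun x y e =>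
    (f.map_t x).trans ((congrArg f.onV e).trans (f.map_t y).symm),
    h'.2.of_embedding _ f.onS.injective h.rS fun x y e =>
    (f.map_s x).trans ((congrArg f.onV e).trans (f.map_s y).symm)⟩
  lact _ h := h
  ract _ h := h
  vcomp {_ _ _ A B} h := ⟨⟨IsFibreOrder.sum_right (φ := Graph.eT A.toGraph B.toGraph) h.1,
    IsFibreOrder.sum_right (φ := Graph.eS A.toGraph B.toGraph) h.2⟩,
    IsFibreOrder.sum_left (φ := Graph.eT A.toGraph B.toGraph) h.1,
    IsFibreOrder.sum_left (φ := Graph.eS A.toGraph B.toGraph) h.2⟩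
  hcomp {_ _ _ _ A B} h := ⟨⟨IsFibreOrder.sum_left (φ := Graph.hT A.toGraph B.toGraph) h.1,
    IsFibreOrder.sum_left (φ := Graph.hS A.toGraph B.toGraph) h.2⟩,
    IsFibreOrder.sum_right (φ := Graph.hT A.toGraph B.toGraph) h.1,
    IsFibreOrder.sum_right (φ := Graph.hS A.toGraph B.toGraph) h.2⟩

/-- The vertices are decorated by elements of `X`, and the loops are not decorated. -/
def IsDecorated {X : ℕ → ℕ → Type u} (G : MarkedGraph (Option (Σ p : ℕ × ℕ, X p.1 p.2)) k l) :
    Prop :=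
  (∀ v, ∃ d, G.dec (.inl v) = some d ∧ d.1 = (G.toGraph.inDeg v, G.toGraph.outDeg v)) ∧
    ∀ c, G.dec (.inr c) = none

/-- Gluing keeps the number of edges which end or start at each vertex, so a decoration has the
right degrees in a factor as soon as it has them in the composite. -/
theorem isFactorProp_isDecorated {X : ℕ → ℕ → Type u} :
    IsFactorProp (fun _ _ G => IsDecorated (X := X) G) where
  iso {_ _ _ _ f} h h' := by
    refine ⟨fun v => ?_, fun c => (h.dec (.inr c)).symm.trans (h'.2 _)⟩
    obtain ⟨d, e, e'⟩ := h'.1 (f.onV v)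
    refine ⟨d, (h.dec (.inl v)).symm.trans e, ?_⟩
    rw [e', f.inDeg_eq, f.outDeg_eq]
  lact _ h := h
  ract _ h := h
  vcomp h := by
    refine ⟨⟨fun v => ?_, fun c => h.2 (.inr c)⟩, ⟨fun v => ?_, fun c => h.2 (.inl c)⟩⟩
    · obtain ⟨d, e, e'⟩ := h.1 (.inr v)
      exact ⟨d, e, e'.trans (Prod.ext (card_fibre_inr _ _ (Graph.eT _ _) v)
        (card_fibre_inr _ _ (Graph.eS _ _) v))⟩
    · obtain ⟨d, e, e'⟩ := h.1 (.inl v)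
      exact ⟨d, e, e'.trans (Prod.ext (card_fibre_inl _ _ (Graph.eT _ _) v)
        (card_fibre_inl _ _ (Graph.eS _ _) v))⟩
  hcomp h := by
    refine ⟨⟨fun v => ?_, fun c => h.2 (.inl c)⟩, ⟨fun v => ?_, fun c => h.2 (.inr c)⟩⟩
    · obtain ⟨d, e, e'⟩ := h.1 (.inl v)
      exact ⟨d, e, e'.trans (Prod.ext (card_fibre_inl _ _ (Graph.hT _ _) v)
        (card_fibre_inl _ _ (Graph.hS _ _) v))⟩
    · obtain ⟨d, e, e'⟩ := h.1 (.inr v)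
      exact ⟨d, e, e'.trans (Prod.ext (card_fibre_inr _ _ (Graph.hT _ _) v)
        (card_fibre_inr _ _ (Graph.hS _ _) v))⟩

end MarkedGraph

end GraphProP

namespace GraphProP

/-! ### Decorated graphs as marked graphs -/

open MarkedGraph MarkedGraph.Class

variable {X : ℕ → ℕ → Type u} {k l m n k' l' : ℕ}

/-- A decorated graph, as a marked graph without relations. -/
def DecGraph.toMarked (G : DecGraph X k l) : MarkedGraph (Option (Σ p : ℕ × ℕ, X p.1 p.2)) k l where
  toGraph := G.toGraph
  dec := Sum.elim (fun v => some (G.dec v)) fun _ => none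
  rT _ _ := False
  rS _ _ := False
  rT_fibre h := h.elim
  rS_fibre h := h.elim

/-- A planar decorated graph, as a marked graph. -/
def PDecGraph.toMarked (G : PDecGraph X k l) :
    MarkedGraph (Option (Σ p : ℕ × ℕ, X p.1 p.2)) k l where
  toGraph := G.toGraph
  dec := Sum.elim (fun v => some (G.dec v)) fun _ => none
  rT := G.inOrd.lt
  rS := G.outOrd.lt
  rT_fibre h := G.inOrd.fibre h
  rS_fibre h := G.outOrd.fibre h

theorem sumElim_some_none {V V' L L' A : Type*} (d : V → A) (d' : V' → A) (x) :
    Sum.elim (Sum.elim (fun v => some (d v)) fun _ : L => none)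
      (Sum.elim (fun v => some (d' v)) fun _ : L' => none) (sumSumSumComm V V' L L' x) =
    Sum.elim (fun v => some (Sum.elim d d' v)) (fun _ => none) x := by
  rcases x with (x | x) | (x | x) <;> rfl

theorem not_liftRel_false {A B : Type*} (x y : A ⊕ B) :
    ¬ Sum.LiftRel (fun _ _ => False) (fun _ _ => False) x y := by
  rcases x with x | x <;> rcases y with y | y <;> simp

theorem MarkedGraph.Class.mk_eq_of_toGraph {D : Type v} {G : Graph k l}
    {d d' : G.V ⊕ G.L → D} {rT rT' rS rS'} {h₁ h₁' h₂ h₂'} (hd : ∀ x, d x = d' x)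
    (hT : ∀ x y, rT x y ↔ rT' x y) (hS : ∀ x y, rS x y ↔ rS' x y) :
    mk (MarkedGraph.mk G d rT rS h₁ h₂) = mk (MarkedGraph.mk G d' rT' rS' h₁' h₂') := by
  obtain rfl : d = d' := funext hd
  obtain rfl : rT = rT' := funext fun x => funext fun y => propext (hT x y)
  obtain rfl : rS = rS' := funext fun x => funext fun y => propext (hS x y)
  rfl

/-- The class of a decorated graph, as a class of marked graphs. -/
def DecGraph.toClass (k l : ℕ) :
    (decGraphs X).obj k l → (markedGraphs (Option (Σ p : ℕ × ℕ, X p.1 p.2))).obj k l :=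
  Quotient.map DecGraph.toMarked fun G H ⟨f, hf⟩ => ⟨f, by
    rintro (v | v)
    · exact congrArg some (hf v)
    · rfl, fun _ _ => Iff.rfl, fun _ _ => Iff.rfl⟩

theorem DecGraph.toClass_injective (k l : ℕ) : Injective (DecGraph.toClass (X := X) k l) := by
  rintro ⟨G⟩ ⟨H⟩ h
  obtain ⟨f, hf⟩ := mk_eq_iff.1 h
  exact Quotient.sound ⟨f, fun v => Option.some_injective _ (hf.dec (.inl v))⟩

theorem DecGraph.isHomOn_toClass (B : (decGraphs X).SubProP) :
    SetProP.IsHomOn B (markedGraphs _) (DecGraph.toClass (X := X)) where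
  map_lact := by rintro k l σ ⟨G⟩ -; rfl
  map_ract := by rintro k l σ ⟨G⟩ -; rfl
  map_hcomp := by
    rintro k l k' l' ⟨G⟩ ⟨H⟩ - -
    exact mk_eq_of_toGraph (fun x => (sumElim_some_none _ _ x).symm)
      (fun x y => iff_of_false not_false (not_liftRel_false _ _))
      (fun x y => iff_of_false not_false (not_liftRel_false _ _))
  map_vcomp := by
    rintro k l m ⟨G⟩ ⟨H⟩ - -
    exact mk_eq_of_toGraph (fun x => (sumElim_some_none _ _ x).symm)
      (fun x y => iff_of_false not_false (not_liftRel_false _ _))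
      (fun x y => iff_of_false not_false (not_liftRel_false _ _))
  map_unit₀ := mk_eq_of_toGraph (by rintro (⟨⟨⟩⟩ | ⟨⟨⟩⟩)) (fun _ _ => Iff.rfl) fun _ _ => Iff.rfl
  map_unit₁ := mk_eq_of_toGraph (by rintro (⟨⟨⟩⟩ | ⟨⟨⟩⟩)) (fun _ _ => Iff.rfl) fun _ _ => Iff.rfl

/-- The image of the embedding is cut out by properties which pass to factors, so it is factor
closed. The extra property `p` of the graph allows for all graphs and for cycleless graphs with one
proof. -/
theorem DecGraph.toClass_image (p : ∀ k l, Graph k l → Prop) (k l : ℕ) :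
    DecGraph.toClass (X := X) k l '' (Quotient.mk _ '' {G : DecGraph X k l | p k l G.toGraph}) =
      {x | ∃ G, MarkedGraph.Class.mk G = x ∧ (IsDecorated G ∧ IsUnordered G) ∧ p k l G.toGraph} := by
  ext x
  constructor
  · rintro ⟨_, ⟨G, hG, rfl⟩, rfl⟩
    exact ⟨_, rfl, ⟨⟨fun v => ⟨_, rfl, G.dec_fst v⟩, fun _ => rfl⟩, fun _ _ h => h,
      fun _ _ h => h⟩, hG⟩
  · rintro ⟨G, rfl, ⟨⟨hd, hL⟩, hT, hS⟩, hG⟩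
    choose d hd hd' using hd
    refine ⟨_, ⟨⟨G.toGraph, d, hd'⟩, hG, rfl⟩, mk_eq_of_toGraph ?_ ?_ ?_⟩
    · rintro (v | v)
      exacts [(hd v).symm, (hL v).symm]
    · exact fun x y => iff_of_false not_false (hT x y)
    · exact fun x y => iff_of_false not_false (hS x y)

/-- The class of a planar decorated graph, as a class of marked graphs. -/
def PDecGraph.toClass (k l : ℕ) :
    (planarDecGraphs X).obj k l → (markedGraphs (Option (Σ p : ℕ × ℕ, X p.1 p.2))).obj k l :=
  Quotient.map PDecGraph.toMarked fun G H ⟨f, hf, hi, ho⟩ => ⟨f, by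
    rintro (v | v)
    · exact congrArg some (hf v)
    · rfl, hi, ho⟩

theorem PDecGraph.toClass_injective (k l : ℕ) : Injective (PDecGraph.toClass (X := X) k l) := by
  rintro ⟨G⟩ ⟨H⟩ h
  obtain ⟨f, hf⟩ := mk_eq_iff.1 h
  exact Quotient.sound ⟨f, fun v => Option.some_injective _ (hf.dec (.inl v)), hf.rT, hf.rS⟩

theorem PDecGraph.isHomOn_toClass (B : (planarDecGraphs X).SubProP) :
    SetProP.IsHomOn B (markedGraphs _) (PDecGraph.toClass (X := X)) where
  map_lact := by rintro k l σ ⟨G⟩ -; rfl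
  map_ract := by rintro k l σ ⟨G⟩ -; rfl
  map_hcomp := by
    rintro k l k' l' ⟨G⟩ ⟨H⟩ - -
    exact mk_eq_of_toGraph (fun x => (sumElim_some_none _ _ x).symm) (fun _ _ => Iff.rfl)
      fun _ _ => Iff.rfl
  map_vcomp := by
    rintro k l m ⟨G⟩ ⟨H⟩ - -
    exact mk_eq_of_toGraph (fun x => (sumElim_some_none _ _ x).symm) (fun _ _ => Iff.rfl)
      fun _ _ => Iff.rfl
  map_unit₀ := mk_eq_of_toGraph (by rintro (⟨⟨⟩⟩ | ⟨⟨⟩⟩)) (fun _ _ => Iff.rfl) fun _ _ => Iff.rfl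
  map_unit₁ := mk_eq_of_toGraph (by rintro (⟨⟨⟩⟩ | ⟨⟨⟩⟩)) (fun _ _ => Iff.rfl) fun _ _ => Iff.rfl

theorem PDecGraph.toClass_image (p : ∀ k l, Graph k l → Prop) (k l : ℕ) :
    PDecGraph.toClass (X := X) k l '' (Quotient.mk _ '' {G : PDecGraph X k l | p k l G.toGraph}) =
      {x | ∃ G, MarkedGraph.Class.mk G = x ∧ (IsDecorated G ∧ IsOrdered G) ∧ p k l G.toGraph} := by
  ext x
  constructor
  · rintro ⟨_, ⟨G, hG, rfl⟩, rfl⟩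
    exact ⟨_, rfl, ⟨⟨fun v => ⟨_, rfl, G.dec_fst v⟩, fun _ => rfl⟩,
      ⟨G.inOrd.irrefl, G.inOrd.trans, G.inOrd.total⟩,
      ⟨G.outOrd.irrefl, G.outOrd.trans, G.outOrd.total⟩⟩, hG⟩
  · rintro ⟨G, rfl, ⟨⟨hd, hL⟩, hT, hS⟩, hG⟩
    choose d hd hd' using hd
    refine ⟨_, ⟨⟨⟨G.toGraph, d, hd'⟩, ⟨G.rT, G.rT_fibre, hT.1, hT.2, hT.3⟩,
      ⟨G.rS, G.rS_fibre, hS.1, hS.2, hS.3⟩⟩, hG, rfl⟩, mk_eq_of_toGraph ?_ ?_ ?_⟩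
    · rintro (v | v)
      exacts [(hd v).symm, (hL v).symm]
    · exact fun _ _ => Iff.rfl
    · exact fun _ _ => Iff.rfl

/-! ### Freeness of the ProPs of graphs in sets -/

theorem MarkedGraph.isFactorProp_true {D : Type v} :
    IsFactorProp (D := D) (fun _ _ _ => True) where
  iso _ h := h
  lact _ h := h
  ract _ h := h
  vcomp _ := ⟨trivial, trivial⟩
  hcomp _ := ⟨trivial, trivial⟩

theorem image_mk_univ {A : Type v} [s : Setoid A] :
    (Quotient.mk s '' {_a : A | True}) = Set.univ := by
  ext x
  obtain ⟨a, rfl⟩ := Quotient.exists_rep x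
  exact iff_of_true ⟨a, trivial, rfl⟩ trivial

/-- The general criterion is applied to the embedding in marked graphs. Indecomposability depends on
the underlying graph only and is invariant under isomorphism, so it corresponds on the two sides. -/
theorem DecGraph.isFreeOn {p : ∀ k l, Graph k l → Prop} (B : (decGraphs X).SubProP)
    (I : (decGraphs X).StableSet)
    (hp : IsFactorProp (D := Option (Σ p : ℕ × ℕ, X p.1 p.2)) fun k l G => p k l G.toGraph)
    (hB : ∀ k l, B.set k l = Quotient.mk _ '' {G : DecGraph X k l | p k l G.toGraph})
    (hI : ∀ k l, I.set k l = Quotient.mk _ '' {G : DecGraph X k l |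
      G.toGraph.IsIndecomposable ∧ p k l G.toGraph}) : B.IsFreeOn.{max 1 u, w} I := by
  refine SetProP.SubProP.isFreeOn_of_embedding (DecGraph.isHomOn_toClass B)
    (fun k l => (DecGraph.toClass_injective k l).injOn) ?_ ?_ ?_
  · refine (congrArg FactorClosed (funext fun k => funext fun l => ?_)).mpr
      ((isFactorProp_isDecorated.and isFactorProp_isUnordered).and hp).factorClosed
    exact (congrArg _ (hB k l)).trans (DecGraph.toClass_image p k l)
  · intro k l
    rw [hB, hI]
    exact Set.image_mono fun _ h => h.2
  · intro k l x hx
    rw [hB] at hx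
    rw [hI]
    obtain ⟨G, hG, rfl⟩ := hx
    constructor
    · rintro ⟨H, hH, e⟩
      rw [← e]
      exact ⟨H.toMarked, rfl, hH.1⟩
    · exact fun h => ⟨G, ⟨Indec.of_mk (G := G.toMarked) h, hG⟩, rfl⟩

theorem PDecGraph.isFreeOn {p : ∀ k l, Graph k l → Prop} (B : (planarDecGraphs X).SubProP)
    (I : (planarDecGraphs X).StableSet)
    (hp : IsFactorProp (D := Option (Σ p : ℕ × ℕ, X p.1 p.2)) fun k l G => p k l G.toGraph)
    (hB : ∀ k l, B.set k l = Quotient.mk _ '' {G : PDecGraph X k l | p k l G.toGraph})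
    (hI : ∀ k l, I.set k l = Quotient.mk _ '' {G : PDecGraph X k l |
      G.toGraph.IsIndecomposable ∧ p k l G.toGraph}) : B.IsFreeOn.{max 1 u, w} I := by
  refine SetProP.SubProP.isFreeOn_of_embedding (PDecGraph.isHomOn_toClass B)
    (fun k l => (PDecGraph.toClass_injective k l).injOn) ?_ ?_ ?_
  · refine (congrArg FactorClosed (funext fun k => funext fun l => ?_)).mpr
      ((isFactorProp_isDecorated.and isFactorProp_isOrdered).and hp).factorClosed
    exact (congrArg _ (hB k l)).trans (PDecGraph.toClass_image p k l)
  · intro k l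
    rw [hB, hI]
    exact Set.image_mono fun _ h => h.2
  · intro k l x hx
    rw [hB] at hx
    rw [hI]
    obtain ⟨G, hG, rfl⟩ := hx
    constructor
    · rintro ⟨H, hH, e⟩
      rw [← e]
      exact ⟨H.toMarked, rfl, hH.1⟩
    · exact fun h => ⟨G, ⟨Indec.of_mk (G := G.toMarked) h, hG⟩, rfl⟩

variable (X) (K : Type v) [Field K]

theorem isFreeOn_gr : (Gr X K).IsFreeOn.{v, max v 1 u, w} (GrInd X K) := by
  refine SetProP.SubProP.IsFreeOn.lin (DecGraph.isFreeOn (p := fun _ _ _ => True) _ _ isFactorProp_true ?_ ?_)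
  · exact fun k l => image_mk_univ.symm
  · intro k l
    simp only [and_true]
    rfl

theorem isFreeOn_grUp : (GrUp X K).toProP.IsFreeOn.{v, max v 1 u, w} (GrUpInd X K) :=
  SetProP.SubProP.IsFreeOn.span (DecGraph.isFreeOn _ _ isFactorProp_isCycleless (fun _ _ => rfl)
    fun _ _ => rfl)

theorem isFreeOn_pGr : (PGr X K).IsFreeOn.{v, max v 1 u, w} (PGrInd X K) := by
  refine SetProP.SubProP.IsFreeOn.lin (PDecGraph.isFreeOn (p := fun _ _ _ => True) _ _ isFactorProp_true ?_ ?_)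
  · exact fun k l => image_mk_univ.symm
  · intro k l
    simp only [and_true]
    rfl

theorem isFreeOn_pGrUp : (PGrUp X K).toProP.IsFreeOn.{v, max v 1 u, w} (PGrUpInd X K) :=
  SetProP.SubProP.IsFreeOn.span (PDecGraph.isFreeOn _ _ isFactorProp_isCycleless (fun _ _ => rfl)
    fun _ _ => rfl)

end GraphProP

namespace GraphProP

/-! ### Cycleless indecomposable graphs -/

namespace Graph

variable {k l : ℕ} {G : Graph k l}

/-- A colouring of an indecomposable graph which does not decrease along the edges is constant. -/
theorem IsIndecomposable.colour_eq (h : G.IsIndecomposable) (W : G.V → Bool)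
    (hW : ∀ e, W (G.s (.inl e)) = true → W (G.t (.inl e)) = true) (v v' : G.V) : W v = W v' := by
  -- Only the colours matter, so the other marks are trivial. The cut is a vertical decomposition,
  -- in which one part has no vertex, so one of the colours does not occur on vertices.
  obtain ⟨m, A, B, f, hf⟩ := MarkedGraph.exists_cut (D := Unit)
    { toGraph := G
      dec := Sum.elim (fun v => ((), W v)) fun _ => ((), true)
      rT := fun _ _ => False
      rS := fun _ _ => False
      rT_fibre := fun h => h.elim
      rS_fibre := fun h => h.elim } hW
  have hA : ∀ a, W (f.onV (.inr a)) = true := fun a => congrArg Prod.snd (hf.dec (.inl (.inr a)))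
  have hB : ∀ b, W (f.onV (.inl b)) = false := fun b => congrArg Prod.snd (hf.dec (.inl (.inl b)))
  obtain ⟨x, rfl⟩ := f.onV.surjective v
  obtain ⟨x', rfl⟩ := f.onV.surjective v'
  rcases h.vertical m _ _ ⟨f.symm⟩ with hE | hE
  · rcases x with b | a
    · rcases x' with b' | a'
      · exact (hB b).trans (hB b').symm
      · exact hE.elim a'
    · exact hE.elim a
  · rcases x with b | a
    · exact hE.elim b
    · rcases x' with b' | a'
      · exact hE.elim b'
      · exact (hA a).trans (hA a').symm

/-- For an edge `e`, colour the vertices which can be reached from the source of `e`. The colour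
does not decrease along edges and is true at the target of `e`, hence also at its source, which
would lie on a cycle. -/
theorem IsIndecomposable.isEmpty_edges (h : G.IsIndecomposable) (h' : G.IsCycleless) :
    IsEmpty G.E := by
  classical
  refine ⟨fun e => h'.2 (G.s (.inl e)) ?_⟩
  have := h.colour_eq (fun v => decide (Relation.TransGen G.Step (G.s (.inl e)) v))
    (fun e' he' => by
      rw [decide_eq_true_iff] at he' ⊢
      exact he'.tail ⟨e', rfl, rfl⟩) (G.s (.inl e)) (G.t (.inl e))
  rw [decide_eq_decide] at this
  exact this.2 (.single ⟨e, rfl, rfl⟩)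

/-- Without internal edges every colouring is admissible, in particular the one which singles out a
vertex. -/
theorem IsIndecomposable.subsingleton_vertices (h : G.IsIndecomposable) (h' : G.IsCycleless) :
    Subsingleton G.V := by
  classical
  refine ⟨fun v v' => ?_⟩
  have := h.colour_eq (fun w => decide (w = v)) (fun e => (h.isEmpty_edges h').elim e) v v'
  rw [decide_eq_decide] at this
  exact (this.1 rfl).symm

/-- With one vertex and only input and output edges, the indexations themselves are the bijections
to the edges of the corolla. Absence of loops excludes the graph reduced to a loop. -/
theorem IsIndecomposable.exists_iso_corolla (h : G.IsIndecomposable) (h' : G.IsCycleless) :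
    Nonempty (Iso G (corolla k l)) := by
  have hE := h.isEmpty_edges h'
  have hV := h.subsingleton_vertices h'
  have hI := h.isEmpty_inOut
  have hL := h'.isEmpty_loops
  have hne : Nonempty G.V := h.nonempty.resolve_right fun h => by
    have := h.2.2.2.2.2
    rw [Nat.card_of_isEmpty] at this
    cases this
  exact ⟨{
    onV := ⟨fun _ => (), fun _ => hne.some, fun _ => Subsingleton.elim _ _, fun _ => rfl⟩
    onE := equivEmpty _
    onIn := (sumEmpty _ _).symm.trans G.α
    onOut := (sumEmpty _ _).symm.trans G.β
    onInOut := equivEmpty _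
    onL := equivEmpty _
    map_s := fun _ => rfl
    map_t := fun _ => rfl
    map_α := by
      rintro (x | x)
      exacts [rfl, hI.elim x]
    map_β := by
      rintro (x | x)
      exacts [rfl, hI.elim x] }⟩

theorem isIndecomposable_corolla (k l : ℕ) : (corolla k l).IsIndecomposable where
  nonempty := .inl ⟨()⟩
  isEmpty_inOut := inferInstanceAs (IsEmpty Empty)
  isEmpty_loops := .inl (inferInstanceAs (IsEmpty Empty))
  vertical m G' G'' := fun ⟨f⟩ => by
    by_contra hn
    rw [not_or, not_isEmpty_iff, not_isEmpty_iff] at hn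
    obtain ⟨⟨a⟩, ⟨b⟩⟩ := hn
    have e : f.symm.onV (.inl b) = f.symm.onV (.inr a) := rfl
    cases f.symm.onV.injective e
  horizontal k₁ l₁ k₂ l₂ hk hl G' G'' σ τ := fun ⟨f⟩ => by
    by_contra hn
    rw [not_or, not_isEmpty_iff, not_isEmpty_iff] at hn
    obtain ⟨⟨a⟩, ⟨b⟩⟩ := hn
    have e : f.symm.onV (.inl a) = f.symm.onV (.inr b) := rfl
    cases f.symm.onV.injective e

theorem isCycleless_corolla (k l : ℕ) : (corolla k l).IsCycleless where
  isEmpty_loops := inferInstanceAs (IsEmpty Empty)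
  not_cycle x hx := by
    obtain ⟨y, -, ⟨e, -⟩⟩ := Relation.TransGen.tail'_iff.1 hx
    exact e.elim

end Graph

variable {X : ℕ → ℕ → Type u} {k l : ℕ}

theorem DecGraph.exists_dec_eq (G : DecGraph X k l) (f : Graph.Iso G.toGraph (Graph.corolla k l)) :
    ∃ x : X k l, ∀ v, G.dec v = ⟨(k, l), x⟩ := by
  let v₀ : (Graph.corolla k l).V := ()
  have h : (G.dec (f.symm.onV v₀)).1 = (k, l) := by
    rw [G.dec_fst, f.symm.inDeg_eq, f.symm.outDeg_eq]
    -- The degrees of the vertex of a corolla are known as soon as a corolla carries some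
    -- decoration; a trivial one is used.
    exact ((DecGraph.corolla (X := fun _ _ => Unit) (k := k) (l := l) ()).dec_fst v₀).symm
  obtain ⟨x, hx⟩ : ∃ x : X k l, G.dec (f.symm.onV v₀) = ⟨(k, l), x⟩ := by
    rcases hd : G.dec (f.symm.onV v₀) with ⟨p, x⟩
    rw [hd] at h
    cases h
    exact ⟨x, rfl⟩
  exact ⟨x, fun v => by rw [← hx]; exact congrArg G.dec (f.onV.symm_apply_apply v).symm⟩

/-- The isomorphism with the corolla absorbs any indexation of the inputs and outputs, so the
decoration is the only invariant. The triviality of the two actions follows. -/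
theorem DecGraph.mk_eq_corolla {G : DecGraph X k l} (h : G.toGraph.IsIndecomposable)
    (h' : G.toGraph.IsCycleless) {x : X k l} (hx : ∀ v, G.dec v = ⟨(k, l), x⟩) :
    Quotient.mk (DecGraph.setoid X k l) (DecGraph.corolla x) = Quotient.mk _ G := by
  obtain ⟨f⟩ := h.exists_iso_corolla h'
  exact Quotient.sound (Setoid.symm ⟨f, fun v => (hx v).symm⟩)

theorem DecGraph.mk_corolla_injective :
    Injective fun x : X k l => Quotient.mk (DecGraph.setoid X k l) (DecGraph.corolla x) := by
  intro x y h
  obtain ⟨f, hf⟩ := Quotient.exact h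
  exact (eq_of_heq (Sigma.mk.inj (hf ())).2).symm

theorem DecGraph.range_mk_corolla :
    (Set.range fun x : X k l => Quotient.mk (DecGraph.setoid X k l) (DecGraph.corolla x)) =
      (indCyclelessDec X).set k l := by
  ext z
  constructor
  · rintro ⟨x, rfl⟩
    exact ⟨_, ⟨Graph.isIndecomposable_corolla k l, Graph.isCycleless_corolla k l⟩, rfl⟩
  · rintro ⟨G, ⟨h, h'⟩, rfl⟩
    obtain ⟨f⟩ := h.exists_iso_corolla h'
    obtain ⟨x, hx⟩ := G.exists_dec_eq f
    exact ⟨x, DecGraph.mk_eq_corolla h h' hx⟩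

theorem DecGraph.lact_mk_corolla (σ : Perm (Fin l)) (x : X k l) :
    (decGraphs X).lact σ (Quotient.mk _ (DecGraph.corolla x)) =
      Quotient.mk _ (DecGraph.corolla x) :=
  (DecGraph.mk_eq_corolla (G := (DecGraph.corolla x).lact σ)
    ((Graph.isIndecomposable_corolla k l).lact σ) ((Graph.isCycleless_corolla k l).lact σ)
    fun _ => rfl).symm

theorem DecGraph.ract_mk_corolla (τ : Perm (Fin k)) (x : X k l) :
    (decGraphs X).ract τ (Quotient.mk _ (DecGraph.corolla x)) =
      Quotient.mk _ (DecGraph.corolla x) :=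
  (DecGraph.mk_eq_corolla (G := (DecGraph.corolla x).ract τ)
    ((Graph.isIndecomposable_corolla k l).ract τ) ((Graph.isCycleless_corolla k l).ract τ)
    fun _ => rfl).symm

/-! ### Planar corollas -/

theorem exists_perm_of_isStrictTotalOrder {A : Type} {n : ℕ} (e₀ : A ≃ Fin n) (r : A → A → Prop)
    [IsStrictTotalOrder A r] : ∃ e : A ≃ Fin n, ∀ a b, e a < e b ↔ r a b := by
  classical
  let _ := Fintype.ofEquiv _ e₀.symm
  let _ := linearOrderOfSTO r
  have e := (Fintype.orderIsoFinOfCardEq A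
    ((Fintype.card_congr e₀).trans (Fintype.card_fin n)))
  exact ⟨e.symm.toEquiv, fun a b => e.symm.lt_iff_lt⟩

/-- When all the edges belong to one vertex, the order is total and each edge has a rank. The
bijection `e₀` only provides the number of edges. -/
theorem FibreOrder.exists_perm {A B C : Type} {n : ℕ} {t : A ⊕ B → C} (o : FibreOrder t)
    (ht : ∀ x y, t x = t y) (e₀ : B ≃ Fin n) :
    ∃ e : B ≃ Fin n, ∀ a b, e a < e b ↔ o.lt (.inr a) (.inr b) := by
  have : IsStrictTotalOrder B fun a b => o.lt (.inr a) (.inr b) :=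
    { irrefl := fun a => o.irrefl _
      trans := fun _ _ _ => o.trans
      trichotomous := fun a b hab hba => by
        rcases o.total (ht (.inr a) (.inr b)) with h | h | h
        exacts [(hab h).elim, Sum.inr_injective h, (hba h).elim] }
  exact exists_perm_of_isStrictTotalOrder e₀ _

/-- An order automorphism of `Fin n` is the identity: this is the rigidity which makes the actions
on planar corollas free. -/
theorem eq_refl_of_lt_iff {n : ℕ} (e : Fin n ≃ Fin n) (h : ∀ a b, e a < e b ↔ a < b) (a : Fin n) :
    e a = a := by
  let f : Fin n ≃o Fin n := ⟨e, fun {a b} => by rw [← not_lt, h, not_lt]⟩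
  have : f = OrderIso.refl _ := Subsingleton.elim _ _
  exact congrArg (fun g : Fin n ≃o Fin n => g a) this

/-- The class `σ · PG(x) · τ`. -/
def PDecGraph.corollaClass (k l : ℕ) (a : Perm (Fin l) × X k l × Perm (Fin k)) :
    (planarDecGraphs X).obj k l :=
  Quotient.mk _ (((PDecGraph.corolla a.2.1).ract a.2.2).lact a.1)

theorem PDecGraph.corollaClass_injective :
    Injective (PDecGraph.corollaClass (X := X) k l) := by
  rintro ⟨σ, x, τ⟩ ⟨σ', x', τ'⟩ h
  obtain ⟨f, hf, hi, ho⟩ := Quotient.exact h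
  have hI := eq_refl_of_lt_iff f.onIn fun a b => hi (.inr a) (.inr b)
  have hO := eq_refl_of_lt_iff f.onOut fun a b => ho (.inr a) (.inr b)
  have e1 : x = x' := (eq_of_heq (Sigma.mk.inj (hf ())).2).symm
  -- An isomorphism must preserve the usual orders, so it fixes every input and every output, and
  -- the indexations have to coincide.
  have e2 : τ'⁻¹ = τ⁻¹ := by
    refine Equiv.ext fun i => Eq.trans ?_ (f.map_α (.inl i))
    exact congrArg (fun i => τ'⁻¹ i) (hI i).symm
  have e3 : σ' = σ := by
    refine Equiv.ext fun i => Eq.trans ?_ (f.map_β (.inl i))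
    exact congrArg σ' (hO i).symm
  rw [e1, inv_injective e2, e3]

theorem PDecGraph.range_corollaClass :
    Set.range (PDecGraph.corollaClass (X := X) k l) = (indCyclelessPlanarDec X).set k l := by
  ext z
  constructor
  · rintro ⟨⟨σ, x, τ⟩, rfl⟩
    exact ⟨_, ⟨((Graph.isIndecomposable_corolla k l).ract τ).lact σ,
      ((Graph.isCycleless_corolla k l).ract τ).lact σ⟩, rfl⟩
  · rintro ⟨G, ⟨h, h'⟩, rfl⟩
    obtain ⟨f⟩ := h.exists_iso_corolla h'
    obtain ⟨x, hx⟩ := G.exists_dec_eq f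
    have hV := h.subsingleton_vertices h'
    have hE := h.isEmpty_edges h'
    obtain ⟨e, he⟩ := G.inOrd.exists_perm (fun _ _ => Subsingleton.elim _ _) f.onIn
    obtain ⟨e', he'⟩ := G.outOrd.exists_perm (fun _ _ => Subsingleton.elim _ _) f.onOut
    -- The map `f` numbers the edges by their indices, `e` and `e'` by their ranks. The permutation
    -- `σ` sends the rank of an output to its index; since `τ` acts through its inverse, it sends
    -- the index of an input to its rank.
    refine ⟨(e'.symm.trans f.onOut, x, f.onIn.symm.trans e), Quotient.sound (Setoid.symm
      ⟨{ onV := f.onV, onE := f.onE, onIn := e, onOut := e', onInOut := f.onInOut, onL := f.onL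
         map_s := fun _ => rfl, map_t := fun _ => rfl, map_α := ?_, map_β := ?_ }, ?_, ?_, ?_⟩)⟩
    · rintro (i | i)
      · refine Eq.trans ?_ (f.map_α (.inl i))
        change (f.onIn.symm.trans e).symm (e i) = f.onIn i
        simp
      · exact (h.isEmpty_inOut).elim i
    · rintro (i | i)
      · refine Eq.trans ?_ (f.map_β (.inl i))
        change (e'.symm.trans f.onOut) (e' i) = f.onOut i
        simp
      · exact (h.isEmpty_inOut).elim i
    · exact fun v => (hx v).symm
    · rintro (a | a) (b | b)
      exacts [hE.elim a, hE.elim a, hE.elim b, he a b]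
    · rintro (a | a) (b | b)
      exacts [hE.elim a, hE.elim a, hE.elim b, he' a b]

theorem PDecGraph.lact_corollaClass (σ : Perm (Fin l)) (a : Perm (Fin l) × X k l × Perm (Fin k)) :
    (planarDecGraphs X).lact σ (PDecGraph.corollaClass k l a) =
      PDecGraph.corollaClass k l (σ * a.1, a.2.1, a.2.2) := rfl

theorem PDecGraph.ract_corollaClass (τ : Perm (Fin k)) (a : Perm (Fin l) × X k l × Perm (Fin k)) :
    (planarDecGraphs X).ract τ (PDecGraph.corollaClass k l a) =
      PDecGraph.corollaClass k l (a.1, a.2.1, a.2.2 * τ) := by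
  let p : (planarDecGraphs X).obj k l := Quotient.mk _ (PDecGraph.corolla a.2.1)
  exact ((planarDecGraphs X).lact_ract a.1 τ ((planarDecGraphs X).ract a.2.2 p)).symm.trans
    (congrArg ((planarDecGraphs X).lact a.1) ((planarDecGraphs X).ract_ract a.2.2 τ p))

end GraphProP

/-! ### The modules spanned by corollas. -/

namespace GraphProP

section

variable {K : Type v} [Field K]

/-- A module with a basis on which the groups act as on a stable family `I` is isomorphic to the
module spanned by `I`. -/
theorem exists_bijective_hom {S : SetProP.{w}} {I : S.StableSet} {B : S.SubProP}
    (hIB : ∀ k l, I.set k l ⊆ B.set k l) {M : SModule.{v, w'} K} {A : ℕ → ℕ → Type u}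
    (e : ∀ k l, (A k l →₀ K) ≃ₗ[K] M.obj k l) (j : ∀ k l, A k l → S.obj k l)
    (inj : ∀ k l, Injective (j k l)) (hj : ∀ k l, Set.range (j k l) = I.set k l)
    (hl : ∀ {k l} (σ : Perm (Fin l)) (a : A k l), ∃ a',
      M.lact σ (e k l (Finsupp.single a 1)) = e k l (Finsupp.single a' 1) ∧
        S.lact σ (j k l a) = j k l a')
    (hr : ∀ {k l} (τ : Perm (Fin k)) (a : A k l), ∃ a',
      M.ract τ (e k l (Finsupp.single a 1)) = e k l (Finsupp.single a' 1) ∧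
        S.ract τ (j k l a) = j k l a') :
    ∃ f : M.Hom ((I.span K).within (B.span K).toSub).toSModule,
      (∀ k l, Bijective (f.toFun k l)) ∧ ∀ (k l : ℕ) (a : A k l),
        (f.toFun k l (e k l (Finsupp.single a 1))).1.1 = Finsupp.single (j k l a) 1 := by
  let T : ∀ k l, M.obj k l →ₗ[K] (S.lin K).obj k l := fun k l =>
    (Finsupp.lmapDomain K K (j k l)).comp (e k l).symm.toLinearMap
  have hT : ∀ k l a, T k l (e k l (Finsupp.single a 1)) = Finsupp.single (j k l a) (1 : K) := by
    intro k l a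
    refine (congrArg (Finsupp.lmapDomain K K (j k l)) ((e k l).symm_apply_apply _)).trans ?_
    exact Finsupp.mapDomain_single
  have hTI : ∀ k l x, T k l x ∈ (I.span K).carrier k l := by
    intro k l x
    obtain ⟨q, rfl⟩ := (e k l).surjective x
    induction q using Finsupp.induction_linear with
    | zero => rw [map_zero, map_zero]; exact Submodule.zero_mem _
    | add x y hx hy => rw [map_add, map_add]; exact Submodule.add_mem _ hx hy
    | single a c =>
      rw [← mul_one c, ← smul_eq_mul, ← Finsupp.smul_single, map_smul, map_smul, hT]
      exact Submodule.smul_mem _ c (Submodule.subset_span ⟨_, hj k l ▸ ⟨a, rfl⟩, rfl⟩)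
  -- The target is a submodule of a submodule, so membership in the span of `B` and in the span of
  -- `I` are both recorded.
  have hTB : ∀ k l x, T k l x ∈ (B.span K).carrier k l := fun k l x =>
    Submodule.span_mono (Set.image_mono (hIB k l)) (hTI k l x)
  refine ⟨⟨fun k l => ((T k l).codRestrict ((B.span K).carrier k l) (hTB k l)).codRestrict
    (((I.span K).within (B.span K).toSub).carrier k l) (hTI k l), ?_, ?_⟩, ?_, ?_⟩
  · intro k l σ p
    refine Subtype.ext (Subtype.ext ?_)
    change T k l (M.lact σ p) = (S.lin K).lact σ (T k l p)
    obtain ⟨q, rfl⟩ := (e k l).surjective p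
    revert q
    refine lin_ext fun a => ?_
    obtain ⟨a', h, h'⟩ := hl σ a
    rw [h, hT, hT, ← h']
    exact (lin₁_single _ _).symm
  · intro k l σ p
    refine Subtype.ext (Subtype.ext ?_)
    change T k l (M.ract σ p) = (S.lin K).ract σ (T k l p)
    obtain ⟨q, rfl⟩ := (e k l).surjective p
    revert q
    refine lin_ext fun a => ?_
    obtain ⟨a', h, h'⟩ := hr σ a
    rw [h, hT, hT, ← h']
    exact (lin₁_single _ _).symm
  · intro k l
    constructor
    · intro x y h
      have h' : T k l x = T k l y := congrArg (fun z => z.1.1) h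
      exact (e k l).symm.injective (Finsupp.mapDomain_injective (inj k l) h')
    · rintro ⟨⟨y, hy⟩, hy'⟩
      obtain ⟨x, hx⟩ : ∃ x, T k l x = y := by
        refine span_single_induction (p := fun y => ∃ x, T k l x = y) hy' ?_ ?_ ?_ ?_
        · intro b hb
          rw [← hj] at hb
          obtain ⟨a, rfl⟩ := hb
          exact ⟨_, hT k l a⟩
        · exact ⟨0, map_zero _⟩
        · rintro _ _ ⟨x, rfl⟩ ⟨y, rfl⟩
          exact ⟨_, map_add _ _ _⟩
        · rintro c _ ⟨x, rfl⟩
          exact ⟨_, map_smul _ _ _⟩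
      exact ⟨x, Subtype.ext (Subtype.ext hx)⟩
  · exact hT

end

variable (X : ℕ → ℕ → Type u) (K : Type v) [Field K]

theorem exists_trivialSModule_hom : ∃ f : (trivialSModule X K).Hom (GrUpInd X K).toSModule,
    (∀ k l, Bijective (f.toFun k l)) ∧ ∀ (k l : ℕ) (x : X k l),
      (f.toFun k l (Finsupp.single x 1)).1.1 =
        Finsupp.single (Quotient.mk _ (DecGraph.corolla x)) 1 :=
  exists_bijective_hom (S := decGraphs X) (I := indCyclelessDec X) (B := cyclelessDec X)
    (M := trivialSModule X K) (fun _ _ => Set.image_mono fun _ h => h.2)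
    (fun k l => LinearEquiv.refl K (X k l →₀ K))
    (fun _ _ x => Quotient.mk _ (DecGraph.corolla x))
    (fun _ _ => DecGraph.mk_corolla_injective) (fun _ _ => DecGraph.range_mk_corolla)
    (fun σ x => ⟨x, rfl, DecGraph.lact_mk_corolla σ x⟩)
    (fun τ x => ⟨x, rfl, DecGraph.ract_mk_corolla τ x⟩)

theorem exists_freeSModule_hom : ∃ f : (freeSModule X K).Hom (PGrUpInd X K).toSModule,
    (∀ k l, Bijective (f.toFun k l)) ∧ ∀ (k l : ℕ) (x : X k l),
      (f.toFun k l (Finsupp.single (1, x, 1) 1)).1.1 =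
        Finsupp.single (Quotient.mk _ (PDecGraph.corolla x)) 1 := by
  obtain ⟨f, hf, h⟩ := exists_bijective_hom (S := planarDecGraphs X)
    (I := indCyclelessPlanarDec X) (B := cyclelessPlanarDec X)
    (M := freeSModule X K) (fun _ _ => Set.image_mono fun _ h => h.2)
    (fun k l => LinearEquiv.refl K (Perm (Fin l) × X k l × Perm (Fin k) →₀ K))
    PDecGraph.corollaClass (fun _ _ => PDecGraph.corollaClass_injective)
    (fun _ _ => PDecGraph.range_corollaClass)
    (fun σ a => ⟨_, lin₁_single _ a, PDecGraph.lact_corollaClass σ a⟩)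
    (fun τ a => ⟨_, lin₁_single _ a, PDecGraph.ract_corollaClass τ a⟩)
  exact ⟨f, hf, fun k l x => h k l (1, x, 1)⟩

end GraphProP
-- The theorem.
theorem mainTheorem6 {K : Type v} [RCLike K] (X : ℕ → ℕ → Type u) :
    ((Gr X K).IsFreeOn.{v, max v 1 u, w} (GrInd X K) ∧
      (GrUp X K).toProP.IsFreeOn.{v, max v 1 u, w} (GrUpInd X K) ∧
      ∃ f : (trivialSModule X K).Hom (GrUpInd X K).toSModule,
        (∀ k l, Function.Bijective (f.toFun k l)) ∧
        ∀ (k l : ℕ) (x : X k l),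
          (f.toFun k l (Finsupp.single x 1)).1.1 =
            Finsupp.single (Quotient.mk _ (DecGraph.corolla x)) 1) ∧
    ((PGr X K).IsFreeOn.{v, max v 1 u, w} (PGrInd X K) ∧
      (PGrUp X K).toProP.IsFreeOn.{v, max v 1 u, w} (PGrUpInd X K) ∧
      ∃ f : (freeSModule X K).Hom (PGrUpInd X K).toSModule,
        (∀ k l, Function.Bijective (f.toFun k l)) ∧
        ∀ (k l : ℕ) (x : X k l),
          (f.toFun k l (Finsupp.single (1, x, 1) 1)).1.1 =
            Finsupp.single (Quotient.mk _ (PDecGraph.corolla x)) 1) :=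
  ⟨⟨isFreeOn_gr X K, isFreeOn_grUp X K, exists_trivialSModule_hom X K⟩,
    isFreeOn_pGr X K, isFreeOn_pGrUp X K, exists_freeSModule_hom X K⟩
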